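/- **Conventions.** Let $\mathbb F$ be $\mathbb R$ or $\mathbb C$, and let $\mathcal G$ be a discrete groupoid. A *graded $\mathcal G$-$C^\ast$-algebra* $A$ is a family of $\mathbb Z/2$-graded $C^\ast$-algebras $A_a$ ($a\in \mathrm{Ob}\,\mathcal G$) over $\mathbb F$ with functorial degree-preserving $\ast$-isomorphisms $g\colon A_a\to A_b$ for $g\in\mathrm{Hom}(a,b)_{\mathcal G}$; it is *$\sigma$-unital* if each $A_a$ is. Its *reduced crossed product* $A\rtimes_r\mathcal G$ is the graded $C^\ast$-category with the objects of $\mathcal G$, in which $\mathrm{Hom}(a,b)$ is the completion of the formal sums $\sum x_ig_i$ with $x_i\in A_b$, $g_i\in\mathrm{Hom}(a,b)_{\mathcal G}$, composition $(xg)(yh)=x\,g(y)\,gh$ and involution $(xg)^\ast=g^{-1}(x^\ast)g^{-1}$, in the norm given by the regular representations (on $\ell^2(\mathrm{Hom}(c,-)_{\mathcal G},H)$, for objects $c$ and representations $A_c\to\mathcal L(H)$). For graded $C^\ast$-categories $\mathcal A,\mathcal B$, a *bimodule* $\mathcal E$ is a graded $C^\ast$-functor from $\mathcal A$ to the category of countably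 generated graded Hilbert $\mathcal B$-modules. $\mathcal D(\mathcal A,\mathcal B)$ has the bimodules as objects and as morphisms the bounded families $T=(T_p\colon\mathcal E_p\to\mathcal E'_p)_{p\in \mathrm{Ob}\,\mathcal A}$ of adjointable operators such that the graded commutators $xT-(-1)^{\deg x\deg T}Tx$ are compact for all homogeneous morphisms $x$ of $\mathcal A$; $\mathcal{KD}(\mathcal A,\mathcal B)$ is the ideal of those $T$ for which all $xT$ and $Tx$ are compact, and $\mathcal{QD}=\mathcal D/\mathcal{KD}$. For graded $\mathcal G$-$C^\ast$-algebras $A,B$, $\mathcal{QD}_{\mathcal G}(A,B)=\mathcal D_{\mathcal G}(A,B)/\mathcal{KD}_{\mathcal G}(A,B)$ is defined in the same way from the $\mathcal G$-equivariant bimodules, i.e. families of countably generated graded Hilbert $(A_a,B_a)$-bimodules $\mathcal E_a$ with a compatible degree-preserving action of $\mathcal G$ (so $g(x\eta y)=g(x)g(\eta)g(y)$, $\langle g\eta,g\xi\rangle=g\langle\eta,\xi\rangle$), where morphisms are moreover required to satisfy that $x(gT_ag^{-1}-T_b)$ and $(gT_ag^{-1}-T_b)x$ are compact for all $g\in\mathrm{Hom}(a,b)_{\mathcal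 G}$ and $x\in A_b$. For a graded $C^\ast$-category $\mathcal C$, $\mathbb K(\mathcal C)$ is the spectrum whose $n$-th space is the space of graded $\ast$-homomorphisms from $C_0(\mathbb R)$ (graded by even and odd functions) to finite matrices over $\mathcal C\,\hat\otimes\,\mathbb F_{n,0}$ ($\mathbb F_{n,0}$ the Clifford algebra on $n$ anticommuting generators with $e_i^2=1$; the matrices are indexed by finite families of objects with parities, and homomorphisms differing by zero summands are identified). Put $\mathbb{KK}(\mathcal A,\mathcal B)=\Omega\mathbb K\mathcal{QD}(\mathcal A,\mathcal B)$ and $\mathbb{KK}_{\mathcal G}(A,B)=\Omega\mathbb K\mathcal{QD}_{\mathcal G}(A,B)$. **Theorem.** For all $\sigma$-unital graded $\mathcal G$-$C^\ast$-algebras $A$ and $B$ there is a graded $C^\ast$-functor (the *descent functor*) $$D\colon\mathcal{QD}_{\mathcal G}(A,B)\to\mathcal{QD}(A\rtimes_r\mathcal G,B\rtimes_r\mathcal G)$$ given as follows. For an equivariant bimodule $\mathcal E$ and objects $a,b$ of $\mathcal G$, the space $D(\mathcal E)(b,a)$ is the completion of the space of formal sums $\sum\eta_ig_i$ with $\eta_i\in\mathcal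 E_a$ and $g_i\in\mathrm{Hom}(b,a)_{\mathcal G}$; $D(\mathcal E)(-,a)$ is the Hilbert $B\rtimes_r\mathcal G$-module with $$(\eta g)(xh)=\eta\, g(x)\,gh,\qquad \langle\eta g,\xi h\rangle=g^{-1}(\langle\eta,\xi\rangle)\,g^{-1}h,\qquad \deg(\eta g)=\deg\eta,$$ the category $A\rtimes_r\mathcal G$ acts by $(xg)(\eta h)=x\,g(\eta)\,gh$, and $D$ maps the class of $T$ to the class of the operator $\sum\eta_ig_i\mapsto\sum(T\eta_i)g_i$. The functor $D$ is determined by this up to natural unitary isomorphism of degree $0$, and the following hold, where diagrams commute up to natural unitary isomorphism of degree $0$. 1. *(Naturality in $A$.)* For each degree-preserving equivariant $\ast$-homomorphism $\alpha\colon A'\to A$, with $A'$ also $\sigma$-unital, $D\circ\alpha^\ast\cong(\alpha\rtimes_r\mathcal G)^\ast\circ D$ as functors $\mathcal{QD}_{\mathcal G}(A,B)\to\mathcal{QD}(A'\rtimes_r\mathcal G,B\rtimes_r\mathcal G)$. 2. *(Naturality in $B$.)* For each degree-preserving equivariant $\ast$-homomorphism $\beta\colon B\to B'$, with $B'$ also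 $\sigma$-unital, the change of coefficients functors $\beta_\ast=-\otimes_BB'$ and $(\beta\rtimes_r\mathcal G)_\ast=-\otimes_{B\rtimes_r\mathcal G}(B'\rtimes_r\mathcal G)$ exist, and $D\circ\beta_\ast\cong(\beta\rtimes_r\mathcal G)_\ast\circ D$ as functors $\mathcal{QD}_{\mathcal G}(A,B)\to\mathcal{QD}(A\rtimes_r\mathcal G,B'\rtimes_r\mathcal G)$. 3. *(Naturality in $\mathcal G$.)* For each faithful functor $f\colon\mathcal H\to\mathcal G$ of discrete groupoids, with induced functors $f_A\colon A\rtimes_r\mathcal H\to A\rtimes_r\mathcal G$ and $f_B\colon B\rtimes_r\mathcal H\to B\rtimes_r\mathcal G$ (where $\mathcal H$ acts on $A$ and $B$ through $f$), the change of coefficients $(f_B)_\ast$ exists and the two composites $$\mathcal{QD}_{\mathcal G}(A,B)\xrightarrow{D}\mathcal{QD}(A\rtimes_r\mathcal G,B\rtimes_r\mathcal G)\xrightarrow{f_A^\ast}\mathcal{QD}(A\rtimes_r\mathcal H,B\rtimes_r\mathcal G),$$ $$\mathcal{QD}_{\mathcal G}(A,B)\xrightarrow{f^\ast}\mathcal{QD}_{\mathcal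 H}(A,B)\xrightarrow{D}\mathcal{QD}(A\rtimes_r\mathcal H,B\rtimes_r\mathcal H)\xrightarrow{(f_B)_\ast}\mathcal{QD}(A\rtimes_r\mathcal H,B\rtimes_r\mathcal G)$$ agree. 4. *(Spectra.)* $D$ induces, by composing homomorphisms into matrices over $\mathcal{QD}_{\mathcal G}(A,B)\,\hat\otimes\,\mathbb F_{n,0}$ with $D$, a map of spectra $\mathbb{KK}_{\mathcal G}(A,B)\to\mathbb{KK}(A\rtimes_r\mathcal G,B\rtimes_r\mathcal G)$. -/

import Mathlib

open CategoryTheory Topology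

set_option linter.checkUnivs false

universe u v w v' w' v'' w''

namespace CStarDescent

noncomputable section

/-! ## Graded C*-categories and graded C*-functors -/

/-- The data of a (possibly non-unital) graded `C*`-category over `𝕜`: normed morphism spaces,
bilinear associative composition, a conjugate-linear involution, and the grading, recorded by the
grading automorphism `grade`; a morphism `x` has degree `0` if `grade x = x` and degree `1` if
`grade x = -x`.  (So `Hom a b` is the direct sum of the morphisms of degree `0` and `1`, and degrees
add under composition.)  The `C*`-identity and completeness are properties of the examples below
and never enter the definitions which follow. -/
structure GStarCat (𝕜 : Type) [RCLike 𝕜] where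
  Obj : Type v
  Hom : Obj → Obj → Type w
  [grp : ∀ a b, SeminormedAddCommGroup (Hom a b)]
  [mod : ∀ a b, NormedSpace 𝕜 (Hom a b)]
  comp : ∀ {a b c}, Hom b c →ₗ[𝕜] Hom a b →ₗ[𝕜] Hom a c
  assoc : ∀ {a b c d} (x : Hom c d) (y : Hom b c) (z : Hom a b),
    comp (comp x y) z = comp x (comp y z)
  star : ∀ {a b}, Hom a b →ₗ⋆[𝕜] Hom b a
  star_star : ∀ {a b} (x : Hom a b), star (star x) = x
  star_comp : ∀ {a b c} (x : Hom b c) (y : Hom a b), star (comp x y) = comp (star y) (star x)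
  grade : ∀ {a b}, Hom a b →ₗ[𝕜] Hom a b
  grade_grade : ∀ {a b} (x : Hom a b), grade (grade x) = x
  grade_comp : ∀ {a b c} (x : Hom b c) (y : Hom a b),
    grade (comp x y) = comp (grade x) (grade y)
  grade_star : ∀ {a b} (x : Hom a b), grade (star x) = star (grade x)
  norm_grade_le : ∀ {a b} (x : Hom a b), ‖grade x‖ ≤ ‖x‖

attribute [instance] GStarCat.grp GStarCat.mod

variable {𝕜 : Type} [RCLike 𝕜]

namespace GStarCat

variable (C : GStarCat.{v, w} 𝕜)

instance (a b : C.Obj) : AddCommGroup (C.Hom a b) := inferInstance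

instance (a b : C.Obj) : AddCommMonoid (C.Hom a b) := inferInstance

instance (a b : C.Obj) : Module 𝕜 (C.Hom a b) := inferInstance

/-- The degree `0` part of a morphism. -/
def even {a b : C.Obj} : C.Hom a b →ₗ[𝕜] C.Hom a b := (2⁻¹ : 𝕜) • (LinearMap.id + C.grade)

/-- The degree `1` part of a morphism. -/
def odd {a b : C.Obj} : C.Hom a b →ₗ[𝕜] C.Hom a b := (2⁻¹ : 𝕜) • (LinearMap.id - C.grade)

theorem even_add_odd {a b : C.Obj} (x : C.Hom a b) : C.even x + C.odd x = x := by
  simp only [even, odd, LinearMap.smul_apply, LinearMap.add_apply, LinearMap.sub_apply,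
    LinearMap.id_apply]
  module

theorem grade_even {a b : C.Obj} (x : C.Hom a b) : C.grade (C.even x) = C.even x := by
  simp only [even, LinearMap.smul_apply, LinearMap.add_apply, LinearMap.id_apply, map_smul,
    map_add, C.grade_grade]
  module

theorem grade_odd {a b : C.Obj} (x : C.Hom a b) : C.grade (C.odd x) = -C.odd x := by
  simp only [odd, LinearMap.smul_apply, LinearMap.sub_apply, LinearMap.id_apply, map_smul,
    map_sub, C.grade_grade]
  module

theorem even_of {a b : C.Obj} {x : C.Hom a b} (h : C.grade x = x) :
    C.even x = x ∧ C.odd x = 0 := by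
  simp only [even, odd, LinearMap.smul_apply, LinearMap.add_apply, LinearMap.sub_apply,
    LinearMap.id_apply, h]
  constructor <;> module

theorem odd_of {a b : C.Obj} {x : C.Hom a b} (h : C.grade x = -x) :
    C.even x = 0 ∧ C.odd x = x := by
  simp only [even, odd, LinearMap.smul_apply, LinearMap.add_apply, LinearMap.sub_apply,
    LinearMap.id_apply, h]
  constructor <;> module

/-- `e` is an identity morphism. -/
def IsId {a : C.Obj} (e : C.Hom a a) : Prop :=
  (∀ b (x : C.Hom b a), C.comp e x = x) ∧ ∀ b (x : C.Hom a b), C.comp x e = x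

/-- `U` is a unitary morphism. -/
def IsUnitary {a b : C.Obj} (U : C.Hom a b) : Prop :=
  C.IsId (C.comp (C.star U) U) ∧ C.IsId (C.comp U (C.star U))

end GStarCat

/-- A graded `C*`-functor: a linear functor (on possibly non-unital categories) compatible with
involutions and gradings.  Contractivity is automatic for `C*`-categories. -/
structure GFunctor (C : GStarCat.{v, w} 𝕜) (C' : GStarCat.{v', w'} 𝕜) where
  obj : C.Obj → C'.Obj
  map : ∀ {a b}, C.Hom a b →ₗ[𝕜] C'.Hom (obj a) (obj b)
  map_comp : ∀ {a b c} (x : C.Hom b c) (y : C.Hom a b), map (C.comp x y) = C'.comp (map x) (map y)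
  map_star : ∀ {a b} (x : C.Hom a b), map (C.star x) = C'.star (map x)
  map_grade : ∀ {a b} (x : C.Hom a b), map (C.grade x) = C'.grade (map x)
  norm_map_le : ∀ {a b} (x : C.Hom a b), ‖map x‖ ≤ ‖x‖

/-- Composition of graded `C*`-functors: first `F`, then `G`. -/
def GFunctor.comp {C : GStarCat.{v, w} 𝕜} {C' : GStarCat.{v', w'} 𝕜} {C'' : GStarCat.{v'', w''} 𝕜}
    (F : GFunctor C C') (G : GFunctor C' C'') : GFunctor C C'' where
  obj a := G.obj (F.obj a)
  map := G.map ∘ₗ F.map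
  map_comp x y := by simp [F.map_comp, G.map_comp]
  map_star x := by simp [F.map_star, G.map_star]
  map_grade x := by simp [F.map_grade, G.map_grade]
  norm_map_le x := (G.norm_map_le _).trans (F.norm_map_le x)

theorem GFunctor.map_even {C : GStarCat.{v, w} 𝕜} {C' : GStarCat.{v', w'} 𝕜} (F : GFunctor C C')
    {a b : C.Obj} (x : C.Hom a b) : F.map (C.even x) = C'.even (F.map x) := by
  simp [GStarCat.even, F.map_grade]

theorem GFunctor.map_odd {C : GStarCat.{v, w} 𝕜} {C' : GStarCat.{v', w'} 𝕜} (F : GFunctor C C')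
    {a b : C.Obj} (x : C.Hom a b) : F.map (C.odd x) = C'.odd (F.map x) := by
  simp [GStarCat.odd, F.map_grade]

/-- Existence of a natural isomorphism between graded `C*`-functors: a family of degree `0`
unitaries intertwining them. -/
def NatIso {C : GStarCat.{v, w} 𝕜} {C' : GStarCat.{v', w'} 𝕜} (F G : GFunctor C C') : Prop :=
  ∃ U : ∀ a, C'.Hom (F.obj a) (G.obj a),
    (∀ a, C'.IsUnitary (U a)) ∧ (∀ a, C'.grade (U a) = U a) ∧
    ∀ {a b} (x : C.Hom a b), C'.comp (U b) (F.map x) = C'.comp (G.map x) (U a)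

/-! ## Subcategories and quotients by ideals -/

/-- A graded `*`-subcategory `P` of `C` with the same objects, together with a family `Q` of
subspaces of `C` such that the morphisms of `P` lying in `Q` form a graded `*`-ideal of `P`. -/
structure SubQuot (C : GStarCat.{v, w} 𝕜) where
  P : ∀ a b, Submodule 𝕜 (C.Hom a b)
  Q : ∀ a b, Submodule 𝕜 (C.Hom a b)
  P_comp : ∀ {a b c} {x : C.Hom b c} {y : C.Hom a b}, x ∈ P b c → y ∈ P a b → C.comp x y ∈ P a c
  P_star : ∀ {a b} {x : C.Hom a b}, x ∈ P a b → C.star x ∈ P b a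
  P_grade : ∀ {a b} {x : C.Hom a b}, x ∈ P a b → C.grade x ∈ P a b
  PQ_comp : ∀ {a b c} {x : C.Hom b c} {y : C.Hom a b}, x ∈ P b c → y ∈ Q a b → C.comp x y ∈ Q a c
  QP_comp : ∀ {a b c} {x : C.Hom b c} {y : C.Hom a b}, x ∈ Q b c → y ∈ P a b → C.comp x y ∈ Q a c
  Q_star : ∀ {a b} {x : C.Hom a b}, x ∈ Q a b → C.star x ∈ Q b a
  Q_grade : ∀ {a b} {x : C.Hom a b}, x ∈ Q a b → C.grade x ∈ Q a b

namespace SubQuot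

variable {C : GStarCat.{v, w} 𝕜} (S : SubQuot C)

/-- The morphisms of `P` belonging to the ideal. -/
def J (a b : C.Obj) : Submodule 𝕜 (S.P a b) := (S.Q a b).comap (S.P a b).subtype

/-- The class in the quotient of a morphism of `P`. -/
def cls {a b : C.Obj} : S.P a b →ₗ[𝕜] S.P a b ⧸ S.J a b := (S.J a b).mkQ

/-- Composition on the subcategory `P`. -/
def compP {a b c : C.Obj} : S.P b c →ₗ[𝕜] S.P a b →ₗ[𝕜] S.P a c :=
  LinearMap.mk₂ 𝕜 (fun x y => ⟨C.comp x.1 y.1, S.P_comp x.2 y.2⟩)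
    (fun _ _ _ => Subtype.ext (by simp)) (fun _ _ _ => Subtype.ext (by simp))
    (fun _ _ _ => Subtype.ext (by simp)) (fun _ _ _ => Subtype.ext (by simp))

def starP {a b : C.Obj} : S.P a b →ₗ⋆[𝕜] S.P b a where
  toFun x := ⟨C.star x.1, S.P_star x.2⟩
  map_add' _ _ := Subtype.ext (by simp)
  map_smul' _ _ := Subtype.ext (by simp)

def gradeP {a b : C.Obj} : S.P a b →ₗ[𝕜] S.P a b where
  toFun x := ⟨C.grade x.1, S.P_grade x.2⟩
  map_add' _ _ := Subtype.ext (by simp)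
  map_smul' _ _ := Subtype.ext (by simp)

/-- Composition on the quotient. -/
def compQ {a b c : C.Obj} :
    (S.P b c ⧸ S.J b c) →ₗ[𝕜] (S.P a b ⧸ S.J a b) →ₗ[𝕜] (S.P a c ⧸ S.J a c) :=
  (S.J b c).liftQ
    { toFun := fun x => (S.J a b).liftQ (S.cls ∘ₗ S.compP x) (fun y hy => by
        simp only [LinearMap.mem_ker, LinearMap.comp_apply, cls, Submodule.mkQ_apply,
          Submodule.Quotient.mk_eq_zero]
        exact S.PQ_comp x.2 hy)
      map_add' := fun x y => by
        refine LinearMap.ext fun z => ?_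
        obtain ⟨z, rfl⟩ := (S.J a b).mkQ_surjective z
        simp
      map_smul' := fun r x => by
        refine LinearMap.ext fun z => ?_
        obtain ⟨z, rfl⟩ := (S.J a b).mkQ_surjective z
        simp }
    (fun x hx => by
      refine LinearMap.ext fun z => ?_
      obtain ⟨z, rfl⟩ := (S.J a b).mkQ_surjective z
      change S.cls (S.compP x z) = 0
      simp only [cls, Submodule.mkQ_apply, Submodule.Quotient.mk_eq_zero]
      exact S.QP_comp hx z.2)

def starQ {a b : C.Obj} : (S.P a b ⧸ S.J a b) →ₗ⋆[𝕜] (S.P b a ⧸ S.J b a) :=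
  (S.J a b).liftQ ((S.J b a).mkQ.comp S.starP) (fun x hx => by
    simp only [LinearMap.mem_ker, LinearMap.comp_apply, Submodule.mkQ_apply,
      Submodule.Quotient.mk_eq_zero]
    exact S.Q_star hx)

def gradeQ {a b : C.Obj} : (S.P a b ⧸ S.J a b) →ₗ[𝕜] (S.P a b ⧸ S.J a b) :=
  (S.J a b).liftQ ((S.J a b).mkQ.comp S.gradeP) (fun x hx => by
    simp only [LinearMap.mem_ker, LinearMap.comp_apply, Submodule.mkQ_apply,
      Submodule.Quotient.mk_eq_zero]
    exact S.Q_grade hx)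

theorem cls_surj {a b : C.Obj} (x : S.P a b ⧸ S.J a b) : ∃ y : S.P a b, S.cls y = x :=
  (S.J a b).mkQ_surjective x

/-- The quotient of the subcategory `P` by the ideal, with the quotient norms. -/
def quot : GStarCat.{v, w} 𝕜 where
  Obj := C.Obj
  Hom a b := S.P a b ⧸ S.J a b
  comp := S.compQ
  assoc x y z := by
    obtain ⟨x, rfl⟩ := S.cls_surj x
    obtain ⟨y, rfl⟩ := S.cls_surj y
    obtain ⟨z, rfl⟩ := S.cls_surj z
    exact congrArg S.cls (Subtype.ext (C.assoc x.1 y.1 z.1))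
  star := S.starQ
  star_star x := by
    obtain ⟨x, rfl⟩ := S.cls_surj x
    exact congrArg S.cls (Subtype.ext (C.star_star x.1))
  star_comp x y := by
    obtain ⟨x, rfl⟩ := S.cls_surj x
    obtain ⟨y, rfl⟩ := S.cls_surj y
    exact congrArg S.cls (Subtype.ext (C.star_comp x.1 y.1))
  grade := S.gradeQ
  grade_grade x := by
    obtain ⟨x, rfl⟩ := S.cls_surj x
    exact congrArg S.cls (Subtype.ext (C.grade_grade x.1))
  grade_comp x y := by
    obtain ⟨x, rfl⟩ := S.cls_surj x
    obtain ⟨y, rfl⟩ := S.cls_surj y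
    exact congrArg S.cls (Subtype.ext (C.grade_comp x.1 y.1))
  grade_star x := by
    obtain ⟨x, rfl⟩ := S.cls_surj x
    exact congrArg S.cls (Subtype.ext (C.grade_star x.1))
  norm_grade_le x := by
    refine le_of_forall_pos_le_add fun ε hε => ?_
    obtain ⟨y, rfl, hy⟩ := Submodule.Quotient.norm_mk_lt (S := S.J _ _) x hε
    refine le_trans (Submodule.Quotient.norm_mk_le _ _) (le_trans ?_ hy.le)
    exact C.norm_grade_le y.1

/-- A graded functor carrying `P` into `P'` and `Q` into `Q'` induces a functor of quotients. -/
def mapQ {C' : GStarCat.{v', w'} 𝕜} (S' : SubQuot C') (F : GFunctor C C')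
    (hP : ∀ {a b} {x : C.Hom a b}, x ∈ S.P a b → F.map x ∈ S'.P _ _)
    (hQ : ∀ {a b} {x : C.Hom a b}, x ∈ S.Q a b → F.map x ∈ S'.Q _ _) :
    GFunctor S.quot S'.quot where
  obj := F.obj
  map := fun {a b} => (S.J a b).mapQ (S'.J _ _) (F.map.restrict fun _ hx => hP hx) fun _ hx => hQ hx
  map_comp x y := by
    obtain ⟨x, rfl⟩ := S.cls_surj x
    obtain ⟨y, rfl⟩ := S.cls_surj y
    exact congrArg S'.cls (Subtype.ext (F.map_comp x.1 y.1))
  map_star x := by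
    obtain ⟨x, rfl⟩ := S.cls_surj x
    exact congrArg S'.cls (Subtype.ext (F.map_star x.1))
  map_grade x := by
    obtain ⟨x, rfl⟩ := S.cls_surj x
    exact congrArg S'.cls (Subtype.ext (F.map_grade x.1))
  norm_map_le x := by
    refine le_of_forall_pos_le_add fun ε hε => ?_
    obtain ⟨y, rfl, hy⟩ := Submodule.Quotient.norm_mk_lt (S := S.J _ _) x hε
    refine le_trans (Submodule.Quotient.norm_mk_le _ _) (le_trans ?_ hy.le)
    exact F.norm_map_le y.1

end SubQuot

/-! ## Seminorms given by bounds -/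

/-- A relation `Bd x K`, read as "`K` is a bound for `x`", defining the seminorm
`‖x‖ = inf {K | Bd x K}`. -/
structure Gauge (𝕜 : Type) [RCLike 𝕜] (V : Type w) [AddCommGroup V] [Module 𝕜 V] where
  Bd : V → ℝ → Prop
  nonneg : ∀ {x K}, Bd x K → 0 ≤ K
  exists_bd : ∀ x, ∃ K, Bd x K
  zero : Bd 0 0
  add : ∀ {x y K L}, Bd x K → Bd y L → Bd (x + y) (K + L)
  smul : ∀ (c : 𝕜) {x K}, Bd x K → Bd (c • x) (‖c‖ * K)

namespace Gauge

variable {V : Type w} [AddCommGroup V] [Module 𝕜 V] (g : Gauge 𝕜 V)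

def nrm (x : V) : ℝ := sInf {K | g.Bd x K}

theorem nrm_le {x : V} {K : ℝ} (h : g.Bd x K) : g.nrm x ≤ K :=
  csInf_le ⟨0, fun _ h => g.nonneg h⟩ h

theorem nrm_nonneg (x : V) : 0 ≤ g.nrm x := Real.sInf_nonneg fun _ h => g.nonneg h

theorem exists_lt (x : V) {ε : ℝ} (hε : 0 < ε) : ∃ K, g.Bd x K ∧ K < g.nrm x + ε := by
  obtain ⟨K, hK, h⟩ := Real.lt_sInf_add_pos (g.exists_bd x) hε
  exact ⟨K, hK, h⟩

theorem nrm_smul_le (c : 𝕜) (x : V) : g.nrm (c • x) ≤ ‖c‖ * g.nrm x := by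
  refine le_of_forall_pos_le_add fun ε hε => ?_
  have hc : 0 < ‖c‖ + 1 := by positivity
  obtain ⟨K, hK, h⟩ := g.exists_lt x (div_pos hε hc)
  refine (g.nrm_le (g.smul c hK)).trans ?_
  have h1 : ‖c‖ * K ≤ ‖c‖ * (g.nrm x + ε / (‖c‖ + 1)) :=
    mul_le_mul_of_nonneg_left h.le (norm_nonneg c)
  have h2 : ‖c‖ * (ε / (‖c‖ + 1)) ≤ ε := by
    rw [mul_div_assoc', div_le_iff₀ hc]; nlinarith [norm_nonneg c]
  linarith

/-- The seminorm of a gauge. -/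
@[reducible] def seminormed : SeminormedAddCommGroup V :=
  letI : Norm V := ⟨g.nrm⟩
  SeminormedAddCommGroup.ofCore (𝕜 := 𝕜)
    { norm_nonneg := g.nrm_nonneg
      norm_smul := fun c x => by
        refine le_antisymm (g.nrm_smul_le c x) ?_
        by_cases hc : c = 0
        · subst hc
          rw [norm_zero, zero_mul]
          exact g.nrm_nonneg _
        · have h := g.nrm_smul_le c⁻¹ (c • x)
          rw [smul_smul, inv_mul_cancel₀ hc, one_smul, norm_inv] at h
          have h0 : 0 < ‖c‖ := norm_pos_iff.mpr hc
          calc ‖c‖ * g.nrm x ≤ ‖c‖ * (‖c‖⁻¹ * g.nrm (c • x)) := by gcongr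
            _ = g.nrm (c • x) := by field_simp
      norm_triangle := fun x y => by
        refine le_of_forall_pos_le_add fun ε hε => ?_
        obtain ⟨K, hK, h⟩ := g.exists_lt x (half_pos hε)
        obtain ⟨L, hL, h'⟩ := g.exists_lt y (half_pos hε)
        refine (g.nrm_le (g.add hK hL)).trans ?_
        change K + L ≤ g.nrm x + g.nrm y + ε
        linarith }

/-- Compatibility of the seminorm of a gauge with scalar multiplication. -/
@[reducible] def normedSpace : @NormedSpace 𝕜 V _ g.seminormed :=
  letI := g.seminormed
  { (inferInstance : Module 𝕜 V) with norm_smul_le := fun c x => g.nrm_smul_le c x }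

theorem norm_def (x : V) : @norm V g.seminormed.toNorm x = g.nrm x := rfl

end Gauge

/-! ## Hilbert modules over a graded C*-category -/

/-- A countably generated graded Hilbert module over a graded `C*`-category `C`.  The grading is
again given by an involution: `grade η = ± η` according to the degree. -/
structure HilbMod (C : GStarCat.{v, w} 𝕜) where
  E : C.Obj → Type w
  [grp : ∀ a, NormedAddCommGroup (E a)]
  [mod : ∀ a, NormedSpace 𝕜 (E a)]
  [complete : ∀ a, CompleteSpace (E a)]
  act : ∀ {a b}, E b →ₗ[𝕜] C.Hom a b →ₗ[𝕜] E a
  act_act : ∀ {a b c} (η : E c) (x : C.Hom b c) (y : C.Hom a b),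
    act (act η x) y = act η (C.comp x y)
  inner : ∀ {a b}, E b →ₗ⋆[𝕜] E a →ₗ[𝕜] C.Hom a b
  inner_act : ∀ {a b c} (η : E c) (ξ : E b) (x : C.Hom a b),
    inner η (act ξ x) = C.comp (inner η ξ) x
  inner_star : ∀ {a b} (η : E b) (ξ : E a), C.star (inner η ξ) = inner ξ η
  inner_pos : ∀ {a} (η : E a), ∃ y : C.Hom a a, inner η η = C.comp (C.star y) y
  norm_sq : ∀ {a} (η : E a), ‖η‖ ^ 2 = ‖inner η η‖
  grade : ∀ {a}, E a →ₗ[𝕜] E a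
  grade_grade : ∀ {a} (η : E a), grade (grade η) = η
  grade_act : ∀ {a b} (η : E b) (x : C.Hom a b), grade (act η x) = act (grade η) (C.grade x)
  grade_inner : ∀ {a b} (η : E b) (ξ : E a), inner (grade η) (grade ξ) = C.grade (inner η ξ)
  countably_generated : ∃ Ω : Set (Σ b, E b), Ω.Countable ∧ ∀ a (η : E a),
    η ∈ closure (Submodule.span 𝕜 {ζ : E a | ∃ p ∈ Ω, ∃ x : C.Hom a p.1, ζ = act p.2 x} : Set (E a))

attribute [instance] HilbMod.grp HilbMod.mod HilbMod.complete

namespace HilbMod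

variable {C : GStarCat.{v, w} 𝕜}

instance (E : HilbMod C) (a : C.Obj) : AddCommGroup (E.E a) := inferInstance

instance (E : HilbMod C) (a : C.Obj) : AddCommMonoid (E.E a) := inferInstance

instance (E : HilbMod C) (a : C.Obj) : Module 𝕜 (E.E a) := inferInstance

theorem eq_zero_of_inner (E : HilbMod C) {a : C.Obj} {η : E.E a} (h : E.inner η η = 0) :
    η = 0 := by
  have := E.norm_sq η
  rw [h, norm_zero] at this
  exact norm_eq_zero.mp (pow_eq_zero_iff two_ne_zero |>.mp this)

theorem ext_inner (E : HilbMod C) {a : C.Obj} {η ξ : E.E a}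
    (h : ∀ ζ : E.E a, E.inner η ζ = E.inner ξ ζ) : η = ξ := by
  rw [← sub_eq_zero]
  apply E.eq_zero_of_inner
  simp [h]

theorem ext_inner' (E : HilbMod C) {a : C.Obj} {η ξ : E.E a}
    (h : ∀ ζ : E.E a, E.inner ζ η = E.inner ζ ξ) : η = ξ := by
  rw [← sub_eq_zero]
  apply E.eq_zero_of_inner
  simp [h]

theorem norm_grade (E : HilbMod C) {a : C.Obj} (η : E.E a) : ‖E.grade η‖ ≤ ‖η‖ := by
  have h : ‖E.grade η‖ ^ 2 ≤ ‖η‖ ^ 2 := by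
    rw [E.norm_sq, E.norm_sq, E.grade_inner]; exact C.norm_grade_le _
  exact (sq_le_sq₀ (norm_nonneg _) (norm_nonneg _)).mp h

end HilbMod

/-- A bounded operator between Hilbert `C`-modules: a family of maps possessing an adjoint, both
uniformly bounded over the objects of `C`. -/
structure Op {C : GStarCat.{v, w} 𝕜} (E F : HilbMod C) where
  toFun : ∀ {a}, E.E a →ₗ[𝕜] F.E a
  adj : ∀ {a}, F.E a →ₗ[𝕜] E.E a
  inner_adj : ∀ {a b} (ξ : F.E b) (η : E.E a), F.inner ξ (toFun η) = E.inner (adj ξ) η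
  bdd : ∃ K : ℝ, 0 ≤ K ∧ (∀ {a} (η : E.E a), ‖toFun η‖ ≤ K * ‖η‖) ∧
    ∀ {a} (ξ : F.E a), ‖adj ξ‖ ≤ K * ‖ξ‖

namespace Op

variable {C : GStarCat.{v, w} 𝕜} {E F G : HilbMod C}

theorem ext {S T : Op E F} (h : ∀ a (η : E.E a), S.toFun η = T.toFun η) : S = T := by
  have h1 : @S.toFun = @T.toFun := funext fun a => LinearMap.ext (h a)
  have h2 : @S.adj = @T.adj := by
    funext a
    refine LinearMap.ext fun ξ => E.ext_inner fun ζ => ?_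
    rw [← S.inner_adj, ← T.inner_adj, h]
  cases S; cases T
  simp only at h1 h2
  subst h1; subst h2; rfl

theorem inner_adj' (T : Op E F) {a b : C.Obj} (ξ : F.E a) (η : E.E b) :
    F.inner (T.toFun η) ξ = E.inner η (T.adj ξ) := by
  rw [← F.inner_star, T.inner_adj, E.inner_star]

/-- Bounded operators are morphisms of modules. -/
theorem map_act (T : Op E F) {a b : C.Obj} (η : E.E b) (x : C.Hom a b) :
    T.toFun (E.act η x) = F.act (T.toFun η) x := by
  refine F.ext_inner' fun ζ => ?_
  rw [T.inner_adj, E.inner_act, F.inner_act, T.inner_adj]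

instance : Zero (Op E F) := ⟨⟨0, 0, by simp, 0, by simp⟩⟩

instance : Add (Op E F) := ⟨fun S T => ⟨S.toFun + T.toFun, S.adj + T.adj,
  by simp [S.inner_adj, T.inner_adj], by
    obtain ⟨K, hK, h1, h2⟩ := S.bdd
    obtain ⟨L, hL, h3, h4⟩ := T.bdd
    refine ⟨K + L, by positivity, fun η => ?_, fun ξ => ?_⟩
    · rw [add_mul]; exact (norm_add_le _ _).trans (add_le_add (h1 η) (h3 η))
    · rw [add_mul]; exact (norm_add_le _ _).trans (add_le_add (h2 ξ) (h4 ξ))⟩⟩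

instance : SMul 𝕜 (Op E F) := ⟨fun c T => ⟨c • T.toFun, (starRingEnd 𝕜 c) • T.adj,
  by simp [T.inner_adj], by
    obtain ⟨K, hK, h1, h2⟩ := T.bdd
    refine ⟨‖c‖ * K, by positivity, fun η => ?_, fun ξ => ?_⟩
    · rw [LinearMap.smul_apply, norm_smul, mul_assoc]; gcongr; exact h1 η
    · rw [LinearMap.smul_apply, norm_smul, mul_assoc, RCLike.norm_conj]; gcongr; exact h2 ξ⟩⟩

instance : Neg (Op E F) := ⟨fun T => (-1 : 𝕜) • T⟩

instance : Sub (Op E F) := ⟨fun S T => S + -T⟩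

@[simp] theorem zero_apply {a : C.Obj} (η : E.E a) : (0 : Op E F).toFun η = 0 := rfl

@[simp] theorem add_apply (S T : Op E F) {a : C.Obj} (η : E.E a) :
    (S + T).toFun η = S.toFun η + T.toFun η := rfl

@[simp] theorem smul_apply (c : 𝕜) (T : Op E F) {a : C.Obj} (η : E.E a) :
    (c • T).toFun η = c • T.toFun η := rfl

@[simp] theorem neg_apply (T : Op E F) {a : C.Obj} (η : E.E a) :
    (-T).toFun η = -T.toFun η := by
  change (-1 : 𝕜) • T.toFun η = _
  simp

@[simp] theorem sub_apply (S T : Op E F) {a : C.Obj} (η : E.E a) :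
    (S - T).toFun η = S.toFun η - T.toFun η := by
  change S.toFun η + (-T).toFun η = _
  rw [neg_apply, sub_eq_add_neg]

@[simp] theorem add_adj (S T : Op E F) {a : C.Obj} (η : F.E a) :
    (S + T).adj η = S.adj η + T.adj η := rfl

@[simp] theorem zero_adj {a : C.Obj} (η : F.E a) : (0 : Op E F).adj η = 0 := rfl

@[simp] theorem smul_adj (c : 𝕜) (T : Op E F) {a : C.Obj} (η : F.E a) :
    (c • T).adj η = (starRingEnd 𝕜 c) • T.adj η := rfl

@[simp] theorem sub_adj (S T : Op E F) {a : C.Obj} (η : F.E a) :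
    (S - T).adj η = S.adj η - T.adj η := by
  change S.adj η + starRingEnd 𝕜 (-1 : 𝕜) • T.adj η = _
  simp [sub_eq_add_neg]

instance : AddCommGroup (Op E F) where
  add_assoc _ _ _ := ext fun _ _ => by simp [add_assoc]
  zero_add _ := ext fun _ _ => by simp
  add_zero _ := ext fun _ _ => by simp
  add_comm _ _ := ext fun _ _ => by simp [add_comm]
  neg_add_cancel _ := ext fun _ _ => by simp
  sub_eq_add_neg _ _ := rfl
  nsmul := nsmulRec
  zsmul := zsmulRec

instance : Module 𝕜 (Op E F) where
  one_smul _ := ext fun _ _ => by simp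
  mul_smul _ _ _ := ext fun _ _ => by simp [mul_smul]
  smul_zero _ := ext fun _ _ => by simp
  smul_add _ _ _ := ext fun _ _ => by simp
  add_smul _ _ _ := ext fun _ _ => by simp [add_smul]
  zero_smul _ := ext fun _ _ => by simp

/-- `K` bounds both `T` and its adjoint.  (Their norms agree for modules over `C*`-categories.) -/
def Bd (T : Op E F) (K : ℝ) : Prop :=
  0 ≤ K ∧ (∀ {a} (η : E.E a), ‖T.toFun η‖ ≤ K * ‖η‖) ∧ ∀ {a} (ξ : F.E a), ‖T.adj ξ‖ ≤ K * ‖ξ‖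

theorem Bd.add {S T : Op E F} {K L : ℝ} (hS : S.Bd K) (hT : T.Bd L) : (S + T).Bd (K + L) := by
  obtain ⟨hK, h1, h2⟩ := hS
  obtain ⟨hL, h3, h4⟩ := hT
  refine ⟨by positivity, fun η => ?_, fun ξ => ?_⟩
  · rw [add_mul]; exact (norm_add_le _ _).trans (add_le_add (h1 η) (h3 η))
  · rw [add_mul]; exact (norm_add_le _ _).trans (add_le_add (h2 ξ) (h4 ξ))

theorem Bd.smul (c : 𝕜) {T : Op E F} {K : ℝ} (hT : T.Bd K) : (c • T).Bd (‖c‖ * K) := by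
  obtain ⟨hK, h1, h2⟩ := hT
  refine ⟨by positivity, fun η => ?_, fun ξ => ?_⟩
  · rw [smul_apply, norm_smul, mul_assoc]; gcongr; exact h1 η
  · rw [smul_adj, norm_smul, mul_assoc, RCLike.norm_conj]; gcongr; exact h2 ξ

/-- The norm of operators. -/
def gauge (E F : HilbMod C) : Gauge 𝕜 (Op E F) where
  Bd := Bd
  nonneg h := h.1
  exists_bd T := T.bdd
  zero := ⟨le_rfl, by simp, fun ξ => by change ‖(0 : E.E _)‖ ≤ _; simp⟩
  add := Bd.add
  smul := Bd.smul

instance : SeminormedAddCommGroup (Op E F) := (gauge E F).seminormed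

instance : NormedSpace 𝕜 (Op E F) := (gauge E F).normedSpace

/-- Composition of operators. -/
def comp (S : Op F G) (T : Op E F) : Op E G where
  toFun := S.toFun ∘ₗ T.toFun
  adj := T.adj ∘ₗ S.adj
  inner_adj ξ η := by simp [S.inner_adj, T.inner_adj]
  bdd := by
    obtain ⟨K, hK, h1, h2⟩ := S.bdd
    obtain ⟨L, hL, h3, h4⟩ := T.bdd
    refine ⟨K * L, by positivity, fun η => ?_, fun ξ => ?_⟩
    · exact (h1 _).trans (by rw [mul_assoc]; gcongr; exact h3 η)
    · exact (h4 _).trans (by rw [mul_comm K, mul_assoc]; gcongr; exact h2 ξ)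

@[simp] theorem comp_apply (S : Op F G) (T : Op E F) {a : C.Obj} (η : E.E a) :
    (S.comp T).toFun η = S.toFun (T.toFun η) := rfl

@[simp] theorem comp_adj (S : Op F G) (T : Op E F) {a : C.Obj} (η : G.E a) :
    (S.comp T).adj η = T.adj (S.adj η) := rfl

theorem Bd.comp {S : Op F G} {T : Op E F} {K L : ℝ} (hS : S.Bd K) (hT : T.Bd L) :
    (S.comp T).Bd (K * L) := by
  obtain ⟨hK, h1, h2⟩ := hS
  obtain ⟨hL, h3, h4⟩ := hT
  refine ⟨by positivity, fun η => ?_, fun ξ => ?_⟩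
  · exact (h1 _).trans (by rw [mul_assoc]; gcongr; exact h3 η)
  · exact (h4 _).trans (by rw [mul_comm K, mul_assoc]; gcongr; exact h2 ξ)

/-- The adjoint operator. -/
def star (T : Op E F) : Op F E where
  toFun := T.adj
  adj := T.toFun
  inner_adj ξ η := (T.inner_adj' η ξ).symm
  bdd := by
    obtain ⟨K, hK, h1, h2⟩ := T.bdd
    exact ⟨K, hK, h2, h1⟩

@[simp] theorem star_apply (T : Op E F) {a : C.Obj} (η : F.E a) : T.star.toFun η = T.adj η := rfl

@[simp] theorem star_adj (T : Op E F) {a : C.Obj} (η : E.E a) : T.star.adj η = T.toFun η := rfl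

theorem Bd.star {T : Op E F} {K : ℝ} (hT : T.Bd K) : T.star.Bd K := ⟨hT.1, hT.2.2, hT.2.1⟩

/-- The grading of operators, `T ↦ γ T γ`: so `T` has degree `k` if it shifts degrees by `k`. -/
def grade (T : Op E F) : Op E F where
  toFun := F.grade ∘ₗ T.toFun ∘ₗ E.grade
  adj := E.grade ∘ₗ T.adj ∘ₗ F.grade
  inner_adj ξ η := by
    have h1 := F.grade_inner (F.grade ξ) (T.toFun (E.grade η))
    have h2 := E.grade_inner (T.adj (F.grade ξ)) (E.grade η)
    rw [F.grade_grade] at h1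
    rw [E.grade_grade] at h2
    simp only [LinearMap.comp_apply]
    rw [h1, h2, T.inner_adj]
  bdd := by
    obtain ⟨K, hK, h1, h2⟩ := T.bdd
    refine ⟨K, hK, fun η => ?_, fun ξ => ?_⟩
    · exact (F.norm_grade _).trans ((h1 _).trans (by gcongr; exact E.norm_grade _))
    · exact (E.norm_grade _).trans ((h2 _).trans (by gcongr; exact F.norm_grade _))

@[simp] theorem grade_apply (T : Op E F) {a : C.Obj} (η : E.E a) :
    T.grade.toFun η = F.grade (T.toFun (E.grade η)) := rfl

@[simp] theorem grade_adj (T : Op E F) {a : C.Obj} (η : F.E a) :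
    T.grade.adj η = E.grade (T.adj (F.grade η)) := rfl

theorem Bd.grade {T : Op E F} {K : ℝ} (hT : T.Bd K) : T.grade.Bd K := by
  obtain ⟨hK, h1, h2⟩ := hT
  refine ⟨hK, fun η => ?_, fun ξ => ?_⟩
  · exact (F.norm_grade _).trans ((h1 _).trans (by gcongr; exact E.norm_grade _))
  · exact (E.norm_grade _).trans ((h2 _).trans (by gcongr; exact F.norm_grade _))

end Op

/-- The graded `C*`-category `L(C)` of countably generated graded Hilbert `C`-modules and bounded
operators. -/
def LCat (C : GStarCat.{v, w} 𝕜) : GStarCat.{max v (w + 1), max v w} 𝕜 where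
  Obj := HilbMod C
  Hom E F := Op E F
  comp := LinearMap.mk₂ 𝕜 Op.comp (fun _ _ _ => Op.ext fun _ _ => by simp)
    (fun _ _ _ => Op.ext fun _ _ => by simp) (fun _ _ _ => Op.ext fun _ _ => by simp)
    (fun _ _ _ => Op.ext fun _ _ => by simp)
  assoc _ _ _ := rfl
  star :=
    { toFun := Op.star
      map_add' := fun _ _ => Op.ext fun _ _ => rfl
      map_smul' := fun _ _ => Op.ext fun _ _ => rfl }
  star_star _ := rfl
  star_comp _ _ := rfl
  grade :=
    { toFun := Op.grade
      map_add' := fun _ _ => Op.ext fun _ _ => by simp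
      map_smul' := fun _ _ => Op.ext fun _ _ => by simp }
  grade_grade {E F} T := Op.ext fun a (η : HilbMod.E E a) => by
    simp [HilbMod.grade_grade]
  grade_comp {E F G} S T := Op.ext fun a (η : HilbMod.E E a) => by
    simp [HilbMod.grade_grade]
  grade_star _ := rfl
  norm_grade_le {E F} T := by
    refine le_of_forall_pos_le_add fun ε hε => ?_
    obtain ⟨K, hK, h⟩ := (Op.gauge E F).exists_lt T hε
    exact ((Op.gauge E F).nrm_le (Op.Bd.grade hK)).trans h.le

/-! ## Compact operators -/

namespace Op

variable {C : GStarCat.{v, w} 𝕜} {E F G : HilbMod C}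

theorem norm_le_of_bd {T : Op E F} {K : ℝ} (h : T.Bd K) : ‖T‖ ≤ K := (gauge E F).nrm_le h

theorem bd_norm (T : Op E F) : T.Bd ‖T‖ := by
  refine ⟨norm_nonneg T, fun η => ?_, fun η => ?_⟩
  all_goals
    refine le_of_forall_pos_le_add fun ε hε => ?_
    have h1 : 0 < ‖η‖ + 1 := by positivity
    obtain ⟨K, hK, h⟩ := (gauge E F).exists_lt T (div_pos hε h1)
    have h2 : K ≤ ‖T‖ + ε / (‖η‖ + 1) := h.le
    have h3 : ε / (‖η‖ + 1) * ‖η‖ ≤ ε := by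
      rw [div_mul_eq_mul_div, div_le_iff₀ h1]; nlinarith [norm_nonneg η]
    have h4 : K * ‖η‖ ≤ (‖T‖ + ε / (‖η‖ + 1)) * ‖η‖ := by gcongr
  · exact (hK.2.1 η).trans (by linarith)
  · exact (hK.2.2 η).trans (by linarith)

theorem norm_comp_le (S : Op F G) (T : Op E F) : ‖S.comp T‖ ≤ ‖S‖ * ‖T‖ :=
  norm_le_of_bd (S.bd_norm.comp T.bd_norm)

/-- The rank one operators `ζ ↦ η ⟨ξ, ζ⟩`. -/
def IsRankOne (R : Op E F) : Prop :=
  ∃ (b : C.Obj) (η : F.E b) (ξ : E.E b), ∀ a (ζ : E.E a), R.toFun ζ = F.act η (E.inner ξ ζ)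

/-- The compact operators: norm limits of finite linear combinations of rank one operators. -/
def compacts (E F : HilbMod C) : Submodule 𝕜 (Op E F) :=
  (Submodule.span 𝕜 {R : Op E F | R.IsRankOne}).topologicalClosure

theorem map_mem_compacts {C' : GStarCat.{v', w'} 𝕜} {E' F' : HilbMod C'} {σ : 𝕜 →+* 𝕜} (f : Op E F →ₛₗ[σ] Op E' F') (K : ℝ)
    (hK : ∀ T, ‖f T‖ ≤ K * ‖T‖) (hf : ∀ R, R.IsRankOne → (f R).IsRankOne) {T : Op E F}
    (hT : T ∈ compacts E F) : f T ∈ compacts E' F' := by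
  have hc : Continuous f := AddMonoidHomClass.continuous_of_bound f K hK
  refine map_mem_closure hc hT fun S hS => ?_
  have : Submodule.span 𝕜 {R : Op E F | R.IsRankOne} ≤
      (Submodule.span 𝕜 {R : Op E' F' | R.IsRankOne}).comap f :=
    Submodule.span_le.mpr fun R hR => Submodule.subset_span (hf R hR)
  exact this hS

theorem comp_mem_left (S : Op F G) {T : Op E F} (hT : T ∈ compacts E F) :
    S.comp T ∈ compacts E G :=
  map_mem_compacts (σ := RingHom.id 𝕜)
    (f := { toFun := fun T : Op E F => S.comp T
            map_add' := fun _ _ => ext fun _ _ => by simp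
            map_smul' := fun _ _ => ext fun _ _ => by simp }) ‖S‖ (norm_comp_le S)
    (fun R ⟨b, η, ξ, h⟩ => ⟨b, S.toFun η, ξ, fun a ζ => by
      change S.toFun (R.toFun ζ) = _
      rw [h, S.map_act]⟩) hT

theorem comp_mem_right {S : Op F G} (hS : S ∈ compacts F G) (T : Op E F) :
    S.comp T ∈ compacts E G :=
  map_mem_compacts (σ := RingHom.id 𝕜)
    (f := { toFun := fun S : Op F G => S.comp T
            map_add' := fun _ _ => ext fun _ _ => rfl
            map_smul' := fun _ _ => ext fun _ _ => rfl }) ‖T‖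
    (fun S => (norm_comp_le S T).trans_eq (mul_comm _ _))
    (fun R ⟨b, η, ξ, h⟩ => ⟨b, η, T.adj ξ, fun a ζ => by
      change R.toFun (T.toFun ζ) = _
      rw [h, T.inner_adj]⟩) hS

theorem star_mem {T : Op E F} (hT : T ∈ compacts E F) : T.star ∈ compacts F E :=
  map_mem_compacts (f := (LCat C).star (a := E) (b := F)) 1
    (fun T => by rw [one_mul]; exact norm_le_of_bd T.bd_norm.star)
    (fun R ⟨b, η, ξ, h⟩ => ⟨b, ξ, η, fun a ζ => E.ext_inner' fun θ => by
      change E.inner θ (R.adj ζ) = _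
      rw [← R.inner_adj', h, E.inner_act, ← F.inner_star, F.inner_act, C.star_comp, F.inner_star,
        E.inner_star]⟩) hT

theorem grade_mem {T : Op E F} (hT : T ∈ compacts E F) : T.grade ∈ compacts E F :=
  map_mem_compacts (f := (LCat C).grade (a := E) (b := F)) 1
    (fun T => by rw [one_mul]; exact norm_le_of_bd T.bd_norm.grade)
    (fun R ⟨b, η, ξ, h⟩ => ⟨b, F.grade η, E.grade ξ, fun a ζ => by
      change F.grade (R.toFun (E.grade ζ)) = _
      rw [h, F.grade_act, ← E.grade_inner, E.grade_grade]⟩) hT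

end Op

/-! ## Bounded families of operators -/

/-- Uniformly bounded families of operators between families of Hilbert modules. -/
def Fam {I : Type v'} {C : I → GStarCat.{v, w} 𝕜} (E F : ∀ i, HilbMod (C i)) :
    Submodule 𝕜 (∀ i, Op (E i) (F i)) where
  carrier := {T | ∃ K, 0 ≤ K ∧ ∀ i, (T i).Bd K}
  add_mem' := by
    rintro S T ⟨K, hK, h⟩ ⟨L, hL, h'⟩
    exact ⟨K + L, by positivity, fun i => (h i).add (h' i)⟩
  zero_mem' := ⟨0, le_rfl, fun i => (Op.gauge (E i) (F i)).zero⟩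
  smul_mem' := by
    rintro c T ⟨K, hK, h⟩
    exact ⟨‖c‖ * K, by positivity, fun i => (h i).smul c⟩

namespace Fam

variable {I : Type v'} {C : I → GStarCat.{v, w} 𝕜} {E F G : ∀ i, HilbMod (C i)}

/-- The supremum norm on families. -/
def gauge (E F : ∀ i, HilbMod (C i)) : Gauge 𝕜 (Fam E F) where
  Bd T K := 0 ≤ K ∧ ∀ i, (T.1 i).Bd K
  nonneg h := h.1
  exists_bd T := T.2
  zero := ⟨le_rfl, fun i => (Op.gauge (E i) (F i)).zero⟩
  add h h' := ⟨add_nonneg h.1 h'.1, fun i => (h.2 i).add (h'.2 i)⟩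
  smul c _ _ h := ⟨mul_nonneg (norm_nonneg c) h.1, fun i => (h.2 i).smul c⟩

instance : SeminormedAddCommGroup (Fam E F) := (gauge E F).seminormed

instance : NormedSpace 𝕜 (Fam E F) := (gauge E F).normedSpace

theorem norm_le_of_bd {I' : Type v''} {C' : I' → GStarCat.{v, w} 𝕜} {E' F' : ∀ i, HilbMod (C' i)}
    (S : Fam E F) (T : Fam E' F') (h : ∀ K, (gauge E F).Bd S K → (gauge E' F').Bd T K) :
    ‖T‖ ≤ ‖S‖ := by
  refine le_of_forall_pos_le_add fun ε hε => ?_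
  obtain ⟨K, hK, h'⟩ := (gauge E F).exists_lt S hε
  exact ((gauge E' F').nrm_le (h K hK)).trans h'.le

end Fam

/-- The graded `C*`-category with prescribed objects, each giving a family of Hilbert modules, and
with bounded families of operators as morphisms. -/
def FamCat {I : Type v'} (C : I → GStarCat.{v, w} 𝕜) {Ob : Type v''}
    (o : Ob → ∀ i, HilbMod (C i)) : GStarCat.{v'', max v v' w} 𝕜 where
  Obj := Ob
  Hom a b := Fam (o a) (o b)
  comp := LinearMap.mk₂ 𝕜 (fun S T => ⟨fun i => (S.1 i).comp (T.1 i), by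
      obtain ⟨K, hK, h⟩ := S.2
      obtain ⟨L, hL, h'⟩ := T.2
      exact ⟨K * L, by positivity, fun i => (h i).comp (h' i)⟩⟩)
    (fun _ _ _ => Subtype.ext (funext fun _ => Op.ext fun _ _ => rfl))
    (fun _ _ _ => Subtype.ext (funext fun _ => Op.ext fun _ _ => rfl))
    (fun _ _ _ => Subtype.ext (funext fun _ => Op.ext fun _ _ => by
      simp))
    (fun _ _ _ => Subtype.ext (funext fun _ => Op.ext fun _ _ => by
      simp))
  assoc _ _ _ := rfl
  star :=
    { toFun := fun T => ⟨fun i => (T.1 i).star, by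
        obtain ⟨K, hK, h⟩ := T.2
        exact ⟨K, hK, fun i => (h i).star⟩⟩
      map_add' := fun _ _ => Subtype.ext (funext fun _ => Op.ext fun _ _ => rfl)
      map_smul' := fun _ _ => Subtype.ext (funext fun _ => Op.ext fun _ _ => rfl) }
  star_star _ := rfl
  star_comp _ _ := rfl
  grade :=
    { toFun := fun T => ⟨fun i => (T.1 i).grade, by
        obtain ⟨K, hK, h⟩ := T.2
        exact ⟨K, hK, fun i => (h i).grade⟩⟩
      map_add' := fun _ _ => Subtype.ext (funext fun _ => Op.ext fun _ _ => by simp)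
      map_smul' := fun _ _ => Subtype.ext (funext fun _ => Op.ext fun _ _ => by simp) }
  grade_grade _ := Subtype.ext (funext fun _ => Op.ext fun _ _ => by simp [HilbMod.grade_grade])
  grade_comp _ _ := Subtype.ext (funext fun _ => Op.ext fun _ _ => by simp [HilbMod.grade_grade])
  grade_star _ := rfl
  norm_grade_le _ := Fam.norm_le_of_bd _ _ fun _ h => ⟨h.1, fun i => (h.2 i).grade⟩

/-! ## Bimodules and the categories `D(A,B)`, `KD(A,B)` and `QD(A,B)` -/

/-- A graded Hilbert `(A,B)`-bimodule: a graded `C*`-functor from `A` to `L(B)`. -/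
abbrev Bimod (A : GStarCat.{v', w'} 𝕜) (B : GStarCat.{v, w} 𝕜) := GFunctor A (LCat B)

namespace Bimod

variable {A : GStarCat.{v', w'} 𝕜} {B : GStarCat.{v, w} 𝕜}

/-- The Hilbert `B`-module associated to an object of `A`. -/
def fiber (E : Bimod A B) (p : A.Obj) : HilbMod B := E.obj p

/-- The left action of a morphism of `A`. -/
def op (E : Bimod A B) {p q : A.Obj} : A.Hom p q →ₗ[𝕜] Op (E.fiber p) (E.fiber q) := E.map

theorem op_comp (E : Bimod A B) {p q r : A.Obj} (x : A.Hom q r) (y : A.Hom p q) :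
    E.op (A.comp x y) = (E.op x).comp (E.op y) := E.map_comp x y

theorem op_star (E : Bimod A B) {p q : A.Obj} (x : A.Hom p q) :
    E.op (A.star x) = (E.op x).star := E.map_star x

theorem op_grade (E : Bimod A B) {p q : A.Obj} (x : A.Hom p q) :
    E.op (A.grade x) = (E.op x).grade := E.map_grade x

variable {E F G : Bimod A B}

/-- The graded commutator `[x, T] = x T_p - (-1)^(deg x deg T) T_q x`, extended bilinearly. -/
def gcomm {p q : A.Obj} (x : A.Hom p q) (T : Op (E.fiber p) (F.fiber p)) (T' : Op (E.fiber q) (F.fiber q)) :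
    Op (E.fiber p) (F.fiber q) :=
  (F.op x).comp T - T'.comp (E.op (A.even x)) - T'.grade.comp (E.op (A.odd x))

theorem gcomm_even {p q : A.Obj} (x : A.Hom p q) (T : Op (E.fiber p) (F.fiber p))
    (T' : Op (E.fiber q) (F.fiber q)) :
    gcomm (A.even x) T T' = (F.op (A.even x)).comp T - T'.comp (E.op (A.even x)) := by
  have h := A.even_of (A.grade_even x)
  refine Op.ext fun a η => ?_
  simp [gcomm, h.1, h.2]

theorem gcomm_odd {p q : A.Obj} (x : A.Hom p q) (T : Op (E.fiber p) (F.fiber p))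
    (T' : Op (E.fiber q) (F.fiber q)) :
    gcomm (A.odd x) T T' = (F.op (A.odd x)).comp T - T'.grade.comp (E.op (A.odd x)) := by
  have h := A.odd_of (A.grade_odd x)
  refine Op.ext fun a η => ?_
  simp [gcomm, h.1, h.2]

theorem op_split {p q : A.Obj} (x : A.Hom p q) {a : B.Obj} (η : (E.fiber p).E a) :
    (E.op x).toFun η = (E.op (A.even x)).toFun η + (E.op (A.odd x)).toFun η := by
  conv_lhs => rw [← A.even_add_odd x, map_add]
  rfl
theorem grade_grade_op {H K : HilbMod B} (T : Op H K) : T.grade.grade = T :=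
  Op.ext fun _ _ => by simp [HilbMod.grade_grade]

/-- The families satisfying the condition that all graded commutators are compact. -/
def Comm (E F : Bimod A B) (T : ∀ p, Op (E.fiber p) (F.fiber p)) : Prop :=
  ∀ {p q : A.Obj} (x : A.Hom p q), gcomm x (T p) (T q) ∈ Op.compacts (E.fiber p) (F.fiber q)

/-- The families which are compact after multiplication by elements of `A`. -/
def Cpt (E F : Bimod A B) (T : ∀ p, Op (E.fiber p) (F.fiber p)) : Prop :=
  ∀ {p q : A.Obj} (x : A.Hom p q),
    (F.op x).comp (T p) ∈ Op.compacts (E.fiber p) (F.fiber q) ∧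
    (T q).comp (E.op x) ∈ Op.compacts (E.fiber p) (F.fiber q)

theorem Comm.comp {S : ∀ p, Op (F.fiber p) (G.fiber p)} {T : ∀ p, Op (E.fiber p) (F.fiber p)}
    (hS : Comm F G S) (hT : Comm E F T) : Comm E G fun p => (S p).comp (T p) := by
  intro p q x
  have h : gcomm x ((S p).comp (T p)) ((S q).comp (T q)) = (gcomm x (S p) (S q)).comp (T p) +
      (S q).comp (gcomm (A.even x) (T p) (T q)) +
      (S q).grade.comp (gcomm (A.odd x) (T p) (T q)) := by
    rw [gcomm_even, gcomm_odd]
    refine Op.ext fun a η => ?_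
    simp only [gcomm, Op.add_apply, Op.sub_apply, Op.comp_apply, Op.grade_apply, map_sub,
      HilbMod.grade_grade]
    abel
  rw [h]
  exact add_mem (add_mem (Op.comp_mem_right (hS x) _) (Op.comp_mem_left _ (hT _)))
    (Op.comp_mem_left _ (hT _))

theorem Comm.grade {T : ∀ p, Op (E.fiber p) (F.fiber p)} (hT : Comm E F T) :
    Comm E F fun p => (T p).grade := by
  intro p q x
  have h : gcomm x (T p).grade (T q).grade = (gcomm (A.grade x) (T p) (T q)).grade := by
    have h1 : A.even (A.grade x) = A.even x := by simp [GStarCat.even, A.grade_grade, add_comm]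
    have h2 : A.odd (A.grade x) = -A.odd x := by
      simp only [GStarCat.odd, LinearMap.smul_apply, LinearMap.sub_apply, LinearMap.id_apply,
        A.grade_grade]
      module
    have h3 := E.op_grade (A.even x)
    have h4 := E.op_grade (A.odd x)
    rw [A.grade_even] at h3
    rw [A.grade_odd] at h4
    refine Op.ext fun a η => ?_
    have h3' := congrArg (fun R => Op.toFun R (E.fiber p |>.grade η)) h3
    have h4' := congrArg (fun R => Op.toFun R (E.fiber p |>.grade η)) h4
    simp only [Op.grade_apply, HilbMod.grade_grade, map_neg, Op.neg_apply] at h3' h4'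
    simp only [gcomm, h1, h2, op_grade, Op.sub_apply, Op.comp_apply, Op.grade_apply, map_sub,
      HilbMod.grade_grade, map_neg, Op.neg_apply]
    rw [h3', neg_eq_iff_eq_neg.mp h4']
    simp [HilbMod.grade_grade]
  rw [h]
  exact Op.grade_mem (hT _)

theorem Comm.star {T : ∀ p, Op (E.fiber p) (F.fiber p)} (hT : Comm E F T) :
    Comm F E fun p => (T p).star := by
  intro p q x
  have e1 := A.grade_even x
  have e2 := A.grade_odd x
  have h1 := A.even_of (x := A.star (A.even x)) (by rw [A.grade_star, e1])
  have h2 := A.odd_of (x := A.star (A.odd x)) (by rw [A.grade_star, e2, map_neg])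
  have h : gcomm x (T p).star (T q).star = -(gcomm (A.star (A.even x)) (T q) (T p)).star -
      (gcomm (A.star (A.odd x)) (T q).grade (T p).grade).star := by
    refine Op.ext fun a η => ?_
    simp only [gcomm, h1.1, h1.2, h2.1, h2.2, map_zero, op_star, grade_grade_op, Op.neg_apply,
      Op.sub_apply, Op.star_apply, Op.sub_adj, Op.comp_adj, Op.comp_apply, Op.star_adj,
      Op.grade_apply, Op.grade_adj]
    rw [op_split x]
    simp only [Op.zero_adj]
    abel
  rw [h]
  exact sub_mem (neg_mem (Op.star_mem (hT _))) (Op.star_mem (hT.grade _))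

theorem Cpt.star {T : ∀ p, Op (E.fiber p) (F.fiber p)} (hT : Cpt E F T) :
    Cpt F E fun p => (T p).star := by
  intro p q x
  have h := hT (A.star x)
  have h1 := Op.star_mem h.1
  have h2 := Op.star_mem h.2
  rw [op_star] at h1 h2
  exact ⟨h2, h1⟩

theorem Cpt.grade {T : ∀ p, Op (E.fiber p) (F.fiber p)} (hT : Cpt E F T) :
    Cpt E F fun p => (T p).grade := by
  intro p q x
  have h := hT (A.grade x)
  have h1 := Op.grade_mem h.1
  have h2 := Op.grade_mem h.2
  rw [op_grade] at h1 h2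
  constructor
  · convert h1 using 1
    exact Op.ext fun _ _ => by simp [HilbMod.grade_grade]
  · convert h2 using 1
    exact Op.ext fun _ _ => by simp [HilbMod.grade_grade]

theorem Comm.comp_cpt {S : ∀ p, Op (F.fiber p) (G.fiber p)} {T : ∀ p, Op (E.fiber p) (F.fiber p)}
    (hS : Comm F G S) (hT : Cpt E F T) : Cpt E G fun p => (S p).comp (T p) := by
  intro p q x
  constructor
  · have h : (G.op x).comp ((S p).comp (T p)) = (gcomm x (S p) (S q)).comp (T p) +
        (S q).comp ((F.op (A.even x)).comp (T p)) +
        (S q).grade.comp ((F.op (A.odd x)).comp (T p)) := by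
      refine Op.ext fun a η => ?_
      simp only [gcomm, Op.add_apply, Op.sub_apply, Op.comp_apply, Op.grade_apply]
      abel
    rw [h]
    exact add_mem (add_mem (Op.comp_mem_right (hS x) _) (Op.comp_mem_left _ (hT _).1))
      (Op.comp_mem_left _ (hT _).1)
  · exact Op.comp_mem_left (S q) (hT x).2

theorem Cpt.comp_comm {S : ∀ p, Op (F.fiber p) (G.fiber p)} {T : ∀ p, Op (E.fiber p) (F.fiber p)}
    (hS : Cpt F G S) (hT : Comm E F T) : Cpt E G fun p => (S p).comp (T p) := by
  intro p q x
  exact Cpt.star (T := fun p => (T p).star.comp (S p).star)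
    (Comm.comp_cpt (Comm.star hT) (Cpt.star hS)) x

theorem Comm.add {S T : ∀ p, Op (E.fiber p) (F.fiber p)} (hS : Comm E F S) (hT : Comm E F T) :
    Comm E F fun p => S p + T p := by
  intro p q x
  convert add_mem (hS x) (hT x) using 1
  refine Op.ext fun a η => ?_
  simp [gcomm]
  abel

theorem Comm.smul (c : 𝕜) {T : ∀ p, Op (E.fiber p) (F.fiber p)} (hT : Comm E F T) :
    Comm E F fun p => c • T p := by
  intro p q x
  convert Submodule.smul_mem _ c (hT x) using 1
  refine Op.ext fun a η => ?_
  simp [gcomm, smul_sub]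

theorem Comm.zero : Comm E F fun _ => 0 := by
  intro p q x
  convert (Op.compacts (E.fiber p) (F.fiber q)).zero_mem using 1
  exact Op.ext fun a η => by simp [gcomm]

theorem Cpt.add {S T : ∀ p, Op (E.fiber p) (F.fiber p)} (hS : Cpt E F S) (hT : Cpt E F T) :
    Cpt E F fun p => S p + T p := by
  intro p q x
  constructor
  · convert add_mem (hS x).1 (hT x).1 using 1
    exact Op.ext fun a η => by simp
  · convert add_mem (hS x).2 (hT x).2 using 1
    exact Op.ext fun a η => by simp

theorem Cpt.smul (c : 𝕜) {T : ∀ p, Op (E.fiber p) (F.fiber p)} (hT : Cpt E F T) :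
    Cpt E F fun p => c • T p := by
  intro p q x
  constructor
  · convert Submodule.smul_mem _ c (hT x).1 using 1
    exact Op.ext fun a η => by simp
  · convert Submodule.smul_mem _ c (hT x).2 using 1
    exact Op.ext fun a η => by simp

theorem Cpt.zero : Cpt E F fun _ => 0 := by
  intro p q x
  constructor
  · convert (Op.compacts (E.fiber p) (F.fiber q)).zero_mem using 1
    exact Op.ext fun a η => by simp
  · convert (Op.compacts (E.fiber p) (F.fiber q)).zero_mem using 1
    exact Op.ext fun a η => by simp

end Bimod

/-- The pair consisting of `D(A,B)` (the bounded operators between bimodules with compact graded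
commutators with `A`) and of its ideal `KD(A,B)`. -/
def DPair (A : GStarCat.{v', w'} 𝕜) (B : GStarCat.{v, w} 𝕜) :
    SubQuot (FamCat (fun _ : A.Obj => B) (Bimod.fiber (A := A) (B := B))) where
  P E F :=
    { carrier := {T | Bimod.Comm E F T.1}
      add_mem' := fun h h' => Bimod.Comm.add h h'
      zero_mem' := Bimod.Comm.zero
      smul_mem' := fun c _ h => Bimod.Comm.smul c h }
  Q E F :=
    { carrier := {T | Bimod.Cpt E F T.1}
      add_mem' := fun h h' => Bimod.Cpt.add h h'
      zero_mem' := Bimod.Cpt.zero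
      smul_mem' := fun c _ h => Bimod.Cpt.smul c h }
  P_comp h h' := Bimod.Comm.comp h h'
  P_star h := Bimod.Comm.star h
  P_grade h := Bimod.Comm.grade h
  PQ_comp h h' := Bimod.Comm.comp_cpt h h'
  QP_comp h h' := Bimod.Cpt.comp_comm h h'
  Q_star h := Bimod.Cpt.star h
  Q_grade h := Bimod.Cpt.grade h

/-- The quotient `QD(A,B) = D(A,B) / KD(A,B)`. -/
def QD (A : GStarCat.{v', w'} 𝕜) (B : GStarCat.{v, w} 𝕜) := (DPair A B).quot

/-! ## Graded C*-algebras with groupoid actions -/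

/-- A graded `C*`-algebra over `𝕜` (real or complex): a complete normed `*`-algebra satisfying the
`C*`-identity in which every `1 + x* x` is invertible (in the unitization; for `𝕜 = ℂ` this holds
automatically), with a grading automorphism. -/
structure CAlg (𝕜 : Type) [RCLike 𝕜] where
  carrier : Type u
  [ring : NonUnitalNormedRing carrier]
  [space : NormedSpace 𝕜 carrier]
  [tower : IsScalarTower 𝕜 carrier carrier]
  [smulComm : SMulCommClass 𝕜 carrier carrier]
  [starRing : StarRing carrier]
  [starModule : StarModule 𝕜 carrier]
  [cstar : CStarRing carrier]
  [complete : CompleteSpace carrier]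
  one_add_inv : ∀ x : carrier, ∃ z : carrier,
    z + star x * x + star x * x * z = 0 ∧ z + star x * x + z * (star x * x) = 0
  grade : carrier →⋆ₙₐ[𝕜] carrier
  grade_grade : ∀ x, grade (grade x) = x
  norm_grade_le : ∀ x, ‖grade x‖ ≤ ‖x‖

instance : CoeSort (CAlg.{u} 𝕜) (Type u) := ⟨CAlg.carrier⟩

attribute [instance] CAlg.ring CAlg.space CAlg.tower CAlg.smulComm CAlg.starRing CAlg.starModule
  CAlg.cstar CAlg.complete

/-- A graded `C*`-algebra as a graded `C*`-category with one object. -/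
def CAlg.cat (A : CAlg.{u} 𝕜) : GStarCat.{u, u} 𝕜 where
  Obj := PUnit.{u + 1}
  Hom _ _ := A
  comp := LinearMap.mul 𝕜 A
  assoc _ _ _ := mul_assoc _ _ _
  star :=
    { toFun := fun x => star x
      map_add' := star_add
      map_smul' := fun c x => star_smul c x }
  star_star x := _root_.star_star x
  star_comp x y := star_mul x y
  grade := fun {_ _} => (A.grade : A →ₗ[𝕜] A)
  grade_grade := A.grade_grade
  grade_comp x y := map_mul A.grade x y
  grade_star x := map_star A.grade x
  norm_grade_le := A.norm_grade_le

/-- The object of the category of a `C*`-algebra. -/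
def CAlg.pt (A : CAlg.{u} 𝕜) : A.cat.Obj := PUnit.unit

/-- A morphism of graded `C*`-algebras (contractivity is automatic). -/
structure CHom (A B : CAlg.{u} 𝕜) where
  hom : A →⋆ₙₐ[𝕜] B
  map_grade : ∀ x, hom (A.grade x) = B.grade (hom x)
  norm_le : ∀ x, ‖hom x‖ ≤ ‖x‖

instance (A B : CAlg.{u} 𝕜) : CoeFun (CHom A B) (fun _ => A → B) := ⟨fun f => f.hom⟩

/-- A morphism of graded `C*`-algebras as a functor. -/
def CHom.functor {A B : CAlg.{u} 𝕜} (f : CHom A B) : GFunctor A.cat B.cat where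
  obj := id
  map := fun {_ _} => (f.hom : A →ₗ[𝕜] B)
  map_comp x y := map_mul f.hom (show A from x) (show A from y)
  map_star x := map_star f.hom (x : A)
  map_grade := f.map_grade
  norm_map_le := f.norm_le

/-- A graded `𝒢`-`C*`-algebra: a functor from the groupoid `𝒢` to graded `C*`-algebras. -/
structure GCAlg (𝕜 : Type) [RCLike 𝕜] (𝒢 : Type u) [Groupoid.{u} 𝒢] where
  alg : 𝒢 → CAlg.{u} 𝕜
  act : ∀ {a b : 𝒢}, (a ⟶ b) → CHom (alg a) (alg b)
  act_id : ∀ {a : 𝒢} (x : alg a), act (𝟙 a) x = x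
  act_comp : ∀ {a b c : 𝒢} (g : a ⟶ b) (h : b ⟶ c) (x : alg a), act (g ≫ h) x = act h (act g x)

/-- `A` is `σ`-unital: each of its `C*`-algebras has a countable approximate unit. -/
def GCAlg.SigmaUnital {𝒢 : Type u} [Groupoid.{u} 𝒢] (A : GCAlg 𝕜 𝒢) : Prop :=
  ∀ a, ∃ e : ℕ → A.alg a, (∀ n, ‖e n‖ ≤ 1) ∧ ∀ x : A.alg a,
    Filter.Tendsto (fun n => e n * x) Filter.atTop (𝓝 x) ∧
    Filter.Tendsto (fun n => x * e n) Filter.atTop (𝓝 x)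

/-- An equivariant map of graded `C*`-algebras covering a functor of groupoids. -/
structure CovHom {ℋ 𝒢 : Type u} [Groupoid.{u} ℋ] [Groupoid.{u} 𝒢] (f : ℋ ⥤ 𝒢)
    (A : GCAlg 𝕜 ℋ) (B : GCAlg 𝕜 𝒢) where
  app : ∀ a, CHom (A.alg a) (B.alg (f.obj a))
  equivariant : ∀ {a b : ℋ} (g : a ⟶ b) (x : A.alg a), app b (A.act g x) = B.act (f.map g) (app a x)

/-- A `𝒢`-equivariant map between graded `𝒢`-`C*`-algebras. -/
abbrev GHom {𝒢 : Type u} [Groupoid.{u} 𝒢] (A B : GCAlg 𝕜 𝒢) := CovHom (𝟭 𝒢) A B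

/-- Restriction of a `𝒢`-`C*`-algebra along a functor `ℋ ⥤ 𝒢`. -/
def GCAlg.restrict {ℋ 𝒢 : Type u} [Groupoid.{u} ℋ] [Groupoid.{u} 𝒢] (f : ℋ ⥤ 𝒢)
    (A : GCAlg 𝕜 𝒢) : GCAlg 𝕜 ℋ where
  alg a := A.alg (f.obj a)
  act g := A.act (f.map g)
  act_id x := by rw [f.map_id, A.act_id]
  act_comp g h x := by rw [f.map_comp, A.act_comp]

/-- The identity maps, as an equivariant map covering the functor `f`. -/
def GCAlg.restrictHom {ℋ 𝒢 : Type u} [Groupoid.{u} ℋ] [Groupoid.{u} 𝒢] (f : ℋ ⥤ 𝒢)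
    (A : GCAlg 𝕜 𝒢) : CovHom f (A.restrict f) A where
  app _ := ⟨NonUnitalStarAlgHom.id 𝕜 _, fun _ => rfl, fun _ => le_rfl⟩
  equivariant _ _ := rfl

/-! ## Equivariant bimodules and the category `QD_𝒢(A,B)` -/

/-- The space of a Hilbert module over a `C*`-algebra. -/
abbrev HilbMod.sp {B : CAlg.{u} 𝕜} (E : HilbMod B.cat) : Type u := E.E B.pt

/-- A countably generated `𝒢`-equivariant graded Hilbert `(A,B)`-bimodule: graded Hilbert
`(A_a,B_a)`-bimodules `E_a` with a functorial action of `𝒢` by linear maps `tr g : E_a → E_b`,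
compatible with all the structure. -/
structure GMod {𝒢 : Type u} [Groupoid.{u} 𝒢] (A B : GCAlg 𝕜 𝒢) where
  bim : ∀ a, Bimod (A.alg a).cat (B.alg a).cat
  tr : ∀ {a b : 𝒢}, (a ⟶ b) → ((bim a).fiber (CAlg.pt _)).sp →ₗ[𝕜] ((bim b).fiber (CAlg.pt _)).sp
  tr_id : ∀ {a : 𝒢} (η), tr (𝟙 a) η = η
  tr_comp : ∀ {a b c : 𝒢} (g : a ⟶ b) (h : b ⟶ c) (η), tr (g ≫ h) η = tr h (tr g η)
  tr_act : ∀ {a b : 𝒢} (g : a ⟶ b) (η) (x : B.alg a),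
    tr g (((bim a).fiber (CAlg.pt _)).act η x) =
      ((bim b).fiber (CAlg.pt _)).act (tr g η) (B.act g x : B.alg b)
  tr_inner : ∀ {a b : 𝒢} (g : a ⟶ b) (η ξ),
    ((bim b).fiber (CAlg.pt _)).inner (tr g η) (tr g ξ) =
      (B.act g (((bim a).fiber (CAlg.pt _)).inner η ξ : B.alg a) : B.alg b)
  tr_grade : ∀ {a b : 𝒢} (g : a ⟶ b) (η),
    tr g (((bim a).fiber (CAlg.pt _)).grade η) = ((bim b).fiber (CAlg.pt _)).grade (tr g η)
  tr_op : ∀ {a b : 𝒢} (g : a ⟶ b) (x : A.alg a) (η),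
    tr g (((bim a).op (p := CAlg.pt _) (q := CAlg.pt _) x).toFun η) =
      ((bim b).op (p := CAlg.pt _) (q := CAlg.pt _) (A.act g x : A.alg b)).toFun (tr g η)

namespace GMod

variable {𝒢 : Type u} [Groupoid.{u} 𝒢] {A B : GCAlg 𝕜 𝒢}

/-- The Hilbert `B_a`-module `E_a`. -/
abbrev mod (E : GMod A B) (a : 𝒢) : HilbMod (B.alg a).cat := (E.bim a).fiber (CAlg.pt _)

/-- The left action of `A_a` on `E_a`. -/
def op (E : GMod A B) {a : 𝒢} (x : A.alg a) : Op (E.mod a) (E.mod a) :=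
  (E.bim a).op (p := CAlg.pt _) (q := CAlg.pt _) x

theorem op_zero (E : GMod A B) {a : 𝒢} : E.op (0 : A.alg a) = 0 :=
  map_zero ((E.bim a).op (p := CAlg.pt _) (q := CAlg.pt _))

theorem tr_inv (E : GMod A B) {a b : 𝒢} (g : a ⟶ b) (η : (E.mod b).sp) :
    E.tr g (E.tr (Groupoid.inv g) η) = η := by
  rw [← E.tr_comp, Groupoid.inv_comp, E.tr_id]

theorem norm_tr (E : GMod A B) {a b : 𝒢} (g : a ⟶ b) (η : (E.mod a).sp) : ‖E.tr g η‖ ≤ ‖η‖ := by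
  have h : ‖E.tr g η‖ ^ 2 ≤ ‖η‖ ^ 2 := by
    rw [HilbMod.norm_sq, HilbMod.norm_sq, E.tr_inner]
    exact (B.act g).norm_le _
  exact (sq_le_sq₀ (norm_nonneg _) (norm_nonneg _)).mp h

variable {E F G : GMod A B}

/-- Conjugation by a groupoid element, `T ↦ g T g⁻¹`. -/
def conj {a b : 𝒢} (g : a ⟶ b) (T : Op (E.mod a) (F.mod a)) : Op (E.mod b) (F.mod b) where
  toFun := fun {_} => F.tr g ∘ₗ T.toFun ∘ₗ E.tr (Groupoid.inv g)
  adj := fun {_} => E.tr g ∘ₗ T.adj ∘ₗ F.tr (Groupoid.inv g)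
  inner_adj {_ _} ξ η := by
    have h1 := F.tr_inner g (F.tr (Groupoid.inv g) ξ) (T.toFun (E.tr (Groupoid.inv g) η))
    have h2 := E.tr_inner g (T.adj (F.tr (Groupoid.inv g) ξ)) (E.tr (Groupoid.inv g) η)
    have h3 := F.tr_inv g ξ
    have h4 := E.tr_inv g η
    rw [h3] at h1
    rw [h4] at h2
    refine h1.trans (Eq.trans ?_ h2.symm)
    exact congrArg (fun z : B.alg a => (B.act g z : B.alg b)) (T.inner_adj _ _)
  bdd := by
    obtain ⟨K, hK, h1, h2⟩ := T.bdd
    refine ⟨K, hK, fun η => ?_, fun ξ => ?_⟩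
    · exact (F.norm_tr g _).trans ((h1 _).trans (by gcongr; exact E.norm_tr _ _))
    · exact (E.norm_tr g _).trans ((h2 _).trans (by gcongr; exact F.norm_tr _ _))

end GMod

namespace GMod

variable {𝒢 : Type u} [Groupoid.{u} 𝒢] {A B : GCAlg 𝕜 𝒢} {E F G : GMod A B}

theorem tr_inv' (E : GMod A B) {a b : 𝒢} (g : a ⟶ b) (η : (E.mod a).sp) :
    E.tr (Groupoid.inv g) (E.tr g η) = η := by
  rw [← E.tr_comp, Groupoid.comp_inv, E.tr_id]

theorem conj_apply {a b : 𝒢} (g : a ⟶ b) (T : Op (E.mod a) (F.mod a)) (η : (E.mod b).sp) :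
    (conj g T).toFun (a := CAlg.pt _) η = F.tr g (T.toFun (E.tr (Groupoid.inv g) η)) := rfl

/-- Operators between Hilbert modules over a `C*`-algebra are determined by one map. -/
theorem op_ext {B : CAlg.{u} 𝕜} {H K : HilbMod B.cat} {S T : Op H K}
    (h : ∀ η : H.sp, S.toFun (a := B.pt) η = T.toFun (a := B.pt) η) : S = T :=
  Op.ext fun _ η => h η

theorem conj_comp {a b : 𝒢} (g : a ⟶ b) (S : Op (F.mod a) (G.mod a)) (T : Op (E.mod a) (F.mod a)) :
    conj g (S.comp T) = (conj g S).comp (conj g T) := op_ext fun η => by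
  simp only [conj_apply, Op.comp_apply, tr_inv']

theorem conj_star {a b : 𝒢} (g : a ⟶ b) (T : Op (E.mod a) (F.mod a)) :
    conj g T.star = (conj g T).star := rfl

theorem conj_grade {a b : 𝒢} (g : a ⟶ b) (T : Op (E.mod a) (F.mod a)) :
    conj g T.grade = (conj g T).grade := op_ext fun η => by
  simp only [conj_apply, Op.grade_apply, ← tr_grade]

theorem conj_add {a b : 𝒢} (g : a ⟶ b) (S T : Op (E.mod a) (F.mod a)) :
    conj g (S + T) = conj g S + conj g T := op_ext fun η => by
  simp only [conj_apply, Op.add_apply, map_add]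

theorem conj_sub {a b : 𝒢} (g : a ⟶ b) (S T : Op (E.mod a) (F.mod a)) :
    conj g (S - T) = conj g S - conj g T := op_ext fun η => by
  simp only [conj_apply, Op.sub_apply, map_sub]

theorem conj_smul {a b : 𝒢} (g : a ⟶ b) (c : 𝕜) (T : Op (E.mod a) (F.mod a)) :
    conj g (c • T) = c • conj g T := op_ext fun η => by
  simp only [conj_apply, Op.smul_apply, map_smul]

theorem conj_bd {a b : 𝒢} (g : a ⟶ b) {T : Op (E.mod a) (F.mod a)} {K : ℝ} (h : T.Bd K) :
    (conj g T).Bd K := by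
  obtain ⟨hK, h1, h2⟩ := h
  refine ⟨hK, fun η => ?_, fun ξ => ?_⟩
  · exact (F.norm_tr g _).trans ((h1 _).trans (by gcongr; exact E.norm_tr _ _))
  · exact (E.norm_tr g _).trans ((h2 _).trans (by gcongr; exact F.norm_tr _ _))

theorem conj_op {a b : 𝒢} (g : a ⟶ b) (x : A.alg b) :
    conj (E := E) (F := E) g (E.op (A.act (Groupoid.inv g) x)) = E.op x := op_ext fun η => by
  rw [conj_apply]
  refine (E.tr_op g _ _).trans ?_
  rw [← A.act_comp, Groupoid.inv_comp, A.act_id]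
  exact congrArg _ (E.tr_inv g η)

theorem conj_mem {a b : 𝒢} (g : a ⟶ b) {T : Op (E.mod a) (F.mod a)}
    (hT : T ∈ Op.compacts (E.mod a) (F.mod a)) : conj g T ∈ Op.compacts (E.mod b) (F.mod b) :=
  Op.map_mem_compacts (σ := RingHom.id 𝕜)
    (f := { toFun := fun T : Op (E.mod a) (F.mod a) => conj g T
            map_add' := conj_add g
            map_smul' := conj_smul g }) 1
    (fun T => (Op.norm_le_of_bd (conj_bd g T.bd_norm)).trans_eq (one_mul _).symm)
    (fun R ⟨_, η, ξ, h⟩ => ⟨(CAlg.pt _ : (B.alg b).cat.Obj), F.tr g η, E.tr g ξ, fun _ ζ => by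
      refine (congrArg (F.tr g) (h (CAlg.pt _) _)).trans ((F.tr_act g _ _).trans ?_)
      refine congrArg _ ((E.tr_inner g _ _).symm.trans ?_)
      exact congrArg _ (E.tr_inv g ζ)⟩) hT

/-- The families `T` such that all graded commutators with elements of the algebras `A_a`, and all
`x (g T_a g⁻¹ - T_b)`, are compact. -/
def Comm (E F : GMod A B) (T : ∀ a, Op (E.mod a) (F.mod a)) : Prop :=
  (∀ a, Bimod.Comm (E.bim a) (F.bim a) fun _ => T a) ∧
  ∀ {a b : 𝒢} (g : a ⟶ b) (x : A.alg b),
    (F.op x).comp (conj g (T a) - T b) ∈ Op.compacts (E.mod b) (F.mod b)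

/-- The families which are compact after multiplication by elements of the algebras `A_a`. -/
def Cpt (E F : GMod A B) (T : ∀ a, Op (E.mod a) (F.mod a)) : Prop :=
  ∀ a, Bimod.Cpt (E.bim a) (F.bim a) fun _ => T a

/-- The graded commutator on one fibre. -/
abbrev gcomm {a : 𝒢} (x : A.alg a) (T : Op (E.mod a) (F.mod a)) : Op (E.mod a) (F.mod a) :=
  Bimod.gcomm (E := E.bim a) (F := F.bim a) (p := CAlg.pt _) (q := CAlg.pt _) x T T

abbrev ev {a : 𝒢} (x : A.alg a) : A.alg a := (A.alg a).cat.even (a := CAlg.pt _) (b := CAlg.pt _) x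

abbrev od {a : 𝒢} (x : A.alg a) : A.alg a := (A.alg a).cat.odd (a := CAlg.pt _) (b := CAlg.pt _) x

theorem gcomm_def {a : 𝒢} (x : A.alg a) (T : Op (E.mod a) (F.mod a)) :
    gcomm x T = (F.op x).comp T - T.comp (E.op (ev x)) - T.grade.comp (E.op (od x)) := rfl

theorem Comm.comp {S : ∀ a, Op (F.mod a) (G.mod a)} {T : ∀ a, Op (E.mod a) (F.mod a)}
    (hS : Comm F G S) (hT : Comm E F T) : Comm E G fun a => (S a).comp (T a) := by
  refine ⟨fun a => Bimod.Comm.comp (hS.1 a) (hT.1 a), fun {a b} g x => ?_⟩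
  have h : (G.op x).comp (conj g ((S a).comp (T a)) - (S b).comp (T b)) =
      ((G.op x).comp (conj g (S a) - S b)).comp (conj g (T a)) +
      (gcomm x (S b)).comp (conj g (T a) - T b) +
      (S b).comp ((F.op (ev x)).comp (conj g (T a) - T b)) +
      (S b).grade.comp ((F.op (od x)).comp (conj g (T a) - T b)) := by
    rw [conj_comp, gcomm_def]
    refine op_ext fun η => ?_
    simp only [Op.add_apply, Op.sub_apply, Op.comp_apply, map_sub]
    abel
  rw [h]
  exact add_mem (add_mem (add_mem (Op.comp_mem_right (hS.2 g x) _)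
    (Op.comp_mem_right (hS.1 b x) _)) (Op.comp_mem_left _ (hT.2 g _)))
    (Op.comp_mem_left _ (hT.2 g _))

theorem Comm.right {T : ∀ a, Op (E.mod a) (F.mod a)} (hT : Comm E F T) {a b : 𝒢} (g : a ⟶ b)
    (x : A.alg b) : (conj g (T a) - T b).comp (E.op x) ∈ Op.compacts (E.mod b) (F.mod b) := by
  have key : ∀ y : A.alg b, (conj g (T a) - T b).comp (E.op (ev y)) +
      (conj g (T a) - T b).grade.comp (E.op (od y)) ∈ Op.compacts (E.mod b) (F.mod b) := by
    intro y
    have h : (conj g (T a) - T b).comp (E.op (ev y)) +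
        (conj g (T a) - T b).grade.comp (E.op (od y)) =
        (F.op y).comp (conj g (T a) - T b) -
          (conj g (gcomm (A.act (Groupoid.inv g) y) (T a)) - gcomm y (T b)) := by
      have e1 : ev (A.act (Groupoid.inv g) y) = A.act (Groupoid.inv g) (ev y) :=
        ((A.act (Groupoid.inv g)).functor.map_even (a := CAlg.pt _) (b := CAlg.pt _) y).symm
      have e2 : od (A.act (Groupoid.inv g) y) = A.act (Groupoid.inv g) (od y) :=
        ((A.act (Groupoid.inv g)).functor.map_odd (a := CAlg.pt _) (b := CAlg.pt _) y).symm
      rw [gcomm_def, gcomm_def, conj_sub, conj_sub, conj_comp, conj_comp, conj_comp, e1, e2,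
        conj_op, conj_op, conj_op, conj_grade]
      refine op_ext fun η => ?_
      simp only [Op.add_apply, Op.sub_apply, Op.comp_apply, Op.grade_apply, map_sub]
      abel
    rw [h]
    exact sub_mem (hT.2 g y) (sub_mem (conj_mem g (hT.1 a _)) (hT.1 b y))
  have g1 := (A.alg b).cat.grade_even (a := CAlg.pt _) (b := CAlg.pt _) x
  have g2 := (A.alg b).cat.grade_odd (a := CAlg.pt _) (b := CAlg.pt _) x
  have k1 := key (ev x)
  have k2 := key (od x)
  have p1 := (A.alg b).cat.even_of g1
  have p2 := (A.alg b).cat.odd_of g2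
  have h1 : (conj g (T a) - T b).comp (E.op (ev x)) ∈ Op.compacts (E.mod b) (F.mod b) := by
    convert k1 using 1
    rw [show ev (ev x) = ev x from p1.1, show od (ev x) = 0 from p1.2]
    rw [op_zero]
    exact op_ext fun η => by simp
  have h2 : (conj g (T a) - T b).comp (E.op (od x)) ∈ Op.compacts (E.mod b) (F.mod b) := by
    have h := Op.grade_mem k2
    rw [show ev (od x) = 0 from p2.1, show od (od x) = od x from p2.2, op_zero] at h
    have h3 : (E.op (od x)).grade = -E.op (od x) := by
      have := (E.bim b).op_grade (p := CAlg.pt _) (q := CAlg.pt _) (od x)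
      rw [g2, map_neg] at this
      exact this.symm
    convert neg_mem h using 1
    refine op_ext fun η => ?_
    have h4 := congrArg (fun R => Op.toFun (a := CAlg.pt _) R η) h3
    simp only [Op.grade_apply, Op.neg_apply] at h4
    simp only [Op.neg_apply, Op.grade_apply, Op.add_apply, Op.comp_apply, HilbMod.grade_grade,
      h4, Op.zero_apply, map_zero, map_neg, zero_add, neg_neg]
  convert add_mem h1 h2 using 1
  refine op_ext fun η => ?_
  simp only [Op.add_apply, Op.comp_apply, ← map_add]
  exact congrArg _ (Bimod.op_split _ _)

theorem Comm.star {T : ∀ a, Op (E.mod a) (F.mod a)} (hT : Comm E F T) :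
    Comm F E fun a => (T a).star := by
  refine ⟨fun a => Bimod.Comm.star (hT.1 a), fun {a b} g x => ?_⟩
  have h := Op.star_mem (hT.right g (Star.star x))
  have h1 : (E.op (Star.star x)).star = E.op x := by
    have : E.op (Star.star (Star.star x)) = (E.op (Star.star x)).star :=
      (E.bim b).op_star (p := CAlg.pt _) (q := CAlg.pt _) (@Star.star (A.alg b) _ x)
    refine this.symm.trans ?_
    exact congrArg E.op (_root_.star_star (x : A.alg b))
  rw [← h1]
  convert h using 1
  exact op_ext fun η => by simp [conj_star]

theorem Comm.grade {T : ∀ a, Op (E.mod a) (F.mod a)} (hT : Comm E F T) :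
    Comm E F fun a => (T a).grade := by
  refine ⟨fun a => Bimod.Comm.grade (hT.1 a), fun {a b} g x => ?_⟩
  have h := Op.grade_mem (hT.2 g ((A.alg b).grade x))
  have h1 : (F.op ((A.alg b).grade x)) = (F.op x).grade :=
    (F.bim b).op_grade (p := CAlg.pt _) (q := CAlg.pt _) x
  rw [h1] at h
  convert h using 1
  exact op_ext fun η => by simp [conj_grade, HilbMod.grade_grade]

theorem Comm.add {S T : ∀ a, Op (E.mod a) (F.mod a)} (hS : Comm E F S) (hT : Comm E F T) :
    Comm E F fun a => S a + T a := by
  refine ⟨fun a => Bimod.Comm.add (hS.1 a) (hT.1 a), fun {a b} g x => ?_⟩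
  convert add_mem (hS.2 g x) (hT.2 g x) using 1
  refine op_ext fun η => ?_
  simp only [conj_add, Op.comp_apply, Op.sub_apply, Op.add_apply, map_sub, map_add]
  abel

theorem Comm.smul (c : 𝕜) {T : ∀ a, Op (E.mod a) (F.mod a)} (hT : Comm E F T) :
    Comm E F fun a => c • T a := by
  refine ⟨fun a => Bimod.Comm.smul c (hT.1 a), fun {a b} g x => ?_⟩
  convert Submodule.smul_mem _ c (hT.2 g x) using 1
  refine op_ext fun η => ?_
  simp only [conj_smul, Op.comp_apply, Op.sub_apply, Op.smul_apply, map_sub, map_smul, smul_sub]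

theorem Comm.zero : Comm E F fun _ => 0 := by
  refine ⟨fun a => Bimod.Comm.zero, fun {a b} g x => ?_⟩
  convert (Op.compacts (E.mod b) (F.mod b)).zero_mem using 1
  refine op_ext fun η => ?_
  simp only [conj_apply, Op.comp_apply, Op.zero_apply, map_zero, sub_zero]

end GMod

/-- The pair consisting of `D_𝒢(A,B)` and of its ideal `KD_𝒢(A,B)`. -/
def DGPair {𝒢 : Type u} [Groupoid.{u} 𝒢] (A B : GCAlg 𝕜 𝒢) :
    SubQuot (FamCat (fun a : 𝒢 => (B.alg a).cat) (GMod.mod (A := A) (B := B))) where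
  P E F :=
    { carrier := {T | GMod.Comm E F T.1}
      add_mem' := fun h h' => GMod.Comm.add h h'
      zero_mem' := GMod.Comm.zero
      smul_mem' := fun c _ h => GMod.Comm.smul c h }
  Q E F :=
    { carrier := {T | GMod.Cpt E F T.1}
      add_mem' := fun h h' a => Bimod.Cpt.add (h a) (h' a)
      zero_mem' := fun _ => Bimod.Cpt.zero
      smul_mem' := fun c _ h a => Bimod.Cpt.smul c (h a) }
  P_comp h h' := GMod.Comm.comp h h'
  P_star h := GMod.Comm.star h
  P_grade h := GMod.Comm.grade h
  PQ_comp h h' a := Bimod.Comm.comp_cpt (h.1 a) (h' a)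
  QP_comp h h' a := Bimod.Cpt.comp_comm (h a) (h'.1 a)
  Q_star h a := Bimod.Cpt.star (h a)
  Q_grade h a := Bimod.Cpt.grade (h a)

/-- The quotient `QD_𝒢(A,B) = D_𝒢(A,B) / KD_𝒢(A,B)`. -/
def QDG {𝒢 : Type u} [Groupoid.{u} 𝒢] (A B : GCAlg 𝕜 𝒢) := (DGPair A B).quot

/-! ## Completion of the morphism spaces -/

open UniformSpace (Completion)

section Ext

variable {E : Type v} {F : Type v'} {G : Type v''} [SeminormedAddCommGroup E] [NormedSpace 𝕜 E]
  [SeminormedAddCommGroup F] [NormedSpace 𝕜 F] [SeminormedAddCommGroup G] [NormedSpace 𝕜 G]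
  {σ : 𝕜 →+* 𝕜}

/-- The extension of a bounded (semi)linear map to completions. -/
def lext (f : E →ₛₗ[σ] F) (K : ℝ) (h : ∀ x, ‖f x‖ ≤ K * ‖x‖) : Completion E →SL[σ] Completion F :=
  ((Completion.toComplL (𝕜 := 𝕜)).comp (f.mkContinuous K h)).extend (Completion.toComplL (𝕜 := 𝕜))

@[simp] theorem lext_coe (f : E →ₛₗ[σ] F) (K : ℝ) (h : ∀ x, ‖f x‖ ≤ K * ‖x‖) (x : E) :
    lext f K h (x : Completion E) = (f x : Completion F) :=
  ContinuousLinearMap.extend_eq _ Completion.denseRange_coe (Completion.isUniformInducing_coe _) x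

theorem norm_lext_le (f : E →ₛₗ[σ] F) (K : ℝ) (h : ∀ x, ‖f x‖ ≤ K * ‖x‖) (x : Completion E) :
    ‖lext f K h x‖ ≤ K * ‖x‖ := by
  induction x using Completion.induction_on with
  | hp => exact isClosed_le (by fun_prop) (by fun_prop)
  | ih x => simpa using h x

/-- The extension of a contractive bilinear map to completions, in the second variable. -/
def bext₁ (m : E →ₗ[𝕜] F →ₗ[𝕜] G) (h : ∀ x y, ‖m x y‖ ≤ ‖x‖ * ‖y‖) :
    E →ₗ[𝕜] Completion F →L[𝕜] Completion G where
  toFun x := lext (m x) ‖x‖ (h x)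
  map_add' x x' := by
    refine ContinuousLinearMap.ext fun y => ?_
    rw [add_apply]
    induction y using Completion.induction_on with
    | hp =>
      exact isClosed_eq (lext _ _ _).continuous
        ((lext (m x) _ (h x)).continuous.fun_add (lext (m x') _ (h x')).continuous)
    | ih y => rw [lext_coe, lext_coe, lext_coe, map_add, LinearMap.add_apply, Completion.coe_add]
  map_smul' r x := by
    refine ContinuousLinearMap.ext fun y => ?_
    rw [smul_apply]
    induction y using Completion.induction_on with
    | hp =>
      exact isClosed_eq (lext _ _ _).continuous ((lext (m x) _ (h x)).continuous.fun_const_smul r)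
    | ih y =>
      rw [lext_coe, lext_coe, map_smul, LinearMap.smul_apply, Completion.coe_smul, RingHom.id_apply]

/-- The extension of a contractive bilinear map to completions. -/
def bext (m : E →ₗ[𝕜] F →ₗ[𝕜] G) (h : ∀ x y, ‖m x y‖ ≤ ‖x‖ * ‖y‖) :
    Completion E →L[𝕜] Completion F →L[𝕜] Completion G :=
  ((bext₁ m h).mkContinuous 1 fun x => by
    rw [one_mul]
    exact ContinuousLinearMap.opNorm_le_bound _ (norm_nonneg _) fun y => norm_lext_le _ _ _ y).extend
    (Completion.toComplL (𝕜 := 𝕜))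

@[simp] theorem bext_coe (m : E →ₗ[𝕜] F →ₗ[𝕜] G) (h : ∀ x y, ‖m x y‖ ≤ ‖x‖ * ‖y‖) (x : E) (y : F) :
    bext m h (x : Completion E) (y : Completion F) = (m x y : Completion G) := by
  have h1 : bext m h (x : Completion E) = bext₁ m h x :=
    ContinuousLinearMap.extend_eq _ Completion.denseRange_coe (Completion.isUniformInducing_coe _) x
  rw [h1]
  exact lext_coe _ _ _ _

end Ext

/-- The completion of the morphism spaces of a category with contractive operations. -/
def GStarCat.completion (C : GStarCat.{v, w} 𝕜)
    (hc : ∀ {a b c} (x : C.Hom b c) (y : C.Hom a b), ‖C.comp x y‖ ≤ ‖x‖ * ‖y‖)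
    (hs : ∀ {a b} (x : C.Hom a b), ‖C.star x‖ ≤ ‖x‖) : GStarCat.{v, w} 𝕜 where
  Obj := C.Obj
  Hom a b := Completion (C.Hom a b)
  comp := ContinuousLinearMap.coeLM 𝕜 ∘ₗ (bext C.comp hc).toLinearMap
  assoc x y z := by
    change bext C.comp hc (bext C.comp hc x y) z = bext C.comp hc x (bext C.comp hc y z)
    induction x, y, z using Completion.induction_on₃ with
    | hp => exact isClosed_eq (by fun_prop) (by fun_prop)
    | ih x y z => simp [C.assoc]
  star := (lext C.star 1 fun x => (hs x).trans_eq (one_mul _).symm).toLinearMap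
  star_star x := by
    change lext C.star 1 _ (lext C.star 1 _ x) = x
    induction x using Completion.induction_on with
    | hp => exact isClosed_eq (by fun_prop) (by fun_prop)
    | ih x => simp [C.star_star]
  star_comp x y := by
    change lext C.star 1 _ (bext C.comp hc x y) =
      bext C.comp hc (lext C.star 1 _ y) (lext C.star 1 _ x)
    induction x, y using Completion.induction_on₂ with
    | hp => exact isClosed_eq (by fun_prop) (by fun_prop)
    | ih x y => simp [C.star_comp]
  grade := (lext C.grade 1 fun x => (C.norm_grade_le x).trans_eq (one_mul _).symm).toLinearMap
  grade_grade x := by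
    change lext C.grade 1 _ (lext C.grade 1 _ x) = x
    induction x using Completion.induction_on with
    | hp => exact isClosed_eq (by fun_prop) (by fun_prop)
    | ih x => simp [C.grade_grade]
  grade_comp x y := by
    change lext C.grade 1 _ (bext C.comp hc x y) =
      bext C.comp hc (lext C.grade 1 _ x) (lext C.grade 1 _ y)
    induction x, y using Completion.induction_on₂ with
    | hp => exact isClosed_eq (by fun_prop) (by fun_prop)
    | ih x y => simp [C.grade_comp]
  grade_star x := by
    change lext C.grade 1 _ (lext C.star 1 _ x) = lext C.star 1 _ (lext C.grade 1 _ x)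
    induction x using Completion.induction_on with
    | hp => exact isClosed_eq (by fun_prop) (by fun_prop)
    | ih x => simp [C.grade_star]
  norm_grade_le x := (norm_lext_le _ _ _ _).trans_eq (one_mul _)

/-- Extension of a functor to completions. -/
def GFunctor.completion {C : GStarCat.{v, w} 𝕜} {C' : GStarCat.{v', w'} 𝕜} (F : GFunctor C C')
    
    (hc : ∀ {a b c} (x : C.Hom b c) (y : C.Hom a b), ‖C.comp x y‖ ≤ ‖x‖ * ‖y‖)
    (hs : ∀ {a b} (x : C.Hom a b), ‖C.star x‖ ≤ ‖x‖)
    (hc' : ∀ {a b c} (x : C'.Hom b c) (y : C'.Hom a b), ‖C'.comp x y‖ ≤ ‖x‖ * ‖y‖)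
    (hs' : ∀ {a b} (x : C'.Hom a b), ‖C'.star x‖ ≤ ‖x‖) : GFunctor (C.completion hc hs) (C'.completion hc' hs') where
  obj := F.obj
  map := (lext F.map 1 fun x => (F.norm_map_le x).trans_eq (one_mul _).symm).toLinearMap
  map_comp := fun {a b c : C.Obj} x y => by
    change lext F.map 1 _ (bext C.comp hc x y) =
      bext C'.comp hc' (lext F.map 1 _ x) (lext F.map 1 _ y)
    refine Completion.induction_on₂ (α := C.Hom b c) (β := C.Hom a b) x y
      (isClosed_eq ?_ ?_) fun x y => ?_
    · exact (lext (E := C.Hom a c) _ _ _).continuous.comp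
        (f := fun p : Completion (C.Hom b c) × Completion (C.Hom a b) => bext C.comp hc p.1 p.2) (by fun_prop)
    · fun_prop
    · simpa using congrArg _ (F.map_comp x y)
  map_star x := by
    change lext F.map 1 _ (lext C.star 1 _ x) = lext C'.star 1 _ (lext F.map 1 _ x)
    induction x using Completion.induction_on with
    | hp => exact isClosed_eq (by fun_prop) (by fun_prop)
    | ih x => simpa using congrArg _ (F.map_star x)
  map_grade x := by
    change lext F.map 1 _ (lext C.grade 1 _ x) = lext C'.grade 1 _ (lext F.map 1 _ x)
    induction x using Completion.induction_on with
    | hp => exact isClosed_eq (by fun_prop) (by fun_prop)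
    | ih x => simpa using congrArg _ (F.map_grade x)
  norm_map_le := fun {a b : C.Obj} x => (norm_lext_le (E := C.Hom a b) _ _ _ _).trans_eq (one_mul _)

/-! ## Reduced crossed products -/

/-- A representation of a `C*`-algebra on a Hilbert space (contractivity is automatic). -/
structure Repr (A : CAlg.{u} 𝕜) where
  H : Type u
  [grp : NormedAddCommGroup H]
  [ip : InnerProductSpace 𝕜 H]
  [complete : CompleteSpace H]
  hom : A →⋆ₙₐ[𝕜] (H →L[𝕜] H)
  norm_le : ∀ x, ‖hom x‖ ≤ ‖x‖

attribute [instance] Repr.grp Repr.ip Repr.complete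

/-- The pullback of a representation along a morphism. -/
def Repr.pull {A B : CAlg.{u} 𝕜} (α : Repr B) (f : CHom A B) : Repr A where
  H := α.H
  hom := α.hom.comp f.hom
  norm_le x := (α.norm_le _).trans (f.norm_le x)

section l2

open scoped ENNReal

variable {H : Type u} [NormedAddCommGroup H] [InnerProductSpace 𝕜 H]

/-- The Hilbert space `ℓ²(I, H)`. -/
abbrev L2 (I : Type u) (H : Type u) [NormedAddCommGroup H] := lp (fun _ : I => H) 2

theorem L2.summable {I : Type u} (ξ : L2 I H) : Summable fun i => ‖ξ i‖ ^ 2 := by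
  have := (memℓp_gen_iff (p := 2) (by norm_num)).mp (lp.memℓp ξ)
  simpa using this

theorem L2.norm_sq {I : Type u} (ξ : L2 I H) : ‖ξ‖ ^ 2 = ∑' i, ‖ξ i‖ ^ 2 := by
  have := lp.norm_rpow_eq_tsum (p := 2) (by norm_num) ξ
  simpa using this

/-- Construction of elements of `ℓ²`. -/
def L2.mk {I : Type u} (f : I → H) (h : Summable fun i => ‖f i‖ ^ 2) : L2 I H :=
  ⟨f, memℓp_gen (by simpa using h)⟩

@[simp] theorem L2.mk_apply {I : Type u} (f : I → H) (h : Summable fun i => ‖f i‖ ^ 2) (i : I) :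
    L2.mk f h i = f i := rfl

theorem L2.wop_summable {I J : Type u} (e : J ≃ I) (t : J → H →L[𝕜] H) (K : ℝ)
    (h : ∀ j, ‖t j‖ ≤ K) (ξ : L2 I H) : Summable fun j => ‖t j (ξ (e j))‖ ^ 2 := by
  have h1 : Summable fun j => K ^ 2 * ‖ξ (e j)‖ ^ 2 := (e.summable_iff.mpr (L2.summable ξ)).mul_left _
  refine h1.of_nonneg_of_le (fun j => by positivity) fun j => ?_
  rw [← mul_pow]
  exact pow_le_pow_left₀ (norm_nonneg _) (((t j).le_opNorm _).trans (by gcongr; exact h j)) 2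

/-- The operator `ξ ↦ (j ↦ t j (ξ (e j)))` on `ℓ²`-spaces. -/
def L2.wop {I J : Type u} (e : J ≃ I) (t : J → H →L[𝕜] H) (K : ℝ) (hK : 0 ≤ K)
    (h : ∀ j, ‖t j‖ ≤ K) : L2 I H →L[𝕜] L2 J H :=
  LinearMap.mkContinuous
    { toFun := fun ξ => L2.mk _ (L2.wop_summable e t K h ξ)
      map_add' := fun ξ ζ => by ext j; simp
      map_smul' := fun r ξ => by ext j; simp } K fun ξ => by
    refine (sq_le_sq₀ (norm_nonneg _) (by positivity)).mp ?_
    rw [mul_pow, L2.norm_sq, L2.norm_sq, ← tsum_mul_left, ← e.tsum_eq]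
    refine Summable.tsum_le_tsum (fun j => ?_) (L2.wop_summable e t K h ξ)
      ((e.summable_iff.mpr (L2.summable ξ)).mul_left _)
    rw [← mul_pow]
    exact pow_le_pow_left₀ (norm_nonneg _) (((t j).le_opNorm _).trans (by gcongr; exact h j)) 2

@[simp] theorem L2.wop_apply {I J : Type u} (e : J ≃ I) (t : J → H →L[𝕜] H) (K : ℝ) (hK : 0 ≤ K)
    (h : ∀ j, ‖t j‖ ≤ K) (ξ : L2 I H) (j : J) : L2.wop e t K hK h ξ j = t j (ξ (e j)) := rfl

theorem L2.norm_wop_le {I J : Type u} (e : J ≃ I) (t : J → H →L[𝕜] H) (K : ℝ) (hK : 0 ≤ K)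
    (h : ∀ j, ‖t j‖ ≤ K) : ‖L2.wop e t K hK h‖ ≤ K := LinearMap.mkContinuous_norm_le _ hK _

end l2

namespace GCAlg

variable {𝒢 : Type u} [Groupoid.{u} 𝒢] (A : GCAlg 𝕜 𝒢)

theorem act_inv_act {a b : 𝒢} (g : a ⟶ b) (x : A.alg a) :
    A.act (Groupoid.inv g) (A.act g x) = x := by
  rw [← A.act_comp, Groupoid.comp_inv, A.act_id]

/-- Right translation by `g`. -/
def rtrans (c : 𝒢) {a b : 𝒢} (g : a ⟶ b) : (c ⟶ b) ≃ (c ⟶ a) where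
  toFun k := k ≫ Groupoid.inv g
  invFun k := k ≫ g
  left_inv k := by simp
  right_inv k := by simp

/-- The regular representation on `ℓ²(Hom(c, -), H)` induced by a representation of `A_c` on `H`,
on morphisms `x g`. -/
def regS {c : 𝒢} (α : Repr (A.alg c)) {a b : 𝒢} (g : a ⟶ b) (x : A.alg b) :
    L2 (c ⟶ a) α.H →L[𝕜] L2 (c ⟶ b) α.H :=
  L2.wop (rtrans c g) (fun k => α.hom (A.act (Groupoid.inv k) x)) ‖x‖ (norm_nonneg x)
    fun _ => (α.norm_le _).trans ((A.act _).norm_le x)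

theorem regS_apply {c : 𝒢} (α : Repr (A.alg c)) {a b : 𝒢} (g : a ⟶ b) (x : A.alg b)
    (ξ : L2 (c ⟶ a) α.H) (k : c ⟶ b) :
    A.regS α g x ξ k = α.hom (A.act (Groupoid.inv k) x) (ξ (k ≫ Groupoid.inv g)) := rfl

/-- The morphism sets of the convolution category: formal sums of `x g` with `g : a ⟶ b` and
`x ∈ A_b`. -/
def Conv (a b : 𝒢) : Type u := (a ⟶ b) →₀ A.alg b

instance (a b : 𝒢) : AddCommGroup (A.Conv a b) := inferInstanceAs (AddCommGroup (_ →₀ _))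

instance (a b : 𝒢) : Module 𝕜 (A.Conv a b) := inferInstanceAs (Module 𝕜 (_ →₀ _))

/-- The morphism `x g`. -/
def single {a b : 𝒢} (g : a ⟶ b) : A.alg b →ₗ[𝕜] A.Conv a b := Finsupp.lsingle g

variable {A} in
@[elab_as_elim]
theorem Conv.ind {a b : 𝒢} {p : A.Conv a b → Prop} (μ : A.Conv a b) (h0 : p 0)
    (hadd : ∀ μ ν, p μ → p ν → p (μ + ν)) (hs : ∀ (g : a ⟶ b) (x : A.alg b), p (A.single g x)) :
    p μ := Finsupp.induction_linear μ h0 hadd hs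

/-- Linear maps on the convolution category are determined by their values on the `x g`. -/
def lift {a b : 𝒢} {V : Type w} [AddCommGroup V] [Module 𝕜 V] {σ : 𝕜 →+* 𝕜}
    (f : (a ⟶ b) → A.alg b →ₛₗ[σ] V) : A.Conv a b →ₛₗ[σ] V where
  toFun μ := Finsupp.sum μ fun g x => f g x
  map_add' μ ν := Finsupp.sum_add_index' (fun _ => map_zero _) (fun _ _ _ => map_add _ _ _)
  map_smul' r μ := by
    refine (Finsupp.sum_smul_index' (fun _ => map_zero _)).trans ?_
    simp only [map_smulₛₗ]
    exact Finsupp.smul_sum.symm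

@[simp] theorem lift_single {a b : 𝒢} {V : Type w} [AddCommGroup V] [Module 𝕜 V] {σ : 𝕜 →+* 𝕜}
    (f : (a ⟶ b) → A.alg b →ₛₗ[σ] V) (g : a ⟶ b) (x : A.alg b) :
    A.lift f (A.single g x) = f g x := Finsupp.sum_single_index (map_zero _)

/-- The regular representation of the convolution category induced by a representation of `A_c`. -/
def reg {c : 𝒢} (α : Repr (A.alg c)) {a b : 𝒢} :
    A.Conv a b →ₗ[𝕜] L2 (c ⟶ a) α.H →L[𝕜] L2 (c ⟶ b) α.H :=
  A.lift fun g =>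
    { toFun := fun x => A.regS α g x
      map_add' := fun x y => by
        ext ξ k
        simp [regS_apply, map_add]
      map_smul' := fun r x => by
        ext ξ k
        simp [regS_apply, map_smul] }

@[simp] theorem reg_single {c : 𝒢} (α : Repr (A.alg c)) {a b : 𝒢} (g : a ⟶ b) (x : A.alg b) :
    A.reg α (A.single g x) = A.regS α g x := A.lift_single _ _ _

/-- The reduced norm: the supremum of the norms in all regular representations. -/
def gauge (a b : 𝒢) : Gauge 𝕜 (A.Conv a b) where
  Bd μ K := 0 ≤ K ∧ ∀ (c : 𝒢) (α : Repr (A.alg c)), ‖A.reg α μ‖ ≤ K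
  nonneg h := h.1
  exists_bd μ := by
    induction μ using Conv.ind with
    | h0 => exact ⟨0, le_rfl, fun c α => by simp⟩
    | hadd μ ν h h' =>
      obtain ⟨K, hK, h⟩ := h
      obtain ⟨L, hL, h'⟩ := h'
      exact ⟨K + L, by positivity, fun c α => by
        rw [map_add]; exact (norm_add_le _ _).trans (add_le_add (h c α) (h' c α))⟩
    | hs g x =>
      exact ⟨‖x‖, norm_nonneg x, fun c α => by
        rw [reg_single]; exact L2.norm_wop_le _ _ _ _ _⟩
  zero := ⟨le_rfl, fun c α => by simp⟩
  add h h' := ⟨add_nonneg h.1 h'.1, fun c α => by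
    rw [map_add]; exact (norm_add_le _ _).trans (add_le_add (h.2 c α) (h'.2 c α))⟩
  smul r _ _ h := ⟨mul_nonneg (norm_nonneg r) h.1, fun c α => by
    rw [map_smul, norm_smul]; exact mul_le_mul_of_nonneg_left (h.2 c α) (norm_nonneg r)⟩

instance (a b : 𝒢) : SeminormedAddCommGroup (A.Conv a b) := (A.gauge a b).seminormed

instance (a b : 𝒢) : NormedSpace 𝕜 (A.Conv a b) := (A.gauge a b).normedSpace

end GCAlg

namespace GCAlg

variable {𝒢 : Type u} [Groupoid.{u} 𝒢] (A : GCAlg 𝕜 𝒢)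

/-- Composition in the convolution category, `(x h)(y g) = x h(y) hg`. -/
def convComp {a b c : 𝒢} : A.Conv b c →ₗ[𝕜] A.Conv a b →ₗ[𝕜] A.Conv a c :=
  A.lift fun h =>
    { toFun := fun x => A.lift fun g =>
        A.single (g ≫ h) ∘ₗ LinearMap.mulLeft 𝕜 x ∘ₗ ((A.act h).hom : A.alg b →ₗ[𝕜] A.alg c)
      map_add' := fun x y => by
        refine LinearMap.ext fun ν => ?_
        induction ν using Conv.ind with
        | h0 => simp
        | hadd μ ν h h' => rw [map_add, map_add, h, h']
        | hs g z => simp [add_mul]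
      map_smul' := fun r x => by
        refine LinearMap.ext fun ν => ?_
        induction ν using Conv.ind with
        | h0 => simp
        | hadd μ ν h h' => rw [map_add, map_add, h, h']
        | hs g z => simp [smul_mul_assoc] }

@[simp] theorem convComp_single {a b c : 𝒢} (h : b ⟶ c) (x : A.alg c) (g : a ⟶ b) (y : A.alg b) :
    A.convComp (A.single h x) (A.single g y) = A.single (g ≫ h) (x * A.act h y) := by
  simp [convComp]

/-- The involution of the convolution category, `(x g)* = g⁻¹(x*) g⁻¹`. -/
def convStar {a b : 𝒢} : A.Conv a b →ₗ⋆[𝕜] A.Conv b a :=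
  A.lift fun g =>
    { toFun := fun x => A.single (Groupoid.inv g) (A.act (Groupoid.inv g) (star x))
      map_add' := fun x y => by simp
      map_smul' := fun r x => by simp }

@[simp] theorem convStar_single {a b : 𝒢} (g : a ⟶ b) (x : A.alg b) :
    A.convStar (A.single g x) = A.single (Groupoid.inv g) (A.act (Groupoid.inv g) (star x)) := by
  simp [convStar]

/-- The grading of the convolution category. -/
def convGrade {a b : 𝒢} : A.Conv a b →ₗ[𝕜] A.Conv a b :=
  A.lift fun g => A.single g ∘ₗ ((A.alg b).grade : A.alg b →ₗ[𝕜] A.alg b)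

@[simp] theorem convGrade_single {a b : 𝒢} (g : a ⟶ b) (x : A.alg b) :
    A.convGrade (A.single g x) = A.single g ((A.alg b).grade x) := by
  simp [convGrade]

theorem reg_comp {c : 𝒢} (α : Repr (A.alg c)) {a b d : 𝒢} (μ : A.Conv b d) (ν : A.Conv a b) :
    A.reg α (A.convComp μ ν) = (A.reg α μ).comp (A.reg α ν) := by
  induction μ using Conv.ind with
  | h0 => simp
  | hadd μ μ' h h' => rw [map_add, LinearMap.add_apply, map_add, map_add, h, h']; ext; simp
  | hs h x =>
    induction ν using Conv.ind with
    | h0 => simp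
    | hadd ν ν' h h' => rw [map_add, map_add, map_add, h, h']; ext; simp
    | hs g y =>
      ext ξ k
      simp [regS_apply, ← act_comp]

theorem reg_star {c : 𝒢} (α : Repr (A.alg c)) {a b : 𝒢} (μ : A.Conv a b) :
    A.reg α (A.convStar μ) = ContinuousLinearMap.adjoint (A.reg α μ) := by
  rw [ContinuousLinearMap.eq_adjoint_iff]
  intro ξ η
  induction μ using Conv.ind with
  | h0 => simp
  | hadd μ ν h h' => simp only [map_add, add_apply, inner_add_left, inner_add_right, h, h']
  | hs g x =>
    rw [convStar_single, reg_single, reg_single, lp.inner_eq_tsum, lp.inner_eq_tsum,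
      ← (rtrans c (𝒢 := 𝒢) g).tsum_eq]
    refine tsum_congr fun k => ?_
    rw [regS_apply, regS_apply, ← A.act_comp]
    simp only [rtrans, Equiv.coe_fn_mk, Groupoid.inv_eq_inv, IsIso.inv_inv, Category.assoc,
      IsIso.inv_hom_id, Category.comp_id, IsIso.inv_hom_id_assoc, IsIso.inv_comp]
    rw [map_star, map_star, ContinuousLinearMap.star_eq_adjoint,
      ContinuousLinearMap.adjoint_inner_left]

/-- The grading automorphism as a morphism. -/
def _root_.CStarDescent.CAlg.gradeHom (A : CAlg.{u} 𝕜) : CHom A A := ⟨A.grade, fun _ => rfl, A.norm_grade_le⟩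

theorem reg_grade {c : 𝒢} (α : Repr (A.alg c)) {a b : 𝒢} (μ : A.Conv a b) :
    A.reg α (A.convGrade μ) = A.reg (α.pull (A.alg c).gradeHom) μ := by
  induction μ using Conv.ind with
  | h0 => simp; rfl
  | hadd μ ν h h' => rw [map_add, map_add, map_add, h, h']; rfl
  | hs g x =>
    rw [convGrade_single, reg_single, reg_single]
    refine ContinuousLinearMap.ext fun ξ => lp.ext (funext fun k => ?_)
    rw [regS_apply, (A.act _).map_grade]
    rfl

theorem norm_le_of_bd {a b : 𝒢} {μ : A.Conv a b} {K : ℝ} (h : (A.gauge a b).Bd μ K) : ‖μ‖ ≤ K :=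
  (A.gauge a b).nrm_le h

theorem norm_reg_le {c : 𝒢} (α : Repr (A.alg c)) {a b : 𝒢} (μ : A.Conv a b) :
    ‖A.reg α μ‖ ≤ ‖μ‖ := by
  refine le_of_forall_pos_le_add fun ε hε => ?_
  obtain ⟨K, hK, h⟩ := (A.gauge a b).exists_lt μ hε
  exact (hK.2 c α).trans h.le

/-- The convolution category with the reduced norm. -/
def conv : GStarCat.{u, u} 𝕜 where
  Obj := 𝒢
  Hom a b := A.Conv a b
  comp := A.convComp
  assoc x y z := by
    induction x using Conv.ind with
    | h0 => simp
    | hadd _ _ h h' => simp only [map_add, LinearMap.add_apply, h, h']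
    | hs k x =>
      induction y using Conv.ind with
      | h0 => simp
      | hadd _ _ h h' => simp only [map_add, LinearMap.add_apply, h, h']
      | hs h y =>
        induction z using Conv.ind with
        | h0 => simp
        | hadd _ _ h h' => simp only [map_add, h, h']
        | hs g z => simp [mul_assoc, A.act_comp]
  star := A.convStar
  star_star x := by
    induction x using Conv.ind with
    | h0 => simp
    | hadd _ _ h h' => simp only [map_add, h, h']
    | hs g x => simp [← map_star, ← A.act_comp, A.act_id]
  star_comp x y := by
    induction x using Conv.ind with
    | h0 => simp
    | hadd _ _ h h' => simp only [map_add, LinearMap.add_apply, h, h']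
    | hs h x =>
      induction y using Conv.ind with
      | h0 => simp
      | hadd _ _ h h' => simp only [map_add, LinearMap.add_apply, h, h']
      | hs g y => simp [← map_star, ← A.act_comp]
  grade := A.convGrade
  grade_grade x := by
    induction x using Conv.ind with
    | h0 => simp
    | hadd _ _ h h' => simp only [map_add, h, h']
    | hs g x => simp [(A.alg _).grade_grade]
  grade_comp x y := by
    induction x using Conv.ind with
    | h0 => simp
    | hadd _ _ h h' => simp only [map_add, LinearMap.add_apply, h, h']
    | hs h x =>
      induction y using Conv.ind with
      | h0 => simp
      | hadd _ _ h h' => simp only [map_add, h, h']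
      | hs g y => simp [(A.act _).map_grade]
  grade_star x := by
    induction x using Conv.ind with
    | h0 => simp
    | hadd _ _ h h' => simp only [map_add, h, h']
    | hs g x => simp [(A.act _).map_grade, map_star]
  norm_grade_le μ := A.norm_le_of_bd ⟨norm_nonneg _, fun c α => by
    rw [reg_grade]; exact A.norm_reg_le _ μ⟩

theorem norm_conv_comp {a b d : A.conv.Obj} (μ : A.conv.Hom b d) (ν : A.conv.Hom a b) :
    ‖A.conv.comp μ ν‖ ≤ ‖μ‖ * ‖ν‖ :=
  A.norm_le_of_bd ⟨mul_nonneg (norm_nonneg μ) (norm_nonneg ν), fun _ α =>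
    (congrArg norm (A.reg_comp α μ ν)).trans_le ((ContinuousLinearMap.opNorm_comp_le _ _).trans
      (mul_le_mul (A.norm_reg_le α μ) (A.norm_reg_le α ν) (norm_nonneg _) (norm_nonneg μ)))⟩

theorem norm_conv_star {a b : A.conv.Obj} (μ : A.conv.Hom a b) : ‖A.conv.star μ‖ ≤ ‖μ‖ :=
  A.norm_le_of_bd ⟨norm_nonneg μ, fun c α => by
    refine (congrArg norm (A.reg_star α μ)).trans_le ?_
    rw [LinearIsometryEquiv.norm_map]
    exact A.norm_reg_le α μ⟩

/-- The reduced crossed product `A ⋊_r 𝒢`. -/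
def red : GStarCat.{u, u} 𝕜 := A.conv.completion A.norm_conv_comp A.norm_conv_star

/-- An object of `𝒢` as an object of the reduced crossed product. -/
def robj (a : 𝒢) : A.red.Obj := a

/-- The morphism `x g` of the reduced crossed product. -/
def rsingle {a b : 𝒢} (g : a ⟶ b) : A.alg b →ₗ[𝕜] A.red.Hom (A.robj a) (A.robj b) :=
  show A.alg b →ₗ[𝕜] Completion (A.Conv a b) from
    (Completion.toComplₗᵢ (𝕜 := 𝕜) (E := A.Conv a b)).toLinearMap ∘ₗ A.single g

end GCAlg

/-! ## Functoriality of reduced crossed products -/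

namespace CovHom

variable {ℋ 𝒢 : Type u} [Groupoid.{u} ℋ] [Groupoid.{u} 𝒢] {f : ℋ ⥤ 𝒢} {A : GCAlg 𝕜 ℋ}
  {B : GCAlg 𝕜 𝒢} (F : CovHom f A B)

/-- The map of convolution categories `x g ↦ F(x) f(g)`. -/
def convMap {a b : ℋ} : A.Conv a b →ₗ[𝕜] B.Conv (f.obj a) (f.obj b) :=
  A.lift fun g => B.single (f.map g) ∘ₗ ((F.app b).hom : A.alg b →ₗ[𝕜] B.alg (f.obj b))

@[simp] theorem convMap_single {a b : ℋ} (g : a ⟶ b) (x : A.alg b) :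
    F.convMap (A.single g x) = B.single (f.map g) (F.app b x) := by
  simp [convMap]

section

variable {c : 𝒢} {a : ℋ}

/-- The orbit relation of the vertex group of `ℋ` at `a`. -/
def orb (f : ℋ ⥤ 𝒢) (c : 𝒢) (a : ℋ) : Setoid (c ⟶ f.obj a) where
  r k k' := ∃ h : a ⟶ a, k ≫ f.map h = k'
  iseqv :=
    { refl := fun k => ⟨𝟙 a, by simp⟩
      symm := by
        rintro k _ ⟨h, rfl⟩
        exact ⟨inv h, by simp⟩
      trans := by
        rintro k _ _ ⟨h, rfl⟩ ⟨h', rfl⟩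
        exact ⟨h ≫ h', by simp⟩ }

/-- Representatives of the orbits. -/
def rep (q : Quotient (orb f c a)) : c ⟶ f.obj a := q.out

theorem orb_bij [f.Faithful] {d : ℋ} (g : a ⟶ d) : Function.Bijective
    fun p : Quotient (orb f c a) × (a ⟶ d) => rep p.1 ≫ f.map p.2 := by
  constructor
  · rintro ⟨q, h⟩ ⟨q', h'⟩ e
    simp only at e
    have e1 : q = q' := by
      rw [← q.out_eq, ← q'.out_eq]
      refine Quotient.sound ⟨h ≫ inv h', ?_⟩
      rw [f.map_comp, ← Category.assoc]
      change (rep q ≫ f.map h) ≫ _ = _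
      rw [e, Category.assoc, ← f.map_comp]
      simp [rep]
    subst e1
    rw [cancel_epi] at e
    rw [f.map_injective e]
  · intro k
    obtain ⟨h, hh⟩ := Quotient.exact (s := orb f c a) (Quotient.out_eq ⟦k ≫ f.map (inv g)⟧)
    refine ⟨(⟦k ≫ f.map (inv g)⟧, h ≫ g), ?_⟩
    simp only [f.map_comp]
    rw [← Category.assoc]
    refine (congrArg (· ≫ f.map g) hh).trans ?_
    simp

/-- The decomposition into orbits. -/
def orbEquiv [f.Faithful] {d : ℋ} (g : a ⟶ d) :
    Quotient (orb f c a) × (a ⟶ d) ≃ (c ⟶ f.obj d) := Equiv.ofBijective _ (orb_bij g)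

theorem orbEquiv_apply [f.Faithful] {d : ℋ} (g : a ⟶ d) (q : Quotient (orb f c a)) (h : a ⟶ d) :
    orbEquiv g (q, h) = rep q ≫ f.map h := rfl

/-- The representation of `A_a` attached to an orbit. -/
def orbRepr (α : Repr (B.alg c)) (q : Quotient (orb f c a)) : Repr (A.alg a) :=
  (α.pull (B.act (Groupoid.inv (rep q)))).pull (F.app a)

/-- Restriction of a vector to an orbit. -/
def orbRestr [f.Faithful] (α : Repr (B.alg c)) {d : ℋ} (g : a ⟶ d) (ξ : L2 (c ⟶ f.obj d) α.H)
    (q : Quotient (orb f c a)) : L2 (a ⟶ d) (F.orbRepr α q).H :=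
  L2.mk (H := α.H) (fun h => ξ (orbEquiv g (q, h))) (((orbEquiv g).summable_iff.mpr
    (L2.summable ξ)).prod_factor q)

theorem orb_norm [f.Faithful] (α : Repr (B.alg c)) {d : ℋ} (g : a ⟶ d)
    (ξ : L2 (c ⟶ f.obj d) α.H) :
    HasSum (fun q => ‖F.orbRestr α g ξ q‖ ^ 2) (‖ξ‖ ^ 2) := by
  have h1 := (orbEquiv (c := c) (f := f) g).summable_iff.mpr (L2.summable ξ)
  have h2 : ‖ξ‖ ^ 2 = ∑' q, ‖F.orbRestr α g ξ q‖ ^ 2 := by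
    rw [L2.norm_sq, ← (orbEquiv (c := c) (f := f) g).tsum_eq]
    exact (Summable.tsum_prod h1).trans
      (tsum_congr fun q => (L2.norm_sq (F.orbRestr α g ξ q)).symm)
  rw [h2]
  refine Summable.hasSum (h1.prod.congr fun q => ?_)
  exact (L2.norm_sq (F.orbRestr α g ξ q)).symm

theorem reg_orb [f.Faithful] (α : Repr (B.alg c)) {d : ℋ} (g : a ⟶ d) (μ : A.Conv a d)
    (ξ : L2 (c ⟶ f.obj a) α.H) (q : Quotient (orb f c a)) :
    F.orbRestr α g (B.reg α (F.convMap μ) ξ) q =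
      A.reg (F.orbRepr α q) μ (F.orbRestr α (𝟙 a) ξ q) := by
  refine lp.ext (funext fun h => ?_)
  induction μ using GCAlg.Conv.ind with
  | h0 => simp [orbRestr]; rfl
  | hadd μ ν h1 h2 =>
    rw [map_add, map_add, map_add]
    exact congrArg₂ (· + ·) h1 h2
  | hs k x =>
    rw [convMap_single, GCAlg.reg_single, GCAlg.reg_single]
    change α.hom (B.act (Groupoid.inv (rep q ≫ f.map h)) (F.app d x))
      (ξ ((rep q ≫ f.map h) ≫ Groupoid.inv (f.map k))) =
      α.hom (B.act (Groupoid.inv (rep q)) (F.app a (A.act (Groupoid.inv h) x)))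
        (ξ (rep q ≫ f.map (h ≫ Groupoid.inv k)))
    rw [F.equivariant, ← B.act_comp]
    simp

end

theorem reg_convMap_le [f.Faithful] {a b : ℋ} {μ : A.Conv a b} {K : ℝ}
    (h : (A.gauge a b).Bd μ K) : (B.gauge _ _).Bd (F.convMap μ) K := by
  refine ⟨h.1, fun c α => ?_⟩
  by_cases hne : Nonempty (a ⟶ b)
  · obtain ⟨g⟩ := hne
    refine ContinuousLinearMap.opNorm_le_bound _ h.1 fun ξ => ?_
    refine (sq_le_sq₀ (norm_nonneg _) (mul_nonneg h.1 (norm_nonneg _))).mp ?_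
    rw [mul_pow]
    refine hasSum_le (fun q => ?_) (F.orb_norm α g _) ((F.orb_norm α (𝟙 a) ξ).mul_left (K ^ 2))
    rw [reg_orb, ← mul_pow]
    refine pow_le_pow_left₀ (norm_nonneg _) ?_ 2
    exact ((A.reg _ μ).le_opNorm _).trans (by gcongr; exact h.2 _ _)
  · have : IsEmpty (a ⟶ b) := not_nonempty_iff.mp hne
    have h0 : μ = 0 := Finsupp.ext fun g => this.elim g
    rw [h0]
    simpa using h.1

theorem convMap_comp {a b c : ℋ} (x : A.Conv b c) (y : A.Conv a b) :
    F.convMap (A.convComp x y) = B.convComp (F.convMap x) (F.convMap y) := by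
  induction x using GCAlg.Conv.ind with
  | h0 => simp
  | hadd _ _ h h' => simp only [map_add, LinearMap.add_apply, h, h']
  | hs h x =>
    induction y using GCAlg.Conv.ind with
    | h0 => simp
    | hadd _ _ h h' => simp only [map_add, h, h']
    | hs g y => simp [F.equivariant]

theorem convMap_star {a b : ℋ} (x : A.Conv a b) :
    F.convMap (A.convStar x) = B.convStar (F.convMap x) := by
  induction x using GCAlg.Conv.ind with
  | h0 => simp
  | hadd _ _ h h' => simp only [map_add, h, h']
  | hs g x => simp [F.equivariant, map_star]

theorem convMap_grade {a b : ℋ} (x : A.Conv a b) :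
    F.convMap (A.convGrade x) = B.convGrade (F.convMap x) := by
  induction x using GCAlg.Conv.ind with
  | h0 => simp
  | hadd _ _ h h' => simp only [map_add, h, h']
  | hs g x => simp [(F.app _).map_grade]

theorem norm_convMap_le [f.Faithful] {a b : ℋ} (μ : A.Conv a b) : ‖F.convMap μ‖ ≤ ‖μ‖ := by
  refine le_of_forall_pos_le_add fun ε hε => ?_
  obtain ⟨K, hK, h⟩ := (A.gauge a b).exists_lt μ hε
  exact (B.norm_le_of_bd (F.reg_convMap_le hK)).trans h.le

/-- The functor of convolution categories induced by an equivariant map. -/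
def convFunctor [f.Faithful] : GFunctor A.conv B.conv where
  obj := f.obj
  map := F.convMap
  map_comp := F.convMap_comp
  map_star := F.convMap_star
  map_grade := F.convMap_grade
  norm_map_le := F.norm_convMap_le

/-- The functor `A ⋊_r ℋ → B ⋊_r 𝒢` induced by an equivariant map covering a faithful functor. -/
def red [f.Faithful] : GFunctor A.red B.red :=
  F.convFunctor.completion A.norm_conv_comp A.norm_conv_star B.norm_conv_comp B.norm_conv_star

end CovHom

/-! ## Change of the first variable and of the groupoid -/

/-- Reindexing of families. -/
def FamCat.reindex {I : Type v'} {I' : Type w'} {C : I → GStarCat.{v, w} 𝕜} {Ob : Type v''}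
    (o : Ob → ∀ i, HilbMod (C i)) (r : I' → I) :
    GFunctor (FamCat C o) (FamCat (fun i => C (r i)) fun X i => o X (r i)) where
  obj X := X
  map {X Y} :=
    show Fam (o X) (o Y) →ₗ[𝕜] Fam (fun i => o X (r i)) (fun i => o Y (r i)) from
    { toFun := fun T => ⟨fun i => T.1 (r i), by
        obtain ⟨K, hK, h⟩ := T.2
        exact ⟨K, hK, fun i => h _⟩⟩
      map_add' := fun _ _ => rfl
      map_smul' := fun _ _ => rfl }
  map_comp _ _ := rfl
  map_star _ := rfl
  map_grade _ := rfl
  norm_map_le T := Fam.norm_le_of_bd T _ fun _ h => ⟨h.1, fun _ => h.2 _⟩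

/-- Change of the set of objects. -/
def FamCat.obMap {I : Type v'} {C : I → GStarCat.{v, w} 𝕜} {Ob : Type v''} {Ob' : Type w''}
    (o : Ob' → ∀ i, HilbMod (C i)) (φ : Ob → Ob') :
    GFunctor (FamCat C fun X => o (φ X)) (FamCat C o) where
  obj := φ
  map {X Y} :=
    show Fam (o (φ X)) (o (φ Y)) →ₗ[𝕜] Fam (o (φ X)) (o (φ Y)) from LinearMap.id
  map_comp _ _ := rfl
  map_star _ := rfl
  map_grade _ := rfl
  norm_map_le _ := le_rfl


namespace Bimod

variable {A : GStarCat.{v', w'} 𝕜} {A' : GStarCat.{v'', w''} 𝕜} {B : GStarCat.{v, w} 𝕜}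

/-- Pullback of a bimodule along a functor in the first variable. -/
def pull (F : GFunctor A' A) (E : Bimod A B) : Bimod A' B := F.comp E

theorem Comm.pull (F : GFunctor A' A) {E E' : Bimod A B} {T : ∀ p, Op (E.fiber p) (E'.fiber p)}
    (h : Comm E E' T) : Comm (E.pull F) (E'.pull F) fun p => T (F.obj p) := by
  intro p q x
  have h1 : gcomm (E := E.pull F) (F := E'.pull F) x (T (F.obj p)) (T (F.obj q)) =
      gcomm (E := E) (F := E') (F.map x) (T (F.obj p)) (T (F.obj q)) := by
    unfold gcomm
    rw [← F.map_even, ← F.map_odd]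
    rfl
  rw [h1]
  exact h _

theorem Cpt.pull (F : GFunctor A' A) {E E' : Bimod A B} {T : ∀ p, Op (E.fiber p) (E'.fiber p)}
    (h : Cpt E E' T) : Cpt (E.pull F) (E'.pull F) fun p => T (F.obj p) := fun x => h (F.map x)

end Bimod

/-- The functor `QD(A,B) → QD(A',B)` induced by a functor `A' → A`. -/
def QD.pull {A : GStarCat.{v', w'} 𝕜} {A' : GStarCat.{v'', w''} 𝕜} {B : GStarCat.{v, w} 𝕜}
    (F : GFunctor A' A) : GFunctor (QD A B) (QD A' B) :=
  (DPair A B).mapQ (DPair A' B)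
    ((FamCat.reindex Bimod.fiber F.obj).comp (FamCat.obMap Bimod.fiber (Bimod.pull F)))
    (fun h => Bimod.Comm.pull F h) (fun h => Bimod.Cpt.pull F h)

namespace GMod

variable {𝒢 : Type u} [Groupoid.{u} 𝒢] {A A' B : GCAlg 𝕜 𝒢}

/-- The functors underlying an equivariant map. -/
def _root_.CStarDescent.CovHom.fib (α : GHom A' A) (a : 𝒢) :
    GFunctor (A'.alg a).cat (A.alg a).cat := (α.app a).functor

/-- Pullback of an equivariant bimodule along an equivariant map in the first variable. -/
def pull (α : GHom A' A) (E : GMod A B) : GMod A' B where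
  bim a := (E.bim a).pull (α.fib a)
  tr := E.tr
  tr_id := E.tr_id
  tr_comp := E.tr_comp
  tr_act := E.tr_act
  tr_inner := E.tr_inner
  tr_grade := E.tr_grade
  tr_op {a b} g x η := by
    refine (E.tr_op g (α.app a x : A.alg a) η).trans ?_
    exact congrArg (fun y : A.alg b => (E.op y).toFun (a := CAlg.pt _) (E.tr g η))
      (α.equivariant g x).symm

/-- Restriction of an equivariant bimodule along a functor of groupoids. -/
def restrict {ℋ : Type u} [Groupoid.{u} ℋ] (f : ℋ ⥤ 𝒢) (E : GMod A B) :
    GMod (A.restrict f) (B.restrict f) where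
  bim a := E.bim (f.obj a)
  tr g := E.tr (f.map g)
  tr_id {a} η := (congrArg (fun g => E.tr g η) (f.map_id a)).trans (E.tr_id η)
  tr_comp g h η := (congrArg (fun g => E.tr g η) (f.map_comp g h)).trans (E.tr_comp _ _ η)
  tr_act g := E.tr_act (f.map g)
  tr_inner g := E.tr_inner (f.map g)
  tr_grade g := E.tr_grade (f.map g)
  tr_op g := E.tr_op (f.map g)

theorem conj_restrict {ℋ : Type u} [Groupoid.{u} ℋ] (f : ℋ ⥤ 𝒢) (E F : GMod A B) {a b : ℋ}
    (g : a ⟶ b) (T : Op (E.mod (f.obj a)) (F.mod (f.obj a))) :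
    conj (E := E.restrict f) (F := F.restrict f) g T = conj (E := E) (F := F) (f.map g) T := by
  have h : f.map (Groupoid.inv g) = Groupoid.inv (f.map g) := by simp
  refine op_ext fun η => ?_
  exact congrArg (fun k => F.tr (f.map g) (T.toFun (a := CAlg.pt _) (E.tr k η))) h

theorem Comm.restrict {ℋ : Type u} [Groupoid.{u} ℋ] (f : ℋ ⥤ 𝒢) {E F : GMod A B}
    {T : ∀ a, Op (E.mod a) (F.mod a)} (h : Comm E F T) :
    Comm (E.restrict f) (F.restrict f) fun a => T (f.obj a) := by
  refine ⟨fun a => h.1 (f.obj a), fun {a b} g x => ?_⟩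
  have h1 := h.2 (f.map g) x
  have h2 := conj_restrict f E F g (T (f.obj a))
  exact h2 ▸ h1

end GMod

section

variable {𝒢 : Type u} [Groupoid.{u} 𝒢]

/-- The functor `QD_𝒢(A,B) → QD_𝒢(A',B)` induced by an equivariant map `A' → A`. -/
def QDG.pull {A A' B : GCAlg 𝕜 𝒢} (α : GHom A' A) : GFunctor (QDG A B) (QDG A' B) :=
  (DGPair A B).mapQ (DGPair A' B)
    (FamCat.obMap GMod.mod (GMod.pull α))
    (fun h => ⟨fun a => Bimod.Comm.pull (α.fib a) (h.1 a), fun g x => h.2 g (α.app _ x)⟩)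
    (fun h a => Bimod.Cpt.pull (α.fib a) (h a))

/-- The functor `QD_𝒢(A,B) → QD_ℋ(A,B)` induced by a functor of groupoids `ℋ ⥤ 𝒢`. -/
def QDG.restrict {ℋ : Type u} [Groupoid.{u} ℋ] (f : ℋ ⥤ 𝒢) {A B : GCAlg 𝕜 𝒢} :
    GFunctor (QDG A B) (QDG (A.restrict f) (B.restrict f)) :=
  (DGPair A B).mapQ (DGPair (A.restrict f) (B.restrict f))
    ((FamCat.reindex GMod.mod f.obj).comp (FamCat.obMap GMod.mod (GMod.restrict f)))
    (fun h => GMod.Comm.restrict f h)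
    (fun h a => h (f.obj a))

end

/-! ## Change of the second variable -/

/-- `E'` is the Hilbert module `E ⊗_F B'` obtained from the Hilbert `B`-module `E` by change of
coefficients along `F : B → B'`; `τ η y` is the elementary tensor `η ⊗ y`. -/
structure Tensor {B : GStarCat.{v, w} 𝕜} {B' : GStarCat.{v', w'} 𝕜} (F : GFunctor B B')
    (E : HilbMod B) (E' : HilbMod B') where
  τ : ∀ {b : B.Obj} {c : B'.Obj}, E.E b →ₗ[𝕜] B'.Hom c (F.obj b) →ₗ[𝕜] E'.E c
  inner_τ : ∀ {a b : B.Obj} {c d : B'.Obj} (η : E.E b) (y : B'.Hom c (F.obj b)) (ξ : E.E a)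
    (z : B'.Hom d (F.obj a)), E'.inner (τ η y) (τ ξ z) =
      B'.comp (B'.star y) (B'.comp (F.map (E.inner η ξ)) z)
  act_τ : ∀ {b : B.Obj} {c d : B'.Obj} (η : E.E b) (y : B'.Hom c (F.obj b)) (z : B'.Hom d c),
    E'.act (τ η y) z = τ η (B'.comp y z)
  grade_τ : ∀ {b : B.Obj} {c : B'.Obj} (η : E.E b) (y : B'.Hom c (F.obj b)),
    E'.grade (τ η y) = τ (E.grade η) (B'.grade y)
  dense : ∀ (c : B'.Obj) (ζ : E'.E c), ζ ∈ closure (Submodule.span 𝕜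
    {ζ : E'.E c | ∃ (b : B.Obj) (η : E.E b) (y : B'.Hom c (F.obj b)), ζ = τ η y} : Set (E'.E c))

/-- The functor `Ψ : QD(A,B) → QD(A,B')` is the change of coefficients along `F : B → B'`: it maps a
bimodule `E` to `E ⊗_F B'` and the class of an operator `T` to the class of `T ⊗ 1`. -/
def IsCoeffChange {A : GStarCat.{v'', w''} 𝕜} {B : GStarCat.{v, w} 𝕜} {B' : GStarCat.{v', w'} 𝕜}
    (F : GFunctor B B') (Ψ : GFunctor (QD A B) (QD A B')) : Prop :=
  ∃ t : ∀ (E : Bimod A B) (p : A.Obj),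
      Tensor F (E.fiber p) (Bimod.fiber (Ψ.obj E : Bimod A B') p),
    (∀ (E : Bimod A B) {p q : A.Obj} (x : A.Hom p q) {b : B.Obj} {c : B'.Obj}
      (η : (E.fiber p).E b) (y : B'.Hom c (F.obj b)),
      (Bimod.op (Ψ.obj E : Bimod A B') x).toFun ((t E p).τ η y) =
        (t E q).τ ((E.op x).toFun η) y) ∧
    ∀ (E E' : Bimod A B) (T : (DPair A B).P E E'),
      ∃ T' : (DPair A B').P (Ψ.obj E : Bimod A B') (Ψ.obj E' : Bimod A B'),
        (∀ (p : A.Obj) {b : B.Obj} {c : B'.Obj} (η : (E.fiber p).E b) (y : B'.Hom c (F.obj b)),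
          (T'.1.1 p).toFun ((t E p).τ η y) = (t E' p).τ ((T.1.1 p).toFun η) y) ∧
        Ψ.map ((DPair A B).cls T) = (DPair A B').cls T'

section

variable {𝒢 : Type u} [Groupoid.{u} 𝒢] {A B B' : GCAlg 𝕜 𝒢}

/-- The functor `Φ : QD_𝒢(A,B) → QD_𝒢(A,B')` is the change of coefficients along an equivariant
map `β : B → B'`. -/
def IsCoeffChangeG (β : GHom B B') (Φ : GFunctor (QDG A B) (QDG A B')) : Prop :=
  ∃ t : ∀ (E : GMod A B) (a : 𝒢), Tensor (β.fib a) (E.mod a) (GMod.mod (Φ.obj E : GMod A B') a),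
    (∀ (E : GMod A B) {a : 𝒢} (x : A.alg a) (η : (E.mod a).sp) (y : B'.alg a),
      (GMod.op (Φ.obj E : GMod A B') x).toFun (a := CAlg.pt _) ((t E a).τ (b := CAlg.pt _) η y) =
        (t E a).τ (b := CAlg.pt _) ((E.op x).toFun η) y) ∧
    (∀ (E : GMod A B) {a b : 𝒢} (g : a ⟶ b) (η : (E.mod a).sp) (y : B'.alg a),
      GMod.tr (Φ.obj E : GMod A B') g ((t E a).τ (b := CAlg.pt _) η y) =
        (t E b).τ (b := CAlg.pt _) (E.tr g η) (B'.act g y : B'.alg b)) ∧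
    ∀ (E E' : GMod A B) (T : (DGPair A B).P E E'),
      ∃ T' : (DGPair A B').P (Φ.obj E : GMod A B') (Φ.obj E' : GMod A B'),
        (∀ (a : 𝒢) (η : (E.mod a).sp) (y : B'.alg a),
          (T'.1.1 a).toFun (a := CAlg.pt _) ((t E a).τ (b := CAlg.pt _) η y) =
            (t E' a).τ (b := CAlg.pt _) ((T.1.1 a).toFun η) y) ∧
        Φ.map ((DGPair A B).cls T) = (DGPair A B').cls T'

/-! ## The descent functor -/

/-- The bimodule `F` is the completion of the spaces of formal sums `η₁ g₁ + ⋯ + ηₙ gₙ` with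
`ηᵢ ∈ E_a` and `gᵢ : b ⟶ a`; `ι g η` is the element `η g`. -/
structure DescentMod (E : GMod A B) (F : Bimod A.red B.red) where
  ι : ∀ {a b : 𝒢}, (b ⟶ a) → (E.mod a).sp →ₗ[𝕜] (F.fiber (A.robj a)).E (B.robj b)
  inner_ι : ∀ {a b c : 𝒢} (g : c ⟶ a) (h : b ⟶ a) (η ξ : (E.mod a).sp),
    (F.fiber (A.robj a)).inner (ι g η) (ι h ξ) =
      B.rsingle (h ≫ Groupoid.inv g) (B.act (Groupoid.inv g) ((E.mod a).inner η ξ : B.alg a))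
  act_ι : ∀ {a b c : 𝒢} (g : b ⟶ a) (η : (E.mod a).sp) (h : c ⟶ b) (x : B.alg b),
    (F.fiber (A.robj a)).act (ι g η) (B.rsingle h x) =
      ι (h ≫ g) ((E.mod a).act (a := CAlg.pt _) η (B.act g x : B.alg a))
  op_ι : ∀ {a a' b : 𝒢} (g : a ⟶ a') (x : A.alg a') (h : b ⟶ a) (η : (E.mod a).sp),
    (F.op (A.rsingle g x)).toFun (ι h η) = ι (h ≫ g) ((E.op x).toFun (E.tr g η))
  grade_ι : ∀ {a b : 𝒢} (g : b ⟶ a) (η : (E.mod a).sp),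
    (F.fiber (A.robj a)).grade (ι g η) = ι g ((E.mod a).grade η)
  dense : ∀ (a b : 𝒢) (ζ : (F.fiber (A.robj a)).E (B.robj b)), ζ ∈ closure (Submodule.span 𝕜
    {ζ : (F.fiber (A.robj a)).E (B.robj b) | ∃ (g : b ⟶ a) (η : (E.mod a).sp), ζ = ι g η} :
      Set ((F.fiber (A.robj a)).E (B.robj b)))

/-- `D` is the descent functor: it maps `E` to the completion of the formal sums `∑ ηᵢ gᵢ`, and the
class of `T` to the class of the operator `∑ ηᵢ gᵢ ↦ ∑ (T ηᵢ) gᵢ`. -/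
def IsDescent (D : GFunctor (QDG A B) (QD A.red B.red)) : Prop :=
  ∃ d : ∀ E : GMod A B, DescentMod E (D.obj E : Bimod A.red B.red),
    ∀ (E E' : GMod A B) (T : (DGPair A B).P E E'),
      ∃ T' : (DPair A.red B.red).P (D.obj E : Bimod A.red B.red) (D.obj E' : Bimod A.red B.red),
        (∀ {a b : 𝒢} (g : b ⟶ a) (η : (E.mod a).sp),
          (T'.1.1 (A.robj a)).toFun ((d E).ι g η) = (d E').ι g ((T.1.1 a).toFun η)) ∧
        D.map ((DGPair A B).cls T) = (DPair A.red B.red).cls T'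

end

/-! ## Tensor products with the Clifford algebra on one generator -/

/-- The graded tensor product of `C` with the Clifford algebra generated by one odd selfadjoint
element `e` with `e² = 1`; the pair `(x, y)` stands for `x + y e`, and `e x = γ(x) e`.  (The norm is
one of the equivalent norms on the direct sum.) -/
def Cl (C : GStarCat.{v, w} 𝕜) : GStarCat.{v, w} 𝕜 where
  Obj := C.Obj
  Hom a b := C.Hom a b × C.Hom a b
  comp := LinearMap.mk₂ 𝕜
    (fun p q => (C.comp p.1 q.1 + C.comp p.2 (C.grade q.2), C.comp p.1 q.2 + C.comp p.2 (C.grade q.1)))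
    (fun p p' q => by ext <;> simp <;> abel)
    (fun r p q => by ext <;> simp)
    (fun p q q' => by ext <;> simp <;> abel)
    (fun r p q => by ext <;> simp)
  assoc p q r := by
    ext <;> simp [C.assoc, C.grade_comp, C.grade_grade] <;> abel
  star :=
    { toFun := fun p => (C.star p.1, C.grade (C.star p.2))
      map_add' := fun p q => by simp
      map_smul' := fun r p => by simp }
  star_star p := by
    simp [C.star_star, ← C.grade_star, C.grade_grade]
  star_comp p q := by
    ext <;> simp [C.star_comp, C.grade_comp, C.grade_grade, ← C.grade_star, add_comm]
  grade :=
    { toFun := fun p => (C.grade p.1, -C.grade p.2)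
      map_add' := fun p q => by ext <;> simp [add_comm]
      map_smul' := fun r p => by simp }
  grade_grade p := by simp [C.grade_grade]
  grade_comp p q := by
    ext <;> simp [C.grade_comp, C.grade_grade, add_comm]
  grade_star p := by simp [C.grade_star, C.grade_grade]
  norm_grade_le p := by
    simp only [LinearMap.coe_mk, AddHom.coe_mk, Prod.norm_def, norm_neg]
    exact max_le_max (C.norm_grade_le _) (C.norm_grade_le _)

/-- The functor induced on tensor products with the Clifford algebra. -/
def GFunctor.cl {C : GStarCat.{v, w} 𝕜} {C' : GStarCat.{v', w'} 𝕜} (F : GFunctor C C') :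
    GFunctor (Cl C) (Cl C') where
  obj := F.obj
  map := fun {a b : C.Obj} =>
    show C.Hom a b × C.Hom a b →ₗ[𝕜] C'.Hom (F.obj a) (F.obj b) × C'.Hom (F.obj a) (F.obj b) from
      F.map.prodMap F.map
  map_comp := fun {a b c : C.Obj} p q => by
    change (F.map (C.comp p.1 q.1 + C.comp p.2 (C.grade q.2)),
      F.map (C.comp p.1 q.2 + C.comp p.2 (C.grade q.1))) =
      (C'.comp (F.map p.1) (F.map q.1) + C'.comp (F.map p.2) (C'.grade (F.map q.2)),
        C'.comp (F.map p.1) (F.map q.2) + C'.comp (F.map p.2) (C'.grade (F.map q.1)))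
    simp only [map_add, F.map_comp, F.map_grade]
  map_star := fun {a b : C.Obj} p => by
    change (F.map (C.star p.1), F.map (C.grade (C.star p.2))) =
      (C'.star (F.map p.1), C'.grade (C'.star (F.map p.2)))
    simp only [F.map_star, F.map_grade]
  map_grade := fun {a b : C.Obj} p => by
    change (F.map (C.grade p.1), F.map (-C.grade p.2)) =
      (C'.grade (F.map p.1), -C'.grade (F.map p.2))
    simp only [map_neg, F.map_grade]
  norm_map_le p := max_le_max (F.norm_map_le p.1) (F.norm_map_le p.2)

/-- The `n`-fold tensor product with the Clifford algebra on one generator. -/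
def ClN (C : GStarCat.{v, w} 𝕜) : ℕ → GStarCat.{v, w} 𝕜
  | 0 => C
  | n + 1 => Cl (ClN C n)

/-- The functors induced on iterated tensor products. -/
def GFunctor.clN {C : GStarCat.{v, w} 𝕜} {C' : GStarCat.{v', w'} 𝕜} (F : GFunctor C C') :
    ∀ n : ℕ, GFunctor (ClN C n) (ClN C' n)
  | 0 => F
  | n + 1 => (F.clN n).cl

/-! ## Spectra -/

/-- The loop space of a pointed space; the circle is the one-point compactification of `ℝ`. -/
def Loop (X : Type w) [TopologicalSpace X] (x : X) : Type w :=
  {γ : C(OnePoint ℝ, X) // γ OnePoint.infty = x}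

instance (X : Type w) [TopologicalSpace X] (x : X) : TopologicalSpace (Loop X x) :=
  inferInstanceAs (TopologicalSpace {γ : C(OnePoint ℝ, X) // γ OnePoint.infty = x})

/-- The constant loop. -/
def Loop.const {X : Type w} [TopologicalSpace X] (x : X) : Loop X x := ⟨ContinuousMap.const _ x, rfl⟩

theorem Loop.continuous_mk {X : Type w} [TopologicalSpace X] {x : X} {Y : Type v}
    [TopologicalSpace Y] {g : Y → Loop X x}
    (h : Continuous fun p : Y × OnePoint ℝ => (g p.1).1 p.2) : Continuous g :=
  Continuous.subtype_mk (ContinuousMap.curry ⟨_, h⟩).continuous fun y => (g y).2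

theorem Loop.continuous_eval {X : Type w} [TopologicalSpace X] {x : X} :
    Continuous fun p : Loop X x × OnePoint ℝ => p.1.1 p.2 :=
  (continuous_subtype_val.comp continuous_fst).eval continuous_snd

/-- A (sequential) spectrum: pointed spaces `X n` with pointed maps `X n → Ω X (n + 1)`. -/
structure Spectrum where
  X : ℕ → Type w
  [top : ∀ n, TopologicalSpace (X n)]
  pt : ∀ n, X n
  σ : ∀ n, X n → Loop (X (n + 1)) (pt (n + 1))
  σ_cont : ∀ n, Continuous (σ n)
  σ_pt : ∀ n, σ n (pt n) = Loop.const _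

attribute [instance] Spectrum.top

/-- A map of spectra. -/
structure SpectrumHom (E : Spectrum.{w}) (F : Spectrum.{w'}) where
  f : ∀ n, E.X n → F.X n
  cont : ∀ n, Continuous (f n)
  map_pt : ∀ n, f n (E.pt n) = F.pt n
  map_σ : ∀ n x t, (F.σ n (f n x)).1 t = f (n + 1) ((E.σ n x).1 t)

/-- The loop spectrum `Ω E`. -/
def Spectrum.loop (E : Spectrum.{w}) : Spectrum.{w} where
  X n := Loop (E.X n) (E.pt n)
  pt n := Loop.const _
  σ n γ := ⟨⟨fun s => ⟨⟨fun t => (E.σ n (γ.1 t)).1 s,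
      Loop.continuous_eval.comp (((E.σ_cont n).comp γ.1.continuous).prodMk continuous_const)⟩, by
        change (E.σ n (γ.1 OnePoint.infty)).1 s = _
        rw [γ.2, E.σ_pt]; rfl⟩,
      Loop.continuous_mk (Loop.continuous_eval.comp
        (((E.σ_cont n).comp (γ.1.continuous.comp continuous_snd)).prodMk continuous_fst))⟩, by
        refine Subtype.ext (ContinuousMap.ext fun t => ?_)
        exact (E.σ n (γ.1 t)).2⟩
  σ_cont n := by
    refine Loop.continuous_mk (Loop.continuous_mk ?_)
    refine Loop.continuous_eval.comp (((E.σ_cont n).comp ?_).prodMk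
      (continuous_snd.comp continuous_fst))
    exact Loop.continuous_eval.comp ((continuous_fst.comp continuous_fst).prodMk continuous_snd)
  σ_pt n := by
    refine Subtype.ext (ContinuousMap.ext fun s => Subtype.ext (ContinuousMap.ext fun t => ?_))
    change (E.σ n (E.pt n)).1 s = E.pt (n + 1)
    rw [E.σ_pt]; rfl

/-! ## Functions on the line and on the plane -/

section C0

open scoped ZeroAtInfty
open Filter

/-- The grading of `C₀(ℝ)`: reflection of functions at the origin. -/
def refl (f : C₀(ℝ, 𝕜)) : C₀(ℝ, 𝕜) := f.comp (Homeomorph.neg ℝ).toCocompactMap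

@[simp] theorem refl_apply (f : C₀(ℝ, 𝕜)) (x : ℝ) : refl f x = f (-x) := rfl

/-- The restriction of a function on the plane to the line `{t} × ℝ`, and `0` for `t = ∞`. -/
def slice (F : C₀(ℝ × ℝ, 𝕜)) (t : OnePoint ℝ) : C₀(ℝ, 𝕜) :=
  t.elim 0 fun t =>
    { toFun := fun x => F (t, x)
      continuous_toFun := by fun_prop
      zero_at_infty' := F.zero_at_infty'.comp (by
        have h : Topology.IsClosedEmbedding fun x : ℝ => (t, x) := by
          exact ⟨isEmbedding_prodMkRight t, (isClosedMap_prodMk_left t).isClosed_range⟩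
        exact h.tendsto_cocompact) }

theorem slice_infty (F : C₀(ℝ × ℝ, 𝕜)) : slice F OnePoint.infty = 0 := rfl

@[simp] theorem slice_coe (F : C₀(ℝ × ℝ, 𝕜)) (t x : ℝ) : slice F t x = F (t, x) := rfl

theorem C0.norm_le {X : Type} [TopologicalSpace X] {f : C₀(X, 𝕜)} {K : ℝ} (hK : 0 ≤ K)
    (h : ∀ x, ‖f x‖ ≤ K) : ‖f‖ ≤ K := by
  rw [← ZeroAtInftyContinuousMap.norm_toBCF_eq_norm]
  exact (BoundedContinuousFunction.norm_le hK).mpr h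

theorem C0.le_norm {X : Type} [TopologicalSpace X] (f : C₀(X, 𝕜)) (x : X) : ‖f x‖ ≤ ‖f‖ := by
  rw [← ZeroAtInftyContinuousMap.norm_toBCF_eq_norm]
  exact f.toBCF.norm_coe_le_norm x

theorem norm_slice_le (F : C₀(ℝ × ℝ, 𝕜)) (t : OnePoint ℝ) : ‖slice F t‖ ≤ ‖F‖ := by
  induction t with
  | infty => rw [slice_infty, norm_zero]; exact norm_nonneg _
  | coe t => exact C0.norm_le (norm_nonneg _) fun x => C0.le_norm F _

theorem continuous_slice (F : C₀(ℝ × ℝ, 𝕜)) : Continuous (slice F) := by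
  rw [continuous_iff_continuousAt]
  intro t
  induction t with
  | infty =>
    rw [OnePoint.continuousAt_infty', slice_infty, Metric.tendsto_nhds]
    intro ε hε
    have h := F.zero_at_infty'
    rw [Metric.tendsto_nhds] at h
    have h1 := h (ε / 2) (half_pos hε)
    rw [← Filter.coprod_cocompact, Filter.eventually_iff, Filter.mem_coprod_iff] at h1
    obtain ⟨⟨s, hs, h2⟩, -⟩ := h1
    rw [Filter.coclosedCompact_eq_cocompact]
    filter_upwards [hs] with t ht
    rw [Function.comp_apply, dist_zero_right]
    refine (C0.norm_le (half_pos hε).le fun x => ?_).trans_lt (half_lt_self hε)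
    have h3 : (t, x) ∈ Prod.fst ⁻¹' s := ht
    have h4 := h2 h3
    rw [Set.mem_ofPred_eq, dist_zero_right] at h4
    exact h4.le
  | coe t =>
    rw [OnePoint.continuousAt_coe, Metric.continuousAt_iff]
    intro ε hε
    obtain ⟨δ, hδ, h⟩ := Metric.uniformContinuous_iff.mp
      (ZeroAtInftyContinuousMap.uniformContinuous F) (ε / 2) (half_pos hε)
    refine ⟨δ, hδ, fun {t'} ht => ?_⟩
    rw [dist_eq_norm]
    refine (C0.norm_le (half_pos hε).le fun x => ?_).trans_lt (half_lt_self hε)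
    rw [ZeroAtInftyContinuousMap.sub_apply, ← dist_eq_norm]
    refine (h ?_).le
    simpa [Prod.dist_eq] using ht

/-- The even part of `f`, evaluated at the distance from the origin. -/
def radEven (f : C₀(ℝ, 𝕜)) (p : ℝ × ℝ) : 𝕜 :=
  2⁻¹ * (f (√(p.1 ^ 2 + p.2 ^ 2)) + f (-√(p.1 ^ 2 + p.2 ^ 2)))

/-- The odd part of `f`, evaluated at the distance from the origin. -/
def radOdd (f : C₀(ℝ, 𝕜)) (p : ℝ × ℝ) : 𝕜 :=
  2⁻¹ * (f (√(p.1 ^ 2 + p.2 ^ 2)) - f (-√(p.1 ^ 2 + p.2 ^ 2)))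

theorem tendsto_rad :
    Tendsto (fun p : ℝ × ℝ => √(p.1 ^ 2 + p.2 ^ 2)) (cocompact (ℝ × ℝ)) atTop := by
  refine tendsto_atTop_mono (fun p => ?_) (tendsto_norm_cocompact_atTop (E := ℝ × ℝ))
  rw [Prod.norm_def]
  refine max_le ?_ ?_
  · exact Real.abs_le_sqrt (by nlinarith [sq_nonneg p.2])
  · exact Real.abs_le_sqrt (by nlinarith [sq_nonneg p.1])

theorem tendsto_rad₁ (f : C₀(ℝ, 𝕜)) :
    Tendsto (fun p : ℝ × ℝ => f √(p.1 ^ 2 + p.2 ^ 2)) (cocompact (ℝ × ℝ)) (𝓝 0) :=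
  (f.zero_at_infty'.mono_left atTop_le_cocompact).comp tendsto_rad

theorem tendsto_rad₂ (f : C₀(ℝ, 𝕜)) :
    Tendsto (fun p : ℝ × ℝ => f (-√(p.1 ^ 2 + p.2 ^ 2))) (cocompact (ℝ × ℝ)) (𝓝 0) :=
  (f.zero_at_infty'.mono_left atBot_le_cocompact).comp (tendsto_neg_atTop_atBot.comp tendsto_rad)

theorem tendsto_radEven (f : C₀(ℝ, 𝕜)) : Tendsto (radEven f) (cocompact (ℝ × ℝ)) (𝓝 0) := by
  have h := ((tendsto_rad₁ f).add (tendsto_rad₂ f)).const_mul (2⁻¹ : 𝕜)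
  rwa [add_zero, mul_zero] at h

theorem tendsto_radOdd (f : C₀(ℝ, 𝕜)) : Tendsto (radOdd f) (cocompact (ℝ × ℝ)) (𝓝 0) := by
  have h := ((tendsto_rad₁ f).sub (tendsto_rad₂ f)).const_mul (2⁻¹ : 𝕜)
  rwa [sub_zero, mul_zero] at h

theorem continuous_radEven (f : C₀(ℝ, 𝕜)) : Continuous (radEven f) := by
  unfold radEven; fun_prop

theorem continuous_radOdd (f : C₀(ℝ, 𝕜)) : Continuous (radOdd f) := by
  unfold radOdd; fun_prop

theorem radOdd_zero (f : C₀(ℝ, 𝕜)) : radOdd f 0 = 0 := by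
  simp [radOdd]

theorem continuous_mul_odd {u : ℝ × ℝ → ℝ} (hu : ∀ p, |u p| ≤ 1) (hc : ∀ p, p ≠ 0 → ContinuousAt u p)
    (f : C₀(ℝ, 𝕜)) : Continuous fun p => (u p : 𝕜) * radOdd f p := by
  rw [continuous_iff_continuousAt]
  intro p
  by_cases hp : p = 0
  · subst hp
    have h := (continuous_radOdd f).continuousAt (x := 0)
    unfold ContinuousAt at h ⊢
    rw [radOdd_zero] at h
    beta_reduce
    rw [radOdd_zero, mul_zero]
    refine squeeze_zero_norm (fun p => ?_) (tendsto_zero_iff_norm_tendsto_zero.mp h)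
    rw [norm_mul, RCLike.norm_ofReal]
    exact mul_le_of_le_one_left (norm_nonneg _) (hu p)
  · exact (RCLike.continuous_ofReal.continuousAt.comp (hc p hp)).mul (continuous_radOdd f).continuousAt

theorem tendsto_mul_odd {u : ℝ × ℝ → ℝ} (hu : ∀ p, |u p| ≤ 1) (f : C₀(ℝ, 𝕜)) :
    Tendsto (fun p => (u p : 𝕜) * radOdd f p) (cocompact (ℝ × ℝ)) (𝓝 0) := by
  refine squeeze_zero_norm (fun p => ?_) (tendsto_zero_iff_norm_tendsto_zero.mp (tendsto_radOdd f))
  rw [norm_mul, RCLike.norm_ofReal]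
  exact mul_le_of_le_one_left (norm_nonneg _) (hu p)

/-- The unit vector `p / |p|`: first coordinate. -/
def uSin (p : ℝ × ℝ) : ℝ := p.1 / √(p.1 ^ 2 + p.2 ^ 2)

/-- The unit vector `p / |p|`: second coordinate. -/
def uCos (p : ℝ × ℝ) : ℝ := p.2 / √(p.1 ^ 2 + p.2 ^ 2)

theorem abs_uSin (p : ℝ × ℝ) : |uSin p| ≤ 1 := by
  unfold uSin
  rw [abs_div, abs_of_nonneg (Real.sqrt_nonneg _)]
  exact div_le_one_of_le₀ (Real.abs_le_sqrt (by nlinarith [sq_nonneg p.2])) (Real.sqrt_nonneg _)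

theorem abs_uCos (p : ℝ × ℝ) : |uCos p| ≤ 1 := by
  unfold uCos
  rw [abs_div, abs_of_nonneg (Real.sqrt_nonneg _)]
  exact div_le_one_of_le₀ (Real.abs_le_sqrt (by nlinarith [sq_nonneg p.1])) (Real.sqrt_nonneg _)

theorem rad_pos {p : ℝ × ℝ} (hp : p ≠ 0) : 0 < p.1 ^ 2 + p.2 ^ 2 := by
  by_contra h
  apply hp
  have h1 : p.1 = 0 := by nlinarith [sq_nonneg p.1, sq_nonneg p.2]
  have h2 : p.2 = 0 := by nlinarith [sq_nonneg p.1, sq_nonneg p.2]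
  exact Prod.ext h1 h2

theorem continuousAt_uSin (p : ℝ × ℝ) (hp : p ≠ 0) : ContinuousAt uSin p :=
  ContinuousAt.div (by fun_prop) (by fun_prop) (Real.sqrt_pos.mpr (rad_pos hp)).ne'

theorem continuousAt_uCos (p : ℝ × ℝ) (hp : p ≠ 0) : ContinuousAt uCos p :=
  ContinuousAt.div (by fun_prop) (by fun_prop) (Real.sqrt_pos.mpr (rad_pos hp)).ne'

theorem uCos_sq_add (p : ℝ × ℝ) (hp : p ≠ 0) : uCos p ^ 2 + uSin p ^ 2 = 1 := by
  have h := rad_pos hp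
  unfold uCos uSin
  rw [div_pow, div_pow, Real.sq_sqrt h.le, ← add_div, add_comm, div_self h.ne']

/-- For `f = f₀ + f₁` (even and odd parts) and `r = √(t² + x²)`, the function
`(t, x) ↦ f₀(r) + (x / r) f₁(r)` on the plane. -/
def cosPart (f : C₀(ℝ, 𝕜)) : C₀(ℝ × ℝ, 𝕜) where
  toFun p := radEven f p + (uCos p : 𝕜) * radOdd f p
  continuous_toFun := (continuous_radEven f).add (continuous_mul_odd abs_uCos continuousAt_uCos f)
  zero_at_infty' := by
    simpa using (tendsto_radEven f).add (tendsto_mul_odd abs_uCos f)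

/-- The function `(t, x) ↦ (t / r) f₁(r)` on the plane. -/
def sinPart (f : C₀(ℝ, 𝕜)) : C₀(ℝ × ℝ, 𝕜) where
  toFun p := (uSin p : 𝕜) * radOdd f p
  continuous_toFun := continuous_mul_odd abs_uSin continuousAt_uSin f
  zero_at_infty' := tendsto_mul_odd abs_uSin f

theorem cosPart_apply (f : C₀(ℝ, 𝕜)) (p : ℝ × ℝ) :
    cosPart f p = radEven f p + (uCos p : 𝕜) * radOdd f p := rfl

theorem sinPart_apply (f : C₀(ℝ, 𝕜)) (p : ℝ × ℝ) : sinPart f p = (uSin p : 𝕜) * radOdd f p := rfl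

theorem norm_radOdd_le (f : C₀(ℝ, 𝕜)) (p : ℝ × ℝ) : ‖radOdd f p‖ ≤ ‖f‖ := by
  unfold radOdd
  rw [norm_mul, norm_inv, RCLike.norm_ofNat]
  have h1 := norm_sub_le (f √(p.1 ^ 2 + p.2 ^ 2)) (f (-√(p.1 ^ 2 + p.2 ^ 2)))
  have h2 := C0.le_norm f √(p.1 ^ 2 + p.2 ^ 2)
  have h3 := C0.le_norm f (-√(p.1 ^ 2 + p.2 ^ 2))
  linarith

theorem norm_sinPart_le (f : C₀(ℝ, 𝕜)) : ‖sinPart f‖ ≤ ‖f‖ := by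
  refine C0.norm_le (norm_nonneg _) fun p => ?_
  rw [sinPart_apply, norm_mul, RCLike.norm_ofReal]
  exact (mul_le_of_le_one_left (norm_nonneg _) (abs_uSin p)).trans (norm_radOdd_le f p)

theorem norm_cosPart_le (f : C₀(ℝ, 𝕜)) : ‖cosPart f‖ ≤ ‖f‖ := by
  refine C0.norm_le (norm_nonneg _) fun p => ?_
  have hu := abs_le.mp (abs_uCos p)
  set a := f √(p.1 ^ 2 + p.2 ^ 2) with ha
  set b := f (-√(p.1 ^ 2 + p.2 ^ 2)) with hb
  have h : cosPart f p = (((1 + uCos p) / 2 : ℝ) : 𝕜) * a + (((1 - uCos p) / 2 : ℝ) : 𝕜) * b := by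
    rw [cosPart_apply, radEven, radOdd, ← ha, ← hb]
    push_cast
    ring
  rw [h]
  refine (norm_add_le _ _).trans ?_
  rw [norm_mul, norm_mul, RCLike.norm_ofReal, RCLike.norm_ofReal,
    abs_of_nonneg (by linarith), abs_of_nonneg (by linarith)]
  have h2 : ‖a‖ ≤ ‖f‖ := C0.le_norm f _
  have h3 : ‖b‖ ≤ ‖f‖ := C0.le_norm f _
  nlinarith

end C0

section C0

open scoped ZeroAtInfty
open Filter

theorem radEven_mul (f g : C₀(ℝ, 𝕜)) (p : ℝ × ℝ) :
    radEven (f * g) p = radEven f p * radEven g p + radOdd f p * radOdd g p := by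
  simp only [radEven, radOdd, ZeroAtInftyContinuousMap.mul_apply]; ring

theorem radOdd_mul (f g : C₀(ℝ, 𝕜)) (p : ℝ × ℝ) :
    radOdd (f * g) p = radEven f p * radOdd g p + radOdd f p * radEven g p := by
  simp only [radEven, radOdd, ZeroAtInftyContinuousMap.mul_apply]; ring

theorem radEven_refl (f : C₀(ℝ, 𝕜)) (p : ℝ × ℝ) : radEven (refl f) p = radEven f p := by
  simp [radEven, add_comm]

theorem radOdd_refl (f : C₀(ℝ, 𝕜)) (p : ℝ × ℝ) : radOdd (refl f) p = -radOdd f p := by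
  simp only [radOdd, refl_apply, neg_neg]; ring

theorem refl_zero : refl (0 : C₀(ℝ, 𝕜)) = 0 := rfl

theorem radEven_neg (f : C₀(ℝ, 𝕜)) (t x : ℝ) : radEven f (t, -x) = radEven f (t, x) := by
  simp [radEven]

theorem radOdd_neg (f : C₀(ℝ, 𝕜)) (t x : ℝ) : radOdd f (t, -x) = radOdd f (t, x) := by
  simp [radOdd]

theorem uCos_neg (t x : ℝ) : uCos (t, -x) = -uCos (t, x) := by simp [uCos, neg_div]

theorem uSin_neg (t x : ℝ) : uSin (t, -x) = uSin (t, x) := by simp [uSin]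

/-- The restrictions of `cosPart f` to lines. -/
def cosS (t : OnePoint ℝ) : C₀(ℝ, 𝕜) →ₗ[𝕜] C₀(ℝ, 𝕜) where
  toFun f := slice (cosPart f) t
  map_add' f g := by
    induction t with
    | infty => simp [slice_infty]
    | coe t =>
      ext x
      simp only [slice_coe, cosPart_apply, ZeroAtInftyContinuousMap.add_apply, radEven, radOdd]
      ring
  map_smul' r f := by
    induction t with
    | infty => simp [slice_infty]
    | coe t =>
      ext x
      simp only [slice_coe, cosPart_apply, ZeroAtInftyContinuousMap.smul_apply, radEven, radOdd,
        smul_eq_mul, RingHom.id_apply]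
      ring

/-- The restrictions of `sinPart f` to lines. -/
def sinS (t : OnePoint ℝ) : C₀(ℝ, 𝕜) →ₗ[𝕜] C₀(ℝ, 𝕜) where
  toFun f := slice (sinPart f) t
  map_add' f g := by
    induction t with
    | infty => simp [slice_infty]
    | coe t =>
      ext x
      simp only [slice_coe, sinPart_apply, ZeroAtInftyContinuousMap.add_apply, radOdd]
      ring
  map_smul' r f := by
    induction t with
    | infty => simp [slice_infty]
    | coe t =>
      ext x
      simp only [slice_coe, sinPart_apply, ZeroAtInftyContinuousMap.smul_apply, radOdd,
        smul_eq_mul, RingHom.id_apply]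
      ring

theorem cosS_infty (f : C₀(ℝ, 𝕜)) : cosS OnePoint.infty f = 0 := rfl

theorem sinS_infty (f : C₀(ℝ, 𝕜)) : sinS OnePoint.infty f = 0 := rfl

theorem cosS_coe (t x : ℝ) (f : C₀(ℝ, 𝕜)) :
    cosS t f x = radEven f (t, x) + (uCos (t, x) : 𝕜) * radOdd f (t, x) := rfl

theorem sinS_coe (t x : ℝ) (f : C₀(ℝ, 𝕜)) : sinS t f x = (uSin (t, x) : 𝕜) * radOdd f (t, x) := rfl

theorem norm_cosS_le (t : OnePoint ℝ) (f : C₀(ℝ, 𝕜)) : ‖cosS t f‖ ≤ ‖f‖ :=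
  (norm_slice_le _ _).trans (norm_cosPart_le f)

theorem norm_sinS_le (t : OnePoint ℝ) (f : C₀(ℝ, 𝕜)) : ‖sinS t f‖ ≤ ‖f‖ :=
  (norm_slice_le _ _).trans (norm_sinPart_le f)

theorem continuous_cosS (f : C₀(ℝ, 𝕜)) : Continuous fun t => cosS t f := continuous_slice _

theorem continuous_sinS (f : C₀(ℝ, 𝕜)) : Continuous fun t => sinS t f := continuous_slice _

theorem cosS_mul (t : OnePoint ℝ) (f g : C₀(ℝ, 𝕜)) :
    cosS t (f * g) = cosS t f * cosS t g + sinS t f * refl (sinS t g) := by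
  induction t with
  | infty => simp [cosS_infty, sinS_infty]
  | coe t =>
    ext x
    simp only [ZeroAtInftyContinuousMap.add_apply, ZeroAtInftyContinuousMap.mul_apply, refl_apply,
      cosS_coe, sinS_coe, radEven_mul, radOdd_mul, radOdd_neg, uSin_neg]
    by_cases h : (t, x) = 0
    · rw [h, radOdd_zero, radOdd_zero]; ring
    · have h1 : (uCos (t, x) : 𝕜) ^ 2 + (uSin (t, x) : 𝕜) ^ 2 = 1 := by
        exact_mod_cast congrArg (fun r : ℝ => (r : 𝕜)) (uCos_sq_add _ h)
      linear_combination (-(radOdd f (t, x) * radOdd g (t, x))) * h1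

theorem sinS_mul (t : OnePoint ℝ) (f g : C₀(ℝ, 𝕜)) :
    sinS t (f * g) = cosS t f * sinS t g + sinS t f * refl (cosS t g) := by
  induction t with
  | infty => simp [cosS_infty, sinS_infty]
  | coe t =>
    ext x
    simp only [ZeroAtInftyContinuousMap.add_apply, ZeroAtInftyContinuousMap.mul_apply, refl_apply,
      cosS_coe, sinS_coe, radOdd_mul, radOdd_neg, radEven_neg, uCos_neg]
    push_cast
    ring

theorem cosS_star (t : OnePoint ℝ) (f : C₀(ℝ, 𝕜)) : cosS t (star f) = star (cosS t f) := by
  induction t with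
  | infty => simp [cosS_infty]
  | coe t =>
    ext x
    simp [cosS_coe, radEven, radOdd]

theorem sinS_star (t : OnePoint ℝ) (f : C₀(ℝ, 𝕜)) :
    sinS t (star f) = refl (star (sinS t f)) := by
  induction t with
  | infty => simp [sinS_infty, refl_zero]
  | coe t =>
    ext x
    simp [sinS_coe, radOdd, uSin_neg]

theorem cosS_refl (t : OnePoint ℝ) (f : C₀(ℝ, 𝕜)) : cosS t (refl f) = refl (cosS t f) := by
  induction t with
  | infty => simp [cosS_infty, refl_zero]
  | coe t =>
    ext x
    simp only [cosS_coe, refl_apply, radEven_neg, radOdd_neg, uCos_neg, radEven_refl, radOdd_refl]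
    push_cast
    ring

theorem sinS_refl (t : OnePoint ℝ) (f : C₀(ℝ, 𝕜)) : sinS t (refl f) = -refl (sinS t f) := by
  induction t with
  | infty => simp [sinS_infty, refl_zero]
  | coe t =>
    ext x
    simp only [sinS_coe, refl_apply, radOdd_neg, uSin_neg, radOdd_refl,
      ZeroAtInftyContinuousMap.neg_apply]
    ring

/-! ## The K-theory spectrum -/

/-- The sign `±1` as a scalar. -/
def sgn (e : ℤˣ) : 𝕜 := ((e : ℤ) : 𝕜)

theorem sgn_mul_self (e : ℤˣ) : (sgn e : 𝕜) * sgn e = 1 := by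
  rcases Int.units_eq_one_or e with rfl | rfl <;> simp [sgn]

theorem conj_sgn (e : ℤˣ) : starRingEnd 𝕜 (sgn e) = sgn e := by simp [sgn]

theorem norm_sgn (e : ℤˣ) : ‖(sgn e : 𝕜)‖ = 1 := by
  rcases Int.units_eq_one_or e with rfl | rfl <;> simp [sgn]

/-- Graded `*`-homomorphisms from `C₀(ℝ)` (graded by even and odd functions) to the matrices over
the finite formal direct sum of the objects `(L i).1`; the sign `(L i).2` tells whether the grading
is reversed on a summand.  Contractivity is automatic. -/
structure KRep (C : GStarCat.{v, w} 𝕜) {S : Finset ℕ} (L : S → C.Obj × ℤˣ) where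
  toFun : C₀(ℝ, 𝕜) →ₗ[𝕜] ∀ i j : S, C.Hom (L j).1 (L i).1
  map_mul : ∀ f g i k, toFun (f * g) i k = ∑ j, C.comp (toFun f i j) (toFun g j k)
  map_star : ∀ f i j, toFun (star f) i j = C.star (toFun f j i)
  map_refl : ∀ f i j,
    toFun (refl f) i j = ((sgn (L i).2 : 𝕜) * sgn (L j).2) • C.grade (toFun f i j)
  norm_le : ∀ f i j, ‖toFun f i j‖ ≤ ‖f‖

namespace KRep

variable {C : GStarCat.{v, w} 𝕜}

/-- The topology of pointwise convergence. -/
instance {S : Finset ℕ} (L : S → C.Obj × ℤˣ) : TopologicalSpace (KRep C L) :=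
  TopologicalSpace.induced (fun φ f i j => φ.toFun f i j)
    (inferInstanceAs (TopologicalSpace (C₀(ℝ, 𝕜) → ∀ i j : S, C.Hom (L j).1 (L i).1)))

theorem ext {S : Finset ℕ} {L : S → C.Obj × ℤˣ} {φ ψ : KRep C L}
    (h : ∀ f i j, φ.toFun f i j = ψ.toFun f i j) : φ = ψ := by
  have h1 : φ.toFun = ψ.toFun := LinearMap.ext fun f => funext fun i => funext fun j => h f i j
  cases φ; cases ψ
  simp only at h1
  subst h1; rfl

theorem continuous_entry {S : Finset ℕ} {L : S → C.Obj × ℤˣ} (f : C₀(ℝ, 𝕜)) (i j : S) :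
    Continuous fun φ : KRep C L => φ.toFun f i j := by
  have h : Continuous fun (φ : KRep C L) (f : C₀(ℝ, 𝕜)) (i j : S) => φ.toFun f i j :=
    continuous_induced_dom
  exact continuous_pi_iff.mp (continuous_pi_iff.mp (continuous_pi_iff.mp h f) i) j

theorem continuous_of_entries {S : Finset ℕ} {L : S → C.Obj × ℤˣ} {Y : Type*} [TopologicalSpace Y]
    {g : Y → KRep C L} (h : ∀ f i j, Continuous fun y => (g y).toFun f i j) : Continuous g :=
  continuous_induced_rng.mpr (continuous_pi fun f => continuous_pi fun i => continuous_pi fun j =>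
    h f i j)

/-- The trivial homomorphism. -/
def zero {S : Finset ℕ} (L : S → C.Obj × ℤˣ) : KRep C L where
  toFun := 0
  map_mul f g i k := by simp
  map_star f i j := by simp
  map_refl f i j := by simp
  norm_le f i j := by simp

/-- The matrix entries of `φ` outside of `T` vanish. -/
def Vanish {S : Finset ℕ} {L : S → C.Obj × ℤˣ} (φ : KRep C L) (T : Finset ℕ) : Prop :=
  ∀ f i j, ¬ (i.1 ∈ T ∧ j.1 ∈ T) → φ.toFun f i j = 0

/-- Removing summands on which a homomorphism vanishes. -/
def corner {S : Finset ℕ} {L : S → C.Obj × ℤˣ} (φ : KRep C L) {T : Finset ℕ} (h : T ⊆ S)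
    (hv : φ.Vanish T) : KRep C fun i : T => L ⟨i.1, h i.2⟩ where
  toFun :=
    { toFun := fun f i j => φ.toFun f ⟨i.1, h i.2⟩ ⟨j.1, h j.2⟩
      map_add' := fun f g => by simp; rfl
      map_smul' := fun r f => by simp; rfl }
  map_mul f g i k := by
    refine (φ.map_mul f g _ _).trans ?_
    refine (Finset.sum_subset (Finset.subset_univ (Finset.univ.map
      ⟨fun j : T => (⟨j.1, h j.2⟩ : S), fun j j' e => Subtype.ext (congrArg (fun s : S => s.1) e)⟩))
      fun j _ hj => ?_).symm.trans (Finset.sum_map _ _ _)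
    have : j.1 ∉ T := fun hT => hj (Finset.mem_map.mpr ⟨⟨j.1, hT⟩, Finset.mem_univ _, rfl⟩)
    rw [hv g j _ fun h => this h.1, map_zero]
  map_star f i j := φ.map_star f _ _
  map_refl f i j := φ.map_refl f _ _
  norm_le f i j := φ.norm_le f _ _

/-- Composition with a functor. -/
def map {C' : GStarCat.{v', w'} 𝕜} (F : GFunctor C C') {S : Finset ℕ} {L : S → C.Obj × ℤˣ}
    (φ : KRep C L) : KRep C' fun i => (F.obj (L i).1, (L i).2) where
  toFun :=
    { toFun := fun f i j => F.map (φ.toFun f i j)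
      map_add' := fun f g => by simp; rfl
      map_smul' := fun r f => by simp; rfl }
  map_mul f g i k := by
    refine (congrArg F.map (φ.map_mul f g i k)).trans ?_
    rw [map_sum]
    exact Finset.sum_congr rfl fun j _ => F.map_comp _ _
  map_star f i j := (congrArg F.map (φ.map_star f i j)).trans (F.map_star _)
  map_refl f i j := (congrArg F.map (φ.map_refl f i j)).trans (by rw [map_smul, F.map_grade]; rfl)
  norm_le f i j := (F.norm_map_le _).trans (φ.norm_le f i j)

/-- Objects of `C` as objects of `Cl C`. -/
def lab {S : Finset ℕ} (L : S → C.Obj × ℤˣ) : S → (Cl C).Obj × ℤˣ := L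

/-- The homomorphism `f ↦ φ(f₀(√(t² + x²)) + (x + t e) / √(t² + x²) f₁(√(t² + x²)))`, where
`f = f₀ + f₁` is the decomposition into even and odd parts: the functional calculus of the sum of
`φ` and `t e`.  For `t = ∞` it is trivial. -/
def susp {S : Finset ℕ} {L : S → C.Obj × ℤˣ} (φ : KRep C L) (t : OnePoint ℝ) :
    KRep (Cl C) (lab L) where
  toFun :=
    { toFun := fun f i j => ((φ.toFun (cosS t f) i j, (sgn (L j).2 : 𝕜) • φ.toFun (sinS t f) i j) :
        C.Hom (L j).1 (L i).1 × C.Hom (L j).1 (L i).1)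
      map_add' := fun f g => by
        funext i j
        simp only [map_add, Pi.add_apply, smul_add]
        rfl
      map_smul' := fun r f => by
        funext i j
        simp only [map_smul, Pi.smul_apply, smul_comm _ r]
        rfl }
  map_mul f g i k := by
    change ((φ.toFun (cosS t (f * g)) i k, (sgn (L k).2 : 𝕜) • φ.toFun (sinS t (f * g)) i k) :
      C.Hom (L k).1 (L i).1 × C.Hom (L k).1 (L i).1) = ∑ j : S,
      ((C.comp (φ.toFun (cosS t f) i j) (φ.toFun (cosS t g) j k) +
          C.comp ((sgn (L j).2 : 𝕜) • φ.toFun (sinS t f) i j)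
            (C.grade ((sgn (L k).2 : 𝕜) • φ.toFun (sinS t g) j k)),
        C.comp (φ.toFun (cosS t f) i j) ((sgn (L k).2 : 𝕜) • φ.toFun (sinS t g) j k) +
          C.comp ((sgn (L j).2 : 𝕜) • φ.toFun (sinS t f) i j)
            (C.grade (φ.toFun (cosS t g) j k))) : C.Hom (L k).1 (L i).1 × C.Hom (L k).1 (L i).1)
    rw [cosS_mul, sinS_mul, map_add, map_add]
    simp only [Pi.add_apply, φ.map_mul, φ.map_refl]
    refine Prod.ext ?_ ?_
    · rw [Prod.fst_sum, ← Finset.sum_add_distrib]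
      refine Finset.sum_congr rfl fun j _ => ?_
      simp only [map_smul, LinearMap.smul_apply, smul_smul]
      rw [mul_comm (sgn (L k).2 : 𝕜)]
    · rw [Prod.snd_sum]
      dsimp only
      rw [← Finset.sum_add_distrib, Finset.smul_sum]
      refine Finset.sum_congr rfl fun j _ => ?_
      simp only [map_smul, LinearMap.smul_apply, smul_smul, smul_add]
      rw [mul_comm (sgn (L j).2 : 𝕜), ← mul_assoc, sgn_mul_self, one_mul]
  map_star f i j := by
    change ((φ.toFun (cosS t (star f)) i j, (sgn (L j).2 : 𝕜) • φ.toFun (sinS t (star f)) i j) :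
      C.Hom (L j).1 (L i).1 × C.Hom (L j).1 (L i).1) =
      (C.star (φ.toFun (cosS t f) j i), C.grade (C.star ((sgn (L i).2 : 𝕜) • φ.toFun (sinS t f) j i)))
    rw [cosS_star, sinS_star, φ.map_star, φ.map_refl, φ.map_star, map_smulₛₗ, map_smul, smul_smul,
      conj_sgn, mul_comm (sgn (L i).2 : 𝕜), ← mul_assoc, sgn_mul_self, one_mul]
  map_refl f i j := by
    change ((φ.toFun (cosS t (refl f)) i j, (sgn (L j).2 : 𝕜) • φ.toFun (sinS t (refl f)) i j) :
      C.Hom (L j).1 (L i).1 × C.Hom (L j).1 (L i).1) =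
      ((sgn (L i).2 : 𝕜) * sgn (L j).2) • (C.grade (φ.toFun (cosS t f) i j),
        -C.grade ((sgn (L j).2 : 𝕜) • φ.toFun (sinS t f) i j))
    rw [cosS_refl, sinS_refl, φ.map_refl, map_neg, Pi.neg_apply, Pi.neg_apply, φ.map_refl,
      Prod.smul_mk, map_smul, smul_neg, smul_neg, smul_smul, smul_smul, mul_comm (sgn (L j).2 : 𝕜)]
  norm_le f i j := by
    refine max_le ((φ.norm_le _ _ _).trans (norm_cosS_le t f)) ?_
    change ‖(sgn (L j).2 : 𝕜) • φ.toFun (sinS t f) i j‖ ≤ ‖f‖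
    rw [norm_smul, norm_sgn, one_mul]
    exact (φ.norm_le _ _ _).trans (norm_sinS_le t f)

theorem continuous_susp {S : Finset ℕ} {L : S → C.Obj × ℤˣ} :
    Continuous fun p : KRep C L × OnePoint ℝ => p.1.susp p.2 := by
  have key : ∀ (c : OnePoint ℝ → C₀(ℝ, 𝕜)) (_ : Continuous c) (i j : S),
      Continuous fun p : KRep C L × OnePoint ℝ => p.1.toFun (c p.2) i j := by
    intro c hc i j
    rw [continuous_iff_continuousAt]
    rintro ⟨φ₀, t₀⟩
    rw [ContinuousAt, tendsto_iff_norm_sub_tendsto_zero]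
    have h1 : Tendsto (fun p : KRep C L × OnePoint ℝ => ‖c p.2 - c t₀‖ +
        ‖p.1.toFun (c t₀) i j - φ₀.toFun (c t₀) i j‖) (𝓝 (φ₀, t₀)) (𝓝 0) := by
      have h2 : Continuous fun p : KRep C L × OnePoint ℝ => ‖c p.2 - c t₀‖ +
          ‖p.1.toFun (c t₀) i j - φ₀.toFun (c t₀) i j‖ :=
        ((hc.comp continuous_snd).sub continuous_const).norm.add
          (((continuous_entry (c t₀) i j).comp continuous_fst).sub continuous_const).norm
      simpa using h2.tendsto (φ₀, t₀)
    refine squeeze_zero (fun _ => norm_nonneg _) (fun p => ?_) h1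
    have h3 : p.1.toFun (c p.2) i j - φ₀.toFun (c t₀) i j =
        p.1.toFun (c p.2 - c t₀) i j + (p.1.toFun (c t₀) i j - φ₀.toFun (c t₀) i j) := by
      rw [map_sub, Pi.sub_apply, Pi.sub_apply]; abel
    rw [h3]
    exact (norm_add_le _ _).trans (add_le_add (p.1.norm_le _ _ _) le_rfl)
  refine continuous_of_entries fun f i j => ?_
  exact (key _ (continuous_cosS f) i j).prodMk ((key _ (continuous_sinS f) i j).const_smul _)

end KRep

end C0

section KSpace

variable (C : GStarCat.{v, w} 𝕜)

/-- A finite formal direct sum of objects of `C`, with a homomorphism into its matrices. -/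
abbrev KPt := Σ (S : Finset ℕ) (L : S → C.Obj × ℤˣ), KRep C L

/-- Homomorphisms are identified if they differ by summands on which they vanish. -/
inductive KRel : KPt C → KPt C → Prop
  | corner {S : Finset ℕ} {L : S → C.Obj × ℤˣ} (φ : KRep C L) {T : Finset ℕ} (h : T ⊆ S)
      (hv : φ.Vanish T) : KRel ⟨S, L, φ⟩ ⟨T, _, φ.corner h hv⟩

/-- The space of graded `*`-homomorphisms from `C₀(ℝ)` to finite matrices over `C`. -/
def KSp : Type (max v w) := Quot (KRel C)

instance : TopologicalSpace (KSp C) := inferInstanceAs (TopologicalSpace (Quot (KRel C)))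

variable {C}

/-- The point of `KSp C` given by a homomorphism. -/
def KSp.mk {S : Finset ℕ} {L : S → C.Obj × ℤˣ} (φ : KRep C L) : KSp C := Quot.mk _ ⟨S, L, φ⟩

theorem KSp.continuous_mk {S : Finset ℕ} {L : S → C.Obj × ℤˣ} :
    Continuous (KSp.mk : KRep C L → KSp C) :=
  continuous_quot_mk.comp (continuous_sigmaMk.comp continuous_sigmaMk)

variable (C) in
/-- The base point of `KSp C`. -/
def KSp.base : KSp C := KSp.mk (S := ∅) (KRep.zero fun i => absurd i.2 (Finset.notMem_empty _))

theorem KSp.mk_empty {L : (∅ : Finset ℕ) → C.Obj × ℤˣ} (φ : KRep C L) : KSp.mk φ = KSp.base C := by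
  have h : L = fun i => absurd i.2 (Finset.notMem_empty _) :=
    funext fun i => absurd i.2 (Finset.notMem_empty _)
  subst h
  exact congrArg KSp.mk (KRep.ext fun f i => absurd i.2 (Finset.notMem_empty _))

theorem KSp.mk_corner {S : Finset ℕ} {L : S → C.Obj × ℤˣ} (φ : KRep C L) {T : Finset ℕ}
    (h : T ⊆ S) (hv : φ.Vanish T) : KSp.mk (φ.corner h hv) = KSp.mk φ :=
  (Quot.sound (KRel.corner φ h hv)).symm

theorem KSp.mk_eq_base {S : Finset ℕ} {L : S → C.Obj × ℤˣ} (φ : KRep C L)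
    (h : ∀ f i j, φ.toFun f i j = 0) : KSp.mk φ = KSp.base C := by
  rw [← KSp.mk_corner φ (Finset.empty_subset S) fun f i j _ => h f i j]
  exact KSp.mk_empty _

/-- The map of spaces induced by a functor. -/
def KSp.map {C' : GStarCat.{v', w'} 𝕜} (F : GFunctor C C') : KSp C → KSp C' :=
  Quot.lift (fun p => KSp.mk (p.2.2.map F)) (by
    rintro _ _ ⟨φ, h, hv⟩
    have hv' : (φ.map F).Vanish _ := fun f i j hn =>
      (congrArg F.map (hv f i j hn)).trans (map_zero _)
    exact (KSp.mk_corner (φ.map F) h hv').symm)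

/-- The path of homomorphisms attached to a homomorphism, as a loop. -/
def KRep.loop {S : Finset ℕ} {L : S → C.Obj × ℤˣ} (φ : KRep C L) :
    Loop (KSp (Cl C)) (KSp.base (Cl C)) :=
  ⟨⟨fun t => KSp.mk (φ.susp t), KSp.continuous_mk.comp
    (KRep.continuous_susp.comp (continuous_const.prodMk continuous_id))⟩,
    KSp.mk_eq_base _ fun f i j => by
      change ((φ.toFun (cosS OnePoint.infty f) i j,
        (sgn (L j).2 : 𝕜) • φ.toFun (sinS OnePoint.infty f) i j) :
        C.Hom (L j).1 (L i).1 × C.Hom (L j).1 (L i).1) = 0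
      rw [cosS_infty, sinS_infty, map_zero, Pi.zero_apply, Pi.zero_apply, smul_zero]
      rfl⟩

theorem KRep.Vanish.susp {S : Finset ℕ} {L : S → C.Obj × ℤˣ} {φ : KRep C L} {T : Finset ℕ}
    (hv : φ.Vanish T) (t : OnePoint ℝ) : (φ.susp t).Vanish T := fun f i j hn => by
  change ((φ.toFun (cosS t f) i j, (sgn (L j).2 : 𝕜) • φ.toFun (sinS t f) i j) :
    C.Hom (L j).1 (L i).1 × C.Hom (L j).1 (L i).1) = 0
  rw [hv _ i j hn, hv _ i j hn, smul_zero]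
  rfl

/-- The structure maps of the K-theory spectrum. -/
def KSp.str : KSp C → Loop (KSp (Cl C)) (KSp.base (Cl C)) :=
  Quot.lift (fun p => p.2.2.loop) (by
    rintro _ _ ⟨φ, h, hv⟩
    refine Subtype.ext (ContinuousMap.ext fun t => ?_)
    exact (KSp.mk_corner (φ.susp t) h (hv.susp t)).symm)

theorem KSp.continuous_str : Continuous (KSp.str (C := C)) := by
  refine continuous_quot_lift _ (continuous_sigma fun S => continuous_sigma fun L => ?_)
  exact Loop.continuous_mk (KSp.continuous_mk.comp KRep.continuous_susp)

variable (C) in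
/-- The K-theory spectrum of a graded `C*`-category: its `n`-th space is the space of graded
`*`-homomorphisms from `C₀(ℝ)` to finite matrices over the tensor product of `C` with the Clifford
algebra on `n` generators. -/
def kSpec : Spectrum.{max v w} where
  X n := KSp (ClN C n)
  pt n := KSp.base (ClN C n)
  σ n := KSp.str (C := ClN C n)
  σ_cont _ := KSp.continuous_str
  σ_pt n := by
    refine Subtype.ext (ContinuousMap.ext fun t => ?_)
    exact KSp.mk_empty _

end KSpace

/-- The spectrum `KK(A,B) = Ω K(QD(A,B))`. -/
def KK (A : GStarCat.{v', w'} 𝕜) (B : GStarCat.{v, w} 𝕜) := (kSpec (QD A B)).loop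

/-- The equivariant spectrum `KK_𝒢(A,B) = Ω K(QD_𝒢(A,B))`. -/
def KKG {𝒢 : Type u} [Groupoid.{u} 𝒢] (A B : GCAlg 𝕜 𝒢) := (kSpec (QDG A B)).loop

/-- The map of spectra `Δ` is induced by the functor `D`. -/
def IsInducedBy {𝒢 : Type u} [Groupoid.{u} 𝒢] {A B : GCAlg 𝕜 𝒢}
    (D : GFunctor (QDG A B) (QD A.red B.red)) (Δ : SpectrumHom (KKG A B) (KK A.red B.red)) : Prop :=
  ∀ (n : ℕ) (γ : Loop (KSp (ClN (QDG A B) n)) (KSp.base _)) (t : OnePoint ℝ),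
    (show Loop (KSp (ClN (QD A.red B.red) n)) (KSp.base _) from Δ.f n γ).1 t =
      KSp.map (D.clN n) (γ.1 t)

theorem GCAlg.SigmaUnital.restrict {ℋ 𝒢 : Type u} [Groupoid.{u} ℋ] [Groupoid.{u} 𝒢] (f : ℋ ⥤ 𝒢)
    {A : GCAlg 𝕜 𝒢} (h : A.SigmaUnital) : (A.restrict f).SigmaUnital := fun a => h (f.obj a)

end

end CStarDescent

open CStarDescent CategoryTheory

set_option linter.checkUnivs false
set_option linter.unusedSectionVars false

namespace CStarDescent

noncomputable section

open ComplexConjugate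

/-! ## Real spectral theory in terms of quasi-inverses -/

section Spectral

variable {A : Type u} [NonUnitalNormedRing A] [NormedSpace ℝ A] [IsScalarTower ℝ A A]
  [SMulCommClass ℝ A A]

/-- The complex Banach space of real-linear maps `A → ℂ`. -/
def DualC (A : Type u) [NonUnitalNormedRing A] [NormedSpace ℝ A] : Type u := A →L[ℝ] ℂ

instance : NormedAddCommGroup (DualC A) := inferInstanceAs (NormedAddCommGroup (A →L[ℝ] ℂ))
instance : NormedSpace ℂ (DualC A) := inferInstanceAs (NormedSpace ℂ (A →L[ℝ] ℂ))
instance : CompleteSpace (DualC A) := inferInstanceAs (CompleteSpace (A →L[ℝ] ℂ))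

/-- The complex Banach algebra in which the spectra of multipliers are computed. -/
def PreC (A : Type u) [NonUnitalNormedRing A] [NormedSpace ℝ A] : Type u :=
  DualC A →L[ℂ] DualC A

instance : NormedRing (PreC A) := inferInstanceAs (NormedRing (DualC A →L[ℂ] DualC A))
instance : NormedAlgebra ℂ (PreC A) := inferInstanceAs (NormedAlgebra ℂ (DualC A →L[ℂ] DualC A))
instance : CompleteSpace (PreC A) := inferInstanceAs (CompleteSpace (DualC A →L[ℂ] DualC A))

theorem PreC.norm_one_le : ‖(1 : PreC A)‖ ≤ 1 :=
  ContinuousLinearMap.norm_id_le (𝕜 := ℂ) (E := DualC A)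

/-- Evaluation of an element of `PreC A`. -/
def PreC.ev (T : PreC A) (φ : A →L[ℝ] ℂ) : A →L[ℝ] ℂ :=
  (show DualC A →L[ℂ] DualC A from T) (show DualC A from φ)

theorem PreC.ext {S T : PreC A} (h : ∀ φ x, S.ev φ x = T.ev φ x) : S = T :=
  ContinuousLinearMap.ext fun φ => ContinuousLinearMap.ext fun x => h φ x

theorem PreC.norm_ev_le (T : PreC A) (φ : A →L[ℝ] ℂ) : ‖T.ev φ‖ ≤ ‖T‖ * ‖φ‖ :=
  ContinuousLinearMap.le_opNorm (show DualC A →L[ℂ] DualC A from T) _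

theorem PreC.ev_algebraMap_mul (z : ℂ) (T : PreC A) (φ : A →L[ℝ] ℂ) :
    (algebraMap ℂ (PreC A) z * T).ev φ = z • T.ev φ := by
  rw [← Algebra.smul_def]; rfl

/-- Precomposition with `a`, on the space of real-linear maps `A → ℂ`. -/
def precompC (a : A →L[ℝ] A) : PreC A :=
  show DualC A →L[ℂ] DualC A from LinearMap.mkContinuous
    { toFun := fun φ => ContinuousLinearMap.comp (show A →L[ℝ] ℂ from φ) a
      map_add' := fun _ _ => rfl
      map_smul' := fun _ _ => rfl } ‖a‖ fun φ => by
    rw [mul_comm]; exact ContinuousLinearMap.opNorm_comp_le (show A →L[ℝ] ℂ from φ) a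

theorem precompC_apply (a : A →L[ℝ] A) (φ : A →L[ℝ] ℂ) (x : A) :
    (precompC a).ev φ x = φ (a x) := rfl

theorem precompC_mul (a b : A →L[ℝ] A) : precompC (a * b) = precompC b * precompC a := rfl

theorem precompC_one : precompC (1 : A →L[ℝ] A) = 1 := rfl

theorem precompC_add (a b : A →L[ℝ] A) : precompC (a + b) = precompC a + precompC b :=
  PreC.ext fun φ x => map_add φ (a x) (b x)

theorem precompC_sub (a b : A →L[ℝ] A) : precompC (a - b) = precompC a - precompC b :=
  PreC.ext fun φ x => map_sub φ (a x) (b x)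

theorem precompC_smul' (r : ℝ) (a : A →L[ℝ] A) :
    precompC (r • a) = algebraMap ℂ (PreC A) r * precompC a :=
  PreC.ext fun φ x => by
    rw [PreC.ev_algebraMap_mul, precompC_apply, smul_apply, smul_apply, precompC_apply, map_smul]
    simp

theorem precompC_scalar (r : ℝ) :
    precompC (r • (1 : A →L[ℝ] A)) = algebraMap ℂ (PreC A) r := by
  rw [precompC_smul', precompC_one, mul_one]

theorem precompC_pow (a : A →L[ℝ] A) (n : ℕ) : precompC (a ^ n) = precompC a ^ n := by
  induction n with
  | zero => rfl
  | succ n ih => rw [pow_succ, precompC_mul, ih, pow_succ']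

theorem norm_precompC_le (a : A →L[ℝ] A) : ‖precompC a‖ ≤ ‖a‖ :=
  ContinuousLinearMap.opNorm_le_bound (E := DualC A) (F := DualC A) _ (norm_nonneg _) fun φ => by
    rw [mul_comm]; exact ContinuousLinearMap.opNorm_comp_le (show A →L[ℝ] ℂ from φ) a

theorem norm_precompC (a : A →L[ℝ] A) : ‖precompC a‖ = ‖a‖ := by
  refine le_antisymm (norm_precompC_le a) ?_
  refine ContinuousLinearMap.opNorm_le_bound a (norm_nonneg (precompC a)) fun y => ?_
  obtain ⟨g, hg, hgy⟩ := exists_dual_vector'' ℝ (a y)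
  have h1 : ‖Complex.ofRealCLM.comp g‖ ≤ 1 := by
    refine ContinuousLinearMap.opNorm_le_bound _ zero_le_one fun z => ?_
    have := g.le_of_opNorm_le hg z
    simpa using this
  have h2 : ‖a y‖ = ‖(precompC a).ev (Complex.ofRealCLM.comp g) y‖ := by
    rw [precompC_apply]
    simp only [ContinuousLinearMap.comp_apply, Complex.ofRealCLM_apply]
    rw [hgy]; simp
  rw [h2]
  refine (ContinuousLinearMap.le_opNorm _ _).trans ?_
  gcongr
  refine (PreC.norm_ev_le _ _).trans ?_
  exact mul_le_of_le_one_right (norm_nonneg _) h1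

theorem isUnit_precompC {a : A →L[ℝ] A} (h : IsUnit a) : IsUnit (precompC a) := by
  obtain ⟨u, rfl⟩ := h
  refine ⟨⟨precompC u.1, precompC u.2, ?_, ?_⟩, rfl⟩
  · rw [← precompC_mul]; exact (congrArg precompC u.inv_val).trans precompC_one
  · rw [← precompC_mul]; exact (congrArg precompC u.val_inv).trans precompC_one

variable [StarRing A] [CStarRing A]

/-- A multiplier which is its own adjoint. -/
def IsSymm (u : A →L[ℝ] A) : Prop := ∀ y z, star (u y) * z = star y * u z

theorem IsSymm.mul_self {u : A →L[ℝ] A} (h : IsSymm u) : IsSymm (u * u) := fun y z =>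
  (h (u y) z).trans (h y (u z))

theorem IsSymm.norm_sq {u : A →L[ℝ] A} (h : IsSymm u) : ‖u * u‖ = ‖u‖ ^ 2 := by
  refine le_antisymm ((norm_mul_le u u).trans_eq (sq _).symm) ?_
  have h1 : ‖u‖ ≤ √‖u * u‖ := by
    refine ContinuousLinearMap.opNorm_le_bound _ (Real.sqrt_nonneg _) fun y => ?_
    rw [← Real.sqrt_sq (norm_nonneg (u y)), ← Real.sqrt_sq (norm_nonneg y),
      ← Real.sqrt_mul (norm_nonneg _)]
    refine Real.sqrt_le_sqrt ?_
    rw [sq, ← CStarRing.norm_star_mul_self, h y (u y)]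
    refine (norm_mul_le _ _).trans ?_
    rw [norm_star, sq, mul_left_comm]
    exact mul_le_mul_of_nonneg_left ((u * u).le_opNorm y) (norm_nonneg y)
  calc ‖u‖ ^ 2 ≤ √‖u * u‖ ^ 2 := by gcongr
    _ = ‖u * u‖ := Real.sq_sqrt (norm_nonneg _)

theorem IsSymm.pow_two_pow {u : A →L[ℝ] A} (h : IsSymm u) (n : ℕ) :
    IsSymm (u ^ 2 ^ n) ∧ ‖u ^ 2 ^ n‖ = ‖u‖ ^ 2 ^ n := by
  induction n with
  | zero => simpa using h
  | succ n ih =>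
    have e : u ^ 2 ^ (n + 1) = u ^ 2 ^ n * u ^ 2 ^ n := by rw [← pow_add]; congr 1; ring
    rw [e]
    refine ⟨ih.1.mul_self, ?_⟩
    rw [ih.1.norm_sq, ih.2, ← pow_mul, pow_succ]

/-- The norm of a selfadjoint multiplier is bounded by its complex spectrum. -/
theorem IsSymm.norm_le {u : A →L[ℝ] A} (h : IsSymm u) {K : ℝ} (hK : 0 ≤ K)
    (hs : ∀ z ∈ spectrum ℂ (precompC u), ‖z‖ ≤ K) : ‖u‖ ≤ K := by
  have h1 := (spectrum.pow_nnnorm_pow_one_div_tendsto_nhds_spectralRadius (precompC u)).comp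
    (tendsto_pow_atTop_atTop_of_one_lt one_lt_two)
  have h2 : ((fun n : ℕ => ((‖precompC u ^ n‖₊ : ENNReal) ^ (1 / n : ℝ))) ∘ fun n : ℕ => 2 ^ n) =
      fun _ => (‖u‖₊ : ENNReal) := by
    funext n
    have e : ‖precompC u ^ 2 ^ n‖₊ = ‖u‖₊ ^ 2 ^ n := by
      ext
      rw [coe_nnnorm, ← precompC_pow, norm_precompC, (h.pow_two_pow n).2]
      simp
    simp only [Function.comp_apply]
    rw [e, ENNReal.coe_pow, ← ENNReal.rpow_natCast, ← ENNReal.rpow_mul]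
    rw [mul_one_div_cancel (by positivity), ENNReal.rpow_one]
  rw [h2] at h1
  have h3 := tendsto_nhds_unique tendsto_const_nhds h1
  have h4 : spectralRadius ℂ (precompC u) ≤ ENNReal.ofReal K := by
    refine iSup₂_le fun z hz => ?_
    rw [← ENNReal.ofReal_coe_nnreal]
    exact ENNReal.ofReal_le_ofReal (hs z hz)
  rw [← h3, ← ENNReal.ofReal_coe_nnreal] at h4
  exact (ENNReal.ofReal_le_ofReal_iff hK).mp h4

theorem norm_le_of_mem_spectrum_precompC {u : A →L[ℝ] A} {z : ℂ}
    (hz : z ∈ spectrum ℂ (precompC u)) : ‖z‖ ≤ ‖u‖ := by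
  refine (spectrum.norm_le_norm_mul_of_mem (𝕜 := ℂ) (A := PreC A) hz).trans ?_
  refine (mul_le_of_le_one_right (norm_nonneg (precompC u)) ?_).trans (norm_precompC_le u)
  exact PreC.norm_one_le

/-- Left multiplication. -/
abbrev lmul (h : A) : A →L[ℝ] A := ContinuousLinearMap.mul ℝ A h

theorem isSymm_lmul {h : A} (hh : star h = h) : IsSymm (lmul h) := fun y z => by
  simp [hh, mul_assoc]

theorem isSymm_sub_lmul (c : ℝ) {h : A} [StarModule ℝ A] (hh : star h = h) :
    IsSymm (c • 1 - lmul h) := fun y z => by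
  simp [hh, mul_assoc, sub_mul, mul_sub, smul_mul_assoc, mul_smul_comm]

theorem norm_lmul (h : A) : ‖lmul h‖ = ‖h‖ := by
  refine le_antisymm (ContinuousLinearMap.opNorm_mul_apply_le ℝ A h) ?_
  by_cases h0 : h = 0
  · simp [h0]
  have h1 := (lmul h).le_opNorm (star h)
  rw [ContinuousLinearMap.mul_apply', CStarRing.norm_self_mul_star, norm_star] at h1
  exact le_of_mul_le_mul_right h1 (norm_pos_iff.mpr h0)

variable [StarModule ℝ A] (hinv : ∀ x : A, ∃ z : A,
    z + star x * x + star x * x * z = 0 ∧ z + star x * x + z * (star x * x) = 0)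

include hinv in
theorem isUnit_one_add (x : A) : IsUnit (1 + lmul (star x * x)) := by
  obtain ⟨z, h1, h2⟩ := hinv x
  refine ⟨⟨1 + lmul (star x * x), 1 + lmul z, ?_, ?_⟩, rfl⟩
  · ext y
    have : (z + star x * x + star x * x * z) * y = 0 := by rw [h1, zero_mul]
    simp only [add_mul, one_mul, mul_add, mul_one, add_apply,
      ContinuousLinearMap.mul_apply', one_apply_eq_self, mul_apply_eq_comp]
      at this ⊢
    rw [← sub_eq_zero, ← this]
    noncomm_ring
  · ext y
    have : (z + star x * x + z * (star x * x)) * y = 0 := by rw [h2, zero_mul]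
    simp only [add_mul, one_mul, mul_add, mul_one, add_apply,
      ContinuousLinearMap.mul_apply', one_apply_eq_self, mul_apply_eq_comp]
      at this ⊢
    rw [← sub_eq_zero, ← this]
    noncomm_ring

include hinv in
theorem im_eq_zero_of_mem_spectrum {h : A} (hh : star h = h) {z : ℂ}
    (hz : z ∈ spectrum ℂ (precompC (lmul h))) : z.im = 0 := by
  by_contra hne
  have hn : Complex.normSq z ≠ 0 := fun h0 => hne (by rw [Complex.normSq_eq_zero.mp h0]; rfl)
  set b : ℝ := z.re / (z.im * Complex.normSq z) with hb
  set a : ℝ := z.im / Complex.normSq z - b * z.re with ha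
  have hi : (a : ℂ) * z + b * z ^ 2 = Complex.I := by
    have hn' : z.re * z.re + z.im * z.im ≠ 0 := hn
    have e1 : a * z.re + b * (z.re * z.re - z.im * z.im) = 0 := by
      rw [ha, hb, Complex.normSq_apply]; field_simp; ring
    have e2 : a * z.im + b * (z.re * z.im + z.im * z.re) = 1 := by
      rw [ha, hb, Complex.normSq_apply]; field_simp; ring
    apply Complex.ext
    · simpa [sq] using e1
    · simpa [sq] using e2
  let g : A := a • h + b • (h * h)
  have hg : star g = g := by simp [g, hh]
  have hu := isUnit_precompC (isUnit_one_add hinv g)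
  let p : Polynomial ℂ := 1 + (Polynomial.C (a : ℂ) * Polynomial.X +
    Polynomial.C (b : ℂ) * Polynomial.X ^ 2) ^ 2
  have hp : Polynomial.aeval (precompC (lmul h)) p = precompC (1 + lmul (star g * g)) := by
    have e : lmul (star g * g) = (a • lmul h + b • (lmul h * lmul h)) *
        (a • lmul h + b • (lmul h * lmul h)) := by
      ext y
      simp [hg, g, mul_assoc, add_mul, mul_add, smul_mul_assoc, mul_smul_comm]
    rw [e, precompC_add, precompC_one, precompC_mul, precompC_add, precompC_smul', precompC_smul',
      precompC_mul]
    simp only [p, sq, map_add, map_mul, map_one, Polynomial.aeval_C, Polynomial.aeval_X]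
  have h1 := spectrum.subset_polynomial_aeval (precompC (lmul h)) p ⟨z, hz, rfl⟩
  have h2 : Polynomial.eval z p = 0 := by simp [p, hi]
  rw [hp] at h1
  simp only [h2] at h1
  rw [spectrum.zero_mem_iff] at h1
  exact h1 hu

include hinv in
theorem mem_spectrum_star_mul_self {x : A} {z : ℂ}
    (hz : z ∈ spectrum ℂ (precompC (lmul (star x * x)))) : ∃ t : ℝ, 0 ≤ t ∧ z = t := by
  have h1 := im_eq_zero_of_mem_spectrum hinv (h := star x * x) (by simp) hz
  refine ⟨z.re, ?_, Complex.ext rfl (by simpa using h1)⟩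
  by_contra hneg
  push Not at hneg
  have hz' : z = (z.re : ℂ) := Complex.ext rfl (by simpa using h1)
  set t := -z.re with ht
  have ht0 : 0 < t := by simpa [ht] using hneg
  have hu := isUnit_one_add hinv ((√t)⁻¹ • x)
  have e : 1 + lmul (star ((√t)⁻¹ • x) * ((√t)⁻¹ • x)) = t⁻¹ • (t • 1 + lmul (star x * x)) := by
    ext y
    simp only [star_smul, star_trivial, smul_mul_assoc, mul_smul_comm, smul_smul, ← mul_inv,
      Real.mul_self_sqrt ht0.le, smul_add, inv_mul_cancel₀ ht0.ne', one_smul]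
    simp
  rw [e] at hu
  have h2 : IsUnit (t • (1 : A →L[ℝ] A) + lmul (star x * x)) := by
    have h := hu.smul (Units.mk0 t ht0.ne')
    rwa [Units.smul_mk0, smul_inv_smul₀ ht0.ne'] at h
  have h3 := isUnit_precompC h2
  rw [spectrum.mem_iff] at hz
  apply hz
  have e2 : algebraMap ℂ (PreC A) z - precompC (lmul (star x * x)) =
      -precompC (t • 1 + lmul (star x * x)) := by
    rw [precompC_add, precompC_scalar, hz', ht, Complex.ofReal_neg, map_neg, neg_add, neg_neg,
      sub_eq_add_neg]
  rw [e2]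
  exact h3.neg

include hinv in
/-- `x* x` is positive. -/
theorem norm_sub_star_mul_self (x y : A) :
    ‖‖x‖ ^ 2 • y - star x * x * y‖ ≤ ‖x‖ ^ 2 * ‖y‖ := by
  have h1 : ‖(‖x‖ ^ 2) • (1 : A →L[ℝ] A) - lmul (star x * x)‖ ≤ ‖x‖ ^ 2 := by
    refine (isSymm_sub_lmul _ (by simp)).norm_le (by positivity) fun z hz => ?_
    rw [precompC_sub, precompC_scalar,
      ← spectrum.singleton_sub_eq] at hz
    obtain ⟨_, rfl, s, hs, rfl⟩ := hz
    obtain ⟨t, ht, rfl⟩ := mem_spectrum_star_mul_self hinv hs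
    have h2 : t ≤ ‖x‖ ^ 2 := by
      have h3 := norm_le_of_mem_spectrum_precompC hs
      rwa [norm_lmul, CStarRing.norm_star_mul_self, ← sq, Complex.norm_real,
        Real.norm_of_nonneg ht] at h3
    simp only
    rw [← Complex.ofReal_sub, Complex.norm_real, Real.norm_of_nonneg (by linarith)]
    linarith
  have h2 := (‖x‖ ^ 2 • (1 : A →L[ℝ] A) - lmul (star x * x)).le_of_opNorm_le h1 y
  simpa using h2

include hinv in
/-- `x* x ≤ x* x + y* y`. -/
theorem norm_sq_le_star_add (x y : A) : ‖x‖ ^ 2 ≤ ‖star x * x + star y * y‖ := by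
  set g := star x * x + star y * y with hg
  rw [sq, ← CStarRing.norm_star_mul_self, ← norm_lmul]
  refine (isSymm_lmul (by simp)).norm_le (norm_nonneg _) fun z hz => ?_
  obtain ⟨t, ht, rfl⟩ := mem_spectrum_star_mul_self hinv hz
  rw [Complex.norm_real, Real.norm_of_nonneg ht]
  by_contra hlt
  push Not at hlt
  have h1 : ‖(‖y‖ ^ 2 • (1 : A →L[ℝ] A) - lmul (star y * y)) + lmul g‖ ≤ ‖y‖ ^ 2 + ‖g‖ := by
    refine (norm_add_le _ _).trans (add_le_add ?_ (norm_lmul g).le)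
    refine ContinuousLinearMap.opNorm_le_bound _ (by positivity) fun w => ?_
    simpa using norm_sub_star_mul_self hinv y w
  have e : (‖y‖ ^ 2 • (1 : A →L[ℝ] A) - lmul (star y * y)) + lmul g =
      ‖y‖ ^ 2 • (1 : A →L[ℝ] A) + lmul (star x * x) := by
    ext w
    simp [hg]
  have h2 : (((‖y‖ ^ 2 : ℝ) : ℂ) + (t : ℂ)) ∈
      spectrum ℂ (precompC (‖y‖ ^ 2 • (1 : A →L[ℝ] A) + lmul (star x * x))) := by
    rw [precompC_add, precompC_scalar,
      ← spectrum.singleton_add_eq]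
    exact Set.add_mem_add rfl hz
  have h3 := norm_le_of_mem_spectrum_precompC h2
  rw [← e, ← Complex.ofReal_add, Complex.norm_real, Real.norm_of_nonneg (by positivity)] at h3
  linarith

end Spectral

/-! ## C*-categories -/

open UniformSpace (Completion)

variable {𝕜 : Type} [RCLike 𝕜]

/-- The norm axioms of a `C*`-category: contractivity of the composition, the `C*`-inequality, and
the positivity of the `x* x`. -/
class PreCStar (C : GStarCat.{v, w} 𝕜) : Prop where
  norm_comp_le : ∀ {a b c : C.Obj} (x : C.Hom b c) (y : C.Hom a b), ‖C.comp x y‖ ≤ ‖x‖ * ‖y‖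
  norm_sq_le : ∀ {a b : C.Obj} (x : C.Hom a b), ‖x‖ ^ 2 ≤ ‖C.comp (C.star x) x‖
  norm_sub_le : ∀ {a b c : C.Obj} (x : C.Hom a b) (y : C.Hom c a),
    ‖((‖x‖ ^ 2 : ℝ) : 𝕜) • y - C.comp (C.comp (C.star x) x) y‖ ≤ ‖x‖ ^ 2 * ‖y‖
  norm_sq_le_add : ∀ {a b c : C.Obj} (x : C.Hom a b) (y : C.Hom a c),
    ‖x‖ ^ 2 ≤ ‖C.comp (C.star x) x + C.comp (C.star y) y‖

/-- `C*`-categories. -/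
class IsCStar (C : GStarCat.{v, w} 𝕜) : Prop extends PreCStar C where
  complete : ∀ a b : C.Obj, CompleteSpace (C.Hom a b)
  eq_zero : ∀ {a b : C.Obj} (x : C.Hom a b), ‖x‖ = 0 → x = 0

namespace PreCStar

variable {C : GStarCat.{v, w} 𝕜} [PreCStar C]

theorem norm_star_le {a b : C.Obj} (x : C.Hom a b) : ‖C.star x‖ ≤ ‖x‖ := by
  have h := (norm_sq_le (C.star x)).trans (norm_comp_le _ _)
  rw [C.star_star, sq] at h
  by_cases h0 : ‖C.star x‖ = 0
  · rw [h0]; exact norm_nonneg x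
  · exact le_of_mul_le_mul_right h (lt_of_le_of_ne (norm_nonneg _) (Ne.symm h0))

theorem norm_star {a b : C.Obj} (x : C.Hom a b) : ‖C.star x‖ = ‖x‖ :=
  le_antisymm (norm_star_le x) (by conv_lhs => rw [← C.star_star x]
                                   exact norm_star_le _)

theorem norm_star_comp_self {a b : C.Obj} (x : C.Hom a b) :
    ‖C.comp (C.star x) x‖ = ‖x‖ ^ 2 :=
  le_antisymm ((norm_comp_le _ _).trans_eq (by rw [norm_star, sq])) (norm_sq_le x)

/-- The completion of a category satisfying the norm axioms is a `C*`-category. -/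
theorem completion (hc : ∀ {a b c : C.Obj} (x : C.Hom b c) (y : C.Hom a b),
      ‖C.comp x y‖ ≤ ‖x‖ * ‖y‖)
    (hs : ∀ {a b : C.Obj} (x : C.Hom a b), ‖C.star x‖ ≤ ‖x‖) : IsCStar (C.completion hc hs) := by
  have hs' : ∀ {a b : C.Obj} (x : C.Hom a b), ‖C.star x‖ ≤ 1 * ‖x‖ := fun x =>
    (hs x).trans_eq (one_mul _).symm
  have h1 : ∀ {a b c : C.Obj} (x : Completion (C.Hom b c)) (y : Completion (C.Hom a b)),
      ‖bext C.comp hc x y‖ ≤ ‖x‖ * ‖y‖ := fun {a b c} x y => by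
    refine Completion.induction_on₂ x y (isClosed_le (by fun_prop) (by fun_prop)) fun x y => ?_
    rw [bext_coe, Completion.norm_coe, Completion.norm_coe, Completion.norm_coe]
    exact hc x y
  have h2 : ∀ {a b : C.Obj} (x : Completion (C.Hom a b)),
      ‖x‖ ^ 2 ≤ ‖bext C.comp hc (lext C.star 1 hs' x) x‖ := fun {a b} x => by
    refine Completion.induction_on x (isClosed_le (by fun_prop) (by fun_prop)) fun x => ?_
    rw [lext_coe, bext_coe, Completion.norm_coe, Completion.norm_coe]
    exact norm_sq_le x
  have h3 : ∀ {a b c : C.Obj} (x : Completion (C.Hom a b)) (y : Completion (C.Hom c a)),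
      ‖((‖x‖ ^ 2 : ℝ) : 𝕜) • y - bext C.comp hc (bext C.comp hc (lext C.star 1 hs' x) x) y‖ ≤
        ‖x‖ ^ 2 * ‖y‖ := fun {a b c} x y => by
    have hk : Continuous fun p : Completion (C.Hom a b) × Completion (C.Hom c a) =>
        ((‖p.1‖ ^ 2 : ℝ) : 𝕜) • p.2 := by
      have : Continuous fun p : Completion (C.Hom a b) × Completion (C.Hom c a) =>
          ((‖p.1‖ ^ 2 : ℝ) : 𝕜) := RCLike.continuous_ofReal.comp (by fun_prop)
      exact this.smul continuous_snd
    refine Completion.induction_on₂ x y (isClosed_le ?_ (by fun_prop)) fun x y => ?_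
    · exact (hk.sub (by fun_prop)).norm
    · rw [lext_coe, bext_coe, bext_coe, Completion.norm_coe, Completion.norm_coe,
        ← Completion.coe_smul, ← Completion.coe_sub, Completion.norm_coe]
      exact norm_sub_le x y
  have h4 : ∀ {a b c : C.Obj} (x : Completion (C.Hom a b)) (y : Completion (C.Hom a c)),
      ‖x‖ ^ 2 ≤ ‖bext C.comp hc (lext C.star 1 hs' x) x +
        bext C.comp hc (lext C.star 1 hs' y) y‖ := fun {a b c} x y => by
    refine Completion.induction_on₂ x y (isClosed_le (by fun_prop) (by fun_prop)) fun x y => ?_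
    rw [lext_coe, bext_coe, lext_coe, bext_coe, ← Completion.coe_add, Completion.norm_coe,
      Completion.norm_coe]
    exact norm_sq_le_add x y
  have h5 : ∀ {a b : C.Obj} (x : Completion (C.Hom a b)), ‖x‖ = 0 → x = 0 := fun x =>
    norm_eq_zero.mp
  exact
  { norm_comp_le := fun x y => h1 x y
    norm_sq_le := fun x => h2 x
    norm_sub_le := fun x y => h3 x y
    norm_sq_le_add := fun x y => h4 x y
    complete := fun (a b : C.Obj) => inferInstanceAs (CompleteSpace (Completion (C.Hom a b)))
    eq_zero := fun x h => h5 x h }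

end PreCStar

/-- A graded `C*`-algebra is a `C*`-category. -/
instance CAlg.isCStar (A : CAlg.{u} 𝕜) : IsCStar A.cat := by
  let _ : NormedSpace ℝ A := NormedSpace.restrictScalars ℝ 𝕜 A
  have : IsScalarTower ℝ 𝕜 A := ⟨fun r c x => by
    change (r • c) • x = ((algebraMap ℝ 𝕜 r : 𝕜)) • c • x
    rw [smul_smul, Algebra.smul_def]⟩
  have hr : ∀ (r : ℝ) (x : A), r • x = (r : 𝕜) • x := fun r x => by
    rw [← algebraMap_smul 𝕜 r x]
  have : IsScalarTower ℝ A A := ⟨fun r x y => by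
    simp only [hr, smul_eq_mul, smul_mul_assoc]⟩
  have : SMulCommClass ℝ A A := ⟨fun r x y => by
    simp only [hr, smul_eq_mul, mul_smul_comm]⟩
  have : StarModule ℝ A := ⟨fun r x => by
    simp only [hr, star_smul, star_trivial, RCLike.star_def, RCLike.conj_ofReal]⟩
  exact
  { norm_comp_le := fun x y => norm_mul_le (show A from x) (show A from y)
    norm_sq_le := fun {_ _} x => by
      change ‖(show A from x)‖ ^ 2 ≤ ‖star (show A from x) * (show A from x)‖
      rw [CStarRing.norm_star_mul_self, sq]
    norm_sub_le := fun {_ _ _} x y => by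
      have h := norm_sub_star_mul_self A.one_add_inv (show A from x) (show A from y)
      rw [hr] at h
      exact h
    norm_sq_le_add := fun {_ _ _} x y =>
      norm_sq_le_star_add A.one_add_inv (show A from x) (show A from y)
    complete := fun _ _ => A.complete
    eq_zero := fun {_ _} x h => norm_eq_zero.mp (show ‖(show A from x)‖ = 0 from h) }

end
end CStarDescent

namespace CStarDescent

noncomputable section

open UniformSpace (Completion)
open Filter (Tendsto atTop)

variable {𝕜 : Type} [RCLike 𝕜]

/-! ## The category of Hilbert spaces, and crossed products as C*-categories -/

section Operators

variable {H K L : Type u} [NormedAddCommGroup H] [InnerProductSpace 𝕜 H] [CompleteSpace H]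
  [NormedAddCommGroup K] [InnerProductSpace 𝕜 K] [CompleteSpace K]
  [NormedAddCommGroup L] [InnerProductSpace 𝕜 L] [CompleteSpace L]

open ContinuousLinearMap (adjoint)

theorem norm_smul_sub_adjoint_le (S : H →L[𝕜] K) {M : ℝ} (hM : ‖S‖ ^ 2 ≤ M) (v : H) :
    ‖(M : 𝕜) • v - adjoint S (S v)‖ ≤ M * ‖v‖ := by
  have h0 : 0 ≤ M := (sq_nonneg _).trans hM
  refine (sq_le_sq₀ (norm_nonneg _) (by positivity)).mp ?_
  rw [@norm_sub_sq 𝕜, norm_smul, RCLike.norm_ofReal, abs_of_nonneg h0, inner_smul_left,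
    ContinuousLinearMap.adjoint_inner_right, inner_self_eq_norm_sq_to_K, RCLike.conj_ofReal]
  have h1 : ‖adjoint S (S v)‖ ^ 2 ≤ M * ‖S v‖ ^ 2 := by
    refine le_trans ?_ (mul_le_mul_of_nonneg_right hM (sq_nonneg _))
    rw [← mul_pow]
    refine pow_le_pow_left₀ (norm_nonneg _) ?_ 2
    refine ((adjoint S).le_opNorm _).trans_eq ?_
    rw [LinearIsometryEquiv.norm_map]
  have h2 : RCLike.re ((M : 𝕜) * (‖S v‖ : 𝕜) ^ 2) = M * ‖S v‖ ^ 2 := by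
    norm_cast
  rw [h2]
  nlinarith [mul_nonneg h0 (sq_nonneg ‖S v‖)]

theorem norm_smul_sub_adjoint_comp_le (S : H →L[𝕜] K) {M : ℝ} (hM : ‖S‖ ^ 2 ≤ M) (T : L →L[𝕜] H) :
    ‖(M : 𝕜) • T - ((adjoint S).comp S).comp T‖ ≤ M * ‖T‖ := by
  have h0 : 0 ≤ M := (sq_nonneg _).trans hM
  refine ContinuousLinearMap.opNorm_le_bound _ (by positivity) fun v => ?_
  refine (norm_smul_sub_adjoint_le S hM (T v)).trans ?_
  rw [mul_assoc]
  exact mul_le_mul_of_nonneg_left (T.le_opNorm v) h0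

theorem norm_sq_le_adjoint_add (S : H →L[𝕜] K) (T : H →L[𝕜] L) :
    ‖S‖ ^ 2 ≤ ‖(adjoint S).comp S + (adjoint T).comp T‖ := by
  set R := (adjoint S).comp S + (adjoint T).comp T with hR
  have h1 : ‖S‖ ≤ √‖R‖ := by
    refine ContinuousLinearMap.opNorm_le_bound _ (Real.sqrt_nonneg _) fun v => ?_
    refine (sq_le_sq₀ (norm_nonneg _) (by positivity)).mp ?_
    rw [mul_pow, Real.sq_sqrt (norm_nonneg _)]
    have h2 : inner 𝕜 v (R v) = ((‖S v‖ ^ 2 + ‖T v‖ ^ 2 : ℝ) : 𝕜) := by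
      rw [hR, add_apply, ContinuousLinearMap.comp_apply, ContinuousLinearMap.comp_apply,
        inner_add_right, ContinuousLinearMap.adjoint_inner_right,
        ContinuousLinearMap.adjoint_inner_right, inner_self_eq_norm_sq_to_K,
        inner_self_eq_norm_sq_to_K]
      norm_cast
    have h3 : ‖S v‖ ^ 2 + ‖T v‖ ^ 2 ≤ ‖v‖ * ‖R v‖ := by
      have := norm_inner_le_norm (𝕜 := 𝕜) v (R v)
      rwa [h2, RCLike.norm_ofReal, abs_of_nonneg (by positivity)] at this
    have h4 : ‖v‖ * ‖R v‖ ≤ ‖v‖ * (‖R‖ * ‖v‖) :=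
      mul_le_mul_of_nonneg_left (R.le_opNorm v) (norm_nonneg v)
    nlinarith [sq_nonneg ‖T v‖]
  calc ‖S‖ ^ 2 ≤ √‖R‖ ^ 2 := by gcongr
    _ = ‖R‖ := Real.sq_sqrt (norm_nonneg _)

end Operators

/-- A bundled Hilbert space. -/
structure HilbObj (𝕜 : Type) [RCLike 𝕜] where
  H : Type u
  [grp : NormedAddCommGroup H]
  [ip : InnerProductSpace 𝕜 H]
  [complete : CompleteSpace H]

attribute [instance] HilbObj.grp HilbObj.ip HilbObj.complete

/-- The `C*`-category of Hilbert spaces, with the trivial grading. -/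
def Hilb (𝕜 : Type) [RCLike 𝕜] : GStarCat.{u + 1, u} 𝕜 where
  Obj := HilbObj.{u} 𝕜
  Hom X Y := X.H →L[𝕜] Y.H
  comp := LinearMap.mk₂ 𝕜 (fun S T => S.comp T) (fun _ _ _ => rfl) (fun _ _ _ => rfl)
    (fun _ _ _ => by ext; simp) (fun _ _ _ => by ext; simp)
  assoc _ _ _ := rfl
  star := (ContinuousLinearMap.adjoint (𝕜 := 𝕜)).toLinearEquiv.toLinearMap
  star_star x := ContinuousLinearMap.adjoint_adjoint x
  star_comp x y := ContinuousLinearMap.adjoint_comp x y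
  grade := LinearMap.id
  grade_grade _ := rfl
  grade_comp _ _ := rfl
  grade_star _ := rfl
  norm_grade_le _ := le_rfl

instance : IsCStar (Hilb.{u} 𝕜) where
  norm_comp_le {a b c : HilbObj 𝕜} (x : b.H →L[𝕜] c.H) (y : a.H →L[𝕜] b.H) :=
    x.opNorm_comp_le y
  norm_sq_le {a b : HilbObj 𝕜} (x : a.H →L[𝕜] b.H) := by
    have h := norm_sq_le_adjoint_add x (0 : a.H →L[𝕜] b.H)
    rwa [ContinuousLinearMap.comp_zero, add_zero] at h
  norm_sub_le {a b c : HilbObj 𝕜} (x : a.H →L[𝕜] b.H) (y : c.H →L[𝕜] a.H) :=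
    norm_smul_sub_adjoint_comp_le x le_rfl y
  norm_sq_le_add {a b c : HilbObj 𝕜} (x : a.H →L[𝕜] b.H) (y : a.H →L[𝕜] c.H) :=
    norm_sq_le_adjoint_add x y
  complete (a b : HilbObj 𝕜) := inferInstanceAs (CompleteSpace (a.H →L[𝕜] b.H))
  eq_zero {a b : HilbObj 𝕜} (x : a.H →L[𝕜] b.H) h :=
    norm_eq_zero.mp (show ‖(x : a.H →L[𝕜] b.H)‖ = 0 from h)

namespace GCAlg

variable {𝒢 : Type u} [Groupoid.{u} 𝒢] (A : GCAlg 𝕜 𝒢)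

theorem norm_conv_le_iff {a b : 𝒢} {μ : A.Conv a b} {K : ℝ} (hK : 0 ≤ K) :
    ‖μ‖ ≤ K ↔ ∀ (c : 𝒢) (α : Repr (A.alg c)), ‖A.reg α μ‖ ≤ K :=
  ⟨fun h c α => (A.norm_reg_le α μ).trans h, fun h => A.norm_le_of_bd ⟨hK, h⟩⟩

theorem norm_sq_conv_le {a b : 𝒢} {μ : A.Conv a b} {K : ℝ} (hK : 0 ≤ K)
    (h : ∀ {c : 𝒢} (α : Repr (A.alg c)), ‖A.reg α μ‖ ^ 2 ≤ K) : ‖μ‖ ^ 2 ≤ K := by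
  have h1 : ‖μ‖ ≤ √K := (A.norm_conv_le_iff (Real.sqrt_nonneg K)).mpr fun _ α =>
    Real.le_sqrt_of_sq_le (h α)
  calc ‖μ‖ ^ 2 ≤ √K ^ 2 := by gcongr
    _ = K := Real.sq_sqrt hK

theorem norm_sq_le_convStar_add {a b d : 𝒢} (x : A.Conv a b) (y : A.Conv a d) :
    ‖x‖ ^ 2 ≤ ‖A.convComp (A.convStar x) x + A.convComp (A.convStar y) y‖ :=
  A.norm_sq_conv_le (norm_nonneg _) fun α => by
    have h := norm_sq_le_adjoint_add (A.reg α x) (A.reg α y)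
    rw [← A.reg_star, ← A.reg_comp, ← A.reg_star, ← A.reg_comp, ← map_add] at h
    exact h.trans (A.norm_reg_le α _)

theorem norm_smul_sub_convComp_le {a b d : 𝒢} (x : A.Conv a b) (y : A.Conv d a) :
    ‖((‖x‖ ^ 2 : ℝ) : 𝕜) • y - A.convComp (A.convComp (A.convStar x) x) y‖ ≤ ‖x‖ ^ 2 * ‖y‖ :=
  (A.norm_conv_le_iff (by positivity)).mpr fun c α => by
    have h := norm_smul_sub_adjoint_comp_le (A.reg α x) (M := ‖x‖ ^ 2)
      (by gcongr; exact A.norm_reg_le α x) (A.reg α y)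
    rw [← A.reg_star, ← A.reg_comp, ← A.reg_comp, ← map_smul, ← map_sub] at h
    exact h.trans (by gcongr; exact A.norm_reg_le α y)

instance : PreCStar A.conv where
  norm_comp_le := A.norm_conv_comp
  norm_sq_le {a b : 𝒢} (x : A.Conv a b) := by
    have h := A.norm_sq_le_convStar_add x (0 : A.Conv a b)
    rw [map_zero, add_zero] at h
    exact h
  norm_sub_le := A.norm_smul_sub_convComp_le
  norm_sq_le_add := A.norm_sq_le_convStar_add

instance : IsCStar A.red := PreCStar.completion A.norm_conv_comp A.norm_conv_star

theorem norm_single_le {a b : 𝒢} (g : a ⟶ b) (x : A.alg b) : ‖A.single g x‖ ≤ ‖x‖ :=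
  (A.norm_conv_le_iff (norm_nonneg x)).mpr fun c α => by
    rw [reg_single]; exact L2.norm_wop_le _ _ _ _ _

/-- The inclusion of the convolution category into the reduced crossed product. -/
def coeRed {a b : 𝒢} : A.Conv a b →ₗ[𝕜] A.red.Hom (A.robj a) (A.robj b) :=
  (Completion.toComplₗᵢ (𝕜 := 𝕜) (E := A.Conv a b)).toLinearMap

theorem norm_coeRed {a b : 𝒢} (μ : A.Conv a b) : ‖A.coeRed μ‖ = ‖μ‖ := Completion.norm_coe μ

theorem denseRange_coeRed (a b : 𝒢) : DenseRange (A.coeRed (a := a) (b := b)) :=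
  Completion.denseRange_coe

theorem coeRed_single {a b : 𝒢} (g : a ⟶ b) (x : A.alg b) :
    A.coeRed (A.single g x) = A.rsingle g x := rfl

theorem coeRed_comp {a b c : 𝒢} (μ : A.Conv b c) (ν : A.Conv a b) :
    A.coeRed (A.convComp μ ν) = A.red.comp (A.coeRed μ) (A.coeRed ν) :=
  (bext_coe (E := A.Conv b c) (F := A.Conv a b) (G := A.Conv a c) A.convComp A.norm_conv_comp
    μ ν).symm

theorem coeRed_star {a b : 𝒢} (μ : A.Conv a b) :
    A.coeRed (A.convStar μ) = A.red.star (A.coeRed μ) :=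
  (lext_coe (E := A.Conv a b) (F := A.Conv b a) A.convStar 1 (fun x => (A.norm_conv_star x).trans_eq (one_mul _).symm) μ).symm

theorem coeRed_grade {a b : 𝒢} (μ : A.Conv a b) :
    A.coeRed (A.convGrade μ) = A.red.grade (A.coeRed μ) :=
  (lext_coe (E := A.Conv a b) (F := A.Conv a b) A.convGrade 1 (fun x => (A.conv.norm_grade_le x).trans_eq (one_mul _).symm) μ).symm

theorem norm_rsingle_le {a b : 𝒢} (g : a ⟶ b) (x : A.alg b) : ‖A.rsingle g x‖ ≤ ‖x‖ :=
  (A.norm_coeRed (A.single g x)).trans_le (A.norm_single_le g x)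

theorem rsingle_comp {a b c : 𝒢} (h : b ⟶ c) (x : A.alg c) (g : a ⟶ b) (y : A.alg b) :
    A.red.comp (A.rsingle h x) (A.rsingle g y) = A.rsingle (g ≫ h) (x * A.act h y) := by
  rw [← coeRed_single, ← coeRed_single, ← coeRed_comp, convComp_single, coeRed_single]

theorem rsingle_star {a b : 𝒢} (g : a ⟶ b) (x : A.alg b) :
    A.red.star (A.rsingle g x) =
      A.rsingle (Groupoid.inv g) (A.act (Groupoid.inv g) (star x)) := by
  rw [← coeRed_single, ← coeRed_star, convStar_single, coeRed_single]

theorem rsingle_grade {a b : 𝒢} (g : a ⟶ b) (x : A.alg b) :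
    A.red.grade (A.rsingle g x) = A.rsingle g ((A.alg b).grade x) := by
  rw [← coeRed_single, ← coeRed_grade, convGrade_single, coeRed_single]

end GCAlg

/-- The morphisms of `C` have countable right approximate units. -/
def HasApprox (C : GStarCat.{v, w} 𝕜) : Prop :=
  ∀ a : C.Obj, ∃ e : ℕ → C.Hom a a, (∀ n, ‖e n‖ ≤ 1) ∧ ∀ (b : C.Obj) (x : C.Hom a b),
    Tendsto (fun n => C.comp x (e n)) atTop (𝓝 x) ∧
    Tendsto (fun n => C.comp x (C.star (e n))) atTop (𝓝 x)

theorem GCAlg.SigmaUnital.hasApprox {𝒢 : Type u} [Groupoid.{u} 𝒢] {A : GCAlg 𝕜 𝒢}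
    (h : A.SigmaUnital) (a : 𝒢) : HasApprox (A.alg a).cat := fun _ => by
  obtain ⟨e, he, h⟩ := h a
  have h1 : ∀ x : A.alg a, Tendsto (fun n => x * star (e n)) atTop (𝓝 x) := fun x => by
    simpa only [star_mul, star_star] using ((h (star x)).1).star
  exact ⟨e, he, fun _ x => ⟨(h x).2, h1 x⟩⟩

theorem tendsto_comp_of_dense {C : GStarCat.{v, w} 𝕜} [PreCStar C] {a b : C.Obj}
    {e : ℕ → C.Hom a a} (he : ∀ n, ‖e n‖ ≤ 1) {s : Set (C.Hom a b)} (hs : Dense s)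
    (h : ∀ x ∈ s, Tendsto (fun n => C.comp x (e n)) atTop (𝓝 x)) (x : C.Hom a b) :
    Tendsto (fun n => C.comp x (e n)) atTop (𝓝 x) := by
  rw [Metric.tendsto_atTop]
  intro ε hε
  obtain ⟨y, hy, hxy⟩ := Metric.mem_closure_iff.mp (hs x) (ε / 3) (by positivity)
  obtain ⟨N, hN⟩ := Metric.tendsto_atTop.mp (h y hy) (ε / 3) (by positivity)
  refine ⟨N, fun n hn => ?_⟩
  have h1 : dist (C.comp x (e n)) (C.comp y (e n)) ≤ dist x y := by
    rw [dist_eq_norm, dist_eq_norm, ← LinearMap.sub_apply, ← map_sub]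
    refine (PreCStar.norm_comp_le _ _).trans ?_
    exact mul_le_of_le_one_right (norm_nonneg _) (he n)
  calc dist (C.comp x (e n)) x ≤ dist (C.comp x (e n)) (C.comp y (e n)) +
        dist (C.comp y (e n)) y + dist y x := dist_triangle4 _ _ _ _
    _ < ε / 3 + ε / 3 + ε / 3 := by
        rw [dist_comm y x]
        have := hN n hn
        linarith
    _ = ε := by ring

theorem GCAlg.tendsto_comp_rsingle_id {𝒢 : Type u} [Groupoid.{u} 𝒢] {A : GCAlg 𝕜 𝒢} {a : 𝒢}
    {e : ℕ → A.alg a} (he : ∀ n, ‖e n‖ ≤ 1) (h : ∀ x, Tendsto (fun n => x * e n) atTop (𝓝 x))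
    {b : 𝒢} (x : A.red.Hom (A.robj a) (A.robj b)) :
    Tendsto (fun n => A.red.comp x (A.rsingle (𝟙 a) (e n))) atTop (𝓝 x) := by
  refine tendsto_comp_of_dense (C := A.red) (fun n => (A.norm_rsingle_le _ _).trans (he n))
    (A.denseRange_coeRed a b) ?_ x
  rintro _ ⟨μ, rfl⟩
  induction μ using Conv.ind with
  | h0 => simp only [map_zero, LinearMap.zero_apply]; exact tendsto_const_nhds
  | hadd μ ν h h' => simpa only [map_add, LinearMap.add_apply] using h.add h'
  | hs g x =>
    have e1 : ∀ n, A.red.comp (A.rsingle g x) (A.rsingle (𝟙 a) (e n)) =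
        A.rsingle g (A.act g (A.act (Groupoid.inv g) x * e n)) := fun n => by
      rw [rsingle_comp, map_mul (A.act g).hom, ← A.act_comp, Groupoid.inv_comp, A.act_id, Category.id_comp]
    simp only [coeRed_single, e1]
    have h1 := h (A.act (Groupoid.inv g) x)
    have h2 : Continuous fun y : A.alg a => A.rsingle g (A.act g y) :=
      (AddMonoidHomClass.continuous_of_bound (A.rsingle g ∘ₗ ((A.act g).hom : A.alg a →ₗ[𝕜] _)) 1
        fun y => by
          rw [one_mul]
          exact (A.norm_rsingle_le _ _).trans ((A.act g).norm_le y))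
    have h3 := (h2.tendsto _).comp h1
    have e2 : A.act g (A.act (Groupoid.inv g) x) = x := by
      rw [← A.act_comp, Groupoid.inv_comp, A.act_id]
    rw [e2] at h3
    exact h3

theorem GCAlg.SigmaUnital.hasApprox_red {𝒢 : Type u} [Groupoid.{u} 𝒢] {A : GCAlg 𝕜 𝒢}
    (h : A.SigmaUnital) : HasApprox A.red := fun (a : 𝒢) => by
  obtain ⟨e, he, h⟩ := h a
  have e3 : ∀ n, A.red.star (A.rsingle (𝟙 a) (e n)) = A.rsingle (𝟙 a) (star (e n)) := fun n => by
    rw [rsingle_star]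
    have : Groupoid.inv (𝟙 a) = 𝟙 a := by simp
    rw [this, A.act_id]
  refine ⟨fun n => A.rsingle (𝟙 a) (e n), fun n => (A.norm_rsingle_le _ _).trans (he n),
    fun (b : 𝒢) x => ⟨tendsto_comp_rsingle_id he (fun x => (h x).2) x, ?_⟩⟩
  refine (tendsto_comp_rsingle_id (e := fun n => star (e n))
    (fun n => by rw [norm_star]; exact he n)
    (fun x => by simpa only [star_mul, star_star] using ((h (star x)).1).star) x).congr fun n => ?_
  exact congrArg _ (e3 n).symm

/-! ## Forgetting the grading -/

/-- The category `C` with the trivial grading. -/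
def GStarCat.triv (C : GStarCat.{v, w} 𝕜) : GStarCat.{v, w} 𝕜 :=
  { C with
    grade := LinearMap.id
    grade_grade := fun _ => rfl
    grade_comp := fun _ _ => rfl
    grade_star := fun _ => rfl
    norm_grade_le := fun _ => le_rfl }

instance (C : GStarCat.{v, w} 𝕜) [h : IsCStar C] : IsCStar C.triv where
  norm_comp_le := h.norm_comp_le
  norm_sq_le := h.norm_sq_le
  norm_sub_le := h.norm_sub_le
  norm_sq_le_add := h.norm_sq_le_add
  complete := h.complete
  eq_zero := h.eq_zero

/-- A Hilbert module with the trivial grading. -/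
def HilbMod.triv {C : GStarCat.{v, w} 𝕜} (E : HilbMod C) : HilbMod C.triv :=
  { E with
    grade := fun {a : C.Obj} => (LinearMap.id : E.E a →ₗ[𝕜] E.E a)
    grade_grade := fun _ => rfl
    grade_act := fun _ _ => rfl
    grade_inner := fun _ _ => rfl }

end
end CStarDescent

namespace CStarDescent

noncomputable section

open Filter (Tendsto atTop)

variable {𝕜 : Type} [RCLike 𝕜]

/-! ## Positivity in C*-categories -/

section Topological

variable (C : GStarCat.{v, w} 𝕜) [IsCStar C]

instance (a b : C.Obj) : CompleteSpace (C.Hom a b) := IsCStar.complete a b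

instance (a b : C.Obj) : T0Space (C.Hom a b) := by
  refine ⟨fun x y h => ?_⟩
  rw [← sub_eq_zero]
  refine IsCStar.eq_zero _ ?_
  rw [← dist_eq_norm]
  exact Metric.inseparable_iff.mp h

end Topological

/-- Squares of contractions: the iteration for `1 - √(1 - z)`. -/
def sqrtSeq : ℕ → ℝ
  | 0 => 0
  | n + 1 => (1 + sqrtSeq n ^ 2) / 2

theorem sqrtSeq_bounds (n : ℕ) : 0 ≤ sqrtSeq n ∧ sqrtSeq n ≤ 1 := by
  induction n with
  | zero => simp [sqrtSeq]
  | succ n ih =>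
    simp only [sqrtSeq]
    constructor <;> nlinarith [ih.1, ih.2]

theorem sqrtSeq_le_succ (n : ℕ) : sqrtSeq n ≤ sqrtSeq (n + 1) := by
  simp only [sqrtSeq]
  nlinarith [sq_nonneg (sqrtSeq n - 1)]

theorem tendsto_sqrtSeq : Tendsto sqrtSeq atTop (𝓝 1) := by
  have h := tendsto_atTop_ciSup (monotone_nat_of_le_succ sqrtSeq_le_succ)
    ⟨1, by rintro _ ⟨n, rfl⟩; exact (sqrtSeq_bounds n).2⟩
  set l := ⨆ n, sqrtSeq n
  have h1 : Tendsto (fun n => sqrtSeq (n + 1)) atTop (𝓝 l) :=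
    h.comp (Filter.tendsto_add_atTop_nat 1)
  have h2 : Tendsto (fun n => sqrtSeq (n + 1)) atTop (𝓝 ((1 + l ^ 2) / 2)) :=
    ((h.pow 2).const_add 1).div_const 2
  have h3 := tendsto_nhds_unique h1 h2
  have h4 : l = 1 := by nlinarith [sq_nonneg (l - 1)]
  rwa [h4] at h

section Iteration

variable {V : Type w} [SeminormedAddCommGroup V] [NormedSpace 𝕜 V]

/-- The iteration `w ↦ (z + w²) / 2`. -/
def sqrtIter (z : Module.End 𝕜 V) : ℕ → Module.End 𝕜 V
  | 0 => 0
  | n + 1 => (2⁻¹ : 𝕜) • (z + sqrtIter z n * sqrtIter z n)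

theorem norm_sqrtIter_le {z : Module.End 𝕜 V} (hz : ∀ y, ‖z y‖ ≤ ‖y‖) (n : ℕ) (y : V) :
    ‖sqrtIter z n y‖ ≤ sqrtSeq n * ‖y‖ := by
  induction n generalizing y with
  | zero => simp [sqrtIter, sqrtSeq]
  | succ n ih =>
    simp only [sqrtIter, sqrtSeq, LinearMap.smul_apply, LinearMap.add_apply, norm_smul, norm_inv,
      RCLike.norm_ofNat]
    have h1 : ‖sqrtIter z n (sqrtIter z n y)‖ ≤ sqrtSeq n * (sqrtSeq n * ‖y‖) :=
      (ih _).trans (mul_le_mul_of_nonneg_left (ih y) (sqrtSeq_bounds n).1)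
    have h2 := norm_add_le (z y) ((sqrtIter z n * sqrtIter z n) y)
    have h3 := hz y
    rw [Module.End.mul_apply] at h2 ⊢
    nlinarith

theorem norm_sqrtIter_sub_le {z : Module.End 𝕜 V} (hz : ∀ y, ‖z y‖ ≤ ‖y‖) (n : ℕ) (y : V) :
    ‖(sqrtIter z (n + 1) - sqrtIter z n) y‖ ≤ (sqrtSeq (n + 1) - sqrtSeq n) * ‖y‖ := by
  induction n generalizing y with
  | zero =>
    have := norm_sqrtIter_le hz 1 y
    simpa [sqrtIter, sqrtSeq] using this
  | succ n ih =>
    set p := sqrtIter z (n + 1)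
    set q := sqrtIter z n
    have e : sqrtIter z (n + 1 + 1) - p = (2⁻¹ : 𝕜) • (p * (p - q) + (p - q) * q) := by
      have : p = (2⁻¹ : 𝕜) • (z + q * q) := rfl
      conv_lhs => rw [this]
      change (2⁻¹ : 𝕜) • (z + p * p) - _ = _
      rw [← smul_sub]
      congr 1
      noncomm_ring
    have e2 : sqrtSeq (n + 1 + 1) - sqrtSeq (n + 1) =
        2⁻¹ * ((sqrtSeq (n + 1) + sqrtSeq n) * (sqrtSeq (n + 1) - sqrtSeq n)) := by
      have : sqrtSeq (n + 1) = (1 + sqrtSeq n ^ 2) / 2 := rfl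
      conv_lhs => rw [this]
      change (1 + sqrtSeq (n + 1) ^ 2) / 2 - _ = _
      ring
    rw [e, e2, LinearMap.smul_apply, norm_smul, norm_inv, RCLike.norm_ofNat, mul_assoc]
    refine mul_le_mul_of_nonneg_left ?_ (by norm_num)
    rw [LinearMap.add_apply, Module.End.mul_apply, Module.End.mul_apply]
    refine (norm_add_le _ _).trans ?_
    have h1 := norm_sqrtIter_le hz (n + 1) ((p - q) y)
    have h2 := ih y
    have h3 := ih (q y)
    have h4 := norm_sqrtIter_le hz n y
    have h5 := (sqrtSeq_bounds (n + 1)).1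
    have h6 := sub_nonneg.mpr (sqrtSeq_le_succ n)
    have h7 := mul_le_mul_of_nonneg_left h2 h5
    have h8 := mul_le_mul_of_nonneg_left h4 h6
    linarith

end Iteration

namespace GStarCat

variable {C : GStarCat.{v, w} 𝕜}

/-- A positive endomorphism. -/
def IsPos {a : C.Obj} (h : C.Hom a a) : Prop := ∃ y : C.Hom a a, h = C.comp (C.star y) y

/-- Left composition. -/
def lcomp {a : C.Obj} (h : C.Hom a a) : Module.End 𝕜 (C.Hom a a) := C.comp h

theorem lcomp_mul {a : C.Obj} (h k : C.Hom a a) : lcomp (C.comp h k) = lcomp h * lcomp k :=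
  LinearMap.ext fun _ => C.assoc _ _ _

variable [IsCStar C]

theorem norm_le_of_lcomp {a : C.Obj} {h : C.Hom a a} {K : ℝ} (hK : 0 ≤ K)
    (H : ∀ y : C.Hom a a, ‖C.comp h y‖ ≤ K * ‖y‖) : ‖h‖ ≤ K := by
  have h1 := PreCStar.norm_sq_le (C.star h)
  rw [C.star_star, PreCStar.norm_star] at h1
  have h2 := H (C.star h)
  rw [PreCStar.norm_star] at h2
  by_contra hlt
  push Not at hlt
  nlinarith [norm_nonneg h]

theorem continuous_comp_left {a b c : C.Obj} (x : C.Hom b c) :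
    Continuous fun y : C.Hom a b => C.comp x y :=
  AddMonoidHomClass.continuous_of_bound (C.comp x) ‖x‖ (PreCStar.norm_comp_le x)

theorem continuous_comp_right {a b c : C.Obj} (y : C.Hom a b) :
    Continuous fun x : C.Hom b c => C.comp x y :=
  AddMonoidHomClass.continuous_of_bound (C.comp.flip y) ‖y‖ fun x =>
    (PreCStar.norm_comp_le x y).trans_eq (mul_comm _ _)

theorem tendsto_comp {a b c : C.Obj} {ι : Type*} {l : Filter ι} {f : ι → C.Hom b c}
    {g : ι → C.Hom a b} {x : C.Hom b c} {y : C.Hom a b} (hf : Tendsto f l (𝓝 x))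
    (hg : Tendsto g l (𝓝 y)) : Tendsto (fun i => C.comp (f i) (g i)) l (𝓝 (C.comp x y)) := by
  let B : C.Hom b c →L[𝕜] C.Hom a b →L[𝕜] C.Hom a c :=
    LinearMap.mkContinuous₂ C.comp 1 fun x y => by
      rw [one_mul]; exact PreCStar.norm_comp_le x y
  have hB : Continuous fun p : C.Hom b c × C.Hom a b => B p.1 p.2 := by fun_prop
  exact (hB.tendsto (x, y)).comp (hf.prodMk_nhds hg)

theorem continuous_star {a b : C.Obj} : Continuous fun x : C.Hom a b => C.star x :=
  AddMonoidHomClass.continuous_of_bound C.star 1 fun x => by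
    rw [one_mul]; exact PreCStar.norm_star_le x

/-- A convergence criterion. -/
theorem exists_tendsto_of_sqrtSeq {a : C.Obj} {e : ℕ → C.Hom a a}
    (h : ∀ n (y : C.Hom a a), ‖C.comp (e (n + 1) - e n) y‖ ≤ 2 * (sqrtSeq (n + 1) - sqrtSeq n) * ‖y‖) :
    ∃ k, Tendsto e atTop (𝓝 k) := by
  refine cauchySeq_tendsto_of_complete ?_
  refine cauchySeq_of_dist_le_of_summable (fun n => 2 * (sqrtSeq (n + 1) - sqrtSeq n)) (fun n => ?_)
    ?_
  · rw [dist_comm, dist_eq_norm]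
    exact norm_le_of_lcomp (by linarith [sqrtSeq_le_succ n]) (h n)
  · refine Summable.mul_left 2 (summable_of_sum_range_le (c := 1)
      (fun n => sub_nonneg.mpr (sqrtSeq_le_succ n)) fun n => ?_)
    rw [Finset.sum_range_sub]
    linarith [(sqrtSeq_bounds n).2, (sqrtSeq_bounds 0).1]

/-- A selfadjoint element close to a multiple of the identity has a selfadjoint square root. -/
theorem exists_sqrt {a : C.Obj} {h : C.Hom a a} (hs : C.star h = h) {M : ℝ} (hM : 0 < M)
    (H : ∀ y : C.Hom a a, ‖(M : 𝕜) • y - C.comp h y‖ ≤ M * ‖y‖) :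
    ∃ k : C.Hom a a, C.star k = k ∧ h = C.comp k k := by
  have hM' : (M : 𝕜) ≠ 0 := by exact_mod_cast hM.ne'
  obtain ⟨p, hp⟩ : ∃ p : C.Hom a a, p = (M : 𝕜)⁻¹ • h := ⟨_, rfl⟩
  have hps : C.star p = p := by
    rw [hp, map_smulₛₗ, hs, map_inv₀, RCLike.conj_ofReal]
  let z : Module.End 𝕜 (C.Hom a a) := 1 - lcomp p
  have hz : ∀ y, ‖z y‖ ≤ ‖y‖ := fun y => by
    have e : z y = (M : 𝕜)⁻¹ • ((M : 𝕜) • y - C.comp h y) := by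
      simp [z, lcomp, hp, smul_sub, smul_smul, hM']
    rw [e, norm_smul, norm_inv, RCLike.norm_ofReal, abs_of_pos hM, inv_mul_le_iff₀ hM]
    exact H y
  let e : ℕ → C.Hom a a := fun n => Nat.rec 0 (fun n e =>
    (2⁻¹ : 𝕜) • (p + (2 * sqrtSeq n : 𝕜) • e - C.comp e e)) n
  have he : ∀ n, e (n + 1) =
      (2⁻¹ : 𝕜) • (p + (2 * sqrtSeq n : 𝕜) • e n - C.comp (e n) (e n)) := fun n => rfl
  have hw : ∀ n, sqrtIter z n = (sqrtSeq n : 𝕜) • 1 - lcomp (e n) := fun n => by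
    induction n with
    | zero => simp [sqrtIter, sqrtSeq, e, lcomp]
    | succ n ih =>
      rw [sqrtIter, ih, he]
      have h1 : lcomp ((2⁻¹ : 𝕜) • (p + (2 * sqrtSeq n : 𝕜) • e n - C.comp (e n) (e n))) =
          (2⁻¹ : 𝕜) • (lcomp p + (2 * sqrtSeq n : 𝕜) • lcomp (e n) - lcomp (e n) * lcomp (e n)) := by
        rw [← lcomp_mul]
        simp only [lcomp, map_smul, map_add, map_sub]
      have h2 : ((sqrtSeq (n + 1) : ℝ) : 𝕜) = 2⁻¹ * (1 + (sqrtSeq n : 𝕜) ^ 2) := by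
        simp only [sqrtSeq]; push_cast; ring
      rw [h1, h2, mul_smul, ← smul_sub]
      congr 1
      simp only [z, sub_mul, mul_sub, smul_mul_assoc, mul_smul_comm, one_mul, mul_one]
      module
  obtain ⟨k, hk⟩ := exists_tendsto_of_sqrtSeq (C := C) (e := e) fun n y => by
    have h1 := norm_sqrtIter_sub_le hz n y
    have h2 : C.comp (e (n + 1) - e n) y = ((sqrtSeq (n + 1) - sqrtSeq n : ℝ) : 𝕜) • y -
        (sqrtIter z (n + 1) - sqrtIter z n) y := by
      rw [hw, hw]
      simp only [lcomp, map_sub, LinearMap.sub_apply, LinearMap.smul_apply, Module.End.one_apply]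
      module
    have h3 := sub_nonneg.mpr (sqrtSeq_le_succ n)
    rw [h2]
    refine (norm_sub_le _ _).trans ?_
    rw [norm_smul, RCLike.norm_ofReal, abs_of_nonneg h3]
    linarith
  have hes : ∀ n, C.star (e n) = e n := fun n => by
    induction n with
    | zero => exact map_zero _
    | succ n ih =>
      rw [he, map_smulₛₗ, map_sub, map_add, map_smulₛₗ, C.star_comp, ih, hps]
      simp only [map_inv₀, map_mul, map_ofNat, RCLike.conj_ofReal]
  have hks : C.star k = k := by
    have h1 := (continuous_star.tendsto k).comp hk
    exact tendsto_nhds_unique (h1.congr hes) hk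
  have hk2 : C.comp k k = p := by
    have h1 := hk.comp (Filter.tendsto_add_atTop_nat 1)
    have h2 : Tendsto (fun n => (2 * sqrtSeq n : 𝕜)) atTop (𝓝 (2 * (1 : ℝ))) :=
      ((RCLike.continuous_ofReal.tendsto _).comp tendsto_sqrtSeq).const_mul 2
    have h3 := (((h2.smul hk).const_add p).sub (tendsto_comp hk hk)).const_smul (2⁻¹ : 𝕜)
    have h4 := tendsto_nhds_unique h1 h3
    have h5 : (2 : 𝕜) • k = p + (2 * ((1 : ℝ) : 𝕜)) • k - C.comp k k := by
      conv_lhs => rw [h4]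
      exact smul_inv_smul₀ two_ne_zero _
    rw [RCLike.ofReal_one, mul_one, add_sub_right_comm, right_eq_add, sub_eq_zero] at h5
    exact h5.symm
  refine ⟨((√M : ℝ) : 𝕜) • k, by rw [map_smulₛₗ, hks, RCLike.conj_ofReal], ?_⟩
  simp only [map_smul, LinearMap.smul_apply, smul_smul]
  rw [hk2, ← RCLike.ofReal_mul, Real.mul_self_sqrt hM.le, hp, smul_inv_smul₀ hM']

theorem IsPos.star_eq {a : C.Obj} {h : C.Hom a a} (hp : IsPos h) : C.star h = h := by
  obtain ⟨y, rfl⟩ := hp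
  rw [C.star_comp, C.star_star]

theorem IsPos.norm_sub_le {a c : C.Obj} {h : C.Hom a a} (hp : IsPos h) {M : ℝ} (hM : ‖h‖ ≤ M)
    (y : C.Hom c a) : ‖(M : 𝕜) • y - C.comp h y‖ ≤ M * ‖y‖ := by
  obtain ⟨x, rfl⟩ := hp
  rw [PreCStar.norm_star_comp_self] at hM
  have e : (M : 𝕜) • y - C.comp (C.comp (C.star x) x) y = ((M - ‖x‖ ^ 2 : ℝ) : 𝕜) • y +
      (((‖x‖ ^ 2 : ℝ) : 𝕜) • y - C.comp (C.comp (C.star x) x) y) := by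
    rw [RCLike.ofReal_sub]; module
  rw [e]
  refine (norm_add_le _ _).trans ?_
  rw [norm_smul, RCLike.norm_ofReal, abs_of_nonneg (by linarith)]
  have := PreCStar.norm_sub_le x y
  linarith

theorem isPos_of_norm_sub_le {a : C.Obj} {h : C.Hom a a} (hs : C.star h = h) {M : ℝ} (hM : 0 ≤ M)
    (H : ∀ y : C.Hom a a, ‖(M : 𝕜) • y - C.comp h y‖ ≤ M * ‖y‖) : IsPos h := by
  obtain ⟨k, hk, rfl⟩ := exists_sqrt hs (M := M + 1) (by linarith) fun y => by
    have e : ((M + 1 : ℝ) : 𝕜) • y - C.comp h y = y + ((M : 𝕜) • y - C.comp h y) := by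
      push_cast; module
    rw [e]
    refine (norm_add_le _ _).trans ?_
    linarith [H y]
  exact ⟨k, by rw [hk]⟩

theorem isPos_zero {a : C.Obj} : IsPos (0 : C.Hom a a) := ⟨0, by simp⟩

theorem isPos_star_comp {a b : C.Obj} (x : C.Hom a b) : IsPos (C.comp (C.star x) x) :=
  isPos_of_norm_sub_le (by rw [C.star_comp, C.star_star]) (sq_nonneg ‖x‖)
    fun y => PreCStar.norm_sub_le x y

theorem IsPos.add {a : C.Obj} {h k : C.Hom a a} (hh : IsPos h) (hk : IsPos k) : IsPos (h + k) :=
  isPos_of_norm_sub_le (by rw [map_add, hh.star_eq, hk.star_eq]) (M := ‖h‖ + ‖k‖) (by positivity)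
    fun y => by
      have e : ((‖h‖ + ‖k‖ : ℝ) : 𝕜) • y - C.comp (h + k) y =
          (((‖h‖ : ℝ) : 𝕜) • y - C.comp h y) + (((‖k‖ : ℝ) : 𝕜) • y - C.comp k y) := by
        rw [map_add, LinearMap.add_apply]; push_cast; module
      rw [e]
      refine (norm_add_le _ _).trans ?_
      rw [add_mul]
      exact add_le_add (hh.norm_sub_le le_rfl y) (hk.norm_sub_le le_rfl y)

theorem IsPos.smul {a : C.Obj} {h : C.Hom a a} (hh : IsPos h) {r : ℝ} (hr : 0 ≤ r) :
    IsPos ((r : 𝕜) • h) := by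
  obtain ⟨y, rfl⟩ := hh
  refine ⟨((√r : ℝ) : 𝕜) • y, ?_⟩
  simp only [map_smulₛₗ, LinearMap.smul_apply, smul_smul, RCLike.conj_ofReal, RingHom.id_apply]
  rw [← RCLike.ofReal_mul, Real.mul_self_sqrt hr]

theorem IsPos.of_tendsto {a : C.Obj} {h : ℕ → C.Hom a a} {k : C.Hom a a} (hh : ∀ n, IsPos (h n))
    (hk : Tendsto h atTop (𝓝 k)) : IsPos k := by
  have hs : C.star k = k :=
    tendsto_nhds_unique (((continuous_star.tendsto k).comp hk).congr fun n => (hh n).star_eq) hk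
  obtain ⟨N, hN⟩ := Metric.tendsto_atTop.mp hk 1 zero_lt_one
  refine isPos_of_norm_sub_le hs (M := ‖k‖ + 1) (by positivity) fun y => ?_
  have h1 : Tendsto (fun n => ‖((‖k‖ + 1 : ℝ) : 𝕜) • y - C.comp (h n) y‖) atTop
      (𝓝 ‖((‖k‖ + 1 : ℝ) : 𝕜) • y - C.comp k y‖) :=
    (((continuous_comp_right y).tendsto k).comp hk).const_sub _ |>.norm
  refine le_of_tendsto h1 (Filter.eventually_atTop.mpr ⟨N, fun n hn => ?_⟩)
  refine (hh n).norm_sub_le ?_ y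
  have h2 := norm_le_norm_add_norm_sub' (h n) k
  have h3 := hN n hn
  rw [dist_eq_norm] at h3
  linarith

theorem IsPos.conj {a b : C.Obj} {h : C.Hom b b} (hh : IsPos h) (x : C.Hom a b) :
    IsPos (C.comp (C.star x) (C.comp h x)) := by
  obtain ⟨y, rfl⟩ := hh
  have e := isPos_star_comp (C.comp y x)
  rwa [C.star_comp, C.assoc, ← C.assoc _ y x] at e

/-- `x* h x ≤ M x* x` if `‖h‖ ≤ M` and `h` is selfadjoint. -/
theorem isPos_smul_sub {a b : C.Obj} {h : C.Hom b b} (hs : C.star h = h) {M : ℝ} (hM : ‖h‖ ≤ M)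
    (h0 : 0 < M) (x : C.Hom a b) :
    IsPos ((M : 𝕜) • C.comp (C.star x) x - C.comp (C.star x) (C.comp h x)) := by
  have hM' : (M : 𝕜) ≠ 0 := by exact_mod_cast h0.ne'
  obtain ⟨p, hp⟩ : ∃ p : C.Hom b b, p = (M : 𝕜)⁻¹ • h := ⟨_, rfl⟩
  have hps : C.star p = p := by rw [hp, map_smulₛₗ, hs, map_inv₀, RCLike.conj_ofReal]
  have hz : ∀ y, ‖lcomp p y‖ ≤ ‖y‖ := fun y => by
    refine (PreCStar.norm_comp_le p y).trans (mul_le_of_le_one_left (norm_nonneg y) ?_)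
    rw [hp, norm_smul, norm_inv, RCLike.norm_ofReal, abs_of_pos h0, inv_mul_le_iff₀ h0, mul_one]
    exact hM
  let e : ℕ → C.Hom b b := fun n => Nat.rec 0 (fun _ e => (2⁻¹ : 𝕜) • (p + C.comp e e)) n
  have he : ∀ n, e (n + 1) = (2⁻¹ : 𝕜) • (p + C.comp (e n) (e n)) := fun n => rfl
  have hw : ∀ n, sqrtIter (lcomp p) n = lcomp (e n) := fun n => by
    induction n with
    | zero => simp [sqrtIter, e, lcomp]
    | succ n ih => rw [sqrtIter, ih, he, ← lcomp_mul]; simp only [lcomp, map_smul, map_add]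
  obtain ⟨k, hk⟩ := exists_tendsto_of_sqrtSeq (C := C) (e := e) fun n y => by
    have h1 := norm_sqrtIter_sub_le hz n y
    have h2 : C.comp (e (n + 1) - e n) y =
        (sqrtIter (lcomp p) (n + 1) - sqrtIter (lcomp p) n) y := by
      rw [hw, hw]; simp only [lcomp, map_sub]
    have h3 := mul_nonneg (sub_nonneg.mpr (sqrtSeq_le_succ n)) (norm_nonneg y)
    rw [h2]
    linarith
  have hes : ∀ n, C.star (e n) = e n := fun n => by
    induction n with
    | zero => exact map_zero _
    | succ n ih =>
      rw [he, map_smulₛₗ, map_add, C.star_comp, ih, hps]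
      simp only [map_inv₀, map_ofNat]
  have hks : C.star k = k :=
    tendsto_nhds_unique (((continuous_star.tendsto k).comp hk).congr hes) hk
  have hk2 : k = (2⁻¹ : 𝕜) • (p + C.comp k k) :=
    tendsto_nhds_unique (hk.comp (Filter.tendsto_add_atTop_nat 1))
      (((tendsto_comp hk hk).const_add p).const_smul (2⁻¹ : 𝕜))
  have hk3 : h = (M : 𝕜) • ((2 : 𝕜) • k - C.comp k k) := by
    have : (2 : 𝕜) • k - C.comp k k = p := by
      nth_rewrite 1 [hk2]
      rw [smul_smul, mul_inv_cancel₀ two_ne_zero]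
      simp
    rw [this, hp, smul_inv_smul₀ hM']
  have h5 := (isPos_star_comp (x - C.comp k x)).smul h0.le
  convert h5 using 1
  rw [hk3]
  simp only [map_sub, map_smul, LinearMap.sub_apply, LinearMap.smul_apply, C.star_comp, hks,
    C.assoc]
  module

theorem IsPos.norm_le_add {a : C.Obj} {h k : C.Hom a a} (hh : IsPos h) (hk : IsPos k) :
    ‖h‖ ≤ ‖h + k‖ := by
  obtain ⟨x, rfl⟩ := hh
  obtain ⟨y, rfl⟩ := hk
  rw [PreCStar.norm_star_comp_self]
  exact PreCStar.norm_sq_le_add x y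

/-- `ρ = p (p + ε)⁻¹`. -/
theorem IsPos.exists_resolvent {a : C.Obj} {p : C.Hom a a} (hp : IsPos p) {ε : ℝ} (hε : 0 < ε) :
    ∃ ρ : C.Hom a a, C.star ρ = ρ ∧ C.comp p ρ + (ε : 𝕜) • ρ = p := by
  set M := ‖p‖ with hM
  have hM0 : 0 ≤ M := norm_nonneg p
  have hne : ((ε + M : ℝ) : 𝕜) ≠ 0 := by
    exact_mod_cast (by linarith : 0 < ε + M).ne'
  let f : C.Hom a a → C.Hom a a := fun r =>
    (((ε + M : ℝ) : 𝕜))⁻¹ • (p + ((M : 𝕜) • r - C.comp p r))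
  let r : ℕ → C.Hom a a := fun n => Nat.rec 0 (fun _ r => f r) n
  have hr : ∀ n, r (n + 1) = f (r n) := fun _ => rfl
  have hf : ∀ x y, ‖f x - f y‖ ≤ M / (ε + M) * ‖x - y‖ := fun x y => by
    have e : f x - f y = (((ε + M : ℝ) : 𝕜))⁻¹ • ((M : 𝕜) • (x - y) - C.comp p (x - y)) := by
      simp only [f, map_sub]; module
    rw [e, norm_smul, norm_inv, RCLike.norm_ofReal, abs_of_pos (by linarith), inv_mul_eq_div,
      div_mul_eq_mul_div]
    gcongr
    exact hp.norm_sub_le le_rfl _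
  have hd : ∀ n, dist (r n) (r (n + 1)) ≤ ‖r 1‖ * (M / (ε + M)) ^ n := fun n => by
    induction n with
    | zero => simp [r]
    | succ n ih =>
      rw [hr (n + 1)]
      nth_rewrite 1 [hr n]
      rw [dist_eq_norm]
      refine (hf _ _).trans ?_
      rw [dist_eq_norm] at ih
      rw [pow_succ, ← mul_assoc, mul_comm]
      gcongr
  have hlt : M / (ε + M) < 1 := by rw [div_lt_one (by linarith)]; linarith
  obtain ⟨ρ, hρ⟩ := cauchySeq_tendsto_of_complete (cauchySeq_of_le_geometric _ _ hlt hd)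
  have h1 : ρ = f ρ := tendsto_nhds_unique (hρ.comp (Filter.tendsto_add_atTop_nat 1))
    ((((hρ.const_smul (M : 𝕜)).sub (((continuous_comp_left p).tendsto ρ).comp hρ)).const_add
      p).const_smul _)
  have h2 : C.comp p ρ + (ε : 𝕜) • ρ = p := by
    have h3 : ((ε + M : ℝ) : 𝕜) • ρ = p + ((M : 𝕜) • ρ - C.comp p ρ) := by
      nth_rewrite 1 [h1]
      exact smul_inv_smul₀ hne _
    rw [RCLike.ofReal_add, add_smul] at h3
    have h4 : C.comp p ρ + (ε : 𝕜) • ρ =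
        C.comp p ρ + ((ε : 𝕜) • ρ + (M : 𝕜) • ρ) - (M : 𝕜) • ρ := by abel
    rw [h4, h3]; abel
  refine ⟨ρ, ?_, h2⟩
  have h3 : C.comp (C.star ρ) p + (ε : 𝕜) • C.star ρ = p := by
    have := congrArg C.star h2
    rwa [map_add, C.star_comp, map_smulₛₗ, hp.star_eq, RCLike.conj_ofReal] at this
  have h4 : C.comp (C.star ρ) p = C.comp p ρ := by
    have h5 : C.comp (C.star ρ) (C.comp p ρ + (ε : 𝕜) • ρ) =
        C.comp (C.comp (C.star ρ) p + (ε : 𝕜) • C.star ρ) ρ := by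
      simp only [map_add, map_smul, LinearMap.add_apply, LinearMap.smul_apply, C.assoc]
    rwa [h2, h3] at h5
  have hε' : (ε : 𝕜) ≠ 0 := by exact_mod_cast hε.ne'
  have h5 : (ε : 𝕜) • C.star ρ = (ε : 𝕜) • ρ := by
    rw [← add_right_inj (C.comp p ρ), h2, ← h4, h3]
  exact smul_right_injective _ hε' h5

end GStarCat

end
end CStarDescent

namespace CStarDescent

noncomputable section

open Filter (Tendsto atTop)

variable {𝕜 : Type} [RCLike 𝕜]

/-! ## Positive matrices are preserved by functors -/

namespace GStarCat

section Form

variable {C : GStarCat.{v, w} 𝕜} {ι : Type*}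

/-- The quadratic form of a matrix of morphisms. -/
def form {b : ι → C.Obj} (s : Finset ι) (m : ∀ i j, C.Hom (b j) (b i)) {c : C.Obj}
    (x : ∀ i, C.Hom c (b i)) : C.Hom c c :=
  ∑ i ∈ s, ∑ j ∈ s, C.comp (C.star (x i)) (C.comp (m i j) (x j))

theorem form_congr {b : ι → C.Obj} {s : Finset ι} {m : ∀ i j, C.Hom (b j) (b i)} {c : C.Obj}
    {x y : ∀ i, C.Hom c (b i)} (h : ∀ i ∈ s, x i = y i) : form s m x = form s m y :=
  Finset.sum_congr rfl fun i hi => Finset.sum_congr rfl fun j hj => by rw [h i hi, h j hj]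

/-- The row of the matrix with index `k`, applied to a vector. -/
def row {b : ι → C.Obj} (s : Finset ι) (m : ∀ i j, C.Hom (b j) (b i)) (k : ι) {c : C.Obj}
    (x : ∀ i, C.Hom c (b i)) : C.Hom c (b k) :=
  ∑ j ∈ s, C.comp (m k j) (x j)

theorem row_congr {b : ι → C.Obj} {s : Finset ι} {m : ∀ i j, C.Hom (b j) (b i)} {k : ι} {c : C.Obj}
    {x y : ∀ i, C.Hom c (b i)} (h : ∀ i ∈ s, x i = y i) : row s m k x = row s m k y :=
  Finset.sum_congr rfl fun i hi => by rw [h i hi]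

theorem form_insert [DecidableEq ι] {b : ι → C.Obj} {s : Finset ι} {k : ι} (hk : k ∉ s)
    {m : ∀ i j, C.Hom (b j) (b i)} (hm : ∀ i j, C.star (m i j) = m j i) {c : C.Obj}
    (x : ∀ i, C.Hom c (b i)) :
    form (insert k s) m x = C.comp (C.star (x k)) (C.comp (m k k) (x k)) +
      C.comp (C.star (x k)) (row s m k x) + C.comp (C.star (row s m k x)) (x k) + form s m x := by
  have h1 : ∑ i ∈ s, C.comp (C.star (x i)) (C.comp (m i k) (x k)) =
      C.comp (C.star (row s m k x)) (x k) := by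
    rw [row, map_sum, map_sum, LinearMap.sum_apply]
    refine Finset.sum_congr rfl fun i _ => ?_
    rw [C.star_comp, hm, C.assoc]
  have h2 : ∑ j ∈ s, C.comp (C.star (x k)) (C.comp (m k j) (x j)) =
      C.comp (C.star (x k)) (row s m k x) := by
    rw [row, map_sum]
  rw [form, Finset.sum_insert hk, Finset.sum_insert hk]
  simp only [Finset.sum_insert hk]
  rw [Finset.sum_add_distrib, h1, h2, form]
  abel

/-- The Schur complement of the entry with index `k`. -/
def schur {b : ι → C.Obj} (m : ∀ i j, C.Hom (b j) (b i)) (k : ι) (ρ : C.Hom (b k) (b k)) (ε : ℝ)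
    (i j : ι) : C.Hom (b j) (b i) :=
  m i j - C.comp (m i k) ((ε : 𝕜)⁻¹ • (m k j - C.comp ρ (m k j)))

theorem schur_star {b : ι → C.Obj} {m : ∀ i j, C.Hom (b j) (b i)}
    (hm : ∀ i j, C.star (m i j) = m j i) {k : ι} {ρ : C.Hom (b k) (b k)} (hρ : C.star ρ = ρ) (ε : ℝ)
    (i j : ι) : C.star (schur m k ρ ε i j) = schur m k ρ ε j i := by
  simp only [schur, map_sub, map_smulₛₗ, C.star_comp, hm, hρ, C.assoc, map_inv₀, RCLike.conj_ofReal,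
    RingHom.id_apply]

theorem form_schur {b : ι → C.Obj} {m : ∀ i j, C.Hom (b j) (b i)}
    (hm : ∀ i j, C.star (m i j) = m j i) {k : ι} {ρ : C.Hom (b k) (b k)} (ε : ℝ)
    (s : Finset ι) {c : C.Obj} (x : ∀ i, C.Hom c (b i)) :
    form s (schur m k ρ ε) x = form s m x - C.comp (C.star (row s m k x))
      ((ε : 𝕜)⁻¹ • (row s m k x - C.comp ρ (row s m k x))) := by
  have h1 : C.comp (C.star (row s m k x))
      ((ε : 𝕜)⁻¹ • (row s m k x - C.comp ρ (row s m k x))) = ∑ i ∈ s, ∑ j ∈ s,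
      C.comp (C.star (x i)) (C.comp (C.comp (m i k)
        ((ε : 𝕜)⁻¹ • (m k j - C.comp ρ (m k j)))) (x j)) := by
    have e1 : (ε : 𝕜)⁻¹ • (row s m k x - C.comp ρ (row s m k x)) = ∑ j ∈ s,
        C.comp ((ε : 𝕜)⁻¹ • (m k j - C.comp ρ (m k j))) (x j) := by
      simp only [row, map_sum, map_smul, map_sub, LinearMap.smul_apply, LinearMap.sub_apply,
        ← Finset.smul_sum, Finset.sum_sub_distrib, C.assoc]
    have e2 : C.star (row s m k x) = ∑ i ∈ s, C.comp (C.star (x i)) (m i k) := by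
      simp only [row, map_sum, C.star_comp, hm]
    rw [e1, e2, map_sum C.comp, LinearMap.sum_apply]
    refine Finset.sum_congr rfl fun i _ => ?_
    rw [map_sum]
    exact Finset.sum_congr rfl fun j _ => by simp only [C.assoc]
  rw [h1]
  simp only [form, schur, map_sub, LinearMap.sub_apply, Finset.sum_sub_distrib]

/-- Completing the square. -/
theorem complete_square {a c : C.Obj} {p ρ : C.Hom a a} {ε : ℝ} (hε : (ε : 𝕜) ≠ 0)
    (hp : C.star p = p) (hpρ : C.comp p ρ + (ε : 𝕜) • ρ = p)
    (x w : C.Hom c a) (t : C.Hom c a) (ht : t = (ε : 𝕜)⁻¹ • (w - C.comp ρ w)) :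
    C.comp (C.star x) (C.comp p x) + C.comp (C.star x) w + C.comp (C.star w) x +
        (ε : 𝕜) • C.comp (C.star x) x + C.comp (C.star w) t =
      C.comp (C.star (x + t)) (C.comp p (x + t)) + (ε : 𝕜) • C.comp (C.star (x + t)) (x + t) := by
  have h1 : C.comp p t + (ε : 𝕜) • t = w := by
    have h2 : C.comp (C.comp p ρ + (ε : 𝕜) • ρ) w = C.comp p w := by rw [hpρ]
    rw [map_add, map_smul, LinearMap.add_apply, LinearMap.smul_apply, C.assoc] at h2
    rw [ht, smul_inv_smul₀ hε, map_smul, map_sub, ← h2, add_sub_cancel_left, inv_smul_smul₀ hε]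
    abel
  have h3 : C.comp (C.star t) p + (ε : 𝕜) • C.star t = C.star w := by
    rw [← h1, map_add, C.star_comp, hp, map_smulₛₗ, RCLike.conj_ofReal]
  nth_rewrite 1 [← h1]
  rw [← h3]
  simp only [map_add, map_smul, LinearMap.add_apply, LinearMap.smul_apply, C.assoc, smul_add]
  abel

end Form

section Schur

variable {C : GStarCat.{v, w} 𝕜} {C' : GStarCat.{v', w'} 𝕜} [IsCStar C] [IsCStar C']

theorem IsPos.map {a : C.Obj} {h : C.Hom a a} (hh : IsPos h) (F : GFunctor C C') :
    IsPos (F.map h) := by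
  obtain ⟨y, rfl⟩ := hh
  exact ⟨F.map y, by rw [F.map_comp, F.map_star]⟩

theorem isPos_of_approx (hA : HasApprox C) {a : C.Obj} {p : C.Hom a a} (hs : C.star p = p)
    (h : ∀ x : C.Hom a a, IsPos (C.comp (C.star x) (C.comp p x))) : IsPos p := by
  obtain ⟨e, he, hA⟩ := hA a
  refine IsPos.of_tendsto (fun n => h (e n)) ?_
  have h1 : Tendsto (fun n => C.comp (C.star (e n)) p) atTop (𝓝 p) := by
    have := (continuous_star.tendsto _).comp (hA a p).1
    simpa only [Function.comp_def, C.star_comp, hs] using this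
  have h2 : Tendsto (fun n => C.comp (C.star (e n)) (C.comp p (e n) - p)) atTop (𝓝 0) := by
    refine squeeze_zero_norm (fun n => ?_) (tendsto_iff_norm_sub_tendsto_zero.mp (hA a p).1)
    refine (PreCStar.norm_comp_le _ _).trans (mul_le_of_le_one_left (norm_nonneg _) ?_)
    rw [PreCStar.norm_star]; exact he n
  have h3 := h1.add h2
  rw [add_zero] at h3
  refine h3.congr fun n => ?_
  rw [map_sub]; abel

/-- Functors preserve positive matrices. -/
theorem isPos_form_map (hA : HasApprox C) (F : GFunctor C C') {ι : Type*} [DecidableEq ι]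
    {b : ι → C.Obj} (s : Finset ι) (m : ∀ i j, C.Hom (b j) (b i))
    (hm : ∀ i j, C.star (m i j) = m j i)
    (hp : ∀ (c : C.Obj) (x : ∀ i, C.Hom c (b i)), IsPos (form s m x)) {c' : C'.Obj}
    (y : ∀ i, C'.Hom c' (F.obj (b i))) :
    IsPos (form (C := C') (b := fun i => F.obj (b i)) s (fun i j => F.map (m i j)) y) := by
  induction s using Finset.induction_on generalizing m with
  | empty => exact isPos_zero
  | insert k s hk ih =>
    have hs0 : ∀ {c : C.Obj} (x : ∀ i, C.Hom c (b i)), (∀ i ∈ s, x i = 0) → row s m k x = 0 :=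
      fun x hx => Finset.sum_eq_zero fun j hj => by rw [hx j hj, map_zero]
    have hpk : IsPos (m k k) := by
      refine isPos_of_approx hA (hm k k) fun x => ?_
      have h1 := hp (b k) (Function.update (fun i => (0 : C.Hom (b k) (b i))) k x)
      have h0 : ∀ i ∈ s, Function.update (fun i => (0 : C.Hom (b k) (b i))) k x i = 0 :=
        fun i hi => Function.update_of_ne (ne_of_mem_of_not_mem hi hk) _ _
      rw [form_insert hk hm, hs0 _ h0, Function.update_self] at h1
      rw [form_congr (y := fun i => 0) h0] at h1
      simpa [form] using h1
    let F' : ∀ i j, C'.Hom (F.obj (b j)) (F.obj (b i)) := fun i j => F.map (m i j)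
    have hm' : ∀ i j, C'.star (F' i j) = F' j i := fun i j => by
      simp only [F']; rw [← F.map_star, hm]
    have key : ∀ ε : ℝ, 0 < ε → IsPos (form (C := C') (b := fun i => F.obj (b i)) (insert k s) F' y +
        (ε : 𝕜) • C'.comp (C'.star (y k)) (y k)) := by
      intro ε hε
      have hε' : (ε : 𝕜) ≠ 0 := by exact_mod_cast hε.ne'
      obtain ⟨ρ, hρ, hpρ⟩ := hpk.exists_resolvent hε
      have h1 : ∀ (c : C.Obj) (x : ∀ i, C.Hom c (b i)), IsPos (form s (schur m k ρ ε) x) := by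
        intro c x
        obtain ⟨w, hw⟩ : ∃ w, w = row s m k x := ⟨_, rfl⟩
        obtain ⟨t, ht⟩ : ∃ t, t = (ε : 𝕜)⁻¹ • (w - C.comp ρ w) := ⟨_, rfl⟩
        have h2 := hp c (Function.update x k (-t))
        have h0 : ∀ i ∈ s, Function.update x k (-t) i = x i :=
          fun i hi => Function.update_of_ne (ne_of_mem_of_not_mem hi hk) _ _
        rw [form_insert hk hm, row_congr h0, form_congr h0, Function.update_self, ← hw] at h2
        have h3 := h2.add ((isPos_star_comp t).smul hε.le)
        have h4 := complete_square hε' hpk.star_eq hpρ (-t) w t ht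
        rw [neg_add_cancel] at h4
        simp only [map_zero, smul_zero, add_zero] at h4
        rw [form_schur hm, ← hw, ← ht]
        convert h3 using 1
        have h5 : C.comp (C.star (-t)) (-t) = C.comp (C.star t) t := by simp
        rw [h5] at h4
        rw [← sub_eq_zero]
        rw [← neg_eq_zero] at h4
        rw [← h4]
        abel
      have h2 := ih (schur m k ρ ε) (schur_star hm hρ ε) h1
      have h3 : (fun i j => F.map (schur m k ρ ε i j)) =
          schur (C := C') (b := fun i => F.obj (b i)) F' k (F.map ρ) ε := by
        funext i j
        simp only [schur, map_sub, map_smul, F.map_comp, F']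
      rw [h3, form_schur hm'] at h2
      obtain ⟨w, hw⟩ : ∃ w, w = row (C := C') (b := fun i => F.obj (b i)) s F' k y := ⟨_, rfl⟩
      obtain ⟨t, ht⟩ : ∃ t, t = (ε : 𝕜)⁻¹ • (w - C'.comp (F.map ρ) w) := ⟨_, rfl⟩
      have h4 := complete_square (C := C') (p := F.map (m k k)) hε'
        (by rw [← F.map_star, hm]) (by rw [← F.map_comp, ← map_smul, ← map_add, hpρ]) (y k) w t ht
      rw [← hw, ← ht] at h2
      have h5 := (((hpk.map F).conj (y k + t)).add
        ((isPos_star_comp (y k + t)).smul hε.le)).add h2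
      rw [← h4] at h5
      rw [form_insert hk hm', ← hw]
      convert h5 using 1
      abel
    refine IsPos.of_tendsto (fun n : ℕ => key (1 / ((n : ℝ) + 1)) (by positivity)) ?_
    have h6 : Tendsto (fun n : ℕ => ((1 / ((n : ℝ) + 1) : ℝ) : 𝕜)) atTop (𝓝 ((0 : ℝ) : 𝕜)) :=
      (RCLike.continuous_ofReal.tendsto 0).comp tendsto_one_div_add_atTop_nhds_zero_nat
    have h7 := (h6.smul_const (C'.comp (C'.star (y k)) (y k))).const_add
      (form (C := C') (b := fun i => F.obj (b i)) (insert k s) F' y)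
    rw [RCLike.ofReal_zero, zero_smul, add_zero] at h7
    exact h7

end Schur

end GStarCat

end
end CStarDescent

namespace CStarDescent

noncomputable section

open Filter (Tendsto atTop)
open UniformSpace (Completion)

variable {𝕜 : Type} [RCLike 𝕜]

/-! ## Completion of pre-Hilbert modules -/

instance (C : GStarCat.{v, w} 𝕜) [IsCStar C] (a b : C.Obj) : NormedAddCommGroup (C.Hom a b) :=
  .ofSeparation IsCStar.eq_zero

namespace GStarCat

variable {C : GStarCat.{v, w} 𝕜} [IsCStar C]

theorem isClosed_isPos {a : C.Obj} : IsClosed {h : C.Hom a a | IsPos h} :=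
  IsSeqClosed.isClosed fun _ _ hh hk => IsPos.of_tendsto hh hk

/-- The Cauchy–Schwarz inequality. -/
theorem cauchy_schwarz {a b : C.Obj} {p : C.Hom b b} {q : C.Hom a a} {r : C.Hom a b}
    (hp : IsPos p) (hq : ∀ t : ℝ, IsPos (q - (t : 𝕜) • C.comp (C.star r) r -
      ((t : 𝕜) • C.comp (C.star r) r - ((t * t : ℝ) : 𝕜) • C.comp (C.star r) (C.comp p r)))) :
    ‖r‖ ^ 2 ≤ ‖p‖ * ‖q‖ := by
  have key : ∀ δ : ℝ, 0 < δ → ‖r‖ ^ 2 ≤ (‖p‖ + δ) * ‖q‖ := fun δ hδ => by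
    set M := ‖p‖ + δ
    have hM : 0 < M := by positivity
    have hM' : (M : 𝕜) ≠ 0 := by exact_mod_cast hM.ne'
    have h1 := (hq M⁻¹).add ((isPos_smul_sub hp.star_eq (le_add_of_nonneg_right hδ.le) hM r).smul
      (r := M⁻¹ * M⁻¹) (by positivity))
    have e : q - ((M⁻¹ : ℝ) : 𝕜) • C.comp (C.star r) r - (((M⁻¹ : ℝ) : 𝕜) • C.comp (C.star r) r -
        ((M⁻¹ * M⁻¹ : ℝ) : 𝕜) • C.comp (C.star r) (C.comp p r)) +
        ((M⁻¹ * M⁻¹ : ℝ) : 𝕜) • ((M : 𝕜) • C.comp (C.star r) r -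
          C.comp (C.star r) (C.comp p r)) = q - ((M⁻¹ : ℝ) : 𝕜) • C.comp (C.star r) r := by
      rw [smul_sub, smul_smul]
      have : ((M⁻¹ * M⁻¹ : ℝ) : 𝕜) * (M : 𝕜) = ((M⁻¹ : ℝ) : 𝕜) := by
        push_cast; field_simp
      rw [this]
      abel
    rw [e] at h1
    have h2 := ((isPos_star_comp r).smul (r := M⁻¹) (by positivity)).norm_le_add h1
    rw [add_sub_cancel, norm_smul, PreCStar.norm_star_comp_self, RCLike.norm_ofReal,
      abs_of_pos (by positivity), inv_mul_le_iff₀ hM] at h2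
    exact h2
  refine le_of_forall_pos_le_add fun ε hε => ?_
  have h1 : 0 < ‖q‖ + 1 := by positivity
  refine (key (ε / (‖q‖ + 1)) (by positivity)).trans ?_
  rw [add_mul]
  gcongr
  rw [div_mul_eq_mul_div, div_le_iff₀ h1]
  nlinarith [norm_nonneg q]

end GStarCat

open GStarCat

theorem HilbMod.norm_inner_le {C : GStarCat.{v, w} 𝕜} [IsCStar C] (E : HilbMod C) {a b : C.Obj}
    (η : E.E b) (ξ : E.E a) : ‖E.inner η ξ‖ ≤ ‖η‖ * ‖ξ‖ := by
  refine (sq_le_sq₀ (norm_nonneg _) (by positivity)).mp ?_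
  rw [mul_pow, E.norm_sq, E.norm_sq]
  refine cauchy_schwarz (E.inner_pos η) fun t => ?_
  have h : IsPos _ := E.inner_pos (ξ - (t : 𝕜) • E.act η (E.inner η ξ))
  have h1 : ∀ ζ : E.E a, E.inner (E.act η (E.inner η ξ)) ζ =
      C.comp (C.star (E.inner η ξ)) (E.inner η ζ) := fun ζ => by
    rw [← E.inner_star, E.inner_act, C.star_comp, E.inner_star ζ]
  simp only [map_sub, LinearMap.sub_apply, map_smul, map_smulₛₗ, LinearMap.smul_apply, h1,
    E.inner_act, RCLike.conj_ofReal, ← E.inner_star η ξ] at h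
  convert h using 2
  rw [smul_sub, smul_smul, RCLike.ofReal_mul]

/-- A graded pre-Hilbert module; the action is compatible with the composition only up to vectors
of norm zero. -/
structure PreHilb (C : GStarCat.{v, w} 𝕜) where
  V : C.Obj → Type w
  [grp : ∀ a, AddCommGroup (V a)]
  [mod : ∀ a, Module 𝕜 (V a)]
  inner : ∀ {a b}, V b →ₗ⋆[𝕜] V a →ₗ[𝕜] C.Hom a b
  inner_star : ∀ {a b} (η : V b) (ξ : V a), C.star (inner η ξ) = inner ξ η
  inner_pos : ∀ {a} (η : V a), IsPos (inner η η)
  act : ∀ {a b}, C.Hom a b → V b →ₗ[𝕜] V a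
  inner_act : ∀ {a b c} (η : V c) (ξ : V b) (x : C.Hom a b),
    inner η (act x ξ) = C.comp (inner η ξ) x
  grade : ∀ {a}, V a →ₗ[𝕜] V a
  grade_grade : ∀ {a} (η : V a), grade (grade η) = η
  grade_inner : ∀ {a b} (η : V b) (ξ : V a), inner (grade η) (grade ξ) = C.grade (inner η ξ)

attribute [instance] PreHilb.grp PreHilb.mod

section Sext

variable {E : Type v} {F : Type v'} {G : Type v''} [SeminormedAddCommGroup E] [NormedSpace 𝕜 E]
  [SeminormedAddCommGroup F] [NormedSpace 𝕜 F] [NormedAddCommGroup G] [NormedSpace 𝕜 G]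
  [CompleteSpace G]

/-- The extension of a sesquilinear map to completions. -/
def sext (m : E →ₗ⋆[𝕜] F →ₗ[𝕜] G) (h : ∀ x y, ‖m x y‖ ≤ 1 * ‖x‖ * ‖y‖) :
    Completion E →L⋆[𝕜] Completion F →L[𝕜] G :=
  (((m.mkContinuous₂ 1 h).extend (Completion.toComplL (𝕜 := 𝕜))).flip.extend
    (Completion.toComplL (𝕜 := 𝕜))).flip

theorem sext_coe (m : E →ₗ⋆[𝕜] F →ₗ[𝕜] G) (h : ∀ x y, ‖m x y‖ ≤ 1 * ‖x‖ * ‖y‖) (x : E) (y : F) :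
    sext m h x y = m x y := by
  have h1 : ((m.mkContinuous₂ 1 h).extend (Completion.toComplL (𝕜 := 𝕜))).flip.extend
      (Completion.toComplL (𝕜 := 𝕜)) (y : Completion F) =
      ((m.mkContinuous₂ 1 h).extend (Completion.toComplL (𝕜 := 𝕜))).flip y :=
    ContinuousLinearMap.extend_eq _ Completion.denseRange_coe (Completion.isUniformInducing_coe _) y
  have h2 : (m.mkContinuous₂ 1 h).extend (Completion.toComplL (𝕜 := 𝕜)) (x : Completion E) =
      m.mkContinuous₂ 1 h x :=
    ContinuousLinearMap.extend_eq _ Completion.denseRange_coe (Completion.isUniformInducing_coe _) x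
  rw [sext, ContinuousLinearMap.flip_apply, h1, ContinuousLinearMap.flip_apply, h2]
  rfl

end Sext

namespace PreHilb

variable {C : GStarCat.{v, w} 𝕜} [IsCStar C] (P : PreHilb C)

theorem act_inner {a b c : C.Obj} (η : P.V c) (ξ : P.V b) (x : C.Hom a b) :
    P.inner (P.act x ξ) η = C.comp (C.star x) (P.inner ξ η) := by
  rw [← P.inner_star, P.inner_act, C.star_comp, P.inner_star]

theorem norm_inner_sq_le {a b : C.Obj} (η : P.V b) (ξ : P.V a) :
    ‖P.inner η ξ‖ ^ 2 ≤ ‖P.inner η η‖ * ‖P.inner ξ ξ‖ := by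
  refine cauchy_schwarz (P.inner_pos η) fun t => ?_
  have h := P.inner_pos (ξ - (t : 𝕜) • P.act (P.inner η ξ) η)
  simp only [map_sub, LinearMap.sub_apply, map_smul, map_smulₛₗ, LinearMap.smul_apply,
    P.act_inner, P.inner_act, RCLike.conj_ofReal, ← P.inner_star η ξ] at h
  convert h using 1
  simp only [smul_smul, smul_sub, RCLike.ofReal_mul]

/-- The seminorm of a pre-Hilbert module. -/
instance seminormed (a : C.Obj) : SeminormedAddCommGroup (P.V a) :=
  letI : Norm (P.V a) := ⟨fun η => √‖P.inner η η‖⟩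
  SeminormedAddCommGroup.ofCore (𝕜 := 𝕜)
    { norm_nonneg := fun η => Real.sqrt_nonneg _
      norm_smul := fun c η => by
        change √_ = ‖c‖ * √_
        simp only [map_smul, map_smulₛₗ, LinearMap.smul_apply, norm_smul, RCLike.norm_conj]
        rw [← mul_assoc, Real.sqrt_mul (by positivity), Real.sqrt_mul_self (norm_nonneg c)]
      norm_triangle := fun η ξ => by
        change √_ ≤ √_ + √_
        refine Real.sqrt_le_iff.mpr ⟨by positivity, ?_⟩
        have h1 := P.norm_inner_sq_le η ξ
        have h2 : ‖P.inner η ξ‖ ≤ √‖P.inner η η‖ * √‖P.inner ξ ξ‖ := by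
          rw [← Real.sqrt_mul (norm_nonneg _)]
          exact Real.le_sqrt_of_sq_le h1
        have h3 : ‖P.inner ξ η‖ = ‖P.inner η ξ‖ := by
          rw [← P.inner_star, PreCStar.norm_star]
        have h4 : ‖P.inner (η + ξ) (η + ξ)‖ ≤ ‖P.inner η η‖ + ‖P.inner ξ η‖ +
            (‖P.inner η ξ‖ + ‖P.inner ξ ξ‖) := by
          simp only [map_add, LinearMap.add_apply]
          exact (norm_add_le _ _).trans (add_le_add (norm_add_le _ _) (norm_add_le _ _))
        have h5 := Real.sq_sqrt (norm_nonneg (P.inner η η))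
        have h6 := Real.sq_sqrt (norm_nonneg (P.inner ξ ξ))
        nlinarith }

theorem norm_sq {a : C.Obj} (η : P.V a) : ‖η‖ ^ 2 = ‖P.inner η η‖ := Real.sq_sqrt (norm_nonneg _)

instance normedSpace (a : C.Obj) : NormedSpace 𝕜 (P.V a) where
  norm_smul_le c η := by
    refine (sq_le_sq₀ (norm_nonneg _) (by positivity)).mp ?_
    rw [mul_pow, norm_sq, norm_sq]
    simp only [map_smul, map_smulₛₗ, LinearMap.smul_apply, norm_smul, RCLike.norm_conj]
    rw [sq, mul_assoc]

theorem norm_inner_le {a b : C.Obj} (η : P.V b) (ξ : P.V a) :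
    ‖P.inner η ξ‖ ≤ 1 * ‖η‖ * ‖ξ‖ := by
  refine (sq_le_sq₀ (norm_nonneg _) (by positivity)).mp ?_
  rw [one_mul, mul_pow, norm_sq, norm_sq]
  exact P.norm_inner_sq_le η ξ

theorem norm_act_le {a b : C.Obj} (x : C.Hom a b) (η : P.V b) : ‖P.act x η‖ ≤ ‖x‖ * ‖η‖ := by
  refine (sq_le_sq₀ (norm_nonneg _) (by positivity)).mp ?_
  rw [mul_pow, norm_sq, norm_sq, P.inner_act, P.act_inner]
  refine (PreCStar.norm_comp_le _ _).trans ?_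
  refine (mul_le_mul_of_nonneg_right (PreCStar.norm_comp_le _ _) (norm_nonneg x)).trans_eq ?_
  rw [PreCStar.norm_star]; ring

theorem norm_grade_le {a : C.Obj} (η : P.V a) : ‖P.grade η‖ ≤ 1 * ‖η‖ := by
  refine (sq_le_sq₀ (norm_nonneg _) (by positivity)).mp ?_
  rw [one_mul, norm_sq, norm_sq, P.grade_inner]
  exact C.norm_grade_le _

/-- The completion. -/
abbrev Cpl (a : C.Obj) : Type w := Completion (P.V a)

/-- The inner product of the completion. -/
def cinner {a b : C.Obj} : P.Cpl b →L⋆[𝕜] P.Cpl a →L[𝕜] C.Hom a b := sext P.inner P.norm_inner_le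

@[simp] theorem cinner_coe {a b : C.Obj} (η : P.V b) (ξ : P.V a) :
    P.cinner (η : P.Cpl b) (ξ : P.Cpl a) = P.inner η ξ := sext_coe _ _ _ _

theorem cinner_star {a b : C.Obj} (η : P.Cpl b) (ξ : P.Cpl a) :
    C.star (P.cinner η ξ) = P.cinner ξ η := by
  induction η, ξ using Completion.induction_on₂ with
  | hp => exact isClosed_eq (continuous_star.comp (by fun_prop)) (by fun_prop)
  | ih η ξ => rw [cinner_coe, cinner_coe, P.inner_star]

theorem cnorm_sq {a : C.Obj} (η : P.Cpl a) : ‖η‖ ^ 2 = ‖P.cinner η η‖ := by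
  induction η using Completion.induction_on with
  | hp => exact isClosed_eq (by fun_prop) (by fun_prop)
  | ih η => rw [Completion.norm_coe, cinner_coe, norm_sq]

theorem cinner_pos {a : C.Obj} (η : P.Cpl a) : IsPos (P.cinner η η) := by
  induction η using Completion.induction_on with
  | hp => exact isClosed_isPos.preimage (f := fun η : P.Cpl a => P.cinner η η) (by fun_prop)
  | ih η => rw [cinner_coe]; exact P.inner_pos η

theorem cext {a : C.Obj} {η ξ : P.Cpl a}
    (h : ∀ (b : C.Obj) (ζ : P.V b), P.cinner (ζ : P.Cpl b) η = P.cinner (ζ : P.Cpl b) ξ) :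
    η = ξ := by
  have h1 : ∀ ζ : P.Cpl a, P.cinner ζ η = P.cinner ζ ξ := fun ζ => by
    induction ζ using Completion.induction_on with
    | hp => exact isClosed_eq (by fun_prop) (by fun_prop)
    | ih ζ => exact h a ζ
  rw [← sub_eq_zero, ← norm_eq_zero, ← sq_eq_zero_iff, cnorm_sq, map_sub (P.cinner (η - ξ)), h1,
    sub_self, norm_zero]

/-- The action of one morphism on the completion. -/
def cactₓ {a b : C.Obj} (x : C.Hom a b) : P.Cpl b →L[𝕜] P.Cpl a :=
  lext (P.act x) ‖x‖ (P.norm_act_le x)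

theorem cinner_cactₓ {a b c : C.Obj} (η : P.Cpl c) (ξ : P.Cpl b) (x : C.Hom a b) :
    P.cinner η (P.cactₓ x ξ) = C.comp (P.cinner η ξ) x := by
  induction η, ξ using Completion.induction_on₂ with
  | hp => exact isClosed_eq (by fun_prop) ((continuous_comp_right x).comp (by fun_prop))
  | ih η ξ => rw [cactₓ, lext_coe, cinner_coe, cinner_coe, P.inner_act]

/-- The action on the completion. -/
def cact {a b : C.Obj} : P.Cpl b →ₗ[𝕜] C.Hom a b →ₗ[𝕜] P.Cpl a :=
  LinearMap.mk₂ 𝕜 (fun η x => P.cactₓ x η) (fun η ξ x => map_add _ _ _)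
    (fun c η x => map_smul _ _ _)
    (fun η x y => P.cext fun b ζ => by simp only [cinner_cactₓ, map_add])
    (fun c η x => P.cext fun b ζ => by simp only [cinner_cactₓ, map_smul])

theorem cinner_cact {a b c : C.Obj} (η : P.Cpl c) (ξ : P.Cpl b) (x : C.Hom a b) :
    P.cinner η (P.cact ξ x) = C.comp (P.cinner η ξ) x := P.cinner_cactₓ η ξ x

theorem cact_coe {a b : C.Obj} (η : P.V b) (x : C.Hom a b) :
    P.cact (η : P.Cpl b) x = (P.act x η : P.Cpl a) := lext_coe _ _ _ _

/-- The grading of the completion. -/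
def cgrade {a : C.Obj} : P.Cpl a →L[𝕜] P.Cpl a := lext P.grade 1 P.norm_grade_le

@[simp] theorem cgrade_coe {a : C.Obj} (η : P.V a) :
    P.cgrade (η : P.Cpl a) = (P.grade η : P.Cpl a) := lext_coe _ _ _ _

theorem cgrade_cgrade {a : C.Obj} (η : P.Cpl a) : P.cgrade (P.cgrade η) = η := by
  induction η using Completion.induction_on with
  | hp => exact isClosed_eq (by fun_prop) (by fun_prop)
  | ih η => rw [cgrade_coe, cgrade_coe, P.grade_grade]

theorem cgrade_cinner {a b : C.Obj} (η : P.Cpl b) (ξ : P.Cpl a) :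
    P.cinner (P.cgrade η) (P.cgrade ξ) = C.grade (P.cinner η ξ) := by
  have hc : Continuous fun x : C.Hom a b => C.grade x :=
    AddMonoidHomClass.continuous_of_bound C.grade 1 fun x => by
      rw [one_mul]; exact C.norm_grade_le x
  induction η, ξ using Completion.induction_on₂ with
  | hp => exact isClosed_eq (by fun_prop) (hc.comp (by fun_prop))
  | ih η ξ => rw [cgrade_coe, cgrade_coe, cinner_coe, cinner_coe, P.grade_inner]

theorem cgrade_cact {a b : C.Obj} (η : P.Cpl b) (x : C.Hom a b) :
    P.cgrade (P.cact η x) = P.cact (P.cgrade η) (C.grade x) := P.cext fun c ζ => by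
  rw [← P.cgrade_cgrade (ζ : P.Cpl c), P.cgrade_cinner, cinner_cact, cinner_cact, C.grade_comp,
    P.cgrade_cinner]

/-- The inner product of the completion as a sesquilinear map. -/
def cinnerₗ {a b : C.Obj} : P.Cpl b →ₗ⋆[𝕜] P.Cpl a →ₗ[𝕜] C.Hom a b :=
  LinearMap.mk₂'ₛₗ (starRingEnd 𝕜) (RingHom.id 𝕜) (fun (η : P.Cpl b) (ξ : P.Cpl a) => P.cinner η ξ)
    (fun η ξ ζ => by simp) (fun c η ξ => by simp) (fun η ξ ζ => map_add _ _ _)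
    (fun c η ξ => map_smul _ _ _)

/-- The grading of the completion as a linear map. -/
def cgradeₗ {a : C.Obj} : P.Cpl a →ₗ[𝕜] P.Cpl a := (P.cgrade : P.Cpl a →L[𝕜] P.Cpl a)

/-- The Hilbert module completing a pre-Hilbert module. -/
def toHilb (h : ∃ Ω : Set (Σ b, P.Cpl b), Ω.Countable ∧ ∀ a (η : P.Cpl a),
    η ∈ closure (Submodule.span 𝕜 {ζ : P.Cpl a | ∃ p ∈ Ω, ∃ x : C.Hom a p.1, ζ = P.cact p.2 x} :
      Set (P.Cpl a))) : HilbMod C where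
  E a := P.Cpl a
  act := P.cact
  act_act η x y := P.cext fun b ζ => by simp only [cinner_cact, C.assoc]
  inner := P.cinnerₗ
  inner_act := P.cinner_cact
  inner_star := P.cinner_star
  inner_pos := P.cinner_pos
  norm_sq := P.cnorm_sq
  grade := P.cgradeₗ
  grade_grade := P.cgrade_cgrade
  grade_act := P.cgrade_cact
  grade_inner := P.cgrade_cinner
  countably_generated := h

end PreHilb

end
end CStarDescent

namespace CStarDescent

noncomputable section

open Filter (Tendsto atTop)

variable {𝕜 : Type} [RCLike 𝕜]

/-! ## Operators on Hilbert modules defined on total families -/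

section Total

variable {E : Type w} [SeminormedAddCommGroup E] [NormedSpace 𝕜 E] {J : Type*}

/-- The linear span of the family is dense. -/
def Total (𝕜 : Type) [RCLike 𝕜] {E : Type w} [SeminormedAddCommGroup E] [NormedSpace 𝕜 E]
    {J : Type*} (κ : J → E) : Prop :=
  Dense (Submodule.span 𝕜 (Set.range κ) : Set E)

theorem Total.denseRange {κ : J → E} (h : Total 𝕜 κ) :
    DenseRange (Finsupp.linearCombination 𝕜 κ) := by
  rwa [DenseRange, ← LinearMap.coe_range, Finsupp.range_linearCombination]

theorem Total.ext {κ : J → E} (h : Total 𝕜 κ) {G : Type v'} [AddCommGroup G] [Module 𝕜 G]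
    [TopologicalSpace G] [T2Space G] {σ : 𝕜 →+* 𝕜} {f g : E →ₛₗ[σ] G} (hf : Continuous f)
    (hg : Continuous g) (hfg : ∀ j, f (κ j) = g (κ j)) (x : E) : f x = g x := by
  refine congrFun (hf.ext_on h hg fun y hy => ?_) x
  exact LinearMap.eqOn_span (by rintro _ ⟨j, rfl⟩; exact hfg j) hy

/-- If the closed span of a family contains a total family, then the family is total. -/
theorem Total.of_mem {J' : Type*} {κ : J → E} (h : Total 𝕜 κ) {μ : J' → E}
    (hμ : ∀ j, κ j ∈ closure (Submodule.span 𝕜 (Set.range μ) : Set E)) : Total 𝕜 μ := by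
  have h1 : Submodule.span 𝕜 (Set.range κ) ≤
      (Submodule.span 𝕜 (Set.range μ)).topologicalClosure :=
    Submodule.span_le.mpr (by rintro _ ⟨j, rfl⟩; exact hμ j)
  intro x
  have h2 := closure_mono h1 (h x)
  rwa [Submodule.topologicalClosure_coe, closure_closure] at h2

end Total

namespace HilbMod

variable {C : GStarCat.{v, w} 𝕜} [IsCStar C] (E : HilbMod C)

theorem norm_act_le {a b : C.Obj} (η : E.E b) (x : C.Hom a b) : ‖E.act η x‖ ≤ ‖η‖ * ‖x‖ := by
  refine (sq_le_sq₀ (norm_nonneg _) (by positivity)).mp ?_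
  rw [mul_pow, E.norm_sq, E.norm_sq, E.inner_act, ← E.inner_star, E.inner_act, C.star_comp,
    E.inner_star]
  refine (PreCStar.norm_comp_le _ _).trans ?_
  refine (mul_le_mul_of_nonneg_right (PreCStar.norm_comp_le _ _) (norm_nonneg x)).trans_eq ?_
  rw [PreCStar.norm_star]; ring

theorem continuous_act_left {a b : C.Obj} (x : C.Hom a b) : Continuous fun η => E.act η x :=
  AddMonoidHomClass.continuous_of_bound (E.act.flip x) ‖x‖ fun η =>
    (E.norm_act_le η x).trans_eq (mul_comm _ _)

theorem continuous_inner_left {a b : C.Obj} (ξ : E.E a) :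
    Continuous fun η : E.E b => E.inner η ξ :=
  AddMonoidHomClass.continuous_of_bound (E.inner.flip ξ) ‖ξ‖ fun η =>
    (E.norm_inner_le η ξ).trans_eq (mul_comm _ _)

theorem continuous_inner_right {a b : C.Obj} (η : E.E b) :
    Continuous fun ξ : E.E a => E.inner η ξ :=
  AddMonoidHomClass.continuous_of_bound (E.inner η) ‖η‖ fun ξ => E.norm_inner_le η ξ

theorem continuous_grade {a : C.Obj} : Continuous fun η : E.E a => E.grade η :=
  AddMonoidHomClass.continuous_of_bound E.grade 1 fun η => by
    rw [one_mul]; exact E.norm_grade η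

theorem ext_of_total {J : Type*} {a : C.Obj} {κ : J → E.E a} (h : Total 𝕜 κ) {η ξ : E.E a}
    (he : ∀ j, E.inner (κ j) η = E.inner (κ j) ξ) : η = ξ := by
  refine E.ext_inner' fun ζ => ?_
  exact h.ext (f := E.inner.flip η) (g := E.inner.flip ξ) (E.continuous_inner_left η)
    (E.continuous_inner_left ξ) he ζ

theorem tendsto_act {a : C.Obj} {e : ℕ → C.Hom a a} (he : ∀ n, ‖e n‖ ≤ 1)
    (h : ∀ x : C.Hom a a, Tendsto (fun n => C.comp x (e n)) atTop (𝓝 x)) (η : E.E a) :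
    Tendsto (fun n => E.act η (e n)) atTop (𝓝 η) := by
  rw [tendsto_iff_norm_sub_tendsto_zero]
  have h1 : ∀ n, ‖E.act η (e n) - η‖ ^ 2 ≤
      2 * ‖C.comp (E.inner η η) (e n) - E.inner η η‖ := fun n => by
    have e1 : E.inner (E.act η (e n) - η) (E.act η (e n) - η) =
        C.comp (C.star (e n)) (C.comp (E.inner η η) (e n) - E.inner η η) -
          (C.comp (E.inner η η) (e n) - E.inner η η) := by
      have : ∀ ζ : E.E a, E.inner (E.act η (e n)) ζ = C.comp (C.star (e n)) (E.inner η ζ) :=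
        fun ζ => by rw [← E.inner_star, E.inner_act, C.star_comp, E.inner_star]
      simp only [map_sub, LinearMap.sub_apply, E.inner_act, this, C.assoc]
      abel
    rw [E.norm_sq, e1]
    refine (norm_sub_le _ _).trans ?_
    rw [two_mul]
    refine add_le_add_left ((PreCStar.norm_comp_le _ _).trans ?_) _
    rw [PreCStar.norm_star]
    exact mul_le_of_le_one_left (norm_nonneg _) (he n)
  have h2 := (tendsto_iff_norm_sub_tendsto_zero.mp (h (E.inner η η))).const_mul 2
  rw [mul_zero] at h2
  have h3 := squeeze_zero (fun n => sq_nonneg _) h1 h2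
  have h4 := (Real.continuous_sqrt.tendsto 0).comp h3
  simpa [Function.comp_def, Real.sqrt_sq] using h4

end HilbMod

namespace Op

variable {C : GStarCat.{v, w} 𝕜} [IsCStar C] {E F G : HilbMod C}

theorem continuous (T : Op E F) {a : C.Obj} : Continuous (T.toFun (a := a)) :=
  AddMonoidHomClass.continuous_of_bound _ ‖T‖ T.bd_norm.2.1

theorem continuous_adj (T : Op E F) {a : C.Obj} : Continuous (T.adj (a := a)) := T.star.continuous

theorem ext_of_total {J : C.Obj → Type*} {κ : ∀ {a}, J a → E.E a} (hκ : ∀ a, Total 𝕜 (κ (a := a)))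
    {S T : Op E F} (h : ∀ a (j : J a), S.toFun (κ j) = T.toFun (κ j)) : S = T :=
  Op.ext fun a η => (hκ a).ext S.continuous T.continuous (h a) η

/-- Boundedness of an adjointable operator implies boundedness of its adjoint. -/
theorem bd_of_toFun (T : Op E F) {K : ℝ} (hK : 0 ≤ K)
    (h : ∀ {a} (η : E.E a), ‖T.toFun η‖ ≤ K * ‖η‖) : T.Bd K := by
  refine ⟨hK, h, fun ξ => ?_⟩
  have h1 : ‖T.adj ξ‖ ^ 2 ≤ K * ‖ξ‖ * ‖T.adj ξ‖ := by
    rw [E.norm_sq, ← T.inner_adj]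
    refine (F.norm_inner_le _ _).trans ?_
    calc ‖ξ‖ * ‖T.toFun (T.adj ξ)‖ ≤ ‖ξ‖ * (K * ‖T.adj ξ‖) := by gcongr; exact h _
      _ = _ := by ring
  by_cases h0 : ‖T.adj ξ‖ = 0
  · rw [h0]; positivity
  · rw [sq] at h1
    exact le_of_mul_le_mul_right h1 (lt_of_le_of_ne (norm_nonneg _) (Ne.symm h0))

/-- Construction of an operator from its values, and the values of its adjoint, on total
families. -/
theorem exists_of_total {J J' : C.Obj → Type*} {κ : ∀ {a}, J a → E.E a}
    (hκ : ∀ a, Total 𝕜 (κ (a := a))) {μ : ∀ {a}, J' a → F.E a} (hμ : ∀ a, Total 𝕜 (μ (a := a)))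
    (T : ∀ {a}, J a → F.E a) (S : ∀ {a}, J' a → E.E a)
    (hTS : ∀ {a b} (q : J' b) (p : J a), F.inner (μ q) (T p) = E.inner (S q) (κ p))
    {K : ℝ} (hK : 0 ≤ K) (hb : ∀ a (v : J a →₀ 𝕜),
      ‖Finsupp.linearCombination 𝕜 T v‖ ≤ K * ‖Finsupp.linearCombination 𝕜 κ v‖) :
    ∃ R : Op E F, R.Bd K ∧ (∀ {a} (p : J a), R.toFun (κ p) = T p) ∧
      ∀ {a} (q : J' a), R.adj (μ q) = S q := by
  let T' : ∀ a, E.E a →L[𝕜] F.E a := fun a =>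
    LinearMap.extendOfNorm (Finsupp.linearCombination 𝕜 (T (a := a)))
      (Finsupp.linearCombination 𝕜 (κ (a := a)))
  have hT' : ∀ {a} (v : J a →₀ 𝕜), T' a (Finsupp.linearCombination 𝕜 κ v) =
      Finsupp.linearCombination 𝕜 T v := fun {a} v =>
    LinearMap.extendOfNorm_eq (hκ a).denseRange ⟨K, hb a⟩ v
  have hT'κ : ∀ {a} (p : J a), T' a (κ p) = T p := fun p => by
    simpa using hT' (Finsupp.single p 1)
  have hT'b : ∀ {a} (η : E.E a), ‖T' a η‖ ≤ K * ‖η‖ := fun {a} η => by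
    refine (hκ a).denseRange.induction_on (p := fun η => ‖T' a η‖ ≤ K * ‖η‖) η
      (isClosed_le (by fun_prop) (by fun_prop)) fun v => ?_
    rw [hT']; exact hb a v
  have h1 : ∀ {a b} (w : J' b →₀ 𝕜) (η : E.E a), F.inner (Finsupp.linearCombination 𝕜 μ w) (T' a η) =
      E.inner (Finsupp.linearCombination 𝕜 S w) η := fun {a b} w η => by
    refine (hκ a).ext (f := F.inner (Finsupp.linearCombination 𝕜 μ w) ∘ₗ (T' a : E.E a →ₗ[𝕜] F.E a))
      (g := E.inner (Finsupp.linearCombination 𝕜 S w))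
      ((F.continuous_inner_right _).comp (T' a).continuous) (E.continuous_inner_right _)
      (fun p => ?_) η
    change F.inner _ (T' a (κ p)) = _
    rw [hT'κ]
    induction w using Finsupp.induction_linear with
    | zero => simp
    | add w w' h h' => simp only [map_add, LinearMap.add_apply, h, h']
    | single q c =>
      simp only [Finsupp.linearCombination_single, map_smulₛₗ, LinearMap.smul_apply, hTS]
  have hSb : ∀ {b} (w : J' b →₀ 𝕜), ‖Finsupp.linearCombination 𝕜 S w‖ ≤
      K * ‖Finsupp.linearCombination 𝕜 μ w‖ := fun {b} w => by
    set s := Finsupp.linearCombination 𝕜 S w with hs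
    have h2 : ‖s‖ ^ 2 ≤ K * ‖Finsupp.linearCombination 𝕜 μ w‖ * ‖s‖ := by
      rw [E.norm_sq, hs, ← h1, ← hs]
      refine (F.norm_inner_le _ _).trans ?_
      calc ‖Finsupp.linearCombination 𝕜 μ w‖ * ‖T' b s‖
          ≤ ‖Finsupp.linearCombination 𝕜 μ w‖ * (K * ‖s‖) := by gcongr; exact hT'b _
        _ = _ := by ring
    by_cases h0 : ‖s‖ = 0
    · rw [h0]; positivity
    · rw [sq] at h2
      exact le_of_mul_le_mul_right h2 (lt_of_le_of_ne (norm_nonneg _) (Ne.symm h0))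
  let S' : ∀ a, F.E a →L[𝕜] E.E a := fun a =>
    LinearMap.extendOfNorm (Finsupp.linearCombination 𝕜 (S (a := a)))
      (Finsupp.linearCombination 𝕜 (μ (a := a)))
  have hS' : ∀ {a} (v : J' a →₀ 𝕜), S' a (Finsupp.linearCombination 𝕜 μ v) =
      Finsupp.linearCombination 𝕜 S v := fun {a} v =>
    LinearMap.extendOfNorm_eq (hμ a).denseRange ⟨K, hSb⟩ v
  have hS'μ : ∀ {a} (p : J' a), S' a (μ p) = S p := fun p => by
    simpa using hS' (Finsupp.single p 1)
  have hS'b : ∀ {a} (η : F.E a), ‖S' a η‖ ≤ K * ‖η‖ := fun {a} η => by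
    refine (hμ a).denseRange.induction_on (p := fun η => ‖S' a η‖ ≤ K * ‖η‖) η
      (isClosed_le (by fun_prop) (by fun_prop)) fun v => ?_
    rw [hS']; exact hSb v
  refine ⟨⟨fun {a} => T' a, fun {a} => S' a, fun {a b} ξ η => ?_, K, hK, hT'b, hS'b⟩,
    ⟨hK, hT'b, hS'b⟩, hT'κ, hS'μ⟩
  refine (hμ b).ext (f := F.inner.flip (T' a η))
    (g := E.inner.flip η ∘ₛₗ (S' b : F.E b →ₗ[𝕜] E.E b)) (F.continuous_inner_left _)
    ((E.continuous_inner_left η).comp (S' b).continuous) (fun q => ?_) ξ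
  change F.inner (μ q) (T' a η) = E.inner (S' b (μ q)) η
  rw [hS'μ]
  simpa using h1 (Finsupp.single q 1) η

/-- A unitary operator. -/
structure IsUni (U : Op E F) : Prop where
  adj_toFun : ∀ {a} (η : E.E a), U.adj (U.toFun η) = η
  toFun_adj : ∀ {a} (ξ : F.E a), U.toFun (U.adj ξ) = ξ

theorem IsUni.inner {U : Op E F} (h : U.IsUni) {a b : C.Obj} (η : E.E b) (ξ : E.E a) :
    F.inner (U.toFun η) (U.toFun ξ) = E.inner η ξ := by
  rw [U.inner_adj, h.adj_toFun]

theorem IsUni.norm {U : Op E F} (h : U.IsUni) {a : C.Obj} (η : E.E a) : ‖U.toFun η‖ = ‖η‖ := by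
  refine (sq_eq_sq₀ (norm_nonneg _) (norm_nonneg _)).mp ?_
  rw [F.norm_sq, E.norm_sq, h.inner]

theorem IsUni.star {U : Op E F} (h : U.IsUni) : U.star.IsUni := ⟨h.toFun_adj, h.adj_toFun⟩

theorem IsUni.bd {U : Op E F} (h : U.IsUni) : U.Bd 1 :=
  ⟨zero_le_one, fun η => by rw [one_mul, h.norm], fun ξ => by
    rw [one_mul]; exact (h.star.norm ξ).le⟩

/-- Total families with the same inner products define a unitary operator. -/
theorem exists_unitary {J : C.Obj → Type*} {κ : ∀ {a}, J a → E.E a}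
    (hκ : ∀ a, Total 𝕜 (κ (a := a))) {μ : ∀ {a}, J a → F.E a} (hμ : ∀ a, Total 𝕜 (μ (a := a)))
    (h : ∀ {a b} (q : J b) (p : J a), F.inner (μ q) (μ p) = E.inner (κ q) (κ p)) :
    ∃ U : Op E F, U.IsUni ∧ (∀ {a} (p : J a), U.toFun (κ p) = μ p) ∧
      ∀ {a} (p : J a), U.adj (μ p) = κ p := by
  have h1 : ∀ {a b} (w : J b →₀ 𝕜) (v : J a →₀ 𝕜),
      F.inner (Finsupp.linearCombination 𝕜 μ w) (Finsupp.linearCombination 𝕜 μ v) =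
      E.inner (Finsupp.linearCombination 𝕜 κ w) (Finsupp.linearCombination 𝕜 κ v) := by
    intro a b w v
    induction w using Finsupp.induction_linear with
    | zero => simp
    | add w w' h h' => simp only [map_add, LinearMap.add_apply, h, h']
    | single q c =>
      induction v using Finsupp.induction_linear with
      | zero => simp
      | add w w' h h' => simp only [map_add, h, h']
      | single p d =>
        simp only [Finsupp.linearCombination_single, map_smulₛₗ, LinearMap.smul_apply, h]
  obtain ⟨U, -, hU, hU'⟩ := exists_of_total hκ hμ (fun p => μ p) (fun p => κ p) h zero_le_one
    fun a v => by
      rw [one_mul]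
      refine (sq_le_sq₀ (norm_nonneg _) (norm_nonneg _)).mp ?_
      rw [F.norm_sq, E.norm_sq]
      exact (congrArg norm (h1 v v)).le
  refine ⟨U, ⟨fun {a} η => ?_, fun {a} ξ => ?_⟩, hU, hU'⟩
  · exact (hκ a).ext (f := U.adj ∘ₗ U.toFun) (g := LinearMap.id) (U.continuous_adj.comp U.continuous)
      continuous_id (fun p => by simp [hU, hU']) η
  · exact (hμ a).ext (f := U.toFun ∘ₗ U.adj) (g := LinearMap.id) (U.continuous.comp U.continuous_adj)
      continuous_id (fun p => by simp [hU, hU']) ξ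

end Op

end
end CStarDescent

namespace CStarDescent

noncomputable section

open Filter (Tendsto atTop)
open UniformSpace (Completion)
open GStarCat

variable {𝕜 : Type} [RCLike 𝕜]

/-! ## Pre-Hilbert modules from positive kernels -/

/-- A positive kernel with values in a graded `C*`-category, with compatible actions. -/
structure Kern (C : GStarCat.{v, w} 𝕜) where
  I : C.Obj → Type w
  k : ∀ {a b}, I b → I a → C.Hom a b
  k_star : ∀ {a b} (p : I b) (q : I a), C.star (k p q) = k q p
  k_pos : ∀ {a} (s : Finset (I a)) (c : I a → 𝕜),
    IsPos (∑ p ∈ s, ∑ q ∈ s, (starRingEnd 𝕜 (c p) * c q) • k p q)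
  act : ∀ {a b}, C.Hom a b → I b → I a
  k_act : ∀ {a b c} (p : I c) (q : I b) (x : C.Hom a b), k p (act x q) = C.comp (k p q) x
  gr : ∀ {a}, I a → I a
  gr_gr : ∀ {a} (p : I a), gr (gr p) = p
  k_gr : ∀ {a b} (p : I b) (q : I a), k (gr p) (gr q) = C.grade (k p q)

namespace Kern

variable {C : GStarCat.{v, w} 𝕜} (K : Kern C)

/-- The sesquilinear extension of a kernel. -/
def inner {a b : C.Obj} : (K.I b →₀ 𝕜) →ₗ⋆[𝕜] (K.I a →₀ 𝕜) →ₗ[𝕜] C.Hom a b :=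
  LinearMap.mk₂'ₛₗ (starRingEnd 𝕜) (RingHom.id 𝕜)
    (fun v w => v.sum fun p s => starRingEnd 𝕜 s • Finsupp.linearCombination 𝕜 (K.k p) w)
    (fun v v' w => Finsupp.sum_add_index' (fun _ => by simp) fun _ _ _ => by rw [map_add, add_smul])
    (fun c v w => by
      rw [Finsupp.sum_smul_index' fun _ => by simp, Finsupp.smul_sum]
      simp only [smul_eq_mul, map_mul, mul_smul])
    (fun v w w' => by simp only [map_add, smul_add, Finsupp.sum_add])
    (fun c v w => by
      rw [RingHom.id_apply, Finsupp.smul_sum]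
      simp only [map_smul, smul_comm c])

theorem inner_single {a b : C.Obj} (p : K.I b) (q : K.I a) (c d : 𝕜) :
    K.inner (Finsupp.single p c) (Finsupp.single q d) = (starRingEnd 𝕜 c * d) • K.k p q := by
  refine Eq.trans (b := (Finsupp.single p c).sum fun p s =>
    starRingEnd 𝕜 s • Finsupp.linearCombination 𝕜 (K.k p) (Finsupp.single q d)) rfl ?_
  rw [Finsupp.sum_single_index (by simp), Finsupp.linearCombination_single, mul_smul]

/-- The pre-Hilbert module of a positive kernel. -/
def pre : PreHilb C where
  V a := K.I a →₀ 𝕜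
  inner := K.inner
  inner_star v w := by
    induction v using Finsupp.induction_linear with
    | zero => simp
    | add v v' h h' => simp only [map_add, LinearMap.add_apply, h, h']
    | single p c =>
      induction w using Finsupp.induction_linear with
      | zero => simp
      | add w w' h h' => simp only [map_add, LinearMap.add_apply, h, h']
      | single q d =>
        rw [inner_single, inner_single, map_smulₛₗ, K.k_star, map_mul, RCLike.conj_conj, mul_comm]
  inner_pos v := by
    convert K.k_pos v.support v using 1
    have h : v = ∑ p ∈ v.support, Finsupp.single p (v p) := (Finsupp.sum_single v).symm
    conv_lhs => rw [h]
    rw [map_sum K.inner, LinearMap.sum_apply]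
    refine Finset.sum_congr rfl fun p _ => ?_
    rw [map_sum]
    exact Finset.sum_congr rfl fun q _ => inner_single _ _ _ _ _
  act x := Finsupp.lmapDomain 𝕜 𝕜 (K.act x)
  inner_act v w x := by
    induction v using Finsupp.induction_linear with
    | zero => simp
    | add v v' h h' => simp only [map_add, LinearMap.add_apply, h, h']
    | single p c =>
      induction w using Finsupp.induction_linear with
      | zero => simp
      | add w w' h h' => simp only [map_add, LinearMap.add_apply, h, h']
      | single q d =>
        rw [Finsupp.lmapDomain_apply, Finsupp.mapDomain_single, inner_single, inner_single, K.k_act,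
          map_smul, LinearMap.smul_apply]
  grade := Finsupp.lmapDomain 𝕜 𝕜 K.gr
  grade_grade v := by
    rw [Finsupp.lmapDomain_apply, Finsupp.lmapDomain_apply, ← Finsupp.mapDomain_comp,
      show K.gr ∘ K.gr = id from funext K.gr_gr, Finsupp.mapDomain_id]
  grade_inner v w := by
    induction v using Finsupp.induction_linear with
    | zero => simp
    | add v v' h h' => simp only [map_add, LinearMap.add_apply, h, h']
    | single p c =>
      induction w using Finsupp.induction_linear with
      | zero => simp
      | add w w' h h' => simp only [map_add, h, h']
      | single q d =>
        simp only [Finsupp.lmapDomain_apply, Finsupp.mapDomain_single, inner_single, K.k_gr,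
          map_smul]

variable [IsCStar C]

/-- A finitely supported function as an element of the pre-Hilbert module. -/
def vec {a : C.Obj} : (K.I a →₀ 𝕜) →ₗ[𝕜] K.pre.V a := LinearMap.id

/-- The vector of the completion given by an index. -/
def δ {a : C.Obj} (p : K.I a) : K.pre.Cpl a := (K.vec (Finsupp.single p 1) : Completion (K.pre.V a))

theorem cinner_δ {a b : C.Obj} (p : K.I b) (q : K.I a) : K.pre.cinner (K.δ p) (K.δ q) = K.k p q := by
  rw [δ, δ, PreHilb.cinner_coe]
  exact (K.inner_single p q 1 1).trans (by simp)

theorem cact_δ {a b : C.Obj} (p : K.I b) (x : C.Hom a b) :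
    K.pre.cact (K.δ p) x = K.δ (K.act x p) := by
  rw [δ, PreHilb.cact_coe]
  exact congrArg (fun v : K.pre.V a => (v : K.pre.Cpl a)) Finsupp.mapDomain_single

theorem cgrade_δ {a : C.Obj} (p : K.I a) : K.pre.cgrade (K.δ p) = K.δ (K.gr p) := by
  rw [δ, PreHilb.cgrade_coe]
  exact congrArg (fun v : K.pre.V a => (v : K.pre.Cpl a)) Finsupp.mapDomain_single

theorem coe_mem {a : C.Obj} (v : K.pre.V a) :
    (v : K.pre.Cpl a) ∈ Submodule.span 𝕜 (Set.range (K.δ (a := a))) := by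
  obtain ⟨v, rfl⟩ : ∃ w : K.I a →₀ 𝕜, K.vec w = v := ⟨v, rfl⟩
  induction v using Finsupp.induction_linear with
  | zero => rw [map_zero, Completion.coe_zero]; exact zero_mem _
  | add v v' h h' => rw [map_add, Completion.coe_add]; exact add_mem h h'
  | single p c =>
    rw [← Finsupp.smul_single_one, map_smul, Completion.coe_smul]
    exact Submodule.smul_mem _ _ (Submodule.subset_span ⟨p, rfl⟩)

theorem total_δ (a : C.Obj) : Total 𝕜 (K.δ (a := a)) :=
  Dense.mono (by rintro _ ⟨v, rfl⟩; exact K.coe_mem v)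
    (Completion.denseRange_coe (α := K.pre.V a))

theorem ext_δ {a : C.Obj} {η ξ : K.pre.Cpl a}
    (h : ∀ (b : C.Obj) (p : K.I b), K.pre.cinner (K.δ p) η = K.pre.cinner (K.δ p) ξ) : η = ξ := by
  refine K.pre.cext fun b ζ => ?_
  refine (K.total_δ b).ext (f := K.pre.cinnerₗ.flip η) (g := K.pre.cinnerₗ.flip ξ) ?_ ?_ (h b) ζ
  · change Continuous fun ζ => K.pre.cinner ζ η
    fun_prop
  · change Continuous fun ζ => K.pre.cinner ζ ξ
    fun_prop

end Kern

/-! ## The tensor product along a functor -/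

section Tens

variable {C : GStarCat.{u, u} 𝕜} {C' : GStarCat.{v, u} 𝕜} [IsCStar C] [IsCStar C'] (hA : HasApprox C) (F : GFunctor C C')

/-- The kernel of the tensor product. -/
def tensKern (E : HilbMod C) : Kern C' where
  I c := Σ b : C.Obj, E.E b × C'.Hom c (F.obj b)
  k p q := C'.comp (C'.star p.2.2) (C'.comp (F.map (E.inner p.2.1 q.2.1)) q.2.2)
  k_star p q := by rw [C'.star_comp, C'.star_comp, C'.star_star, ← F.map_star, E.inner_star, C'.assoc]
  k_pos {a} s c := by
    classical
    have h := isPos_form_map hA F s (fun p q => E.inner p.2.1 q.2.1) (fun p q => E.inner_star _ _)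
      (fun d x => by
        have h : IsPos _ := E.inner_pos (∑ p ∈ s, E.act p.2.1 (x p))
        rw [map_sum E.inner, LinearMap.sum_apply] at h
        convert h using 1
        refine Finset.sum_congr rfl fun p _ => ?_
        rw [map_sum]
        refine Finset.sum_congr rfl fun q _ => ?_
        rw [E.inner_act, ← E.inner_star, E.inner_act, C.star_comp, E.inner_star, C.assoc])
      (fun p : Σ b : C.Obj, E.E b × C'.Hom a (F.obj b) => c p • p.2.2)
    convert h using 1
    refine Finset.sum_congr rfl fun p _ => Finset.sum_congr rfl fun q _ => ?_
    simp only [map_smul, map_smulₛₗ, LinearMap.smul_apply, mul_smul]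
    exact smul_comm _ _ _
  act x p := ⟨p.1, p.2.1, C'.comp p.2.2 x⟩
  k_act p q x := by simp only [C'.assoc]
  gr p := ⟨p.1, E.grade p.2.1, C'.grade p.2.2⟩
  gr_gr p := by simp only [E.grade_grade, C'.grade_grade]
  k_gr p q := by simp only [E.grade_inner, F.map_grade, ← C'.grade_star, C'.grade_comp]

variable (E : HilbMod C)



/-- Elementary tensors as a function. -/
def tensδ {b : C.Obj} {c : C'.Obj} (η : E.E b) (y : C'.Hom c (F.obj b)) :
    (tensKern hA F E).pre.Cpl c :=
  (tensKern hA F E).δ (⟨b, η, y⟩ : Σ b : C.Obj, E.E b × C'.Hom c (F.obj b))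

theorem cinner_tensδ {a b : C.Obj} {c d : C'.Obj} (η : E.E b) (y : C'.Hom c (F.obj b)) (ξ : E.E a)
    (z : C'.Hom d (F.obj a)) :
    (tensKern hA F E).pre.cinner (tensδ hA F E η y) (tensδ hA F E ξ z) =
      C'.comp (C'.star y) (C'.comp (F.map (E.inner η ξ)) z) :=
  (tensKern hA F E).cinner_δ _ _

theorem ext_tensδ {c : C'.Obj} {ζ θ : (tensKern hA F E).pre.Cpl c}
    (h : ∀ (b : C.Obj) (d : C'.Obj) (η : E.E b) (y : C'.Hom d (F.obj b)),
      (tensKern hA F E).pre.cinner (tensδ hA F E η y) ζ =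
        (tensKern hA F E).pre.cinner (tensδ hA F E η y) θ) : ζ = θ :=
  (tensKern hA F E).ext_δ fun d ⟨b, η, y⟩ => h b d η y

/-- Elementary tensors. -/
def tensτ {b : C.Obj} {c : C'.Obj} :
    E.E b →ₗ[𝕜] C'.Hom c (F.obj b) →ₗ[𝕜] (tensKern hA F E).pre.Cpl c :=
  LinearMap.mk₂ 𝕜 (tensδ hA F E)
    (fun η ξ y => ext_tensδ hA F E fun d p θ z => by
      simp only [map_add, cinner_tensδ, LinearMap.add_apply])
    (fun r η y => ext_tensδ hA F E fun d p θ z => by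
      simp only [map_smul, cinner_tensδ, LinearMap.smul_apply])
    (fun η y z => ext_tensδ hA F E fun d p θ z => by simp only [map_add, cinner_tensδ])
    (fun r η y => ext_tensδ hA F E fun d p θ z => by simp only [map_smul, cinner_tensδ])

theorem cinner_tensτ {a b : C.Obj} {c d : C'.Obj} (η : E.E b) (y : C'.Hom c (F.obj b)) (ξ : E.E a)
    (z : C'.Hom d (F.obj a)) : (tensKern hA F E).pre.cinner (tensτ hA F E η y) (tensτ hA F E ξ z) =
      C'.comp (C'.star y) (C'.comp (F.map (E.inner η ξ)) z) :=
  (tensKern hA F E).cinner_δ _ _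

theorem cact_tensτ {b : C.Obj} {c d : C'.Obj} (η : E.E b) (y : C'.Hom c (F.obj b))
    (z : C'.Hom d c) : (tensKern hA F E).pre.cact (tensτ hA F E η y) z = tensτ hA F E η (C'.comp y z) :=
  (tensKern hA F E).cact_δ _ _

theorem norm_tensτ_le {b : C.Obj} {c : C'.Obj} (η : E.E b) (y : C'.Hom c (F.obj b)) :
    ‖tensτ hA F E η y‖ ≤ ‖η‖ * ‖y‖ := by
  refine (sq_le_sq₀ (norm_nonneg _) (by positivity)).mp ?_
  rw [mul_pow, PreHilb.cnorm_sq, cinner_tensτ, E.norm_sq]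
  refine (PreCStar.norm_comp_le _ _).trans ?_
  rw [PreCStar.norm_star]
  refine (mul_le_mul_of_nonneg_left ((PreCStar.norm_comp_le _ _).trans
    (mul_le_mul_of_nonneg_right (F.norm_map_le _) (norm_nonneg _))) (norm_nonneg _)).trans_eq ?_
  ring

theorem tensτ_act {a b : C.Obj} {c : C'.Obj} (η : E.E b) (x : C.Hom a b) (y : C'.Hom c (F.obj a)) :
    tensτ hA F E (E.act η x) y = tensτ hA F E η (C'.comp (F.map x) y) :=
  ext_tensδ hA F E fun e d ξ z => by
    refine (cinner_tensτ hA F E ξ z _ _).trans ((cinner_tensτ hA F E ξ z _ _).trans ?_).symm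
    rw [E.inner_act, F.map_comp, C'.assoc]

theorem HasApprox.tendsto_left {C : GStarCat.{v, w} 𝕜} [PreCStar C] {a b : C.Obj}
    {e : ℕ → C.Hom a a}
    (h : ∀ (b : C.Obj) (x : C.Hom a b), Tendsto (fun n => C.comp x (C.star (e n))) atTop (𝓝 x))
    (x : C.Hom b a) : Tendsto (fun n => C.comp (e n) x) atTop (𝓝 x) := by
  rw [tendsto_iff_norm_sub_tendsto_zero]
  refine (tendsto_iff_norm_sub_tendsto_zero.mp (h b (C.star x))).congr fun n => ?_
  rw [← PreCStar.norm_star, map_sub, C.star_comp, C.star_star, C.star_star]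

theorem tens_countably_generated :
    ∃ Ω : Set (Σ b, (tensKern hA F E).pre.Cpl b), Ω.Countable ∧ ∀ a (η : (tensKern hA F E).pre.Cpl a),
    η ∈ closure (Submodule.span 𝕜 {ζ : (tensKern hA F E).pre.Cpl a | ∃ p ∈ Ω, ∃ x : C'.Hom a p.1,
      ζ = (tensKern hA F E).pre.cact p.2 x} : Set ((tensKern hA F E).pre.Cpl a)) := by
  obtain ⟨Ω, hΩ, hE⟩ := E.countably_generated
  have hA₁ := hA
  choose e he hA' using hA₁
  refine ⟨(fun p : (Σ b, E.E b) × ℕ =>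
    (⟨F.obj p.1.1, tensτ hA F E p.1.2 (F.map (e p.1.1 p.2))⟩ : Σ b, (tensKern hA F E).pre.Cpl b)) ''
      (Ω ×ˢ Set.univ), (hΩ.prod Set.countable_univ).image _, fun c => ?_⟩
  obtain ⟨S, hS⟩ : ∃ S : Set ((tensKern hA F E).pre.Cpl c), S = {ζ | ∃ p ∈ (fun p : (Σ b, E.E b) × ℕ =>
    (⟨F.obj p.1.1, tensτ hA F E p.1.2 (F.map (e p.1.1 p.2))⟩ : Σ b, (tensKern hA F E).pre.Cpl b)) ''
      (Ω ×ˢ Set.univ), ∃ x : C'.Hom c p.1, ζ = (tensKern hA F E).pre.cact p.2 x} := ⟨_, rfl⟩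
  rw [← hS]
  obtain ⟨M, hM⟩ : ∃ M, M = (Submodule.span 𝕜 S).topologicalClosure := ⟨_, rfl⟩
  have hMc : IsClosed (M : Set ((tensKern hA F E).pre.Cpl c)) := by
    rw [hM]; exact Submodule.isClosed_topologicalClosure _
  have h1 : ∀ p ∈ Ω, ∀ y : C'.Hom c (F.obj p.1), ∀ n,
      tensτ hA F E p.2 (C'.comp (F.map (e p.1 n)) y) ∈ M := fun p hp y n => by
    rw [hM]
    refine Submodule.le_topologicalClosure _ (Submodule.subset_span ?_)
    rw [hS]
    exact ⟨_, ⟨(p, n), ⟨hp, trivial⟩, rfl⟩, y, (cact_tensτ hA F E _ _ _).symm⟩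
  have h2 : ∀ p ∈ Ω, ∀ (a : C.Obj) (x : C.Hom a p.1) (y : C'.Hom c (F.obj a)),
      tensτ hA F E (E.act p.2 x) y ∈ M := fun p hp a x y => by
    rw [tensτ_act]
    have hc : Continuous fun z : C.Hom a p.1 => tensτ hA F E p.2 (C'.comp (F.map z) y) :=
      AddMonoidHomClass.continuous_of_bound
        (tensτ hA F E p.2 ∘ₗ C'.comp.flip y ∘ₗ F.map (a := a) (b := p.1)) (‖p.2‖ * ‖y‖) fun z => by
        refine (norm_tensτ_le hA F E p.2 (C'.comp (F.map z) y)).trans ?_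
        rw [mul_assoc, mul_comm ‖y‖]
        gcongr
        refine (PreCStar.norm_comp_le _ _).trans ?_
        gcongr
        exact F.norm_map_le _
    have h3 := (hc.tendsto x).comp (HasApprox.tendsto_left (fun b z => (hA' p.1 b z).2) x)
    refine hMc.mem_of_tendsto h3 (Filter.Eventually.of_forall fun n => ?_)
    have h4 := h1 p hp (C'.comp (F.map x) y) n
    rwa [← C'.assoc, ← F.map_comp] at h4
  have h3 : ∀ (b : C.Obj) (η : E.E b) (y : C'.Hom c (F.obj b)), tensτ hA F E η y ∈ M :=
    fun b η y => by
    have hc : Continuous fun η => tensτ hA F E η y :=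
      AddMonoidHomClass.continuous_of_bound ((tensτ hA F E).flip y) ‖y‖ fun η =>
        (norm_tensτ_le hA F E η y).trans_eq (mul_comm _ _)
    refine closure_minimal (fun η hη => ?_) (hMc.preimage hc) (hE b η)
    have : Submodule.span 𝕜 {ζ : E.E b | ∃ p ∈ Ω, ∃ x : C.Hom b p.1, ζ = E.act p.2 x} ≤
        M.comap ((tensτ hA F E).flip y) := Submodule.span_le.mpr (by
      rintro _ ⟨p, hp, x, rfl⟩
      exact h2 p hp b x y)
    exact this hη
  intro η
  have h4 : Submodule.span 𝕜 (Set.range ((tensKern hA F E).δ (a := c))) ≤ M := Submodule.span_le.mpr (by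
    rintro _ ⟨⟨b, ξ, y⟩, rfl⟩
    exact h3 b ξ y)
  have h5 := closure_minimal h4 hMc ((tensKern hA F E).total_δ c η)
  rw [hM] at h5
  exact h5

/-- The tensor product of a Hilbert module with a functor. -/
def tensMod : HilbMod C' := (tensKern hA F E).pre.toHilb (tens_countably_generated hA F E)

/-- The universal elementary tensors. -/
def tensor : Tensor F E (tensMod hA F E) where
  τ := tensτ hA F E
  inner_τ := cinner_tensτ hA F E
  act_τ := cact_tensτ hA F E
  grade_τ η y := (tensKern hA F E).cgrade_δ _
  dense c ζ := closure_mono (Submodule.span_mono (by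
    rintro _ ⟨⟨b, η, y⟩, rfl⟩; exact ⟨b, η, y, rfl⟩)) ((tensKern hA F E).total_δ c ζ)

end Tens

end
end CStarDescent

namespace CStarDescent

noncomputable section

open Filter (Tendsto atTop)
open GStarCat

variable {𝕜 : Type} [RCLike 𝕜]

/-! ## Operators on tensor products -/

theorem le_of_pow_two_pow_le {a b c : ℝ} (hb : 0 ≤ b)
    (h : ∀ m : ℕ, a ^ 2 ^ m ≤ c * b ^ 2 ^ m) : a ≤ b := by
  by_contra! hab
  rcases hb.eq_or_lt with rfl | hb
  · have := h 0
    simp at this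
    linarith
  · have h1 : 1 < a / b := (one_lt_div hb).mpr hab
    obtain ⟨n, hn⟩ := pow_unbounded_of_one_lt c h1
    have h2 := h n
    rw [← div_le_iff₀ (by positivity), ← div_pow] at h2
    exact absurd (hn.trans_le ((pow_le_pow_right₀ h1.le Nat.lt_two_pow_self.le).trans h2))
      (lt_irrefl _)

theorem HilbMod.inner_linearCombination_congr {C : GStarCat.{v, w} 𝕜} {E F : HilbMod C} {J J' : Type*}
    {a b : C.Obj} {κ : J → E.E b} {κ' : J' → E.E a} {μ : J → F.E b} {μ' : J' → F.E a}
    (h : ∀ q p, E.inner (κ q) (κ' p) = F.inner (μ q) (μ' p)) (w : J →₀ 𝕜) (v : J' →₀ 𝕜) :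
    E.inner (Finsupp.linearCombination 𝕜 κ w) (Finsupp.linearCombination 𝕜 κ' v) =
      F.inner (Finsupp.linearCombination 𝕜 μ w) (Finsupp.linearCombination 𝕜 μ' v) := by
  induction w using Finsupp.induction_linear with
  | zero => simp
  | add w w' h h' => simp only [map_add, LinearMap.add_apply, h, h']
  | single q c =>
    induction v using Finsupp.induction_linear with
    | zero => simp
    | add w w' h h' => simp only [map_add, h, h']
    | single p d =>
      simp only [Finsupp.linearCombination_single, map_smulₛₗ, LinearMap.smul_apply, h]

namespace Op

variable {C : GStarCat.{v, w} 𝕜} [IsCStar C] {E F : HilbMod C}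

/-- The rank one operator `ζ ↦ η ⟨ξ, ζ⟩`. -/
def rankOne {b : C.Obj} (η : F.E b) (ξ : E.E b) : Op E F where
  toFun := F.act η ∘ₗ E.inner ξ
  adj := E.act ξ ∘ₗ F.inner η
  inner_adj θ ζ := by
    change F.inner θ (F.act η (E.inner ξ ζ)) = E.inner (E.act ξ (F.inner η θ)) ζ
    rw [F.inner_act, ← E.inner_star ζ (E.act ξ _), E.inner_act, C.star_comp, E.inner_star,
      F.inner_star]
  bdd := by
    refine ⟨‖η‖ * ‖ξ‖, by positivity, fun {a} ζ => ?_, fun {a} ζ => ?_⟩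
    · refine (F.norm_act_le η (E.inner ξ ζ)).trans ?_
      rw [mul_assoc]
      gcongr
      exact E.norm_inner_le _ _
    · refine (E.norm_act_le ξ (F.inner η ζ)).trans ?_
      rw [mul_comm ‖η‖, mul_assoc]
      gcongr
      exact F.norm_inner_le _ _

theorem rankOne_apply {a b : C.Obj} (η : F.E b) (ξ : E.E b) (ζ : E.E a) :
    (rankOne η ξ).toFun ζ = F.act η (E.inner ξ ζ) := rfl

theorem rankOne_mem {b : C.Obj} (η : F.E b) (ξ : E.E b) : rankOne η ξ ∈ compacts E F :=
  Submodule.le_topologicalClosure _ (Submodule.subset_span ⟨b, η, ξ, fun _ _ => rfl⟩)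

theorem norm_rankOne_le {b : C.Obj} (η : F.E b) (ξ : E.E b) : ‖rankOne η ξ‖ ≤ ‖η‖ * ‖ξ‖ :=
  norm_le_of_bd (bd_of_toFun _ (by positivity) fun ζ => by
    rw [rankOne_apply]
    refine (F.norm_act_le η (E.inner ξ ζ)).trans ?_
    rw [mul_assoc]
    gcongr
    exact E.norm_inner_le _ _)

theorem Bd.mono {T : Op E F} {K L : ℝ} (h : T.Bd K) (hKL : K ≤ L) : T.Bd L :=
  ⟨h.1.trans hKL, fun η => (h.2.1 η).trans (by gcongr), fun η => (h.2.2 η).trans (by gcongr)⟩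

end Op

namespace Tensor

variable {B : GStarCat.{v, w} 𝕜} {B' : GStarCat.{v', w'} 𝕜} [IsCStar B] [IsCStar B']
  {F : GFunctor B B'} {E E₁ E₂ : HilbMod B} {E' E₁' E₂' : HilbMod B'}

/-- The index set of the elementary tensors. -/
abbrev Ix (F : GFunctor B B') (E : HilbMod B) (c : B'.Obj) := Σ b : B.Obj, E.E b × B'.Hom c (F.obj b)

/-- The elementary tensor with a given index. -/
abbrev el (t : Tensor F E E') {c : B'.Obj} (p : Ix F E c) : E'.E c := t.τ p.2.1 p.2.2

theorem total (t : Tensor F E E') (c : B'.Obj) : Total 𝕜 (t.el (c := c)) := fun ζ =>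
  closure_mono (Submodule.span_mono (by rintro _ ⟨b, η, y, rfl⟩; exact ⟨⟨b, η, y⟩, rfl⟩))
    (t.dense c ζ)

theorem norm_τ_le (t : Tensor F E E') {b : B.Obj} {c : B'.Obj} (η : E.E b)
    (y : B'.Hom c (F.obj b)) : ‖t.τ η y‖ ≤ ‖η‖ * ‖y‖ := by
  refine (sq_le_sq₀ (norm_nonneg _) (by positivity)).mp ?_
  rw [mul_pow, E'.norm_sq, t.inner_τ, E.norm_sq]
  refine (PreCStar.norm_comp_le _ _).trans ?_
  rw [PreCStar.norm_star]
  refine (mul_le_mul_of_nonneg_left ((PreCStar.norm_comp_le _ _).trans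
    (mul_le_mul_of_nonneg_right (F.norm_map_le _) (norm_nonneg _))) (norm_nonneg _)).trans_eq ?_
  ring

theorem τ_act (t : Tensor F E E') {a b : B.Obj} {c : B'.Obj} (η : E.E b) (x : B.Hom a b)
    (y : B'.Hom c (F.obj a)) : t.τ (E.act η x) y = t.τ η (B'.comp (F.map x) y) := by
  refine E'.ext_of_total (t.total c) fun p => ?_
  rw [t.inner_τ, t.inner_τ, E.inner_act, F.map_comp, B'.assoc]

theorem exists_map_bd (t : Tensor F E E') (t₁ : Tensor F E₁ E₁') (T : Op E E₁) {c : B'.Obj}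
    (v : Ix F E c →₀ 𝕜) :
    ‖Finsupp.linearCombination 𝕜 (fun p => t₁.τ (T.toFun p.2.1) p.2.2) v‖ ≤
      ‖T‖ * ‖Finsupp.linearCombination 𝕜 t.el v‖ := by
  let P : ∀ b, Module.End 𝕜 (E.E b) := fun b => (T.star.comp T).toFun
  have hP : ∀ n {a b} (η : E.E b) (ξ : E.E a),
      E.inner ((P b ^ n) η) ξ = E.inner η ((P a ^ n) ξ) := fun n => by
    induction n with
    | zero => intro a b η ξ; simp
    | succ n ih =>
      intro a b η ξ
      rw [pow_succ', pow_succ, Module.End.mul_apply, Module.End.mul_apply, ← ih]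
      exact (T.star.comp T).inner_adj' _ _
  have hPn : ∀ n {b} (η : E.E b), ‖(P b ^ n) η‖ ≤ (‖T‖ ^ 2) ^ n * ‖η‖ := fun n => by
    induction n with
    | zero => intro b η; simp
    | succ n ih =>
      intro b η
      rw [pow_succ' (P b), Module.End.mul_apply, pow_succ', mul_assoc]
      have h1 := (T.star.comp T).bd_norm.2.1 ((P b ^ n) η)
      refine h1.trans (mul_le_mul ?_ (ih η) (norm_nonneg _) (by positivity))
      exact Op.norm_le_of_bd (sq ‖T‖ ▸ T.bd_norm.star.comp T.bd_norm)
  let f : ℕ → E'.E c := fun n =>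
    Finsupp.linearCombination 𝕜 (fun p : Ix F E c => t.τ ((P _ ^ n) p.2.1) p.2.2) v
  have hf0 : f 0 = Finsupp.linearCombination 𝕜 t.el v := rfl
  have hff : ∀ n, ‖f n‖ ^ 2 ≤ ‖f 0‖ * ‖f (2 * n)‖ := fun n => by
    rw [E'.norm_sq]
    refine (congrArg norm ?_).trans_le (E'.norm_inner_le (f 0) (f (2 * n)))
    refine HilbMod.inner_linearCombination_congr (fun q p => ?_) v v
    rw [t.inner_τ, t.inner_τ, hP, two_mul, pow_add, Module.End.mul_apply, pow_zero,
      Module.End.one_apply]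
  have hfn : ∀ n, ‖f n‖ ≤ (v.sum fun p s => ‖s‖ * (‖p.2.1‖ * ‖p.2.2‖)) * (‖T‖ ^ 2) ^ n := fun n => by
    simp only [f, Finsupp.linearCombination_apply, Finsupp.sum, Finset.sum_mul]
    refine norm_sum_le_of_le _ fun p _ => ?_
    rw [norm_smul, mul_assoc, mul_assoc]
    gcongr
    refine (t.norm_τ_le _ _).trans ((mul_le_mul_of_nonneg_right (hPn n _) (norm_nonneg _)).trans_eq ?_)
    ring
  have h1 : ‖f 1‖ ≤ ‖T‖ ^ 2 * ‖f 0‖ := by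
    by_cases h0 : ‖f 0‖ = 0
    · have := hff 1
      rw [h0, zero_mul] at this
      rw [h0, mul_zero]
      nlinarith [norm_nonneg (f 1)]
    · have h0' : 0 < ‖f 0‖ := lt_of_le_of_ne (norm_nonneg _) (Ne.symm h0)
      have h2 : ∀ m : ℕ, (‖f 1‖ / ‖f 0‖) ^ 2 ^ m ≤ ‖f (2 ^ m)‖ / ‖f 0‖ := fun m => by
        induction m with
        | zero => simp
        | succ m ih =>
          rw [pow_succ, pow_mul]
          refine (pow_le_pow_left₀ (by positivity) ih 2).trans ?_
          rw [div_pow, div_le_div_iff₀ (by positivity) h0', mul_comm (2 ^ m) 2]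
          nlinarith [hff (2 ^ m)]
      rw [← div_le_iff₀ h0']
      refine le_of_pow_two_pow_le (c := (v.sum fun p s => ‖s‖ * (‖p.2.1‖ * ‖p.2.2‖)) / ‖f 0‖)
        (by positivity) fun m => (h2 m).trans ?_
      rw [div_mul_eq_mul_div]
      gcongr
      exact hfn _
  refine (sq_le_sq₀ (norm_nonneg _) (by positivity)).mp ?_
  have h2 : E₁'.inner (Finsupp.linearCombination 𝕜 (fun p => t₁.τ (T.toFun p.2.1) p.2.2) v)
      (Finsupp.linearCombination 𝕜 (fun p => t₁.τ (T.toFun p.2.1) p.2.2) v) =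
      E'.inner (f 0) (f 1) :=
    HilbMod.inner_linearCombination_congr (fun q p => by
      rw [t₁.inner_τ, t.inner_τ, T.inner_adj', pow_zero, pow_one]; rfl) v v
  rw [E₁'.norm_sq, h2]
  refine (E'.norm_inner_le _ _).trans ?_
  rw [← hf0]
  nlinarith [norm_nonneg (f 0)]

theorem exists_map (t : Tensor F E E') (t₁ : Tensor F E₁ E₁') (T : Op E E₁) :
    ∃ R : Op E' E₁', R.Bd ‖T‖ ∧ ∀ {b : B.Obj} {c : B'.Obj} (η : E.E b) (y : B'.Hom c (F.obj b)),
      R.toFun (t.τ η y) = t₁.τ (T.toFun η) y := by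
  obtain ⟨R, h, h1, -⟩ := Op.exists_of_total (κ := fun {c} => t.el (c := c)) t.total
    (μ := fun {c} => t₁.el (c := c)) t₁.total (fun p => t₁.τ (T.toFun p.2.1) p.2.2)
    (fun p => t.τ (T.adj p.2.1) p.2.2)
    (fun q p => by rw [t₁.inner_τ, t.inner_τ, T.inner_adj]) (norm_nonneg T)
    (fun c v => exists_map_bd t t₁ T v)
  exact ⟨R, h, fun {b c} η y => h1 (a := c) ⟨b, η, y⟩⟩

/-- The operator `T ⊗ 1`. -/
def map (t : Tensor F E E') (t₁ : Tensor F E₁ E₁') (T : Op E E₁) : Op E' E₁' :=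
  (exists_map t t₁ T).choose

theorem bd_map (t : Tensor F E E') (t₁ : Tensor F E₁ E₁') {T : Op E E₁} {K : ℝ} (h : T.Bd K) :
    (map t t₁ T).Bd K :=
  (exists_map t t₁ T).choose_spec.1.mono (Op.norm_le_of_bd h)

@[simp] theorem map_τ (t : Tensor F E E') (t₁ : Tensor F E₁ E₁') (T : Op E E₁) {b : B.Obj}
    {c : B'.Obj} (η : E.E b) (y : B'.Hom c (F.obj b)) :
    (map t t₁ T).toFun (t.τ η y) = t₁.τ (T.toFun η) y :=
  (exists_map t t₁ T).choose_spec.2 η y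

theorem op_ext (t : Tensor F E E') {S T : Op E' E₁'}
    (h : ∀ {b : B.Obj} {c : B'.Obj} (η : E.E b) (y : B'.Hom c (F.obj b)),
      S.toFun (t.τ η y) = T.toFun (t.τ η y)) : S = T :=
  Op.ext_of_total t.total fun _ p => h p.2.1 p.2.2

theorem map_comp (t : Tensor F E E') (t₁ : Tensor F E₁ E₁') (t₂ : Tensor F E₂ E₂') (S : Op E₁ E₂)
    (T : Op E E₁) : map t t₂ (S.comp T) = (map t₁ t₂ S).comp (map t t₁ T) :=
  t.op_ext fun η y => by
    rw [map_τ]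
    change _ = (map t₁ t₂ S).toFun ((map t t₁ T).toFun _)
    rw [map_τ, map_τ]; rfl

theorem map_star (t : Tensor F E E') (t₁ : Tensor F E₁ E₁') (T : Op E E₁) :
    map t₁ t T.star = (map t t₁ T).star :=
  t₁.op_ext fun {b c} η y => E'.ext_of_total (t.total c) fun p => by
    change _ = E'.inner _ ((map t t₁ T).adj _)
    rw [← Op.inner_adj', map_τ, map_τ, t.inner_τ, t₁.inner_τ, T.inner_adj']; rfl

theorem map_grade (t : Tensor F E E') (t₁ : Tensor F E₁ E₁') (T : Op E E₁) :
    map t t₁ T.grade = (map t t₁ T).grade :=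
  t.op_ext fun η y => by
    rw [map_τ]
    change _ = E₁'.grade ((map t t₁ T).toFun (E'.grade _))
    rw [t.grade_τ, map_τ, t₁.grade_τ, B'.grade_grade]; rfl

theorem map_add (t : Tensor F E E') (t₁ : Tensor F E₁ E₁') (S T : Op E E₁) :
    map t t₁ (S + T) = map t t₁ S + map t t₁ T :=
  t.op_ext fun η y => by
    rw [map_τ]
    change t₁.τ (S.toFun η + T.toFun η) y = (map t t₁ S).toFun _ + (map t t₁ T).toFun _
    rw [map_τ, map_τ, _root_.map_add]; rfl

theorem map_smul (t : Tensor F E E') (t₁ : Tensor F E₁ E₁') (r : 𝕜) (T : Op E E₁) :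
    map t t₁ (r • T) = r • map t t₁ T :=
  t.op_ext fun η y => by
    rw [map_τ]
    change t₁.τ (r • T.toFun η) y = r • (map t t₁ T).toFun _
    rw [map_τ, _root_.map_smul]; rfl

/-- The linear map `T ↦ T ⊗ 1`. -/
def mapₗ (t : Tensor F E E') (t₁ : Tensor F E₁ E₁') : Op E E₁ →ₗ[𝕜] Op E' E₁' where
  toFun := map t t₁
  map_add' := map_add t t₁
  map_smul' := map_smul t t₁

theorem norm_map_le (t : Tensor F E E') (t₁ : Tensor F E₁ E₁') (T : Op E E₁) :
    ‖map t t₁ T‖ ≤ ‖T‖ := Op.norm_le_of_bd (bd_map t t₁ T.bd_norm)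

theorem map_mem_compacts (hB : HasApprox B) (t : Tensor F E E') (t₁ : Tensor F E₁ E₁') {T : Op E E₁}
    (hT : T ∈ Op.compacts E E₁) : map t t₁ T ∈ Op.compacts E' E₁' := by
  have hc : Continuous (mapₗ t t₁) := AddMonoidHomClass.continuous_of_bound _ 1 fun T => by
    rw [one_mul]; exact norm_map_le t t₁ T
  have hcl : IsClosed (Op.compacts E' E₁' : Set (Op E' E₁')) := Submodule.isClosed_topologicalClosure _
  suffices h : Submodule.span 𝕜 {R : Op E E₁ | R.IsRankOne} ≤
      (Op.compacts E' E₁').comap (mapₗ t t₁) from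
    closure_minimal h (hcl.preimage hc) hT
  refine Submodule.span_le.mpr ?_
  rintro R ⟨b, η, ξ, hR⟩
  obtain ⟨e, he, hA⟩ := hB b
  have h1 := E₁.tendsto_act he (fun x => (hA b x).1) η
  have h2 := E₁.tendsto_act (e := fun n => B.star (e n))
    (fun n => by rw [PreCStar.norm_star]; exact he n) (fun x => (hA b x).2) η
  have h3 : Tendsto (fun n => E₁.act (E₁.act η (e n)) (B.star (e n))) atTop (𝓝 η) := by
    have h4 : Tendsto (fun n => E₁.act (E₁.act η (e n) - η) (B.star (e n))) atTop (𝓝 0) := by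
      refine squeeze_zero_norm (fun n => ?_) (tendsto_iff_norm_sub_tendsto_zero.mp h1)
      refine (E₁.norm_act_le _ _).trans (mul_le_of_le_one_right (norm_nonneg _) ?_)
      rw [PreCStar.norm_star]; exact he n
    have h5 := h4.add h2
    rw [zero_add] at h5
    refine h5.congr fun n => ?_
    rw [map_sub, LinearMap.sub_apply, sub_add_cancel]
  have h4 : Tendsto (fun n => Op.rankOne (E₁.act (E₁.act η (e n)) (B.star (e n))) ξ) atTop
      (𝓝 R) := by
    rw [tendsto_iff_norm_sub_tendsto_zero] at h3 ⊢
    have h5 := h3.mul_const ‖ξ‖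
    rw [zero_mul] at h5
    refine squeeze_zero (fun _ => norm_nonneg _) (fun n => ?_) h5
    refine (congrArg norm ?_).trans_le (Op.norm_rankOne_le _ ξ)
    refine Op.ext fun a ζ => ?_
    simp [hR, Op.rankOne_apply]
  refine hcl.mem_of_tendsto ((hc.tendsto R).comp h4) (Filter.Eventually.of_forall fun n => ?_)
  have h5 : map t t₁ (Op.rankOne (E₁.act (E₁.act η (e n)) (B.star (e n))) ξ) =
      Op.rankOne (t₁.τ η (F.map (e n))) (t.τ ξ (F.map (e n))) := t.op_ext fun ζ y => by
    rw [map_τ, Op.rankOne_apply, Op.rankOne_apply, t.inner_τ, t₁.act_τ, τ_act, τ_act, τ_act,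
      F.map_star]
  exact show map t t₁ _ ∈ Op.compacts E' E₁' from h5 ▸ Op.rankOne_mem _ _

end Tensor

end
end CStarDescent

namespace CStarDescent

noncomputable section

open GStarCat

variable {𝕜 : Type} [RCLike 𝕜]

/-! ## Functors between quotient categories -/

/-- Tensor products of bounded families of operators. -/
def tensFam {I : Type*} {C C' : I → GStarCat.{v, w} 𝕜}
    [∀ i, IsCStar (C i)] [∀ i, IsCStar (C' i)] {F : ∀ i, GFunctor (C i) (C' i)}
    {Ob : Type*} {Ob' : Type*} (o : Ob → ∀ i, HilbMod (C i)) (o' : Ob' → ∀ i, HilbMod (C' i))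
    (φ : Ob → Ob') (t : ∀ X i, Tensor (F i) (o X i) (o' (φ X) i)) :
    GFunctor (FamCat C o) (FamCat C' o') where
  obj := φ
  map {X Y} :=
    show Fam (o X) (o Y) →ₗ[𝕜] Fam (o' (φ X)) (o' (φ Y)) from
    { toFun := fun T => ⟨fun i => Tensor.map (t X i) (t Y i) (T.1 i), by
        obtain ⟨K, hK, h⟩ := T.2
        exact ⟨K, hK, fun i => Tensor.bd_map _ _ (h i)⟩⟩
      map_add' := fun _ _ => Subtype.ext (funext fun i => Tensor.map_add _ _ _ _)
      map_smul' := fun _ _ => Subtype.ext (funext fun i => Tensor.map_smul _ _ _ _) }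
  map_comp {X Y Z} _ _ := Subtype.ext (funext fun i => Tensor.map_comp (t X i) (t Y i) (t Z i) _ _)
  map_star _ := Subtype.ext (funext fun i => Tensor.map_star _ _ _)
  map_grade _ := Subtype.ext (funext fun i => Tensor.map_grade _ _ _)
  norm_map_le _ := Fam.norm_le_of_bd _ _ fun _ h => ⟨h.1, fun i => Tensor.bd_map _ _ (h.2 i)⟩

theorem Tensor.map_sub {B : GStarCat.{v, w} 𝕜} {B' : GStarCat.{v', w'} 𝕜} [IsCStar B] [IsCStar B']
    {F : GFunctor B B'} {E E₁ : HilbMod B} {E' E₁' : HilbMod B'} (t : Tensor F E E')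
    (t₁ : Tensor F E₁ E₁') (S T : Op E E₁) : map t t₁ (S - T) = map t t₁ S - map t t₁ T :=
  _root_.map_sub (mapₗ t t₁) S T

namespace Bimod

variable {A : GStarCat.{v'', w''} 𝕜} {B : GStarCat.{v, w} 𝕜} {B' : GStarCat.{v', w'} 𝕜}
  [IsCStar B] [IsCStar B'] {F : GFunctor B B'} {E E₁ : Bimod A B} {E' E₁' : Bimod A B'}
  (t : ∀ p, Tensor F (E.fiber p) (E'.fiber p)) (t₁ : ∀ p, Tensor F (E₁.fiber p) (E₁'.fiber p))

theorem Comm.tens (hB : HasApprox B)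
    (h : ∀ {p q : A.Obj} (x : A.Hom p q), E'.op x = Tensor.map (t p) (t q) (E.op x))
    (h₁ : ∀ {p q : A.Obj} (x : A.Hom p q), E₁'.op x = Tensor.map (t₁ p) (t₁ q) (E₁.op x))
    {T : ∀ p, Op (E.fiber p) (E₁.fiber p)} (hT : Comm E E₁ T) :
    Comm E' E₁' fun p => Tensor.map (t p) (t₁ p) (T p) := by
  intro p q x
  have := Tensor.map_mem_compacts hB (t p) (t₁ q) (hT x)
  rwa [gcomm, Tensor.map_sub, Tensor.map_sub, Tensor.map_comp (t p) (t₁ p) (t₁ q),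
    Tensor.map_comp (t p) (t q) (t₁ q), Tensor.map_comp (t p) (t q) (t₁ q), Tensor.map_grade,
    ← h, ← h, ← h₁] at this

theorem Cpt.tens (hB : HasApprox B)
    (h : ∀ {p q : A.Obj} (x : A.Hom p q), E'.op x = Tensor.map (t p) (t q) (E.op x))
    (h₁ : ∀ {p q : A.Obj} (x : A.Hom p q), E₁'.op x = Tensor.map (t₁ p) (t₁ q) (E₁.op x))
    {T : ∀ p, Op (E.fiber p) (E₁.fiber p)} (hT : Cpt E E₁ T) :
    Cpt E' E₁' fun p => Tensor.map (t p) (t₁ p) (T p) := by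
  intro p q x
  have h2 := Tensor.map_mem_compacts hB (t p) (t₁ q) (hT x).1
  have h3 := Tensor.map_mem_compacts hB (t p) (t₁ q) (hT x).2
  rw [Tensor.map_comp (t p) (t₁ p) (t₁ q), ← h₁] at h2
  rw [Tensor.map_comp (t p) (t q) (t₁ q), ← h] at h3
  exact ⟨h2, h3⟩

/-- Even operators intertwining the actions have vanishing graded commutators. -/
theorem comm_of_intertwine {U : ∀ p, Op (E.fiber p) (E₁.fiber p)} (hg : ∀ p, (U p).grade = U p)
    (hop : ∀ {p q : A.Obj} (a : A.Hom p q), (U q).comp (E.op a) = (E₁.op a).comp (U p)) :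
    Comm E E₁ U := by
  intro p q a
  have h1 : gcomm a (U p) (U q) = 0 := by
    refine Op.ext fun b η => ?_
    have h3 : (U q).toFun ((E.op a).toFun η) = (E₁.op a).toFun ((U p).toFun η) :=
      congrArg (fun T => T.toFun η) (hop a)
    rw [op_split, _root_.map_add] at h3
    simp only [gcomm, hg]
    simp [← h3]
  rw [h1]
  exact zero_mem _

end Bimod

/-- A natural isomorphism given by unitaries intertwining representatives. -/
theorem QD.natIso {X : GStarCat.{v', w'} 𝕜} {A : GStarCat.{v'', w''} 𝕜} {B : GStarCat.{v, w} 𝕜}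
    [IsCStar B] (F G : GFunctor X (QD A B))
    (U : ∀ (x : X.Obj) (p : A.Obj),
      Op (Bimod.fiber (F.obj x : Bimod A B) p) (Bimod.fiber (G.obj x : Bimod A B) p))
    (hU : ∀ x p, (U x p).IsUni) (hg : ∀ x p, (U x p).grade = U x p)
    (hop : ∀ (x : X.Obj) {p q : A.Obj} (a : A.Hom p q),
      (U x q).comp (Bimod.op (F.obj x : Bimod A B) a) =
        (Bimod.op (G.obj x : Bimod A B) a).comp (U x p))
    (hm : ∀ {x y : X.Obj} (f : X.Hom x y),
      ∃ (S : (DPair A B).P (F.obj x : Bimod A B) (F.obj y : Bimod A B))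
        (T : (DPair A B).P (G.obj x : Bimod A B) (G.obj y : Bimod A B)),
        F.map f = (DPair A B).cls S ∧ G.map f = (DPair A B).cls T ∧
          ∀ p, (U y p).comp (S.1.1 p) = (T.1.1 p).comp (U x p)) :
    NatIso F G := by
  have hcomm : ∀ x, Bimod.Comm (F.obj x : Bimod A B) (G.obj x : Bimod A B) (U x) :=
    fun x => Bimod.comm_of_intertwine (hg x) (hop x)
  let W : ∀ x, (DPair A B).P (F.obj x : Bimod A B) (G.obj x : Bimod A B) := fun x =>
    ⟨⟨U x, 1, zero_le_one, fun p => (hU x p).bd⟩, hcomm x⟩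
  refine ⟨fun x => (DPair A B).cls (W x), fun x => ⟨⟨fun Y T => ?_, fun Y T => ?_⟩,
    ⟨fun Y T => ?_, fun Y T => ?_⟩⟩, fun x => ?_, fun {x y} f => ?_⟩
  · obtain ⟨T, rfl⟩ := (DPair A B).cls_surj T
    exact congrArg (DPair A B).cls (Subtype.ext (Subtype.ext (funext fun p => Op.ext fun b η =>
      (hU x p).adj_toFun _)))
  · obtain ⟨T, rfl⟩ := (DPair A B).cls_surj T
    exact congrArg (DPair A B).cls (Subtype.ext (Subtype.ext (funext fun p => Op.ext fun b η =>
      congrArg (T.1.1 p).toFun ((hU x p).adj_toFun _))))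
  · obtain ⟨T, rfl⟩ := (DPair A B).cls_surj T
    exact congrArg (DPair A B).cls (Subtype.ext (Subtype.ext (funext fun p => Op.ext fun b η =>
      (hU x p).toFun_adj _)))
  · obtain ⟨T, rfl⟩ := (DPair A B).cls_surj T
    exact congrArg (DPair A B).cls (Subtype.ext (Subtype.ext (funext fun p => Op.ext fun b η =>
      congrArg (T.1.1 p).toFun ((hU x p).toFun_adj _))))
  · exact congrArg (DPair A B).cls (Subtype.ext (Subtype.ext (funext fun p => hg x p)))
  · obtain ⟨S, T, hS, hT, h⟩ := hm f
    rw [hS, hT]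
    exact congrArg (DPair A B).cls (Subtype.ext (Subtype.ext (funext h)))

/-! ## Change of coefficients -/

section

variable {C C' : GStarCat.{u, u} 𝕜} [IsCStar C] [IsCStar C'] (F : GFunctor C C')

/-- The functor `- ⊗_F C'` between categories of Hilbert modules. -/
def tensF (hC : HasApprox C) : GFunctor (LCat C) (LCat C') where
  obj E := tensMod hC F E
  map {E E₁} := Tensor.mapₗ (tensor hC F E) (tensor hC F E₁)
  map_comp {E E₁ E₂} S T := Tensor.map_comp (tensor hC F E) (tensor hC F E₁) (tensor hC F E₂) S T
  map_star {E E₁} T := Tensor.map_star (tensor hC F E) (tensor hC F E₁) T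
  map_grade {E E₁} T := Tensor.map_grade (tensor hC F E) (tensor hC F E₁) T
  norm_map_le {E E₁} T := Tensor.norm_map_le (tensor hC F E) (tensor hC F E₁) T

theorem exists_isCoeffChange (hC : HasApprox C) (A : GStarCat.{v'', w''} 𝕜) :
    ∃ Ψ : GFunctor (QD A C) (QD A C'), IsCoeffChange F Ψ := by
  let t : ∀ (E : Bimod A C) (p : A.Obj),
      Tensor F (E.fiber p) (Bimod.fiber (GFunctor.comp E (tensF F hC) : Bimod A C') p) :=
    fun E p => tensor hC F (E.fiber p)
  have hop : ∀ (E : Bimod A C) {p q : A.Obj} (x : A.Hom p q),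
      Bimod.op (GFunctor.comp E (tensF F hC) : Bimod A C') x = Tensor.map (t E p) (t E q) (E.op x) :=
    fun _ _ _ _ => rfl
  let Θ := tensFam (F := fun _ : A.Obj => F) (Bimod.fiber (A := A) (B := C))
    (Bimod.fiber (A := A) (B := C')) (fun E => GFunctor.comp E (tensF F hC)) t
  have hP : ∀ {E E₁ : Bimod A C} {T : Fam E.fiber E₁.fiber}, T ∈ (DPair A C).P E E₁ →
      Θ.map T ∈ (DPair A C').P _ _ :=
    fun {E E₁ T} h => Bimod.Comm.tens (t E) (t E₁) hC (hop E) (hop E₁) h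
  refine ⟨(DPair A C).mapQ (DPair A C') Θ hP
    (fun {E E₁ T} h => Bimod.Cpt.tens (t E) (t E₁) hC (hop E) (hop E₁) h),
    t, fun E p q x b c η y => ?_, fun E E₁ T => ⟨⟨Θ.map T.1, hP T.2⟩, fun p b c η y => ?_, rfl⟩⟩
  · exact Tensor.map_τ (t E p) (t E q) _ η y
  · exact Tensor.map_τ (t E p) (t E₁ p) _ η y

end

/-! ## Equivariant change of coefficients -/

/-- Total families whose inner products correspond under a functor define a twisted isometry. -/
theorem exists_twist {C C' : GStarCat.{v, w} 𝕜} [IsCStar C] [IsCStar C'] (F : GFunctor C C')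
    {X : HilbMod C} {Y : HilbMod C'} {a : C.Obj} {J : Type*} {κ : J → X.E a} {μ : J → Y.E (F.obj a)}
    (hκ : Total 𝕜 κ) (h : ∀ p q, Y.inner (μ p) (μ q) = F.map (X.inner (κ p) (κ q))) :
    ∃ L : X.E a →L[𝕜] Y.E (F.obj a), (∀ p, L (κ p) = μ p) ∧
      ∀ η ξ, Y.inner (L η) (L ξ) = F.map (X.inner η ξ) := by
  have hl : ∀ v w : J →₀ 𝕜, Y.inner (Finsupp.linearCombination 𝕜 μ v)
      (Finsupp.linearCombination 𝕜 μ w) = F.map (X.inner (Finsupp.linearCombination 𝕜 κ v)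
        (Finsupp.linearCombination 𝕜 κ w)) := by
    intro v w
    induction v using Finsupp.induction_linear with
    | zero => simp
    | add w w' h h' => simp only [map_add, LinearMap.add_apply, h, h']
    | single q c =>
      induction w using Finsupp.induction_linear with
      | zero => simp
      | add w w' h h' => simp only [map_add, h, h']
      | single p d =>
        simp only [Finsupp.linearCombination_single, map_smulₛₗ, LinearMap.smul_apply, h,
          RingHom.id_apply]
  have hb : ∀ v : J →₀ 𝕜, ‖Finsupp.linearCombination 𝕜 μ v‖ ≤
      1 * ‖Finsupp.linearCombination 𝕜 κ v‖ := fun v => by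
    rw [one_mul]
    refine (sq_le_sq₀ (norm_nonneg _) (norm_nonneg _)).mp ?_
    rw [Y.norm_sq, X.norm_sq, hl]
    exact F.norm_map_le _
  obtain ⟨L, hL⟩ : ∃ L : X.E a →L[𝕜] Y.E (F.obj a), L = LinearMap.extendOfNorm
    (Finsupp.linearCombination 𝕜 μ) (Finsupp.linearCombination 𝕜 κ) := ⟨_, rfl⟩
  have hLv : ∀ v : J →₀ 𝕜, L (Finsupp.linearCombination 𝕜 κ v) = Finsupp.linearCombination 𝕜 μ v :=
    fun v => by rw [hL]; exact LinearMap.extendOfNorm_eq hκ.denseRange ⟨1, hb⟩ v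
  have hLp : ∀ p, L (κ p) = μ p := fun p => by simpa using hLv (Finsupp.single p 1)
  have hF : Continuous fun x : C.Hom a a => F.map x :=
    AddMonoidHomClass.continuous_of_bound F.map 1 fun x => by rw [one_mul]; exact F.norm_map_le x
  have h1 : ∀ p ξ, Y.inner (μ p) (L ξ) = F.map (X.inner (κ p) ξ) := fun p =>
    hκ.ext (f := Y.inner (μ p) ∘ₗ (L : X.E a →ₗ[𝕜] Y.E (F.obj a))) (g := F.map ∘ₗ X.inner (κ p))
      ((Y.continuous_inner_right _).comp L.continuous) (hF.comp (X.continuous_inner_right _))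
      fun q => by
        change Y.inner (μ p) (L (κ q)) = F.map (X.inner (κ p) (κ q))
        rw [hLp, h]
  refine ⟨L, hLp, fun η ξ => ?_⟩
  exact hκ.ext (f := Y.inner.flip (L ξ) ∘ₛₗ (L : X.E a →ₗ[𝕜] Y.E (F.obj a)))
    (g := F.map ∘ₛₗ X.inner.flip ξ)
    ((Y.continuous_inner_left _).comp L.continuous) (hF.comp (X.continuous_inner_left _))
    (fun q => by
      change Y.inner (L (κ q)) (L ξ) = F.map (X.inner (κ q) ξ)
      rw [hLp, h1]) η

section

variable {𝒢 : Type u} [Groupoid.{u} 𝒢] {A B B' : GCAlg 𝕜 𝒢} (β : GHom B B')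

theorem GCAlg.act_star_mul_mul {a b : 𝒢} (g : a ⟶ b) (y w z : B.alg a) :
    (B.act g (star y * (w * z)) : B.alg b) = star (B.act g y : B.alg b) * (B.act g w * B.act g z) := by
  rw [map_mul (B.act g).hom, map_mul (B.act g).hom, map_star (B.act g).hom]

theorem exists_tr (E : GMod A B) {a b : 𝒢} (g : a ⟶ b) {X : HilbMod (B'.alg a).cat}
    {Y : HilbMod (B'.alg b).cat} (t : Tensor (β.fib a) (E.mod a) X)
    (s : Tensor (β.fib b) (E.mod b) Y) :
    ∃ L : X.sp →L[𝕜] Y.sp, (∀ (η : (E.mod a).sp) (y : B'.alg a),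
        L (t.τ (b := CAlg.pt _) η y) = s.τ (b := CAlg.pt _) (E.tr g η) (B'.act g y : B'.alg b)) ∧
      ∀ η ξ, Y.inner (L η) (L ξ) = (B'.act g (X.inner η ξ : B'.alg a) : B'.alg b) := by
  have key : ∀ (η ξ : (E.mod a).sp) (y z : B'.alg a),
      Y.inner (s.τ (b := CAlg.pt _) (c := CAlg.pt _) (E.tr g η) (B'.act g y : B'.alg b))
        (s.τ (b := CAlg.pt _) (c := CAlg.pt _) (E.tr g ξ) (B'.act g z : B'.alg b)) =
      (B'.act g (X.inner (t.τ (b := CAlg.pt _) (c := CAlg.pt _) η y)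
        (t.τ (b := CAlg.pt _) (c := CAlg.pt _) ξ z) : B'.alg a) : B'.alg b) := fun η ξ y z => by
    have h1 : β.app b ((E.mod b).inner (E.tr g η) (E.tr g ξ) : B.alg b) =
        B'.act g (β.app a ((E.mod a).inner η ξ : B.alg a)) :=
      (congrArg (β.app b) (E.tr_inner g η ξ)).trans (β.equivariant g _)
    refine (s.inner_τ (a := CAlg.pt _) (b := CAlg.pt _) _ _ _ _).trans ?_
    refine (congrArg (fun w : B'.alg b => star (B'.act g y : B'.alg b) * (w * B'.act g z)) h1).trans ?_
    refine (B'.act_star_mul_mul g _ _ _).symm.trans ?_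
    exact congrArg (B'.act g) (t.inner_τ (a := CAlg.pt _) (b := CAlg.pt _) η y ξ z).symm
  obtain ⟨L, h1, h2⟩ := exists_twist (B'.act g).functor (X := X) (Y := Y) (a := CAlg.pt _)
    (t.total (CAlg.pt _))
    (μ := fun p => s.τ (b := CAlg.pt _) (E.tr g p.2.1) (B'.act g p.2.2 : B'.alg b))
    (fun p q => key p.2.1 q.2.1 p.2.2 q.2.2)
  exact ⟨L, fun η y => h1 ⟨CAlg.pt _, η, y⟩, h2⟩

variable (hB : B.SigmaUnital)

/-- The fibres of the tensor product of an equivariant bimodule with a coefficient algebra. -/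
def coeffMod (E : GMod A B) (a : 𝒢) : HilbMod (B'.alg a).cat :=
  tensMod (hB.hasApprox a) (β.fib a) (E.mod a)

/-- The elementary tensors of the fibres. -/
def coeffT (E : GMod A B) (a : 𝒢) : Tensor (β.fib a) (E.mod a) (coeffMod β hB E a) :=
  tensor (hB.hasApprox a) (β.fib a) (E.mod a)

/-- An elementary tensor of a fibre. -/
def coeffEl (E : GMod A B) {a : 𝒢} (η : (E.mod a).sp) (y : B'.alg a) : (coeffMod β hB E a).sp :=
  (coeffT β hB E a).τ (b := CAlg.pt _) η y

/-- Continuous linear maps agreeing on elementary tensors are equal. -/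
theorem coeff_ext (E : GMod A B) {a : 𝒢} {V : Type u} [AddCommGroup V] [Module 𝕜 V]
    [TopologicalSpace V] [T2Space V] (f g : (coeffMod β hB E a).sp →ₗ[𝕜] V)
    (hf : Continuous f) (hg : Continuous g)
    (h : ∀ η y, f (coeffEl β hB E η y) = g (coeffEl β hB E η y)) (ζ) : f ζ = g ζ :=
  ((coeffT β hB E a).total (CAlg.pt _)).ext hf hg (fun p => h p.2.1 p.2.2) ζ

/-- The action of the groupoid on the tensor product. -/
def coeffTr (E : GMod A B) {a b : 𝒢} (g : a ⟶ b) :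
    (coeffMod β hB E a).sp →L[𝕜] (coeffMod β hB E b).sp :=
  (exists_tr β E g (coeffT β hB E a) (coeffT β hB E b)).choose

theorem coeffTr_el (E : GMod A B) {a b : 𝒢} (g : a ⟶ b) (η : (E.mod a).sp) (y : B'.alg a) :
    coeffTr β hB E g (coeffEl β hB E η y) = coeffEl β hB E (E.tr g η) (B'.act g y) :=
  (exists_tr β E g (coeffT β hB E a) (coeffT β hB E b)).choose_spec.1 η y

theorem coeffTr_inner (E : GMod A B) {a b : 𝒢} (g : a ⟶ b) (η ξ : (coeffMod β hB E a).sp) :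
    (coeffMod β hB E b).inner (coeffTr β hB E g η) (coeffTr β hB E g ξ) =
      (B'.act g ((coeffMod β hB E a).inner η ξ : B'.alg a) : B'.alg b) :=
  (exists_tr β E g (coeffT β hB E a) (coeffT β hB E b)).choose_spec.2 η ξ

theorem coeffTr_id (E : GMod A B) {a : 𝒢} (ζ : (coeffMod β hB E a).sp) :
    coeffTr β hB E (𝟙 a) ζ = ζ :=
  coeff_ext β hB E (coeffTr β hB E (𝟙 a)).toLinearMap LinearMap.id
    (coeffTr β hB E (𝟙 a)).continuous continuous_id (fun η y => by
      refine (coeffTr_el β hB E (𝟙 a) η y).trans ?_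
      rw [E.tr_id, B'.act_id]; rfl) ζ

theorem coeffTr_comp (E : GMod A B) {a b c : 𝒢} (g : a ⟶ b) (h : b ⟶ c)
    (ζ : (coeffMod β hB E a).sp) :
    coeffTr β hB E (g ≫ h) ζ = coeffTr β hB E h (coeffTr β hB E g ζ) :=
  coeff_ext β hB E (coeffTr β hB E (g ≫ h)).toLinearMap
    ((coeffTr β hB E h).toLinearMap ∘ₗ (coeffTr β hB E g).toLinearMap)
    (coeffTr β hB E (g ≫ h)).continuous
    ((coeffTr β hB E h).continuous.comp (coeffTr β hB E g).continuous) (fun η y => by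
      change coeffTr β hB E (g ≫ h) _ = coeffTr β hB E h (coeffTr β hB E g _)
      rw [coeffTr_el, coeffTr_el, coeffTr_el, E.tr_comp, B'.act_comp]) ζ

theorem coeffTr_act (E : GMod A B) {a b : 𝒢} (g : a ⟶ b) (ζ : (coeffMod β hB E a).sp)
    (x : B'.alg a) : coeffTr β hB E g ((coeffMod β hB E a).act (a := CAlg.pt _) ζ x) =
      (coeffMod β hB E b).act (a := CAlg.pt _) (coeffTr β hB E g ζ) (B'.act g x : B'.alg b) :=
  coeff_ext β hB E ((coeffTr β hB E g).toLinearMap ∘ₗ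
      (coeffMod β hB E a).act.flip (x : (B'.alg a).cat.Hom (CAlg.pt _) (CAlg.pt _)))
    ((coeffMod β hB E b).act.flip (B'.act g x : (B'.alg b).cat.Hom (CAlg.pt _) (CAlg.pt _)) ∘ₗ
      (coeffTr β hB E g).toLinearMap)
    ((coeffTr β hB E g).continuous.comp (HilbMod.continuous_act_left _ _))
    ((HilbMod.continuous_act_left _ _).comp (coeffTr β hB E g).continuous) (fun η y => by
      have h1 : (coeffMod β hB E a).act (a := CAlg.pt _) (coeffEl β hB E η y) x =
          coeffEl β hB E η (y * x) := (coeffT β hB E a).act_τ (b := CAlg.pt _) η y x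
      have h2 : (coeffMod β hB E b).act (a := CAlg.pt _)
          (coeffEl β hB E (E.tr g η) (B'.act g y)) (B'.act g x : B'.alg b) =
          coeffEl β hB E (E.tr g η) (B'.act g y * B'.act g x) :=
        (coeffT β hB E b).act_τ (b := CAlg.pt _) _ _ _
      refine (congrArg (coeffTr β hB E g) h1).trans ((coeffTr_el β hB E g η _).trans ?_)
      refine Eq.trans ?_ (h2.symm.trans ?_)
      · rw [map_mul (B'.act g).hom]
      · exact congrArg (fun ζ => (coeffMod β hB E b).act (a := CAlg.pt _) ζ (B'.act g x : B'.alg b))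
          (coeffTr_el β hB E g η y).symm) ζ

theorem coeffTr_grade (E : GMod A B) {a b : 𝒢} (g : a ⟶ b) (ζ : (coeffMod β hB E a).sp) :
    coeffTr β hB E g ((coeffMod β hB E a).grade ζ) =
      (coeffMod β hB E b).grade (coeffTr β hB E g ζ) :=
  coeff_ext β hB E ((coeffTr β hB E g).toLinearMap ∘ₗ (coeffMod β hB E a).grade)
    ((coeffMod β hB E b).grade ∘ₗ (coeffTr β hB E g).toLinearMap)
    ((coeffTr β hB E g).continuous.comp (HilbMod.continuous_grade _))
    ((HilbMod.continuous_grade _).comp (coeffTr β hB E g).continuous) (fun η y => by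
      have h1 : (coeffMod β hB E a).grade (coeffEl β hB E η y) =
          coeffEl β hB E ((E.mod a).grade η) ((B'.alg a).grade y) :=
        (coeffT β hB E a).grade_τ (b := CAlg.pt _) η y
      have h2 : (coeffMod β hB E b).grade (coeffEl β hB E (E.tr g η) (B'.act g y)) =
          coeffEl β hB E ((E.mod b).grade (E.tr g η)) ((B'.alg b).grade (B'.act g y)) :=
        (coeffT β hB E b).grade_τ (b := CAlg.pt _) _ _
      refine (congrArg (coeffTr β hB E g) h1).trans ((coeffTr_el β hB E g _ _).trans ?_)
      refine Eq.trans ?_ (h2.symm.trans ?_)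
      · rw [E.tr_grade, (B'.act g).map_grade]
      · exact congrArg (coeffMod β hB E b).grade (coeffTr_el β hB E g η y).symm) ζ

/-- The left action on the fibres. -/
def coeffOp (E : GMod A B) {a : 𝒢} (x : A.alg a) :
    Op (coeffMod β hB E a) (coeffMod β hB E a) :=
  Tensor.map (coeffT β hB E a) (coeffT β hB E a) (E.op x)

theorem coeffOp_el (E : GMod A B) {a : 𝒢} (x : A.alg a) (η : (E.mod a).sp) (y : B'.alg a) :
    (coeffOp β hB E x).toFun (coeffEl β hB E η y) = coeffEl β hB E ((E.op x).toFun η) y :=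
  Tensor.map_τ (coeffT β hB E a) (coeffT β hB E a) (E.op x) (b := CAlg.pt _) η y

theorem coeffTr_op (E : GMod A B) {a b : 𝒢} (g : a ⟶ b) (x : A.alg a)
    (ζ : (coeffMod β hB E a).sp) :
    coeffTr β hB E g ((coeffOp β hB E x).toFun ζ) =
      (coeffOp β hB E (A.act g x : A.alg b)).toFun (coeffTr β hB E g ζ) :=
  coeff_ext β hB E ((coeffTr β hB E g).toLinearMap ∘ₗ (coeffOp β hB E x).toFun)
    ((coeffOp β hB E (A.act g x : A.alg b)).toFun ∘ₗ (coeffTr β hB E g).toLinearMap)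
    ((coeffTr β hB E g).continuous.comp (Op.continuous _))
    ((Op.continuous _).comp (coeffTr β hB E g).continuous) (fun η y => by
      change coeffTr β hB E g ((coeffOp β hB E x).toFun _) =
        (coeffOp β hB E (A.act g x : A.alg b)).toFun (coeffTr β hB E g _)
      rw [coeffOp_el, coeffTr_el, coeffTr_el, coeffOp_el]
      exact congrArg (fun ζ => coeffEl β hB E ζ (B'.act g y)) (E.tr_op g x η)) ζ

/-- The tensor product of an equivariant bimodule with a coefficient algebra. -/
def coeffG (E : GMod A B) : GMod A B' where
  bim a := GFunctor.comp (E.bim a) (tensF (β.fib a) (hB.hasApprox a))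
  tr g := (coeffTr β hB E g).toLinearMap
  tr_id := coeffTr_id β hB E
  tr_comp := coeffTr_comp β hB E
  tr_act := coeffTr_act β hB E
  tr_inner := coeffTr_inner β hB E
  tr_grade := coeffTr_grade β hB E
  tr_op := coeffTr_op β hB E

theorem conj_coeff {E E₁ : GMod A B} {a b : 𝒢} (g : a ⟶ b) (T : Op (E.mod a) (E₁.mod a)) :
    GMod.conj (E := coeffG β hB E) (F := coeffG β hB E₁) g
      (Tensor.map (coeffT β hB E a) (coeffT β hB E₁ a) T) =
    Tensor.map (coeffT β hB E b) (coeffT β hB E₁ b) (GMod.conj g T) := by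
  suffices h : ∀ (η : (E.mod b).sp) (y : B'.alg b), coeffTr β hB E₁ g ((Tensor.map (coeffT β hB E a) (coeffT β hB E₁ a) T).toFun
    (coeffTr β hB E (Groupoid.inv g) (coeffEl β hB E η y))) =
    (Tensor.map (coeffT β hB E b) (coeffT β hB E₁ b) (GMod.conj g T)).toFun (coeffEl β hB E η y) from
    (coeffT β hB E b).op_ext fun {_ _} η y => h η y
  intro η y
  have h1 : ∀ {a : 𝒢} (T : Op (E.mod a) (E₁.mod a)) (η : (E.mod a).sp) (y : B'.alg a),
      (Tensor.map (coeffT β hB E a) (coeffT β hB E₁ a) T).toFun (coeffEl β hB E η y) =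
        coeffEl β hB E₁ (T.toFun (a := CAlg.pt _) η) y := fun {a} T η y =>
    Tensor.map_τ (coeffT β hB E a) (coeffT β hB E₁ a) T (b := CAlg.pt _) η y
  rw [coeffTr_el, h1, coeffTr_el, h1, ← B'.act_comp, Groupoid.inv_comp, B'.act_id]
  rfl

theorem exists_isCoeffChangeG (hB : B.SigmaUnital) : ∃ Φ : GFunctor (QDG A B) (QDG A B'), IsCoeffChangeG β Φ := by
  let t : ∀ (E : GMod A B) (a : 𝒢),
      Tensor (β.fib a) (E.mod a) (GMod.mod (coeffG β hB E) a) := coeffT β hB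
  let Θ := tensFam (F := fun a : 𝒢 => β.fib a) (GMod.mod (A := A) (B := B))
    (GMod.mod (A := A) (B := B')) (coeffG β hB) t
  have hP : ∀ {E E₁ : GMod A B} {T : Fam E.mod E₁.mod}, T ∈ (DGPair A B).P E E₁ →
      Θ.map T ∈ (DGPair A B').P _ _ := fun {E E₁ T} h => by
    refine ⟨fun a => Bimod.Comm.tens (fun _ => t E a) (fun _ => t E₁ a) (hB.hasApprox a)
      (fun _ => rfl) (fun _ => rfl) (h.1 a), fun {a b} g x => ?_⟩
    have h1 := Tensor.map_mem_compacts (hB.hasApprox b) (t E b) (t E₁ b) (h.2 g x)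
    rw [Tensor.map_comp (t E b) (t E₁ b) (t E₁ b), Tensor.map_sub] at h1
    have h2 := conj_coeff β hB g (T.1 a)
    exact h2 ▸ h1
  refine ⟨(DGPair A B).mapQ (DGPair A B') Θ hP
    (fun {E E₁ T} h a => Bimod.Cpt.tens (fun _ => t E a) (fun _ => t E₁ a) (hB.hasApprox a)
      (fun _ => rfl) (fun _ => rfl) (h a)),
    t, fun E a x η y => coeffOp_el β hB E x η y, fun E a b g η y => coeffTr_el β hB E g η y,
    fun E E₁ T => ⟨⟨Θ.map T.1, hP T.2⟩, fun a η y => ?_, rfl⟩⟩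
  exact Tensor.map_τ (t E a) (t E₁ a) _ (b := CAlg.pt _) η y

end

end
end CStarDescent

namespace CStarDescent

noncomputable section

open GStarCat

variable {𝕜 : Type} [RCLike 𝕜]

/-! ## Localization of Hilbert bimodules at representations -/

/-- The one-dimensional Hilbert space. -/
abbrev LineH (𝕜 : Type) [RCLike 𝕜] : Type u := EuclideanSpace 𝕜 PUnit.{u + 1}

/-- The one-dimensional Hilbert space as an object. -/
def lineObj (𝕜 : Type) [RCLike 𝕜] : HilbObj.{u} 𝕜 := ⟨LineH 𝕜⟩

namespace LineH

/-- The unit vector. -/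
def e : LineH.{u} 𝕜 := EuclideanSpace.single PUnit.unit 1

theorem inner_e : inner 𝕜 (e : LineH.{u} 𝕜) e = 1 := by
  rw [e, EuclideanSpace.inner_single_left]; simp

theorem eq_smul (v : LineH.{u} 𝕜) : v = (inner 𝕜 (e : LineH.{u} 𝕜) v) • e := by
  ext i
  rw [e, EuclideanSpace.inner_single_left]; simp

theorem norm_e : ‖(e : LineH.{u} 𝕜)‖ = 1 := by
  have h : ‖(e : LineH.{u} 𝕜)‖ ^ 2 = 1 := by rw [@norm_sq_eq_re_inner 𝕜, inner_e, RCLike.one_re]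
  exact (pow_eq_one_iff_of_nonneg (norm_nonneg _) two_ne_zero).mp h

theorem norm_eq (S : LineH.{u} 𝕜 →L[𝕜] LineH.{u} 𝕜) : ‖S‖ = ‖inner 𝕜 e (S e)‖ := by
  have h1 : ‖S e‖ = ‖inner 𝕜 (e : LineH.{u} 𝕜) (S e)‖ := by
    conv_lhs => rw [eq_smul (S e)]
    rw [norm_smul, norm_e, mul_one]
  refine le_antisymm (S.opNorm_le_bound (norm_nonneg _) fun v => ?_) ?_
  · conv_lhs => rw [eq_smul v]
    rw [map_smul, norm_smul, h1, mul_comm]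
    refine mul_le_mul_of_nonneg_left ?_ (norm_nonneg _)
    refine (norm_inner_le_norm e v).trans_eq ?_
    rw [norm_e, one_mul]
  · rw [← h1]
    refine (S.le_opNorm _).trans_eq ?_
    rw [norm_e, mul_one]

/-- The operator mapping the unit vector to a given vector. -/
def ket {H : Type u} [NormedAddCommGroup H] [InnerProductSpace 𝕜 H] : H →ₗ[𝕜] LineH.{u} 𝕜 →L[𝕜] H where
  toFun v := (innerSL 𝕜 e).smulRight v
  map_add' v w := by ext; simp
  map_smul' c v := by ext; simp [smul_comm c]

theorem ket_e {H : Type u} [NormedAddCommGroup H] [InnerProductSpace 𝕜 H] (v : H) :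
    ket v (e : LineH.{u} 𝕜) = v := by
  simp [ket, norm_e]

end LineH

/-- The value of a Hilbert module at the one-dimensional Hilbert space. -/
def HilbMod.line (X : HilbMod (Hilb.{u} 𝕜)) : Type u := X.E (lineObj 𝕜)

section Line

variable (X : HilbMod (Hilb.{u} 𝕜))

instance : NormedAddCommGroup X.line := X.grp (lineObj 𝕜)
instance : NormedSpace 𝕜 X.line := X.mod (lineObj 𝕜)
instance : CompleteSpace X.line := X.complete (lineObj 𝕜)

/-- The operator-valued inner product on the line. -/
def HilbMod.lineInner : X.line →ₗ⋆[𝕜] X.line →ₗ[𝕜] LineH.{u} 𝕜 →L[𝕜] LineH.{u} 𝕜 :=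
  X.inner (a := lineObj 𝕜) (b := lineObj 𝕜)

theorem HilbMod.lineInner_pos (η : X.line) : ∃ y : LineH.{u} 𝕜 →L[𝕜] LineH.{u} 𝕜,
    X.lineInner η η = (ContinuousLinearMap.adjoint y).comp y :=
  X.inner_pos (a := lineObj 𝕜) η

theorem HilbMod.lineInner_symm (η ξ : X.line) :
    X.lineInner η ξ = ContinuousLinearMap.adjoint (X.lineInner ξ η) :=
  (X.inner_star (a := lineObj 𝕜) (b := lineObj 𝕜) ξ η).symm

theorem HilbMod.norm_sq_line (η : X.line) : ‖η‖ ^ 2 = ‖X.lineInner η η‖ :=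
  X.norm_sq (a := lineObj 𝕜) η

instance HilbMod.innerLine : InnerProductSpace 𝕜 X.line where
  inner := fun η ξ => Inner.inner 𝕜 LineH.e (X.lineInner η ξ LineH.e)
  norm_sq_eq_re_inner := fun η => by
    obtain ⟨y, h1⟩ := X.lineInner_pos η
    have h3 : Inner.inner 𝕜 (LineH.e : LineH.{u} 𝕜) (X.lineInner η η LineH.e) =
        ((‖y LineH.e‖ ^ 2 : ℝ) : 𝕜) := by
      rw [h1, ContinuousLinearMap.comp_apply, ContinuousLinearMap.adjoint_inner_right,
        inner_self_eq_norm_sq_to_K]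
      norm_cast
    rw [X.norm_sq_line, LineH.norm_eq, h3, RCLike.norm_ofReal, RCLike.ofReal_re,
      abs_of_nonneg (by positivity)]
  conj_inner_symm := fun η ξ => by
    rw [inner_conj_symm, X.lineInner_symm η ξ, ContinuousLinearMap.adjoint_inner_right]
  add_left := fun η ξ ζ => by
    rw [map_add, LinearMap.add_apply, add_apply, inner_add_right]
  smul_left := fun η ξ c => by
    rw [LinearMap.map_smulₛₗ, LinearMap.smul_apply, smul_apply, inner_smul_right]

theorem HilbMod.line_inner (η ξ : X.line) :
    Inner.inner 𝕜 η ξ = Inner.inner 𝕜 LineH.e (X.lineInner η ξ LineH.e) := rfl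

end Line

theorem Op.norm_apply_le {C : GStarCat.{v, w} 𝕜} {E F : HilbMod C} (T : Op E F) {a : C.Obj}
    (η : E.E a) : ‖T.toFun η‖ ≤ ‖T‖ * ‖η‖ := T.bd_norm.2.1 η

section OpLine

variable {X Y Z : HilbMod (Hilb.{u} 𝕜)}

/-- The action of an operator on the line, as a linear map. -/
def Op.lineₗ (T : Op X Y) : X.line →ₗ[𝕜] Y.line := T.toFun (a := lineObj 𝕜)

theorem Op.norm_lineₗ_le (T : Op X Y) (η : X.line) : ‖T.lineₗ η‖ ≤ ‖T‖ * ‖η‖ :=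
  T.norm_apply_le (a := lineObj 𝕜) η

/-- The action of an operator on the line. -/
def Op.line (T : Op X Y) : X.line →L[𝕜] Y.line := T.lineₗ.mkContinuous ‖T‖ T.norm_lineₗ_le

theorem Op.line_star (T : Op X Y) : T.star.line = ContinuousLinearMap.adjoint T.line := by
  rw [ContinuousLinearMap.eq_adjoint_iff]
  intro η ξ
  refine congrArg (fun S : LineH.{u} 𝕜 →L[𝕜] LineH.{u} 𝕜 => Inner.inner 𝕜 LineH.e (S LineH.e)) ?_
  exact (T.inner_adj (a := lineObj 𝕜) (b := lineObj 𝕜) η ξ).symm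

theorem Op.norm_line_le (T : Op X Y) : ‖T.line‖ ≤ ‖T‖ :=
  T.lineₗ.mkContinuous_norm_le (norm_nonneg _) _

theorem Op.line_comp (S : Op Y Z) (T : Op X Y) : (S.comp T).line = S.line.comp T.line := rfl

theorem Op.line_add (S T : Op X Y) : (S + T).line = S.line + T.line := rfl

theorem Op.line_smul (c : 𝕜) (T : Op X Y) : (c • T).line = c • T.line := rfl

end OpLine

/-- A bounded operator between modules with trivial gradings. -/
def Op.triv {C : GStarCat.{v, w} 𝕜} {E F : HilbMod C} (T : Op E F) : Op E.triv F.triv where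
  toFun := T.toFun
  adj := T.adj
  inner_adj := T.inner_adj
  bdd := T.bdd

theorem Op.norm_triv_le {C : GStarCat.{v, w} 𝕜} [IsCStar C] {E F : HilbMod C} (T : Op E F) :
    ‖T.triv‖ ≤ ‖T‖ := Op.norm_le_of_bd T.bd_norm

/-- A representation as a functor to Hilbert spaces. -/
def Repr.functor {B : CAlg.{u} 𝕜} (α : Repr B) : GFunctor B.cat.triv (Hilb.{u} 𝕜) where
  obj _ := ⟨α.H⟩
  map := fun {_ _} => (α.hom : B →ₗ[𝕜] (α.H →L[𝕜] α.H))
  map_comp x y := map_mul α.hom (show B from x) (show B from y)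
  map_star x := map_star α.hom (show B from x)
  map_grade _ := rfl
  norm_map_le := α.norm_le

section Localization

variable {A B : CAlg.{u} 𝕜} (α : Repr B) (hB : HasApprox B.cat)

/-- The tensor product of a Hilbert module with a representation, as a module over Hilbert
spaces. -/
def Repr.loc (X : HilbMod B.cat) : HilbMod (Hilb.{u} 𝕜) :=
  tensMod (C := B.cat.triv) hB α.functor X.triv

/-- The localization is a tensor product. -/
def Repr.locT (X : HilbMod B.cat) : Tensor α.functor X.triv (α.loc hB X) :=
  tensor (C := B.cat.triv) hB α.functor X.triv

/-- The operator on the localization induced by an operator. -/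
def Repr.locOp {X Y : HilbMod B.cat} (T : Op X Y) : (α.loc hB X).line →L[𝕜] (α.loc hB Y).line :=
  (Tensor.map (α.locT hB X) (α.locT hB Y) T.triv).line

theorem Repr.locOp_add {X Y : HilbMod B.cat} (S T : Op X Y) :
    α.locOp hB (S + T) = α.locOp hB S + α.locOp hB T :=
  (congrArg Op.line (Tensor.map_add (α.locT hB X) (α.locT hB Y) S.triv T.triv)).trans
    (Op.line_add _ _)

theorem Repr.locOp_smul {X Y : HilbMod B.cat} (c : 𝕜) (T : Op X Y) :
    α.locOp hB (c • T) = c • α.locOp hB T :=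
  (congrArg Op.line (Tensor.map_smul (α.locT hB X) (α.locT hB Y) c T.triv)).trans
    (Op.line_smul _ _)

theorem Repr.locOp_comp {X Y Z : HilbMod B.cat} (S : Op Y Z) (T : Op X Y) :
    α.locOp hB (S.comp T) = (α.locOp hB S).comp (α.locOp hB T) :=
  (congrArg Op.line (Tensor.map_comp (α.locT hB X) (α.locT hB Y) (α.locT hB Z) S.triv
    T.triv)).trans (Op.line_comp _ _)

theorem Repr.locOp_star {X Y : HilbMod B.cat} (T : Op X Y) :
    α.locOp hB T.star = ContinuousLinearMap.adjoint (α.locOp hB T) :=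
  (congrArg Op.line (Tensor.map_star (α.locT hB X) (α.locT hB Y) T.triv)).trans (Op.line_star _)

theorem Repr.norm_locOp_le {X Y : HilbMod B.cat} (T : Op X Y) : ‖α.locOp hB T‖ ≤ ‖T‖ :=
  ((Op.norm_line_le _).trans (Tensor.norm_map_le _ _ _)).trans (Op.norm_triv_le _)

/-- The elementary tensors of the localization. -/
def Repr.locτ (X : HilbMod B.cat) : X.sp →ₗ[𝕜] (LineH.{u} 𝕜 →L[𝕜] α.H) →ₗ[𝕜] (α.loc hB X).line :=
  (α.locT hB X).τ (b := B.pt) (c := lineObj 𝕜)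

/-- The elementary vectors of the localization. -/
def Repr.locEl (X : HilbMod B.cat) : X.sp →ₗ[𝕜] α.H →ₗ[𝕜] (α.loc hB X).line :=
  (α.locτ hB X).compl₂ (LineH.ket (H := α.H))

theorem Repr.inner_locEl (X : HilbMod B.cat) (η ξ : X.sp) (v w : α.H) :
    Inner.inner 𝕜 (α.locEl hB X η v) (α.locEl hB X ξ w) =
      Inner.inner 𝕜 v (α.hom (X.inner (a := B.pt) (b := B.pt) η ξ : B) w) := by
  have h1 : (α.loc hB X).lineInner (α.locEl hB X η v) (α.locEl hB X ξ w) =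
      (ContinuousLinearMap.adjoint (LineH.ket (H := α.H) v)).comp
        ((α.hom (X.inner (a := B.pt) (b := B.pt) η ξ : B)).comp (LineH.ket (H := α.H) w)) :=
    (α.locT hB X).inner_τ (a := B.pt) (b := B.pt) (c := lineObj 𝕜) (d := lineObj 𝕜) η
      (LineH.ket (H := α.H) v) ξ (LineH.ket (H := α.H) w)
  rw [HilbMod.line_inner, h1, ContinuousLinearMap.comp_apply,
    ContinuousLinearMap.adjoint_inner_right, ContinuousLinearMap.comp_apply, LineH.ket_e,
    LineH.ket_e]

theorem Repr.locOp_locEl {X Y : HilbMod B.cat} (T : Op X Y) (η : X.sp) (v : α.H) :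
    α.locOp hB T (α.locEl hB X η v) = α.locEl hB Y (T.toFun (a := B.pt) η) v :=
  Tensor.map_τ (α.locT hB X) (α.locT hB Y) T.triv (b := B.pt) (c := lineObj 𝕜) η
    (LineH.ket (H := α.H) v)

/-- The localization of a Hilbert bimodule at a representation, as a representation. -/
def Repr.locRepr (E : Bimod A.cat B.cat) : Repr A where
  H := (α.loc hB (E.fiber A.pt)).line
  hom :=
    { toFun := fun x => α.locOp hB (E.op (p := A.pt) (q := A.pt) x)
      map_smul' := fun c x => (congrArg (α.locOp hB)
        (map_smul (E.op (p := A.pt) (q := A.pt)) c x)).trans (α.locOp_smul hB _ _)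
      map_zero' := by
        have h1 : E.op (p := A.pt) (q := A.pt) ((0 : A) : A) = (0 : 𝕜) • 0 := by
          rw [zero_smul]; exact map_zero (E.op (p := A.pt) (q := A.pt))
        exact (congrArg (α.locOp hB) h1).trans ((α.locOp_smul hB _ _).trans (zero_smul _ _))
      map_add' := fun x y => (congrArg (α.locOp hB)
        (map_add (E.op (p := A.pt) (q := A.pt)) x y)).trans (α.locOp_add hB _ _)
      map_mul' := fun x y => (congrArg (α.locOp hB)
        (E.op_comp (p := A.pt) (q := A.pt) (r := A.pt) x y)).trans (α.locOp_comp hB _ _)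
      map_star' := fun x => (congrArg (α.locOp hB)
        (E.op_star (p := A.pt) (q := A.pt) x)).trans (α.locOp_star hB _) }
  norm_le := fun x => (α.norm_locOp_le hB _).trans (E.norm_map_le (a := A.pt) (b := A.pt) x)

end Localization

end
end CStarDescent

namespace CStarDescent

noncomputable section

open GStarCat
open Filter (Tendsto atTop)

variable {𝕜 : Type} [RCLike 𝕜]

/-! ## The Hilbert modules of the descent functor -/

section Descent

variable {𝒢 : Type u} [Groupoid.{u} 𝒢]

namespace GCAlg

variable (B : GCAlg 𝕜 𝒢)

theorem rsingle_congr {a b : 𝒢} {g h : a ⟶ b} {x y : B.alg b} (hg : g = h) (hx : x = y) :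
    B.rsingle g x = B.rsingle h y := by rw [hg, hx]

/-- The inclusion of a coefficient algebra into the reduced crossed product. -/
def incl (a : 𝒢) : GFunctor (B.alg a).cat B.red where
  obj _ := B.robj a
  map := fun {_ _} => (B.rsingle (𝟙 a) : B.alg a →ₗ[𝕜] B.red.Hom (B.robj a) (B.robj a))
  map_comp x y := by
    refine Eq.trans ?_ (B.rsingle_comp (𝟙 a) x (𝟙 a) y).symm
    exact B.rsingle_congr (Category.id_comp _).symm (congrArg (fun z : B.alg a => (show B.alg a from x) * z) (B.act_id y).symm)
  map_star x := by
    refine Eq.trans ?_ (B.rsingle_star (𝟙 a) x).symm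
    have h : Groupoid.inv (𝟙 a) = 𝟙 a := by simp
    rw [h, B.act_id]; rfl
  map_grade x := (B.rsingle_grade (𝟙 a) x).symm
  norm_map_le x := B.norm_rsingle_le (𝟙 a) x

/-- The inclusion of a coefficient algebra into the reduced crossed product, twisted by a groupoid
element. -/
def inclTwist {a b : 𝒢} (g : b ⟶ a) : GFunctor (B.alg a).cat B.red :=
  (B.act (Groupoid.inv g)).functor.comp (B.incl b)

theorem continuous_rsingle {a b : 𝒢} (g : a ⟶ b) : Continuous (B.rsingle g) :=
  AddMonoidHomClass.continuous_of_bound (B.rsingle g) 1 fun y => by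
    rw [one_mul]; exact B.norm_rsingle_le g y

theorem continuous_act {a b : 𝒢} (g : a ⟶ b) : Continuous (B.act g).hom :=
  AddMonoidHomClass.continuous_of_bound (B.act g).hom 1 fun y => by
    rw [one_mul]; exact (B.act g).norm_le y

end GCAlg

variable {A B : GCAlg 𝕜 𝒢} (hB : B.SigmaUnital) (E : GMod A B)

namespace HilbMod

variable {B : CAlg.{u} 𝕜} (X : HilbMod B.cat)

/-- The inner product of a Hilbert module over a `C*`-algebra. -/
def ip : X.sp →ₗ⋆[𝕜] X.sp →ₗ[𝕜] B := X.inner (a := B.pt) (b := B.pt)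

/-- The action on a Hilbert module over a `C*`-algebra. -/
def ac : X.sp →ₗ[𝕜] B →ₗ[𝕜] X.sp := X.act (a := B.pt) (b := B.pt)

theorem ac_ac (η : X.sp) (x y : B) : X.ac (X.ac η x) y = X.ac η (x * y) :=
  X.act_act (a := B.pt) (b := B.pt) (c := B.pt) η x y

theorem ip_ac_right (η ξ : X.sp) (x : B) : X.ip η (X.ac ξ x) = X.ip η ξ * x :=
  X.inner_act (a := B.pt) (b := B.pt) (c := B.pt) η ξ x

theorem star_ip (η ξ : X.sp) : star (X.ip η ξ) = X.ip ξ η :=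
  X.inner_star (a := B.pt) (b := B.pt) η ξ

theorem ip_ac (η ξ : X.sp) (x y : B) :
    X.ip (X.ac η x) (X.ac ξ y) = star x * (X.ip η ξ * y) := by
  rw [ip_ac_right, ← star_ip, ip_ac_right, star_mul, star_ip, mul_assoc]

theorem grade_ac (η : X.sp) (x : B) : X.grade (X.ac η x) = X.ac (X.grade η) (B.grade x) :=
  X.grade_act (a := B.pt) (b := B.pt) η x

theorem continuous_ip_left (ξ : X.sp) : Continuous fun η => X.ip η ξ :=
  X.continuous_inner_left (a := B.pt) (b := B.pt) ξ

theorem continuous_ip_right (η : X.sp) : Continuous (X.ip η) :=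
  X.continuous_inner_right (a := B.pt) (b := B.pt) η

theorem continuous_ac_left (x : B) : Continuous fun η => X.ac η x :=
  X.continuous_act_left (a := B.pt) (b := B.pt) x

theorem _root_.CStarDescent.Op.map_ac {X Y : HilbMod B.cat} (T : Op X Y) (η : X.sp) (x : B) :
    T.toFun (a := B.pt) (X.ac η x) = Y.ac (T.toFun (a := B.pt) η) x :=
  T.map_act (a := B.pt) (b := B.pt) η x

end HilbMod

theorem Op.add_comp {C : GStarCat.{v, w} 𝕜} {X Y Z : HilbMod C} (S S' : Op Y Z) (T : Op X Y) :
    (S + S').comp T = S.comp T + S'.comp T := Op.ext fun _ _ => rfl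

theorem Op.smul_comp {C : GStarCat.{v, w} 𝕜} {X Y Z : HilbMod C} (c : 𝕜) (S : Op Y Z)
    (T : Op X Y) : (c • S).comp T = c • S.comp T := Op.ext fun _ _ => rfl

namespace GMod

variable (E : GMod A B)

theorem tr_ip {a b : 𝒢} (g : a ⟶ b) (η ξ : (E.mod a).sp) :
    (E.mod b).ip (E.tr g η) (E.tr g ξ) = B.act g ((E.mod a).ip η ξ) := E.tr_inner g η ξ

theorem tr_ac {a b : 𝒢} (g : a ⟶ b) (η : (E.mod a).sp) (x : B.alg a) :
    E.tr g ((E.mod a).ac η x) = (E.mod b).ac (E.tr g η) (B.act g x) := E.tr_act g η x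

end GMod

theorem GMod.total_act (hB : B.SigmaUnital) (E : GMod A B) (a : 𝒢) :
    Total 𝕜 fun p : (E.mod a).sp × B.alg a =>
      (E.mod a).ac p.1 p.2 := fun η => by
  obtain ⟨e, he, h⟩ := hB a
  have h1 := (E.mod a).tendsto_act (a := CAlg.pt _) he (fun x => (h x).2) η
  exact mem_closure_of_tendsto h1 (Filter.Eventually.of_forall fun n =>
    Submodule.subset_span ⟨(η, e n), rfl⟩)

/-- The value of the descent functor on an equivariant bimodule. -/
def desMod (a : 𝒢) : HilbMod B.red := tensMod (hB.hasApprox a) (B.incl a) (E.mod a)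

/-- The modules `desMod` are tensor products. -/
def desT (a : 𝒢) : Tensor (B.incl a) (E.mod a) (desMod hB E a) :=
  tensor (hB.hasApprox a) (B.incl a) (E.mod a)

/-- The space of sections `∑ ηᵢ gᵢ` with `gᵢ : b ⟶ a`. -/
abbrev desSp (a b : 𝒢) : Type u := (desMod hB E a).E (B.robj b)

/-- Elementary tensors. -/
def desτ (a b : 𝒢) :
    (E.mod a).sp →ₗ[𝕜] B.red.Hom (B.robj b) (B.robj a) →ₗ[𝕜] desSp hB E a b :=
  (desT hB E a).τ (b := CAlg.pt _)

theorem desτ_inner {a b c : 𝒢} (η ξ : (E.mod a).sp) (y : B.red.Hom (B.robj b) (B.robj a))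
    (z : B.red.Hom (B.robj c) (B.robj a)) :
    (desMod hB E a).inner (desτ hB E a b η y) (desτ hB E a c ξ z) =
      B.red.comp (B.red.star y)
        (B.red.comp (B.rsingle (𝟙 a) ((E.mod a).ip η ξ)) z) :=
  (desT hB E a).inner_τ (a := CAlg.pt _) (b := CAlg.pt _) η y ξ z

theorem desτ_inner_rsingle {a b c : 𝒢} (η ξ : (E.mod a).sp) (g : b ⟶ a) (x : B.alg a) (h : c ⟶ a)
    (y : B.alg a) :
    (desMod hB E a).inner (desτ hB E a b η (B.rsingle g x)) (desτ hB E a c ξ (B.rsingle h y)) =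
      B.rsingle (h ≫ Groupoid.inv g) (B.act (Groupoid.inv g)
        ((E.mod a).ip ((E.mod a).ac η x) ((E.mod a).ac ξ y))) := by
  rw [desτ_inner, B.rsingle_star, B.rsingle_comp, B.rsingle_comp]
  refine B.rsingle_congr (by simp) ?_
  rw [B.act_id]
  refine Eq.trans (map_mul (B.act (Groupoid.inv g)).hom _ _).symm ?_
  exact congrArg (B.act (Groupoid.inv g)) ((E.mod a).ip_ac η ξ x y).symm

theorem exists_desι {a b : 𝒢} (g : b ⟶ a) : ∃ L : (E.mod a).sp →L[𝕜] desSp hB E a b,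
    ∀ ξ (x : B.alg a), L ((E.mod a).ac ξ x) = desτ hB E a b ξ (B.rsingle g x) := by
  obtain ⟨L, hL, -⟩ := exists_twist (B.inclTwist g) (X := E.mod a) (Y := desMod hB E a)
    (a := CAlg.pt _) (E.total_act hB a) (μ := fun p => desτ hB E a b p.1 (B.rsingle g p.2))
    (fun p q => by
      refine (desτ_inner_rsingle hB E p.1 q.1 g p.2 g q.2).trans ?_
      exact B.rsingle_congr (by simp) rfl)
  exact ⟨L, fun ξ x => hL (ξ, x)⟩

/-- The element `η g`. -/
def desι {a b : 𝒢} (g : b ⟶ a) : (E.mod a).sp →L[𝕜] desSp hB E a b := (exists_desι hB E g).choose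

theorem desι_act {a b : 𝒢} (g : b ⟶ a) (ξ : (E.mod a).sp) (x : B.alg a) :
    desι hB E g ((E.mod a).ac ξ x) = desτ hB E a b ξ (B.rsingle g x) :=
  (exists_desι hB E g).choose_spec ξ x

/-- Continuous maps agreeing on the elements `ξ x` are equal. -/
theorem GMod.ext_act (hB : B.SigmaUnital) (E : GMod A B) {a : 𝒢} {V : Type v} [AddCommGroup V]
    [Module 𝕜 V] [TopologicalSpace V] [T2Space V] {σ : 𝕜 →+* 𝕜} (f g : (E.mod a).sp →ₛₗ[σ] V)
    (hf : Continuous f) (hg : Continuous g)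
    (h : ∀ ξ (x : B.alg a), f ((E.mod a).ac ξ x) =
      g ((E.mod a).ac ξ x)) (η) : f η = g η :=
  (E.total_act hB a).ext hf hg (fun p => h p.1 p.2) η

theorem inner_desι_right {a b c : 𝒢} (g : c ⟶ a) (h : b ⟶ a) (η ξ : (E.mod a).sp) (x : B.alg a) :
    (desMod hB E a).inner (desι hB E g ((E.mod a).ac η x)) (desι hB E h ξ) =
      B.rsingle (h ≫ Groupoid.inv g) (B.act (Groupoid.inv g)
        ((E.mod a).ip ((E.mod a).ac η x) ξ)) :=
  E.ext_act hB
    ((desMod hB E a).inner (desι hB E g ((E.mod a).ac η x)) ∘ₗ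
      (desι hB E h).toLinearMap)
    (B.rsingle (h ≫ Groupoid.inv g) ∘ₗ
      ((B.act (Groupoid.inv g)).hom : B.alg a →ₗ[𝕜] B.alg c) ∘ₗ
        (E.mod a).ip ((E.mod a).ac η x))
    (((desMod hB E a).continuous_inner_right _).comp (desι hB E h).continuous)
    ((B.continuous_rsingle _).comp ((B.continuous_act _).comp
      ((E.mod a).continuous_ip_right _)))
    (fun ξ y => by
      change (desMod hB E a).inner (desι hB E g _) (desι hB E h _) = _
      rw [desι_act, desι_act]
      exact desτ_inner_rsingle hB E η ξ g x h y) ξ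

theorem inner_desι {a b c : 𝒢} (g : c ⟶ a) (h : b ⟶ a) (η ξ : (E.mod a).sp) :
    (desMod hB E a).inner (desι hB E g η) (desι hB E h ξ) =
      B.rsingle (h ≫ Groupoid.inv g) (B.act (Groupoid.inv g) ((E.mod a).ip η ξ)) :=
  E.ext_act hB
    ((desMod hB E a).inner.flip (desι hB E h ξ) ∘ₛₗ (desι hB E g).toLinearMap)
    ((B.rsingle (h ≫ Groupoid.inv g) ∘ₗ
      ((B.act (Groupoid.inv g)).hom : B.alg a →ₗ[𝕜] B.alg c)) ∘ₛₗ (E.mod a).ip.flip ξ)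
    (((desMod hB E a).continuous_inner_left _).comp (desι hB E g).continuous)
    ((B.continuous_rsingle _).comp ((B.continuous_act _).comp
      ((E.mod a).continuous_ip_left _)))
    (fun η x => inner_desι_right hB E g h η ξ x) η

theorem act_desι {a b c : 𝒢} (g : b ⟶ a) (η : (E.mod a).sp) (h : c ⟶ b) (x : B.alg b) :
    (desMod hB E a).act (desι hB E g η) (B.rsingle h x) =
      desι hB E (h ≫ g) ((E.mod a).ac η (B.act g x)) :=
  E.ext_act hB
    ((desMod hB E a).act.flip (B.rsingle h x) ∘ₗ (desι hB E g).toLinearMap)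
    ((desι hB E (h ≫ g)).toLinearMap ∘ₗ
      (E.mod a).ac.flip (B.act g x))
    (((desMod hB E a).continuous_act_left _).comp (desι hB E g).continuous)
    ((desι hB E (h ≫ g)).continuous.comp ((E.mod a).continuous_ac_left _))
    (fun ξ y => by
      change (desMod hB E a).act (desι hB E g _) (B.rsingle h x) = desι hB E (h ≫ g) _
      refine Eq.trans ?_ (congrArg (desι hB E (h ≫ g)) ((E.mod a).ac_ac _ _ _)).symm
      rw [desι_act, desι_act]
      refine ((desT hB E a).act_τ (b := CAlg.pt _) ξ (B.rsingle g y) (B.rsingle h x)).trans ?_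
      exact congrArg (desτ hB E a c ξ) (B.rsingle_comp g y h x)) η

theorem grade_desι {a b : 𝒢} (g : b ⟶ a) (η : (E.mod a).sp) :
    (desMod hB E a).grade (desι hB E g η) = desι hB E g ((E.mod a).grade η) :=
  E.ext_act hB
    ((desMod hB E a).grade ∘ₗ (desι hB E g).toLinearMap)
    ((desι hB E g).toLinearMap ∘ₗ (E.mod a).grade)
    ((desMod hB E a).continuous_grade.comp (desι hB E g).continuous)
    ((desι hB E g).continuous.comp (E.mod a).continuous_grade)
    (fun ξ y => by
      change (desMod hB E a).grade (desι hB E g _) = desι hB E g _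
      refine Eq.trans ?_ (congrArg (desι hB E g) ((E.mod a).grade_ac _ _)).symm
      rw [desι_act, desι_act]
      refine ((desT hB E a).grade_τ (b := CAlg.pt _) ξ (B.rsingle g y)).trans ?_
      exact congrArg (desτ hB E a b _) (B.rsingle_grade g y)) η

theorem total_desι (a b : 𝒢) :
    Total 𝕜 fun p : (b ⟶ a) × (E.mod a).sp => desι hB E p.1 p.2 := by
  refine Total.of_mem ((desT hB E a).total (B.robj b)) fun p => ?_
  obtain ⟨ξ, hξ⟩ : ∃ ξ : (E.mod a).sp, ξ = p.2.1 := ⟨_, rfl⟩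
  obtain ⟨y, hy⟩ : ∃ y : B.red.Hom (B.robj b) (B.robj a), y = p.2.2 := ⟨_, rfl⟩
  suffices h : desτ hB E a b ξ y ∈ closure (Submodule.span 𝕜 (Set.range fun p : (b ⟶ a) × (E.mod a).sp => desι hB E p.1 p.2) : Set (desSp hB E a b)) by
    rw [hξ, hy] at h; exact h
  have hc : Continuous (desτ hB E a b ξ) :=
    AddMonoidHomClass.continuous_of_bound _ ‖ξ‖ fun y => (desT hB E a).norm_τ_le (b := CAlg.pt _) ξ y
  refine map_mem_closure hc (B.denseRange_coeRed b a y) ?_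
  rintro _ ⟨μ, rfl⟩
  induction μ using GCAlg.Conv.ind with
  | h0 => rw [map_zero, map_zero]; exact zero_mem _
  | hadd μ ν h h' => rw [map_add, map_add]; exact add_mem h h'
  | hs g x =>
    rw [B.coeRed_single, ← desι_act]
    exact Submodule.subset_span ⟨(g, _), rfl⟩

theorem map_desι {E E₁ : GMod A B} {a b : 𝒢} (T : Op (E.mod a) (E₁.mod a)) (g : b ⟶ a)
    (η : (E.mod a).sp) :
    (Tensor.map (desT hB E a) (desT hB E₁ a) T).toFun (desι hB E g η) = desι hB E₁ g (T.toFun η) :=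
  E.ext_act hB
    ((Tensor.map (desT hB E a) (desT hB E₁ a) T).toFun ∘ₗ (desι hB E g).toLinearMap)
    ((desι hB E₁ g).toLinearMap ∘ₗ T.toFun)
    ((Op.continuous _).comp (desι hB E g).continuous)
    ((desι hB E₁ g).continuous.comp (Op.continuous _))
    (fun ξ y => by
      change (Tensor.map (desT hB E a) (desT hB E₁ a) T).toFun (desι hB E g _) = desι hB E₁ g _
      refine Eq.trans ?_ (congrArg (desι hB E₁ g) (T.map_ac ξ y)).symm
      rw [desι_act, desι_act]
      exact Tensor.map_τ (desT hB E a) (desT hB E₁ a) T (b := CAlg.pt _) ξ (B.rsingle g y)) η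

theorem des_ext {E E₁ : GMod A B} {a a' : 𝒢} {S T : Op (desMod hB E a) (desMod hB E₁ a')}
    (h : ∀ {b : 𝒢} (g : b ⟶ a) (η : (E.mod a).sp),
      S.toFun (desι hB E g η) = T.toFun (desι hB E g η)) : S = T :=
  Op.ext fun b η => (total_desι hB E a b).ext S.continuous T.continuous (fun p => h p.1 p.2) η

theorem exists_desU {a a' : 𝒢} (g : a ⟶ a') : ∃ U : Op (desMod hB E a) (desMod hB E a'),
    U.IsUni ∧ ∀ {b : 𝒢} (h : b ⟶ a) (η : (E.mod a).sp),
      U.toFun (desι hB E h η) = desι hB E (h ≫ g) (E.tr g η) := by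
  obtain ⟨U, hU, hU', -⟩ := Op.exists_unitary (E := desMod hB E a) (F := desMod hB E a')
    (J := fun b : 𝒢 => (b ⟶ a) × (E.mod a).sp) (fun b => total_desι hB E a b)
    (μ := fun {b : 𝒢} p => desι hB E (p.1 ≫ g) (E.tr g p.2)) (fun b : 𝒢 => by
      refine Total.of_mem (total_desι hB E a' b) fun p => subset_closure (Submodule.subset_span
        ⟨(p.1 ≫ Groupoid.inv g, E.tr (Groupoid.inv g) p.2), ?_⟩)
      change desι hB E ((p.1 ≫ Groupoid.inv g) ≫ g) (E.tr g (E.tr (Groupoid.inv g) p.2)) = _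
      rw [E.tr_inv, Category.assoc, Groupoid.inv_comp, Category.comp_id])
    (fun {c b : 𝒢} q p => by
      refine (inner_desι hB E (q.1 ≫ g) (p.1 ≫ g) _ _).trans
        (Eq.trans ?_ (inner_desι hB E q.1 p.1 q.2 p.2).symm)
      refine B.rsingle_congr (by simp) ?_
      rw [E.tr_ip]
      rw [← B.act_comp]
      simp)
  exact ⟨U, hU, fun {b} h η => hU' (a := B.robj b) (h, η)⟩

/-- The unitary `η h ↦ g(η) g h`. -/
def desU {a a' : 𝒢} (g : a ⟶ a') : Op (desMod hB E a) (desMod hB E a') :=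
  (exists_desU hB E g).choose

theorem desU_ι {a a' b : 𝒢} (g : a ⟶ a') (h : b ⟶ a) (η : (E.mod a).sp) :
    (desU hB E g).toFun (desι hB E h η) = desι hB E (h ≫ g) (E.tr g η) :=
  (exists_desU hB E g).choose_spec.2 h η

/-- The action of `x g`. -/
def desOpS {a a' : 𝒢} (g : a ⟶ a') : A.alg a' →ₗ[𝕜] Op (desMod hB E a) (desMod hB E a') where
  toFun x := (Tensor.map (desT hB E a') (desT hB E a') (E.op x)).comp (desU hB E g)
  map_add' x y := by
    have h : E.op (x + y) = E.op x + E.op y :=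
      map_add ((E.bim a').op (p := CAlg.pt _) (q := CAlg.pt _)) x y
    rw [h, Tensor.map_add, Op.add_comp]
  map_smul' c x := by
    have h : E.op (c • x) = c • E.op x :=
      map_smul ((E.bim a').op (p := CAlg.pt _) (q := CAlg.pt _)) c x
    rw [h, Tensor.map_smul, Op.smul_comp]; rfl

theorem desOpS_ι {a a' b : 𝒢} (g : a ⟶ a') (x : A.alg a') (h : b ⟶ a) (η : (E.mod a).sp) :
    (desOpS hB E g x).toFun (desι hB E h η) = desι hB E (h ≫ g) ((E.op x).toFun (E.tr g η)) := by
  change (Tensor.map (desT hB E a') (desT hB E a') (E.op x)).toFun ((desU hB E g).toFun _) = _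
  rw [desU_ι, map_desι]

/-- The action of the convolution category. -/
def desOpC {a a' : 𝒢} : A.Conv a a' →ₗ[𝕜] Op (desMod hB E a) (desMod hB E a') :=
  A.lift fun g => desOpS hB E g

@[simp] theorem desOpC_single {a a' : 𝒢} (g : a ⟶ a') (x : A.alg a') :
    desOpC hB E (A.single g x) = desOpS hB E g x := A.lift_single _ _ _

end Descent

end
end CStarDescent

namespace CStarDescent

noncomputable section

open GStarCat
open Filter (Tendsto atTop)

variable {𝕜 : Type} [RCLike 𝕜]

/-! ## The action of the reduced crossed product -/

namespace Op

variable {C : GStarCat.{v, w} 𝕜} {X Y Z : HilbMod C}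

theorem comp_add (S : Op Y Z) (T T' : Op X Y) : S.comp (T + T') = S.comp T + S.comp T' :=
  Op.ext fun _ _ => S.toFun.map_add _ _

theorem comp_zero (S : Op Y Z) : S.comp (0 : Op X Y) = 0 := Op.ext fun _ _ => S.toFun.map_zero

theorem zero_comp (T : Op X Y) : (0 : Op Y Z).comp T = 0 := Op.ext fun _ _ => rfl

theorem grade_add (S T : Op X Y) : (S + T).grade = S.grade + T.grade :=
  Op.ext fun _ _ => Y.grade.map_add _ _

theorem grade_zero : (0 : Op X Y).grade = 0 := Op.ext fun _ _ => Y.grade.map_zero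

end Op

section Descent

variable {𝒢 : Type u} [Groupoid.{u} 𝒢] {A B : GCAlg 𝕜 𝒢}

namespace GMod

variable (E : GMod A B) {a b : 𝒢}

theorem op_mul (x y : A.alg a) (η : (E.mod a).sp) :
    (E.op (x * y)).toFun η = (E.op x).toFun ((E.op y).toFun η) :=
  congrArg (fun T : Op (E.mod a) (E.mod a) => T.toFun (a := CAlg.pt _) η)
    ((E.bim a).op_comp (p := CAlg.pt _) (q := CAlg.pt _) (r := CAlg.pt _) x y)

theorem tr_opₓ (g : a ⟶ b) (x : A.alg a) (η : (E.mod a).sp) :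
    E.tr g ((E.op x).toFun η) = (E.op (A.act g x)).toFun (E.tr g η) := E.tr_op g x η

theorem ip_op (x : A.alg a) (ξ η : (E.mod a).sp) :
    (E.mod a).ip ξ ((E.op x).toFun η) = (E.mod a).ip ((E.op (star x)).toFun ξ) η := by
  have h : E.op (star x) = (E.op x).star :=
    (E.bim a).op_star (p := CAlg.pt _) (q := CAlg.pt _) x
  rw [h]
  exact (E.op x).inner_adj (a := CAlg.pt _) (b := CAlg.pt _) ξ η

theorem op_gradeₓ (x : A.alg a) (η : (E.mod a).sp) :
    (E.op ((A.alg a).grade x)).toFun η = (E.mod a).grade ((E.op x).toFun ((E.mod a).grade η)) :=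
  congrArg (fun T : Op (E.mod a) (E.mod a) => T.toFun (a := CAlg.pt _) η)
    ((E.bim a).op_grade (p := CAlg.pt _) (q := CAlg.pt _) x)

theorem tr_gradeₓ (g : a ⟶ b) (η : (E.mod a).sp) :
    E.tr g ((E.mod a).grade η) = (E.mod b).grade (E.tr g η) := E.tr_grade g η

theorem ip_tr_inv (g : a ⟶ b) (ξ : (E.mod b).sp) (η : (E.mod a).sp) :
    (E.mod a).ip (E.tr (Groupoid.inv g) ξ) η =
      B.act (Groupoid.inv g) ((E.mod b).ip ξ (E.tr g η)) := by
  rw [← tr_ip, tr_inv']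

end GMod

variable (hB : B.SigmaUnital) (E : GMod A B)

theorem desι_congr {a b : 𝒢} {g h : b ⟶ a} {η ξ : (E.mod a).sp} (hg : g = h) (hη : η = ξ) :
    desι hB E g η = desι hB E h ξ := by rw [hg, hη]

theorem desOpC_comp {a a' a'' : 𝒢} (μ : A.Conv a' a'') (ν : A.Conv a a') :
    desOpC hB E (A.convComp μ ν) = (desOpC hB E μ).comp (desOpC hB E ν) := by
  induction μ using GCAlg.Conv.ind with
  | h0 => rw [map_zero, LinearMap.zero_apply, map_zero, map_zero, Op.zero_comp]
  | hadd μ ν h h' => rw [map_add, LinearMap.add_apply, map_add, map_add, h, h', Op.add_comp]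
  | hs h x =>
    induction ν using GCAlg.Conv.ind with
    | h0 => rw [map_zero, map_zero, map_zero, Op.comp_zero]
    | hadd μ ν h h' => rw [map_add, map_add, map_add, h, h', Op.comp_add]
    | hs g y =>
      rw [GCAlg.convComp_single, desOpC_single, desOpC_single, desOpC_single]
      refine des_ext hB fun k η => ?_
      change _ = (desOpS hB E h x).toFun ((desOpS hB E g y).toFun _)
      rw [desOpS_ι, desOpS_ι, desOpS_ι, E.op_mul, E.tr_opₓ, E.tr_comp]
      exact desι_congr hB E (by simp) rfl

theorem desOpC_inner {a a' b b' : 𝒢} (μ : A.Conv a a') (k : b ⟶ a') (ξ : (E.mod a').sp)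
    (h : b' ⟶ a) (η : (E.mod a).sp) :
    (desMod hB E a').inner (desι hB E k ξ) ((desOpC hB E μ).toFun (desι hB E h η)) =
      (desMod hB E a).inner ((desOpC hB E (A.convStar μ)).toFun (desι hB E k ξ))
        (desι hB E h η) := by
  induction μ using GCAlg.Conv.ind with
  | h0 => simp
  | hadd μ ν h h' => simp only [map_add, Op.add_apply, LinearMap.add_apply, h, h']
  | hs g x =>
    rw [GCAlg.convStar_single, desOpC_single, desOpC_single, desOpS_ι, desOpS_ι, inner_desι,
      inner_desι]
    refine B.rsingle_congr (by simp) ?_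
    rw [← E.tr_opₓ, E.ip_tr_inv, E.ip_op, ← B.act_comp]
    simp

theorem desOpC_star {a a' : 𝒢} (μ : A.Conv a a') :
    desOpC hB E (A.convStar μ) = (desOpC hB E μ).star :=
  des_ext hB fun {b} k ξ => (desMod hB E a).ext_of_total (total_desι hB E a b) fun p => by
    have h := desOpC_inner hB E μ k ξ p.1 p.2
    rw [← (desMod hB E a).inner_star, ← h, Op.inner_adj, (desMod hB E a).inner_star]
    rfl

theorem desOpC_grade {a a' : 𝒢} (μ : A.Conv a a') :
    desOpC hB E (A.convGrade μ) = (desOpC hB E μ).grade := by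
  induction μ using GCAlg.Conv.ind with
  | h0 => rw [map_zero, map_zero, Op.grade_zero]
  | hadd μ ν h h' => rw [map_add, map_add, map_add, h, h', Op.grade_add]
  | hs g x =>
    rw [GCAlg.convGrade_single, desOpC_single, desOpC_single]
    refine des_ext hB fun k η => ?_
    change _ = (desMod hB E a').grade ((desOpS hB E g x).toFun ((desMod hB E a).grade _))
    rw [grade_desι, desOpS_ι, desOpS_ι, grade_desι, E.op_gradeₓ, E.tr_gradeₓ]

/-! ### Regular representations of the descent module -/

section Reg

variable {c : 𝒢} (α : Repr (B.alg c))

/-- The representation of `A_c` induced by a representation of `B_c`. -/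
def desK : Repr (A.alg c) := α.locRepr (hB.hasApprox c) (E.bim c)

/-- The elementary tensors in the induced representation. -/
def desσ : (E.mod c).sp →ₗ[𝕜] α.H →ₗ[𝕜] (desK hB E α).H := α.locEl (hB.hasApprox c) (E.mod c)

theorem inner_desσ (η ξ : (E.mod c).sp) (v w : α.H) :
    inner 𝕜 (desσ hB E α η v) (desσ hB E α ξ w) = inner 𝕜 v (α.hom ((E.mod c).ip η ξ) w) :=
  α.inner_locEl (hB.hasApprox c) _ η ξ v w

theorem desK_σ (x : A.alg c) (η : (E.mod c).sp) (v : α.H) :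
    (desK hB E α).hom x (desσ hB E α η v) = desσ hB E α ((E.op x).toFun η) v :=
  α.locOp_locEl (hB.hasApprox c) (E.op x) η v

theorem norm_desσ_le (η : (E.mod c).sp) (v : α.H) : ‖desσ hB E α η v‖ ≤ ‖η‖ * ‖v‖ := by
  refine (sq_le_sq₀ (norm_nonneg _) (by positivity)).mp ?_
  rw [@norm_sq_eq_re_inner 𝕜, inner_desσ]
  refine (RCLike.re_le_norm _).trans ((norm_inner_le_norm _ _).trans ?_)
  have h1 : ‖(E.mod c).ip η η‖ = ‖η‖ ^ 2 := ((E.mod c).norm_sq η).symm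
  have h2 : ‖α.hom ((E.mod c).ip η η) v‖ ≤ ‖η‖ ^ 2 * ‖v‖ :=
    ((α.hom _).le_opNorm v).trans (mul_le_mul_of_nonneg_right ((α.norm_le _).trans_eq h1)
      (norm_nonneg v))
  calc ‖v‖ * ‖α.hom ((E.mod c).ip η η) v‖ ≤ ‖v‖ * (‖η‖ ^ 2 * ‖v‖) := by gcongr
    _ = (‖η‖ * ‖v‖) ^ 2 := by ring

theorem desS_summable {a b : 𝒢} (ξ : L2 (c ⟶ b) α.H) (g : b ⟶ a) (η : (E.mod a).sp) :
    Summable fun k : c ⟶ a =>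
      ‖desσ hB E α (E.tr (Groupoid.inv k) η) (ξ (k ≫ Groupoid.inv g))‖ ^ 2 := by
  have h1 : Summable fun k : c ⟶ a => ‖η‖ ^ 2 * ‖ξ (GCAlg.rtrans c g k)‖ ^ 2 :=
    ((GCAlg.rtrans c g).summable_iff.mpr (L2.summable ξ)).mul_left _
  refine h1.of_nonneg_of_le (fun k => by positivity) fun k => ?_
  rw [← mul_pow]
  refine pow_le_pow_left₀ (norm_nonneg _) ((norm_desσ_le hB E α _ _).trans ?_) 2
  exact mul_le_mul_of_nonneg_right (E.norm_tr _ η) (norm_nonneg _)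

/-- The vector obtained from `ξ` by applying `η g`. -/
def desS {a b : 𝒢} (ξ : L2 (c ⟶ b) α.H) (g : b ⟶ a) :
    (E.mod a).sp →ₗ[𝕜] L2 (c ⟶ a) (desK hB E α).H where
  toFun η := L2.mk _ (desS_summable hB E α ξ g η)
  map_add' η ζ := by ext k; simp
  map_smul' r η := by ext k; simp

theorem desS_apply {a b : 𝒢} (ξ : L2 (c ⟶ b) α.H) (g : b ⟶ a) (η : (E.mod a).sp) (k : c ⟶ a) :
    desS hB E α ξ g η k = desσ hB E α (E.tr (Groupoid.inv k) η) (ξ (k ≫ Groupoid.inv g)) := rfl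

theorem inner_desS {a b b' : 𝒢} (ξ : L2 (c ⟶ b) α.H) (ξ' : L2 (c ⟶ b') α.H) (g : b ⟶ a)
    (h : b' ⟶ a) (η ζ : (E.mod a).sp) :
    inner 𝕜 (desS hB E α ξ g η) (desS hB E α ξ' h ζ) = inner 𝕜 ξ (B.reg α
      (B.single (h ≫ Groupoid.inv g) (B.act (Groupoid.inv g) ((E.mod a).ip η ζ))) ξ') := by
  rw [GCAlg.reg_single, lp.inner_eq_tsum, lp.inner_eq_tsum, ← (GCAlg.rtrans c g).tsum_eq]
  refine tsum_congr fun k => ?_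
  rw [desS_apply, desS_apply, inner_desσ, GCAlg.regS_apply, E.tr_ip, ← B.act_comp]
  simp [GCAlg.rtrans]

theorem reg_desS {a a' b : 𝒢} (ξ : L2 (c ⟶ b) α.H) (g : a ⟶ a') (x : A.alg a') (h : b ⟶ a)
    (η : (E.mod a).sp) :
    A.reg (desK hB E α) (A.single g x) (desS hB E α ξ h η) =
      desS hB E α ξ (h ≫ g) ((E.op x).toFun (E.tr g η)) := by
  rw [GCAlg.reg_single]
  refine lp.ext (funext fun k => ?_)
  rw [GCAlg.regS_apply, desS_apply, desS_apply, desK_σ, E.tr_opₓ, ← E.tr_comp]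
  simp

end Reg

/-- Formal sums `∑ ηᵢ gᵢ`. -/
abbrev DesV (E : GMod A B) (a b : 𝒢) : Type u := (b ⟶ a) →₀ (E.mod a).sp

/-- The class of a formal sum. -/
def desI (a b : 𝒢) : DesV E a b →ₗ[𝕜] desSp hB E a b :=
  Finsupp.lsum 𝕜 fun g => (desι hB E g).toLinearMap

theorem desI_single {a b : 𝒢} (g : b ⟶ a) (η : (E.mod a).sp) :
    desI hB E a b (Finsupp.single g η) = desι hB E g η := by simp [desI]

theorem denseRange_desI (a b : 𝒢) : DenseRange (desI hB E a b) := by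
  refine (total_desι hB E a b).mono ?_
  rw [← LinearMap.coe_range]
  refine Submodule.span_le.mpr ?_
  rintro _ ⟨p, rfl⟩
  exact ⟨Finsupp.single p.1 p.2, desI_single hB E p.1 p.2⟩

/-- The vector obtained from `ξ` by applying a formal sum. -/
def desSV {c : 𝒢} (α : Repr (B.alg c)) {a b : 𝒢} (ξ : L2 (c ⟶ b) α.H) :
    DesV E a b →ₗ[𝕜] L2 (c ⟶ a) (desK hB E α).H := Finsupp.lsum 𝕜 fun g => desS hB E α ξ g

theorem desSV_single {c : 𝒢} (α : Repr (B.alg c)) {a b : 𝒢} (ξ : L2 (c ⟶ b) α.H) (g : b ⟶ a)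
    (η : (E.mod a).sp) : desSV hB E α ξ (Finsupp.single g η) = desS hB E α ξ g η := by
  simp [desSV]

theorem exists_inner_desI {a b b' : 𝒢} (v : DesV E a b) (w : DesV E a b') :
    ∃ μ : B.Conv b' b, B.coeRed μ = (desMod hB E a).inner (desI hB E a b v) (desI hB E a b' w) ∧
      ∀ {c : 𝒢} (α : Repr (B.alg c)) (ξ : L2 (c ⟶ b) α.H) (ξ' : L2 (c ⟶ b') α.H),
        inner 𝕜 (desSV hB E α ξ v) (desSV hB E α ξ' w) = inner 𝕜 ξ (B.reg α μ ξ') := by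
  induction v using Finsupp.induction_linear with
  | zero => exact ⟨0, by simp, fun α ξ ξ' => by simp⟩
  | add v v' h h' =>
    obtain ⟨μ, h1, h2⟩ := h
    obtain ⟨ν, h3, h4⟩ := h'
    refine ⟨μ + ν, by simp only [map_add, LinearMap.add_apply, h1, h3], fun α ξ ξ' => ?_⟩
    rw [map_add, map_add, inner_add_left, h2, h4, add_apply, inner_add_right]
  | single g η =>
    induction w using Finsupp.induction_linear with
    | zero => exact ⟨0, by simp, fun α ξ ξ' => by simp⟩
    | add v v' h h' =>
      obtain ⟨μ, h1, h2⟩ := h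
      obtain ⟨ν, h3, h4⟩ := h'
      refine ⟨μ + ν, by simp only [map_add, h1, h3], fun α ξ ξ' => ?_⟩
      rw [map_add, map_add, inner_add_right, h2, h4, add_apply, inner_add_right]
    | single h ζ =>
      refine ⟨B.single (h ≫ Groupoid.inv g) (B.act (Groupoid.inv g) ((E.mod a).ip η ζ)), ?_,
        fun α ξ ξ' => ?_⟩
      · rw [desI_single, desI_single]; exact (inner_desι hB E g h η ζ).symm
      · rw [desSV_single, desSV_single]; exact inner_desS hB E α ξ ξ' g h η ζ

theorem exists_desOpC_desI {a a' b : 𝒢} (μ : A.Conv a a') (v : DesV E a b) :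
    ∃ w : DesV E a' b, desI hB E a' b w = (desOpC hB E μ).toFun (desI hB E a b v) ∧
      ∀ {c : 𝒢} (α : Repr (B.alg c)) (ξ : L2 (c ⟶ b) α.H),
        desSV hB E α ξ w = A.reg (desK hB E α) μ (desSV hB E α ξ v) := by
  induction μ using GCAlg.Conv.ind with
  | h0 => exact ⟨0, by simp, fun α ξ => by simp⟩
  | hadd μ ν h h' =>
    obtain ⟨w, h1, h2⟩ := h
    obtain ⟨w', h3, h4⟩ := h'
    refine ⟨w + w', by simp only [map_add, h1, h3]; rfl, fun α ξ => ?_⟩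
    rw [map_add, map_add, h2, h4]; rfl
  | hs g x =>
    induction v using Finsupp.induction_linear with
    | zero => exact ⟨0, by simp, fun α ξ => by simp⟩
    | add v v' h h' =>
      obtain ⟨w, h1, h2⟩ := h
      obtain ⟨w', h3, h4⟩ := h'
      refine ⟨w + w', by simp only [map_add, h1, h3], fun α ξ => ?_⟩
      rw [map_add, map_add, h2, h4, map_add]
    | single h η =>
      refine ⟨Finsupp.single (h ≫ g) ((E.op x).toFun (E.tr g η)), ?_, fun α ξ => ?_⟩
      · rw [desI_single, desI_single, desOpC_single, desOpS_ι]
      · rw [desSV_single, desSV_single, reg_desS]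

theorem norm_desOpC_desI_le {a a' b : 𝒢} (μ : A.Conv a a') (v : DesV E a b) :
    ‖(desOpC hB E μ).toFun (desI hB E a b v)‖ ≤ ‖μ‖ * ‖desI hB E a b v‖ := by
  obtain ⟨w, h1, h2⟩ := exists_desOpC_desI hB E μ v
  obtain ⟨m, h3, h4⟩ := exists_inner_desI hB E w w
  obtain ⟨n, h5, h6⟩ := exists_inner_desI hB E v v
  rw [← h1]
  refine (sq_le_sq₀ (norm_nonneg _) (by positivity)).mp ?_
  rw [(desMod hB E a').norm_sq, ← h3, mul_pow, (desMod hB E a).norm_sq, ← h5, B.norm_coeRed,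
    B.norm_coeRed]
  refine (B.norm_conv_le_iff (by positivity)).mpr fun c α => ?_
  have h7 : ∀ ξ : L2 (c ⟶ b) α.H, ‖desSV hB E α ξ w‖ ^ 2 ≤ ‖μ‖ ^ 2 * ‖n‖ * ‖ξ‖ ^ 2 := fun ξ => by
    have h8 : ‖desSV hB E α ξ w‖ ≤ ‖μ‖ * ‖desSV hB E α ξ v‖ := by
      rw [h2]
      exact ((A.reg _ μ).le_opNorm _).trans (by gcongr; exact A.norm_reg_le _ μ)
    have h9 : ‖desSV hB E α ξ v‖ ^ 2 ≤ ‖n‖ * ‖ξ‖ ^ 2 := by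
      rw [@norm_sq_eq_re_inner 𝕜, h6]
      refine (RCLike.re_le_norm _).trans ((norm_inner_le_norm _ _).trans ?_)
      have := ((B.reg α n).le_opNorm ξ).trans
        (mul_le_mul_of_nonneg_right (B.norm_reg_le α n) (norm_nonneg ξ))
      nlinarith [norm_nonneg ξ]
    calc ‖desSV hB E α ξ w‖ ^ 2 ≤ (‖μ‖ * ‖desSV hB E α ξ v‖) ^ 2 := by gcongr
      _ = ‖μ‖ ^ 2 * ‖desSV hB E α ξ v‖ ^ 2 := by ring
      _ ≤ ‖μ‖ ^ 2 * (‖n‖ * ‖ξ‖ ^ 2) := by gcongr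
      _ = _ := by ring
  set K := ‖μ‖ ^ 2 * ‖n‖ with hK
  have hK0 : 0 ≤ K := by positivity
  have h8 : ∀ ξ : L2 (c ⟶ b) α.H, ‖desSV hB E α ξ w‖ ≤ √K * ‖ξ‖ := fun ξ => by
    refine (sq_le_sq₀ (norm_nonneg _) (by positivity)).mp ?_
    rw [mul_pow, Real.sq_sqrt hK0]; exact h7 ξ
  refine ContinuousLinearMap.opNorm_le_bound _ hK0 fun ξ => ?_
  set T := B.reg α m ξ with hT
  have h9 : ‖T‖ ^ 2 ≤ K * ‖ξ‖ * ‖T‖ := by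
    rw [@norm_sq_eq_re_inner 𝕜]
    conv_lhs => rw [hT]
    rw [← hT, ← h4]
    refine (RCLike.re_le_norm _).trans ((norm_inner_le_norm _ _).trans ?_)
    calc ‖desSV hB E α T w‖ * ‖desSV hB E α ξ w‖ ≤ (√K * ‖T‖) * (√K * ‖ξ‖) := by
          gcongr
          · exact h8 T
          · exact h8 ξ
      _ = (√K * √K) * ‖ξ‖ * ‖T‖ := by ring
      _ = _ := by rw [Real.mul_self_sqrt hK0]
  by_cases h0 : ‖T‖ = 0
  · rw [h0]; positivity
  · rw [sq] at h9
    exact le_of_mul_le_mul_right h9 (lt_of_le_of_ne (norm_nonneg _) (Ne.symm h0))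

theorem norm_desOpC_le {a a' b : 𝒢} (μ : A.Conv a a') (η : desSp hB E a b) :
    ‖(desOpC hB E μ).toFun η‖ ≤ ‖μ‖ * ‖η‖ :=
  (denseRange_desI hB E a b).induction_on
    (p := fun η => ‖(desOpC hB E μ).toFun η‖ ≤ ‖μ‖ * ‖η‖) η
    (isClosed_le (Op.continuous _).norm (continuous_const.mul continuous_norm))
    fun v => norm_desOpC_desI_le hB E μ v

end Descent

end
end CStarDescent

namespace CStarDescent

noncomputable section

open GStarCat
open Filter (Tendsto atTop)

variable {𝕜 : Type} [RCLike 𝕜]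

/-! ## The bimodules of the descent functor -/

section Descent

variable {𝒢 : Type u} [Groupoid.{u} 𝒢] {A B : GCAlg 𝕜 𝒢} (hB : B.SigmaUnital) (E : GMod A B)

/-- The morphisms of the reduced crossed product. -/
abbrev GCAlg.rHom (A : GCAlg 𝕜 𝒢) (a b : 𝒢) : Type u := A.red.Hom (A.robj a) (A.robj b)

/-- The orbit map of a vector under the action of the convolution category. -/
def desEv {a b : 𝒢} (a' : 𝒢) (η : desSp hB E a b) : A.Conv a a' →ₗ[𝕜] desSp hB E a' b where
  toFun μ := (desOpC hB E μ).toFun η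
  map_add' μ ν := by rw [map_add]; rfl
  map_smul' c μ := by rw [map_smul]; rfl

theorem norm_desEv_le {a b : 𝒢} (a' : 𝒢) (η : desSp hB E a b) (μ : A.Conv a a') :
    ‖desEv hB E a' η μ‖ ≤ ‖η‖ * ‖A.coeRed μ‖ := by
  rw [A.norm_coeRed, mul_comm]
  exact norm_desOpC_le hB E μ η

/-- The orbit map of a vector under the action of the reduced crossed product. -/
def desΦ {a b : 𝒢} (a' : 𝒢) (η : desSp hB E a b) : A.rHom a a' →L[𝕜] desSp hB E a' b :=
  LinearMap.extendOfNorm (desEv hB E a' η) A.coeRed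

theorem desΦ_coe {a a' b : 𝒢} (η : desSp hB E a b) (μ : A.Conv a a') :
    desΦ hB E a' η (A.coeRed μ) = (desOpC hB E μ).toFun η :=
  LinearMap.extendOfNorm_eq (A.denseRange_coeRed a a') ⟨_, norm_desEv_le hB E a' η⟩ μ

theorem norm_desΦ_le {a a' b : 𝒢} (η : desSp hB E a b) (x : A.rHom a a') :
    ‖desΦ hB E a' η x‖ ≤ ‖x‖ * ‖η‖ :=
  (LinearMap.norm_extendOfNorm_apply_le (A.denseRange_coeRed a a') _
    (norm_desEv_le hB E a' η) x).trans_eq (mul_comm _ _)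

/-- Continuous functions on the reduced crossed product agreeing on the convolution category are
equal. -/
theorem GCAlg.red_ext (A : GCAlg 𝕜 𝒢) {a b : 𝒢} {V : Type v} [TopologicalSpace V] [T2Space V]
    {f g : A.rHom a b → V} (hf : Continuous f) (hg : Continuous g)
    (h : ∀ μ : A.Conv a b, f (A.coeRed μ) = g (A.coeRed μ)) (x) : f x = g x :=
  congrFun ((A.denseRange_coeRed a b).equalizer hf hg (funext h)) x

theorem GCAlg.continuous_red_star (A : GCAlg 𝕜 𝒢) (a b : 𝒢) :
    Continuous fun x : A.rHom a b => (A.red.star x : A.rHom b a) :=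
  AddMonoidHomClass.continuous_of_bound (A.red.star (a := A.robj a) (b := A.robj b)) 1 fun x => by
    rw [one_mul]; exact PreCStar.norm_star_le x

theorem GCAlg.continuous_red_grade (A : GCAlg 𝕜 𝒢) (a b : 𝒢) :
    Continuous fun x : A.rHom a b => (A.red.grade x : A.rHom a b) :=
  AddMonoidHomClass.continuous_of_bound (A.red.grade (a := A.robj a) (b := A.robj b)) 1 fun x => by
    rw [one_mul]; exact A.red.norm_grade_le x

theorem desΦ_add {a a' b : 𝒢} (η ξ : desSp hB E a b) (x : A.rHom a a') :
    desΦ hB E a' (η + ξ) x = desΦ hB E a' η x + desΦ hB E a' ξ x :=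
  A.red_ext (desΦ hB E a' (η + ξ)).continuous
    ((desΦ hB E a' η).continuous.add (desΦ hB E a' ξ).continuous)
    (fun μ => by
      change _ = desΦ hB E a' η (A.coeRed μ) + desΦ hB E a' ξ (A.coeRed μ)
      rw [desΦ_coe, desΦ_coe, desΦ_coe, map_add]) x

theorem desΦ_smul {a a' b : 𝒢} (c : 𝕜) (η : desSp hB E a b) (x : A.rHom a a') :
    desΦ hB E a' (c • η) x = c • desΦ hB E a' η x :=
  A.red_ext (desΦ hB E a' (c • η)).continuous ((desΦ hB E a' η).continuous.const_smul c)
    (fun μ => by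
      change _ = c • desΦ hB E a' η (A.coeRed μ)
      rw [desΦ_coe, desΦ_coe, map_smul]) x

/-- The operator defined by a morphism of the reduced crossed product. -/
def desΨ {a a' : 𝒢} (b : 𝒢) (x : A.rHom a a') : desSp hB E a b →ₗ[𝕜] desSp hB E a' b where
  toFun η := desΦ hB E a' η x
  map_add' η ξ := desΦ_add hB E η ξ x
  map_smul' c η := desΦ_smul hB E c η x

theorem inner_desΦ {a a' b b' : 𝒢} (x : A.rHom a a') (ξ : desSp hB E a' b) (η : desSp hB E a b') :
    (desMod hB E a').inner ξ (desΦ hB E a' η x) =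
      (desMod hB E a).inner (desΦ hB E a ξ (A.red.star x)) η :=
  A.red_ext (((desMod hB E a').continuous_inner_right ξ).comp (desΦ hB E a' η).continuous)
    (((desMod hB E a).continuous_inner_left η).comp
      ((desΦ hB E a ξ).continuous.comp (A.continuous_red_star a a')))
    (fun μ => by
      change (desMod hB E a').inner ξ (desΦ hB E a' η (A.coeRed μ)) =
        (desMod hB E a).inner (desΦ hB E a ξ (A.red.star (A.coeRed μ))) η
      rw [← A.coeRed_star, desΦ_coe, desΦ_coe, Op.inner_adj, desOpC_star]
      rfl) x

theorem norm_desΦ_star_le {a a' b : 𝒢} (η : desSp hB E a' b) (x : A.rHom a a') :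
    ‖desΦ hB E a η (A.red.star x)‖ ≤ ‖x‖ * ‖η‖ := by
  have h : ‖(A.red.star x : A.rHom a' a)‖ = ‖x‖ := PreCStar.norm_star x
  rw [← h]
  exact norm_desΦ_le hB E η (A.red.star x)

/-- The action of the reduced crossed product. -/
def desOp {a a' : 𝒢} (x : A.rHom a a') : Op (desMod hB E a) (desMod hB E a') where
  toFun := fun {b : 𝒢} => desΨ hB E b x
  adj := fun {b : 𝒢} => desΨ hB E b (A.red.star x : A.rHom a' a)
  inner_adj := fun {b b' : 𝒢} ξ η => inner_desΦ hB E x ξ η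
  bdd := ⟨‖x‖, norm_nonneg x, fun {b : 𝒢} η => norm_desΦ_le hB E η x, fun {b : 𝒢} η =>
    norm_desΦ_star_le hB E η x⟩

theorem continuous_desOp_apply {a b : 𝒢} (a' : 𝒢) (η : desSp hB E a b) :
    Continuous fun x : A.rHom a a' => ((desOp hB E x).toFun η : desSp hB E a' b) :=
  (desΦ hB E a' η).continuous

theorem norm_desOp_apply_le {a a' b : 𝒢} (x : A.rHom a a') (η : desSp hB E a b) :
    ‖((desOp hB E x).toFun η : desSp hB E a' b)‖ ≤ ‖x‖ * ‖η‖ := norm_desΦ_le hB E η x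

theorem norm_desOp_le {a a' : 𝒢} (x : A.rHom a a') : ‖desOp hB E x‖ ≤ ‖x‖ :=
  Op.norm_le_of_bd (Op.bd_of_toFun _ (norm_nonneg x) fun η => norm_desOp_apply_le hB E x η)

theorem desOp_coe {a a' : 𝒢} (μ : A.Conv a a') : desOp hB E (A.coeRed μ) = desOpC hB E μ :=
  Op.ext fun (b : 𝒢) η => desΦ_coe hB E (b := b) η μ

/-- The action of the reduced crossed product, as a linear map. -/
def desOpₗ (a a' : 𝒢) : A.rHom a a' →ₗ[𝕜] Op (desMod hB E a) (desMod hB E a') where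
  toFun := desOp hB E
  map_add' x y := Op.ext fun (b : 𝒢) (η : desSp hB E a b) => (desΦ hB E a' η).map_add x y
  map_smul' c x := Op.ext fun (b : 𝒢) (η : desSp hB E a b) => (desΦ hB E a' η).map_smul c x

theorem desOp_star {a a' : 𝒢} (x : A.rHom a a') : desOp hB E (A.red.star x) = (desOp hB E x).star :=
  Op.ext fun _ _ => rfl

theorem desOp_comp_coe {a a' a'' : 𝒢} (μ : A.Conv a' a'') (y : A.rHom a a') :
    desOp hB E (A.red.comp (A.coeRed μ) y) = (desOp hB E (A.coeRed μ)).comp (desOp hB E y) :=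
  Op.ext fun (b : 𝒢) (η : desSp hB E a b) =>
    A.red_ext (V := desSp hB E a'' b)
      (f := fun y => (desOp hB E (A.red.comp (A.coeRed μ) y)).toFun η)
      (g := fun y => (desOp hB E (A.coeRed μ)).toFun ((desOp hB E y).toFun η))
      ((continuous_desOp_apply hB E a'' η).comp (AddMonoidHomClass.continuous_of_bound
        (A.red.comp (A.coeRed μ)) ‖A.coeRed μ‖ fun y => PreCStar.norm_comp_le _ _))
      ((Op.continuous _).comp (continuous_desOp_apply hB E a' η))
      (fun ν => by
        change (desOp hB E (A.red.comp (A.coeRed μ) (A.coeRed ν))).toFun η =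
          (desOp hB E (A.coeRed μ)).toFun ((desOp hB E (A.coeRed ν)).toFun η)
        rw [← A.coeRed_comp, desOp_coe, desOp_coe, desOp_coe, desOpC_comp]
        rfl) y

theorem desOp_comp {a a' a'' : 𝒢} (x : A.rHom a' a'') (y : A.rHom a a') :
    desOp hB E (A.red.comp x y) = (desOp hB E x).comp (desOp hB E y) :=
  Op.ext fun (b : 𝒢) (η : desSp hB E a b) =>
    A.red_ext (V := desSp hB E a'' b)
      (f := fun x => (desOp hB E (A.red.comp x y)).toFun η)
      (g := fun x => (desOp hB E x).toFun ((desOp hB E y).toFun η))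
      ((continuous_desOp_apply hB E a'' η).comp (AddMonoidHomClass.continuous_of_bound
        (A.red.comp.flip y) ‖y‖ fun x => (PreCStar.norm_comp_le x y).trans_eq (mul_comm _ _)))
      (continuous_desOp_apply hB E a'' _)
      (fun μ => by
        change (desOp hB E (A.red.comp (A.coeRed μ) y)).toFun η = _
        rw [desOp_comp_coe]
        rfl) x

theorem desOp_grade {a a' : 𝒢} (x : A.rHom a a') :
    desOp hB E (A.red.grade x) = (desOp hB E x).grade :=
  Op.ext fun (b : 𝒢) (η : desSp hB E a b) =>
    A.red_ext (V := desSp hB E a' b)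
      (f := fun x => (desOp hB E (A.red.grade x)).toFun η)
      (g := fun x => (desMod hB E a').grade ((desOp hB E x).toFun ((desMod hB E a).grade η)))
      ((continuous_desOp_apply hB E a' η).comp (A.continuous_red_grade a a'))
      ((desMod hB E a').continuous_grade.comp (continuous_desOp_apply hB E a' _))
      (fun μ => by
        change (desOp hB E (A.red.grade (A.coeRed μ))).toFun η = _
        rw [← A.coeRed_grade, desOp_coe, desOp_coe, desOpC_grade]
        rfl) x

/-- The descent functor on objects. -/
def desBim : Bimod A.red B.red where
  obj := fun a : 𝒢 => desMod hB E a
  map {a a'} := desOpₗ hB E a a'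
  map_comp x y := desOp_comp hB E x y
  map_star x := desOp_star hB E x
  map_grade x := desOp_grade hB E x
  norm_map_le x := norm_desOp_le hB E x

theorem desOp_rsingle {a a' : 𝒢} (g : a ⟶ a') (x : A.alg a') :
    desOp hB E (A.rsingle g x) = desOpS hB E g x :=
  (desOp_coe hB E (A.single g x)).trans (desOpC_single hB E g x)

/-- The elements `η g` of the bimodule `desBim`. -/
def desDM : DescentMod E (desBim hB E) where
  ι g := (desι hB E g).toLinearMap
  inner_ι g h η ξ := inner_desι hB E g h η ξ
  act_ι g η h x := act_desι hB E g η h x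
  op_ι g x h η := (congrArg (fun S : Op (desMod hB E _) (desMod hB E _) =>
    S.toFun (desι hB E h η)) (desOp_rsingle hB E g x)).trans (desOpS_ι hB E g x h η)
  grade_ι g η := grade_desι hB E g η
  dense a b ζ := by
    refine closure_mono (Submodule.span_mono ?_) (total_desι hB E a b ζ)
    rintro _ ⟨p, rfl⟩
    exact ⟨p.1, p.2, rfl⟩

end Descent

end
end CStarDescent

namespace CStarDescent

noncomputable section

open GStarCat
open Filter (Tendsto atTop)

variable {𝕜 : Type} [RCLike 𝕜]

/-! ## The descent functor -/

namespace Bimod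

variable {A : GStarCat.{v', w'} 𝕜} {B : GStarCat.{v, w} 𝕜} {E F : Bimod A B}

theorem norm_op_le (E : Bimod A B) {p q : A.Obj} (x : A.Hom p q) : ‖E.op x‖ ≤ ‖x‖ := E.norm_map_le x

/-- The graded commutator as a linear map. -/
def gcommₗ {p q : A.Obj} (T : Op (E.fiber p) (F.fiber p)) (T' : Op (E.fiber q) (F.fiber q)) :
    A.Hom p q →ₗ[𝕜] Op (E.fiber p) (F.fiber q) where
  toFun x := gcomm x T T'
  map_add' x y := Op.ext fun _ _ => by
    simp only [gcomm, _root_.map_add, Op.sub_apply, Op.comp_apply, Op.add_apply]; abel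
  map_smul' c x := Op.ext fun _ _ => by
    simp only [gcomm, _root_.map_smul, Op.sub_apply, Op.comp_apply, Op.smul_apply, smul_sub,
      RingHom.id_apply]

theorem norm_gcomm_le {p q : A.Obj} (x : A.Hom p q) (T : Op (E.fiber p) (F.fiber p))
    (T' : Op (E.fiber q) (F.fiber q)) : ‖gcomm x T T'‖ ≤ (‖T‖ + 2 * ‖T'‖) * ‖x‖ := by
  have h0 : ∀ ε : 𝕜, ‖ε‖ = 1 → ‖(2⁻¹ : 𝕜) • (x + ε • A.grade x)‖ ≤ ‖x‖ := fun ε hε => by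
    rw [norm_smul, norm_inv, RCLike.norm_ofNat]
    have h1 := norm_add_le x (ε • A.grade x)
    rw [norm_smul, hε, one_mul] at h1
    have h2 := A.norm_grade_le x
    linarith
  have he : ‖A.even x‖ ≤ ‖x‖ := by
    have := h0 1 (by simp)
    rwa [one_smul] at this
  have ho : ‖A.odd x‖ ≤ ‖x‖ := by
    have := h0 (-1) (by simp)
    rwa [neg_one_smul, ← sub_eq_add_neg] at this
  have hg : ‖T'.grade‖ ≤ ‖T'‖ := Op.norm_le_of_bd T'.bd_norm.grade
  have h1 : ‖(F.op x).comp T‖ ≤ ‖T‖ * ‖x‖ := by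
    rw [mul_comm]
    exact (Op.norm_comp_le _ _).trans (by gcongr; exact F.norm_op_le x)
  have h2 : ‖T'.comp (E.op (A.even x))‖ ≤ ‖T'‖ * ‖x‖ :=
    (Op.norm_comp_le _ _).trans (by gcongr; exact (E.norm_op_le _).trans he)
  have h3 : ‖T'.grade.comp (E.op (A.odd x))‖ ≤ ‖T'‖ * ‖x‖ :=
    (Op.norm_comp_le _ _).trans (by gcongr; exact (E.norm_op_le _).trans ho)
  refine (norm_sub_le _ _).trans ?_
  have h4 := norm_sub_le ((F.op x).comp T) (T'.comp (E.op (A.even x)))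
  linarith

end Bimod

theorem Op.sub_comp {C : GStarCat.{v, w} 𝕜} {X Y Z : HilbMod C} (S S' : Op Y Z) (T : Op X Y) :
    (S - S').comp T = S.comp T - S'.comp T := Op.ext fun _ _ => rfl

theorem mem_of_eq {V : Type v} [AddCommGroup V] [Module 𝕜 V] {S : Submodule 𝕜 V} {x y : V}
    (h : x = y) (hy : y ∈ S) : x ∈ S := h ▸ hy

section Descent

variable {𝒢 : Type u} [Groupoid.{u} 𝒢] {A B : GCAlg 𝕜 𝒢} (hB : B.SigmaUnital)

/-- Closed conditions on morphisms of the reduced crossed product may be checked on elementary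
morphisms. -/
theorem GCAlg.rsingle_induction (A : GCAlg 𝕜 𝒢) {a b : 𝒢} {V : Type v} [SeminormedAddCommGroup V]
    [NormedSpace 𝕜 V] (f : A.rHom a b →ₗ[𝕜] V) (K : ℝ) (hf : ∀ x, ‖f x‖ ≤ K * ‖x‖)
    (S : Submodule 𝕜 V) (hS : IsClosed (S : Set V))
    (h : ∀ (g : a ⟶ b) (x : A.alg b), f (A.rsingle g x) ∈ S) (x : A.rHom a b) : f x ∈ S := by
  have hc : Continuous f := AddMonoidHomClass.continuous_of_bound f K hf
  refine (A.denseRange_coeRed a b).induction_on (p := fun x => f x ∈ S) x (hS.preimage hc) fun μ => ?_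
  induction μ using GCAlg.Conv.ind with
  | h0 => rw [map_zero, map_zero]; exact zero_mem _
  | hadd μ ν h h' => rw [map_add, map_add]; exact add_mem h h'
  | hs g x => exact h g x

variable {E E₁ : GMod A B}

/-- The operator induced on the fibres of `desMod`. -/
abbrev desMap {a : 𝒢} (T : Op (E.mod a) (E₁.mod a)) : Op (desMod hB E a) (desMod hB E₁ a) :=
  Tensor.map (desT hB E a) (desT hB E₁ a) T

theorem desU_comp_map {a b : 𝒢} (g : a ⟶ b) (T : Op (E.mod a) (E₁.mod a)) :
    (desU hB E₁ g).comp (desMap hB T) = (desMap hB (GMod.conj g T)).comp (desU hB E g) :=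
  des_ext hB fun {c} h η => by
    change (desU hB E₁ g).toFun ((desMap hB T).toFun (desι hB E h η)) =
      (desMap hB (GMod.conj g T)).toFun ((desU hB E g).toFun (desι hB E h η))
    rw [map_desι, desU_ι, desU_ι, map_desι]
    refine desι_congr hB E₁ rfl ?_
    refine Eq.trans ?_ (GMod.conj_apply g T _).symm
    exact congrArg (fun ζ => E₁.tr g (T.toFun (a := CAlg.pt _) ζ)) (E.tr_inv' g η).symm

theorem desOpS_comp_map {a b : 𝒢} (g : a ⟶ b) (x : A.alg b) (T : Op (E.mod a) (E₁.mod a)) :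
    (desOpS hB E₁ g x).comp (desMap hB T) =
      (desMap hB ((E₁.op x).comp (GMod.conj g T))).comp (desU hB E g) := by
  have h1 := desU_comp_map hB g T
  have h2 : desMap hB ((E₁.op x).comp (GMod.conj g T)) =
      (desMap hB (E₁.op x)).comp (desMap hB (GMod.conj g T)) := Tensor.map_comp _ _ _ _ _
  rw [h2]
  exact congrArg (desMap hB (E₁.op x)).comp h1

theorem map_comp_desOpS {a b : 𝒢} (g : a ⟶ b) (x : A.alg b) (T : Op (E.mod b) (E₁.mod b)) :
    (desMap hB T).comp (desOpS hB E g x) = (desMap hB (T.comp (E.op x))).comp (desU hB E g) := by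
  have h2 : desMap hB (T.comp (E.op x)) = (desMap hB T).comp (desMap hB (E.op x)) :=
    Tensor.map_comp _ _ _ _ _
  rw [h2]
  rfl

theorem even_rsingle {a b : 𝒢} (g : a ⟶ b) (x : A.alg b) :
    A.red.even (A.rsingle g x) = A.rsingle g (GMod.ev x) := by
  refine Eq.trans (b := (2⁻¹ : 𝕜) • (A.rsingle g x + A.red.grade (A.rsingle g x))) rfl ?_
  rw [A.rsingle_grade, ← map_add, ← map_smul]
  rfl

theorem odd_rsingle {a b : 𝒢} (g : a ⟶ b) (x : A.alg b) :
    A.red.odd (A.rsingle g x) = A.rsingle g (GMod.od x) := by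
  refine Eq.trans (b := (2⁻¹ : 𝕜) • (A.rsingle g x - A.red.grade (A.rsingle g x))) rfl ?_
  rw [A.rsingle_grade, ← map_sub, ← map_smul]
  rfl

theorem gcomm_des {a b : 𝒢} (g : a ⟶ b) (x : A.alg b) (T : Op (E.mod a) (E₁.mod a))
    (T' : Op (E.mod b) (E₁.mod b)) :
    Bimod.gcomm (E := desBim hB E) (F := desBim hB E₁) (p := A.robj a) (q := A.robj b)
        (A.rsingle g x) (desMap hB T) (desMap hB T') =
      (desMap hB ((E₁.op x).comp (GMod.conj g T - T') + GMod.gcomm x T')).comp (desU hB E g) := by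
  have h1 : Bimod.gcomm (E := desBim hB E) (F := desBim hB E₁) (p := A.robj a) (q := A.robj b)
        (A.rsingle g x) (desMap hB T) (desMap hB T') =
      (desOpS hB E₁ g x).comp (desMap hB T) - (desMap hB T').comp (desOpS hB E g (GMod.ev x)) -
        (desMap hB T').grade.comp (desOpS hB E g (GMod.od x)) := by
    rw [← desOp_rsingle, ← desOp_rsingle, ← desOp_rsingle, ← even_rsingle, ← odd_rsingle]
    rfl
  have h2 : (desMap hB T').grade = desMap hB T'.grade := (Tensor.map_grade _ _ _).symm
  have h3 : (E₁.op x).comp (GMod.conj g T - T') + GMod.gcomm x T' =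
      (E₁.op x).comp (GMod.conj g T) - T'.comp (E.op (GMod.ev x)) -
        T'.grade.comp (E.op (GMod.od x)) := by
    rw [GMod.gcomm_def]
    refine GMod.op_ext fun η => ?_
    simp only [Op.add_apply, Op.sub_apply, Op.comp_apply, map_sub]
    abel
  rw [h1, h2, h3, desOpS_comp_map, map_comp_desOpS, map_comp_desOpS]
  have h4 : desMap hB ((E₁.op x).comp (GMod.conj g T) - T'.comp (E.op (GMod.ev x)) -
        T'.grade.comp (E.op (GMod.od x))) = desMap hB ((E₁.op x).comp (GMod.conj g T)) -
          desMap hB (T'.comp (E.op (GMod.ev x))) - desMap hB (T'.grade.comp (E.op (GMod.od x))) := by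
    rw [desMap, Tensor.map_sub, Tensor.map_sub]
  rw [h4, Op.sub_comp, Op.sub_comp]

theorem desMap_mem {a b : 𝒢} {T : Op (E.mod b) (E₁.mod b)} (g : a ⟶ b)
    (hT : T ∈ Op.compacts (E.mod b) (E₁.mod b)) :
    (desMap hB T).comp (desU hB E g) ∈ Op.compacts (desMod hB E a) (desMod hB E₁ b) :=
  Op.comp_mem_right (Tensor.map_mem_compacts (hB.hasApprox b) (desT hB E b) (desT hB E₁ b) hT) _

theorem GMod.Comm.des {T : ∀ a, Op (E.mod a) (E₁.mod a)} (hT : GMod.Comm E E₁ T) :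
    Bimod.Comm (desBim hB E) (desBim hB E₁) fun a : 𝒢 => desMap hB (T a) :=
  fun {a b : 𝒢} x => A.rsingle_induction
    (Bimod.gcommₗ (E := desBim hB E) (F := desBim hB E₁) (p := A.robj a) (q := A.robj b)
      (desMap hB (T a)) (desMap hB (T b))) _
    (fun x => Bimod.norm_gcomm_le x _ _) (Op.compacts _ _) (Submodule.isClosed_topologicalClosure _) (fun g x => by
      exact mem_of_eq (gcomm_des hB g x (T a) (T b))
        (desMap_mem hB g (add_mem (hT.2 g x) (hT.1 b x)))) x

/-- Left and right multiplication with a fixed operator. -/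
def desMul (a b : 𝒢) (T : Op (desMod hB E a) (desMod hB E₁ a)) :
    A.rHom a b →ₗ[𝕜] Op (desMod hB E a) (desMod hB E₁ b) where
  toFun x := (desOp hB E₁ x).comp T
  map_add' x y := by
    rw [← Op.add_comp]; exact congrArg (·.comp T) ((desOpₗ hB E₁ a b).map_add x y)
  map_smul' c x := by
    refine Eq.trans ?_ (Op.smul_comp c _ T)
    exact congrArg (·.comp T) ((desOpₗ hB E₁ a b).map_smul c x)

theorem desMul_mem {a b : 𝒢} {T : Op (E.mod a) (E₁.mod a)}
    (hT : ∀ y : A.alg a, (E₁.op y).comp T ∈ Op.compacts (E.mod a) (E₁.mod a)) (x : A.rHom a b) :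
    (desOp hB E₁ x).comp (desMap hB T) ∈ Op.compacts (desMod hB E a) (desMod hB E₁ b) :=
  A.rsingle_induction (desMul hB a b (desMap hB T)) ‖desMap hB T‖
    (fun x => (Op.norm_comp_le _ _).trans (by
      rw [mul_comm]; exact mul_le_mul_of_nonneg_left (norm_desOp_le hB E₁ x) (norm_nonneg _)))
    (Op.compacts _ _) (Submodule.isClosed_topologicalClosure _) (fun g x => by
      have h1 : (E₁.op x).comp (GMod.conj g T) =
          GMod.conj g ((E₁.op (A.act (Groupoid.inv g) x)).comp T) := by
        rw [GMod.conj_comp, GMod.conj_op]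
      have h2 := desMap_mem hB g (GMod.conj_mem g (hT (A.act (Groupoid.inv g) x)))
      rw [← h1] at h2
      refine mem_of_eq ?_ h2
      rw [← desOpS_comp_map, ← desOp_rsingle]
      rfl) x

theorem star_desOp_comp {a b : 𝒢} (x : A.rHom a b) (T : Op (E.mod b) (E₁.mod b)) :
    ((desOp hB E (A.red.star x : A.rHom b a)).comp (desMap hB T.star)).star =
      (desMap hB T).comp (desOp hB E x) := by
  have h : desMap hB T.star = (desMap hB T).star := Tensor.map_star _ _ _
  rw [desOp_star, h]
  rfl

theorem GMod.Cpt.des {T : ∀ a, Op (E.mod a) (E₁.mod a)} (hT : GMod.Cpt E E₁ T) :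
    Bimod.Cpt (desBim hB E) (desBim hB E₁) fun a : 𝒢 => desMap hB (T a) :=
  fun {a b : 𝒢} x => by
    refine ⟨desMul_mem hB (fun y => (hT a (p := CAlg.pt _) (q := CAlg.pt _) y).1) x, ?_⟩
    have h := Op.star_mem (desMul_mem hB (T := (T b).star) (fun y => by
      have h1 := Op.star_mem (hT b (p := CAlg.pt _) (q := CAlg.pt _) (star y : A.alg b)).2
      have h2 : E.op (star y) = (E.op y).star :=
        (E.bim b).op_star (p := CAlg.pt _) (q := CAlg.pt _) y
      have h3 : (E.op y).comp (T b).star = ((T b).comp (E.op (star y))).star := by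
        rw [h2]; rfl
      rw [h3]
      exact h1) (A.red.star x : A.rHom b a))
    exact mem_of_eq (star_desOp_comp hB x (T b)).symm h

/-- The operators `T ⊗ 1` as a functor. -/
def desFam : GFunctor (FamCat (fun a : 𝒢 => (B.alg a).cat) (GMod.mod (A := A) (B := B)))
    (FamCat (fun _ : 𝒢 => B.red) fun (E : Bimod A.red B.red) (a : 𝒢) => E.fiber (A.robj a)) :=
  tensFam (F := fun a : 𝒢 => B.incl a) GMod.mod
    (fun (E : Bimod A.red B.red) (a : 𝒢) => E.fiber (A.robj a)) (desBim hB) (desT hB)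

/-- The descent functor. -/
def descent (A : GCAlg 𝕜 𝒢) {B : GCAlg 𝕜 𝒢} (hB : B.SigmaUnital) :
    GFunctor (QDG A B) (QD A.red B.red) :=
  (DGPair A B).mapQ (DPair A.red B.red) (desFam hB) (fun h => GMod.Comm.des hB h)
    (fun h => GMod.Cpt.des hB h)

theorem descent_isDescent (A : GCAlg 𝕜 𝒢) {B : GCAlg 𝕜 𝒢} (hB : B.SigmaUnital) :
    IsDescent (descent A hB) :=
  ⟨desDM hB, fun _ _ T => ⟨⟨(desFam hB).map T.1, GMod.Comm.des hB T.2⟩,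
    fun g η => map_desι hB (T.1.1 _) g η, rfl⟩⟩

end Descent

end
end CStarDescent

namespace CStarDescent

noncomputable section

open GStarCat
open Filter (Tendsto atTop)

variable {𝕜 : Type} [RCLike 𝕜]

/-! ## Uniqueness and naturality of the descent functor -/

section Descent

variable {𝒢 : Type u} [Groupoid.{u} 𝒢] {A B : GCAlg 𝕜 𝒢}

theorem Op.norm_toFun_le {C : GStarCat.{v, w} 𝕜} {X Y : HilbMod C} (T : Op X Y) {b : C.Obj}
    (η : X.E b) : ‖T.toFun η‖ ≤ ‖T‖ * ‖η‖ := T.bd_norm.2.1 η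

/-- Evaluation of the action of the reduced crossed product. -/
def Bimod.opEv {B : GStarCat.{v, w} 𝕜} (E : Bimod A.red B) (a a' : 𝒢) {b : B.Obj}
    (η : (E.fiber (A.robj a)).E b) : A.rHom a a' →ₗ[𝕜] (E.fiber (A.robj a')).E b where
  toFun x := (E.op x).toFun η
  map_add' x y := by rw [_root_.map_add]; rfl
  map_smul' c x := by rw [_root_.map_smul]; rfl

theorem Bimod.continuous_opEv {B : GStarCat.{v, w} 𝕜} (E : Bimod A.red B) {a a' : 𝒢} {b : B.Obj}
    (η : (E.fiber (A.robj a)).E b) : Continuous (E.opEv a a' η) :=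
  AddMonoidHomClass.continuous_of_bound _ ‖η‖ fun x => by
    rw [mul_comm]
    exact ((E.op x).norm_toFun_le η).trans
      (mul_le_mul_of_nonneg_right (E.norm_op_le x) (norm_nonneg _))

theorem GCAlg.red_ext_rsingle (A : GCAlg 𝕜 𝒢) {a b : 𝒢} {V : Type v} [AddCommGroup V] [Module 𝕜 V]
    [TopologicalSpace V] [T2Space V] {f g : A.rHom a b →ₗ[𝕜] V} (hf : Continuous f)
    (hg : Continuous g) (h : ∀ (k : a ⟶ b) (x : A.alg b), f (A.rsingle k x) = g (A.rsingle k x))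
    (x) : f x = g x :=
  A.red_ext hf hg (fun μ => by
    induction μ using GCAlg.Conv.ind with
    | h0 => rw [map_zero, map_zero, map_zero]
    | hadd μ ν h h' => rw [map_add, map_add, map_add, h, h']
    | hs k x => exact h k x) x

/-- Functors whose values have total families with the same inner products, on which the gradings,
actions and representatives of morphisms are given by the same formulas, are isomorphic. -/
theorem QD.natIso_of_total {X : GStarCat.{v', w'} 𝕜} {B : GStarCat.{v, w} 𝕜} [IsCStar B]
    (F G : GFunctor X (QD A.red B)) {J : X.Obj → 𝒢 → B.Obj → Type*}
    (κ : ∀ x p {b}, J x p b → (Bimod.fiber (F.obj x : Bimod A.red B) (A.robj p)).E b)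
    (μ : ∀ x p {b}, J x p b → (Bimod.fiber (G.obj x : Bimod A.red B) (A.robj p)).E b)
    (hκ : ∀ x p b, Total 𝕜 (κ x p (b := b))) (hμ : ∀ x p b, Total 𝕜 (μ x p (b := b)))
    (hi : ∀ x p {b c} (i : J x p b) (j : J x p c),
      (Bimod.fiber (G.obj x : Bimod A.red B) (A.robj p)).inner (μ x p i) (μ x p j) =
        (Bimod.fiber (F.obj x : Bimod A.red B) (A.robj p)).inner (κ x p i) (κ x p j))
    (hg : ∀ x p {b} (j : J x p b), ∃ j' : J x p b,
      (Bimod.fiber (F.obj x : Bimod A.red B) (A.robj p)).grade (κ x p j) = κ x p j' ∧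
      (Bimod.fiber (G.obj x : Bimod A.red B) (A.robj p)).grade (μ x p j) = μ x p j')
    (ho : ∀ x {p q : 𝒢} (g : p ⟶ q) (y : A.alg q) {b} (j : J x p b), ∃ j' : J x q b,
      (Bimod.op (F.obj x : Bimod A.red B) (A.rsingle g y)).toFun (κ x p j) = κ x q j' ∧
      (Bimod.op (G.obj x : Bimod A.red B) (A.rsingle g y)).toFun (μ x p j) = μ x q j')
    (hm : ∀ {x y : X.Obj} (f : X.Hom x y),
      ∃ (S : (DPair A.red B).P (F.obj x : Bimod A.red B) (F.obj y : Bimod A.red B))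
        (T : (DPair A.red B).P (G.obj x : Bimod A.red B) (G.obj y : Bimod A.red B)),
        F.map f = (DPair A.red B).cls S ∧ G.map f = (DPair A.red B).cls T ∧
          ∀ p {b} (j : J x p b), ∃ j' : J y p b,
            (S.1.1 (A.robj p)).toFun (κ x p j) = κ y p j' ∧
            (T.1.1 (A.robj p)).toFun (μ x p j) = μ y p j') :
    NatIso F G := by
  choose U hU hUκ hUμ using fun (x : X.Obj) (p : 𝒢) => Op.exists_unitary (J := J x p)
    (κ := κ x p) (hκ x p) (μ := μ x p) (hμ x p) (fun {a b} q p' => hi x p q p')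
  refine QD.natIso F G (fun x (p : 𝒢) => U x p) (fun x (p : 𝒢) => hU x p)
    (fun x (p : 𝒢) => ?_) (fun x => fun {p q : 𝒢} a => ?_) (fun {x y} f => ?_)
  · refine Op.ext_of_total (J := J x p) (hκ x p) fun b j => ?_
    obtain ⟨j', h1, h2⟩ := hg x p j
    change HilbMod.grade _ ((U x p).toFun (HilbMod.grade _ (κ x p j))) = (U x p).toFun (κ x p j)
    rw [h1, hUκ, hUκ, ← h2, HilbMod.grade_grade]
  · refine Op.ext_of_total (J := J x p) (hκ x p) fun b j => ?_
    refine A.red_ext_rsingle (f := (U x q).toFun ∘ₗ Bimod.opEv (F.obj x) p q (κ x p j))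
      (g := Bimod.opEv (G.obj x) p q ((U x p).toFun (κ x p j)))
      ((U x q).continuous.comp (Bimod.continuous_opEv _ _)) (Bimod.continuous_opEv _ _)
      (fun g y => ?_) a
    obtain ⟨j', h1, h2⟩ := ho x g y j
    rw [hUκ]
    exact (congrArg (U x q).toFun h1).trans ((hUκ x q j').trans h2.symm)
  · obtain ⟨S, T, h1, h2, h⟩ := hm f
    refine ⟨S, T, h1, h2, fun (p : 𝒢) => ?_⟩
    refine Op.ext_of_total (J := J x p) (hκ x p) fun b j => ?_
    obtain ⟨j', h1, h2⟩ := h p j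
    refine (congrArg (U y p).toFun h1).trans ((hUκ y p j').trans (h2.symm.trans ?_))
    exact congrArg (T.1.1 (A.robj p)).toFun (hUκ x p j).symm

namespace DescentMod

variable {E : GMod A B} {F : Bimod A.red B.red} (d : DescentMod E F)

/-- The space of sections of a bimodule with the universal property of the descent functor. -/
abbrev secs (_ : DescentMod E F) (a b : 𝒢) : Type u := (F.fiber (A.robj a)).E (B.robj b)

theorem total (a b : 𝒢) : Total 𝕜 fun p : (b ⟶ a) × (E.mod a).sp => (d.ι p.1 p.2 : d.secs a b) :=
  fun ζ => by
  refine closure_mono (Submodule.span_mono ?_) (d.dense a b ζ)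
  rintro _ ⟨g, η, rfl⟩
  exact ⟨(g, η), rfl⟩

theorem inner_ι' {a b c : 𝒢} (g : c ⟶ a) (h : b ⟶ a) (η ξ : (E.mod a).sp) :
    (F.fiber (A.robj a)).inner (d.ι g η) (d.ι h ξ) =
      B.rsingle (h ≫ Groupoid.inv g) (B.act (Groupoid.inv g) ((E.mod a).ip η ξ)) :=
  d.inner_ι g h η ξ

theorem norm_ι_le {a b : 𝒢} (g : b ⟶ a) (η : (E.mod a).sp) : ‖(d.ι g η : d.secs a b)‖ ≤ ‖η‖ := by
  refine (sq_le_sq₀ (norm_nonneg _) (norm_nonneg _)).mp ?_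
  refine ((F.fiber (A.robj a)).norm_sq (d.ι g η)).trans_le ?_
  rw [d.inner_ι', (E.mod a).norm_sq]
  exact (B.norm_rsingle_le _ _).trans ((B.act _).norm_le _)

theorem continuous_ι {a b : 𝒢} (g : b ⟶ a) :
    Continuous fun η : (E.mod a).sp => (d.ι g η : d.secs a b) :=
  AddMonoidHomClass.continuous_of_bound (d.ι g) 1 fun η => by rw [one_mul]; exact d.norm_ι_le g η

end DescentMod

theorem IsDescent.natIso {D D' : GFunctor (QDG A B) (QD A.red B.red)} (h : IsDescent D)
    (h' : IsDescent D') : NatIso D D' := by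
  obtain ⟨d, hd⟩ := h
  obtain ⟨d', hd'⟩ := h'
  refine QD.natIso_of_total D D'
    (J := fun (E : GMod A B) a (b : 𝒢) => (b ⟶ a) × (E.mod a).sp)
    (fun (E : GMod A B) a {b : 𝒢} j => (d E).ι j.1 j.2)
    (fun (E : GMod A B) a {b : 𝒢} j => (d' E).ι j.1 j.2)
    (fun E a (b : 𝒢) => (d E).total a b) (fun E a (b : 𝒢) => (d' E).total a b)
    (fun E a {b c : 𝒢} i j => ((d' E).inner_ι _ _ _ _).trans ((d E).inner_ι _ _ _ _).symm)
    (fun E a {b : 𝒢} j => ⟨(j.1, (E.mod a).grade j.2), (d E).grade_ι _ _, (d' E).grade_ι _ _⟩)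
    (fun E {p q} g y {b : 𝒢} j => ⟨(j.1 ≫ g, (E.op y).toFun (E.tr g j.2)), (d E).op_ι _ _ _ _,
      (d' E).op_ι _ _ _ _⟩)
    (fun {E E₁} f => ?_)
  obtain ⟨T, rfl⟩ := (DGPair A B).cls_surj f
  obtain ⟨S, h1, h2⟩ := hd E E₁ T
  obtain ⟨S', h1', h2'⟩ := hd' E E₁ T
  exact ⟨S, S', h2, h2', fun a {b : 𝒢} j => ⟨(j.1, (T.1.1 a).toFun j.2), h1 _ _, h1' _ _⟩⟩

end Descent

end
end CStarDescent

namespace CStarDescent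

noncomputable section

open GStarCat
open Filter (Tendsto atTop)

variable {𝕜 : Type} [RCLike 𝕜]

theorem Total.mem {V : Type w} [SeminormedAddCommGroup V] [NormedSpace 𝕜 V] {J : Type*} {κ : J → V}
    (h : Total 𝕜 κ) {G : Type v'} [SeminormedAddCommGroup G] [NormedSpace 𝕜 G] {f : V →ₗ[𝕜] G}
    (hf : Continuous f) {J' : Type*} {μ : J' → G}
    (hm : ∀ j, f (κ j) ∈ closure (Submodule.span 𝕜 (Set.range μ) : Set G)) (x : V) :
    f x ∈ closure (Submodule.span 𝕜 (Set.range μ) : Set G) := by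
  have h1 : Submodule.span 𝕜 (Set.range κ) ≤
      (Submodule.span 𝕜 (Set.range μ)).topologicalClosure.comap f :=
    Submodule.span_le.mpr (by rintro _ ⟨j, rfl⟩; exact hm j)
  exact closure_minimal (s := (Submodule.span 𝕜 (Set.range κ) : Set V)) h1
    (isClosed_closure.preimage hf) (h x)

theorem mem_span_range {V : Type w} [SeminormedAddCommGroup V] [NormedSpace 𝕜 V] {J : Type*}
    {μ : J → V} (j : J) {x : V} (h : μ j = x) :
    x ∈ closure (Submodule.span 𝕜 (Set.range μ) : Set V) :=
  subset_closure (Submodule.subset_span ⟨j, h⟩)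

theorem Tensor.total_of {B : GStarCat.{v, w} 𝕜} {B' : GStarCat.{v', w'} 𝕜} [IsCStar B] [IsCStar B']
    {F : GFunctor B B'} {E : HilbMod B} {E' : HilbMod B'} (t : Tensor F E E') {c : B'.Obj}
    {K : B.Obj → Type*} {W : B.Obj → Type*} {κ : ∀ b, K b → E.E b}
    {ω : ∀ b, W b → B'.Hom c (F.obj b)} (hκ : ∀ b, Total 𝕜 (κ b)) (hω : ∀ b, Total 𝕜 (ω b)) :
    Total 𝕜 fun p : Σ b, K b × W b => t.τ (κ p.1 p.2.1) (ω p.1 p.2.2) := by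
  refine Total.of_mem (t.total c) fun ⟨b, η, y⟩ => ?_
  refine (hκ b).mem (f := (t.τ (b := b) (c := c)).flip y)
    (AddMonoidHomClass.continuous_of_bound _ ‖y‖ fun η => (t.norm_τ_le η y).trans_eq (mul_comm _ _))
    (fun k => ?_) η
  refine (hω b).mem (f := t.τ (κ b k))
    (AddMonoidHomClass.continuous_of_bound _ ‖κ b k‖ fun y => t.norm_τ_le _ y) (fun i => ?_) y
  exact mem_span_range ⟨b, k, i⟩ rfl

section Descent

variable {𝒢 : Type u} [Groupoid.{u} 𝒢] {A A' B B' : GCAlg 𝕜 𝒢}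

theorem CovHom.red_rsingle {ℋ : Type u} [Groupoid.{u} ℋ] {f : ℋ ⥤ 𝒢} [f.Faithful]
    {A : GCAlg 𝕜 ℋ} (F : CovHom f A B) {a b : ℋ} (g : a ⟶ b) (x : A.alg b) :
    F.red.map (A.rsingle g x) = B.rsingle (f.map g) (F.app b x) := by
  refine (lext_coe (E := A.Conv a b) (F := B.Conv (f.obj a) (f.obj b)) F.convMap 1
    (fun x => (F.norm_convMap_le x).trans_eq (one_mul _).symm) (A.single g x)).trans ?_
  rw [F.convMap_single]
  rfl

theorem GCAlg.total_rsingle (A : GCAlg 𝕜 𝒢) (a b : 𝒢) :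
    Total 𝕜 fun p : (a ⟶ b) × A.alg b => (A.rsingle p.1 p.2 : A.rHom a b) := fun x => by
  refine (A.denseRange_coeRed a b).induction_on
    (p := fun x => x ∈ closure (Submodule.span 𝕜 (Set.range fun p : (a ⟶ b) × A.alg b =>
      (A.rsingle p.1 p.2 : A.rHom a b)) : Set (A.rHom a b))) x isClosed_closure fun μ =>
    subset_closure ?_
  induction μ using GCAlg.Conv.ind with
  | h0 => rw [map_zero]; exact zero_mem _
  | hadd μ ν h h' => rw [map_add]; exact add_mem h h'
  | hs g x => exact Submodule.subset_span ⟨(g, x), rfl⟩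

theorem IsDescent.natIso_pull {D : GFunctor (QDG A B) (QD A.red B.red)}
    {D' : GFunctor (QDG A' B) (QD A'.red B.red)} (h : IsDescent D) (h' : IsDescent D')
    (α : GHom A' A) : NatIso ((QDG.pull α).comp D') (D.comp (QD.pull α.red)) := by
  obtain ⟨d, hd⟩ := h
  obtain ⟨d', hd'⟩ := h'
  refine QD.natIso_of_total _ _
    (J := fun (E : GMod A B) a (b : 𝒢) => (b ⟶ a) × (E.mod a).sp)
    (fun (E : GMod A B) a {b : 𝒢} j => (d' (GMod.pull α E)).ι j.1 j.2)
    (fun (E : GMod A B) a {b : 𝒢} j => (d E).ι j.1 j.2)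
    (fun E a (b : 𝒢) => (d' (GMod.pull α E)).total a b) (fun E a (b : 𝒢) => (d E).total a b)
    (fun E a {b c : 𝒢} i j => ((d E).inner_ι _ _ _ _).trans
      ((d' (GMod.pull α E)).inner_ι _ _ _ _).symm)
    (fun E a {b : 𝒢} j => ⟨(j.1, (E.mod a).grade j.2), (d' (GMod.pull α E)).grade_ι _ _,
      (d E).grade_ι _ _⟩)
    (fun E {p q} g y {b : 𝒢} j => ⟨(j.1 ≫ g, (E.op (α.app q y)).toFun (E.tr g j.2)),
      (d' (GMod.pull α E)).op_ι _ _ _ _, ?_⟩)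
    (fun {E E₁} f => ?_)
  · refine Eq.trans ?_ ((d E).op_ι g (α.app q y) j.1 j.2)
    exact congrArg (fun x => (Bimod.op (D.obj E : Bimod A.red B.red) x).toFun ((d E).ι j.1 j.2))
      (α.red_rsingle g y)
  · obtain ⟨T, rfl⟩ := (DGPair A B).cls_surj f
    obtain ⟨S, h1, h2⟩ := hd E E₁ T
    let T' : (DGPair A' B).P (GMod.pull α E) (GMod.pull α E₁) :=
      ⟨(FamCat.obMap GMod.mod (GMod.pull α)).map T.1,
        fun a => Bimod.Comm.pull (α.fib a) (T.2.1 a), fun g x => T.2.2 g (α.app _ x)⟩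
    obtain ⟨S', h1', h2'⟩ := hd' _ _ T'
    refine ⟨S', ⟨((FamCat.reindex Bimod.fiber α.red.obj).comp
      (FamCat.obMap Bimod.fiber (Bimod.pull α.red))).map S.1, Bimod.Comm.pull α.red S.2⟩, h2',
      congrArg (QD.pull α.red).map h2, fun a {b : 𝒢} j => ⟨(j.1, (T.1.1 a).toFun j.2), h1' _ _,
        h1 _ _⟩⟩

/-- The inner products of elementary tensors over the reduced crossed product. -/
theorem GCAlg.comp_star_rsingle (B : GCAlg 𝕜 𝒢) {a b b' c c' : 𝒢} (g : b ⟶ a) (h : c ⟶ b)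
    (g' : b' ⟶ a) (h' : c' ⟶ b') (y : B.alg b) (z : B.alg a) (y' : B.alg b') :
    B.red.comp (B.red.star (B.rsingle h y)) (B.red.comp (B.rsingle (g' ≫ Groupoid.inv g)
      (B.act (Groupoid.inv g) z)) (B.rsingle h' y')) =
    B.rsingle ((h' ≫ g') ≫ Groupoid.inv (h ≫ g)) (B.act (Groupoid.inv (h ≫ g))
      (star (B.act g y) * (z * B.act g' y'))) := by
  rw [B.rsingle_star, B.rsingle_comp, B.rsingle_comp]
  refine B.rsingle_congr (by simp) ?_
  rw [map_mul (B.act (Groupoid.inv (h ≫ g))).hom, map_mul (B.act (Groupoid.inv (h ≫ g))).hom,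
    map_mul (B.act (Groupoid.inv h)).hom, ← map_star (B.act g).hom]
  rw [← B.act_comp, ← B.act_comp, ← B.act_comp, ← B.act_comp]
  simp

end Descent

end
end CStarDescent

namespace CStarDescent

noncomputable section

open GStarCat
open Filter (Tendsto atTop)

variable {𝕜 : Type} [RCLike 𝕜]

section Descent

variable {𝒢 : Type u} [Groupoid.{u} 𝒢] {A B B' : GCAlg 𝕜 𝒢}

namespace DescentMod

variable {E : GMod A B} {F : Bimod A.red B.red} (d : DescentMod E F)

theorem ι_congr {a b : 𝒢} {g h : b ⟶ a} {η ξ : (E.mod a).sp} (hg : g = h) (hη : η = ξ) :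
    d.ι g η = d.ι h ξ := by rw [hg, hη]

end DescentMod

/-- The components of an equivariant map. -/
def GHom.fibHom (β : GHom B B') (a : 𝒢) : CHom (B.alg a) (B'.alg a) := β.app a

theorem GHom.fibHom_act (β : GHom B B') {a b : 𝒢} (g : a ⟶ b) (x : B.alg a) :
    β.fibHom b (B.act g x) = B'.act g (β.fibHom a x) := CovHom.equivariant β g x

theorem GHom.red_rsingle (β : GHom B B') {a b : 𝒢} (g : a ⟶ b) (x : B.alg b) :
    β.red.map (B.rsingle g x) = B'.rsingle g (β.fibHom b x) := CovHom.red_rsingle β g x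

section Coeff

variable {β : GHom B B'} {a : 𝒢} {X : HilbMod (B.alg a).cat} {Y : HilbMod (B'.alg a).cat}
  (t : Tensor (β.fib a) X Y)

/-- Elementary tensors over a coefficient algebra. -/
def fibτ : X.sp →ₗ[𝕜] B'.alg a →ₗ[𝕜] Y.sp := t.τ (b := CAlg.pt _) (c := CAlg.pt _)

theorem ip_fibτ (η ξ : X.sp) (y z : B'.alg a) :
    Y.ip (fibτ t η y) (fibτ t ξ z) = star y * (β.fibHom a (X.ip η ξ) * z) :=
  t.inner_τ (a := CAlg.pt _) (b := CAlg.pt _) η y ξ z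

theorem total_fibτ : Total 𝕜 fun p : X.sp × B'.alg a => fibτ t p.1 p.2 := fun ζ => by
  refine closure_mono (Submodule.span_mono ?_) (t.total (CAlg.pt _) ζ)
  rintro _ ⟨p, rfl⟩
  exact ⟨(p.2.1, p.2.2), rfl⟩

theorem grade_fibτ (η : X.sp) (y : B'.alg a) :
    Y.grade (fibτ t η y) = fibτ t (X.grade η) ((B'.alg a).grade y) :=
  t.grade_τ (b := CAlg.pt _) η y

end Coeff

section Index

variable {β : GHom B B'} {E E₁ : GMod A B} {E' E₁' : GMod A B'} {F F₁ : Bimod A.red B.red}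
  {F' F₁' F'' F₁'' : Bimod A.red B'.red} (d : DescentMod E F) (d' : DescentMod E' F')
  (d₁ : DescentMod E₁ F₁) (d₁' : DescentMod E₁' F₁')
  (t : ∀ a, Tensor (β.fib a) (E.mod a) (E'.mod a)) (s : ∀ p, Tensor β.red (F.fiber p) (F''.fiber p))
  (t₁ : ∀ a, Tensor (β.fib a) (E₁.mod a) (E₁'.mod a))
  (s₁ : ∀ p, Tensor β.red (F₁.fiber p) (F₁''.fiber p))

/-- Elementary elements of the descent of a change of coefficients. -/
def elκ {a b c : 𝒢} (g : b ⟶ a) (η : (E.mod a).sp) (h : c ⟶ b) (y : B'.alg b) :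
    (F'.fiber (A.robj a)).E (B'.robj c) := d'.ι (h ≫ g) (fibτ (t a) η (B'.act g y))

/-- Elementary elements of the change of coefficients of a descent. -/
def elμ {a b c : 𝒢} (g : b ⟶ a) (η : (E.mod a).sp) (h : c ⟶ b) (y : B'.alg b) :
    (F''.fiber (A.robj a)).E (B'.robj c) :=
  (s (A.robj a)).τ (b := B.robj b) (d.ι g η) (B'.rsingle h y)

theorem total_elκ (a c : 𝒢) : Total 𝕜 fun j : Σ b : 𝒢, ((b ⟶ a) × (E.mod a).sp) ×
    ((c ⟶ b) × B'.alg b) => elκ d' t j.2.1.1 j.2.1.2 j.2.2.1 j.2.2.2 := by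
  refine Total.of_mem (d'.total a c) fun p => ?_
  refine (total_fibτ (t a)).mem (f := d'.ι p.1) (d'.continuous_ι p.1) (fun q => ?_) p.2
  refine mem_span_range ⟨a, (𝟙 a, q.1), (p.1, q.2)⟩ ?_
  refine d'.ι_congr (by simp) ?_
  rw [B'.act_id]

theorem total_elμ (a c : 𝒢) : Total 𝕜 fun j : Σ b : 𝒢, ((b ⟶ a) × (E.mod a).sp) ×
    ((c ⟶ b) × B'.alg b) => elμ d s j.2.1.1 j.2.1.2 j.2.2.1 j.2.2.2 :=
  (s (A.robj a)).total_of (c := B'.robj c) (κ := fun (b : 𝒢) (p : (b ⟶ a) × (E.mod a).sp) => d.ι p.1 p.2)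
    (ω := fun (b : 𝒢) (p : (c ⟶ b) × B'.alg b) => B'.rsingle p.1 p.2)
    (fun b : 𝒢 => d.total a b) (fun b : 𝒢 => B'.total_rsingle c b)

theorem inner_elκ {a b c b' c' : 𝒢} (g : b ⟶ a) (η : (E.mod a).sp) (h : c ⟶ b) (y : B'.alg b)
    (g' : b' ⟶ a) (η' : (E.mod a).sp) (h' : c' ⟶ b') (y' : B'.alg b') :
    (F'.fiber (A.robj a)).inner (elκ d' t g η h y) (elκ d' t g' η' h' y') =
      B'.rsingle ((h' ≫ g') ≫ Groupoid.inv (h ≫ g)) (B'.act (Groupoid.inv (h ≫ g))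
        (star (B'.act g y) * (β.fibHom a ((E.mod a).ip η η') * B'.act g' y'))) := by
  refine (d'.inner_ι' _ _ _ _).trans ?_
  rw [ip_fibτ]

theorem inner_elμ {a b c b' c' : 𝒢} (g : b ⟶ a) (η : (E.mod a).sp) (h : c ⟶ b) (y : B'.alg b)
    (g' : b' ⟶ a) (η' : (E.mod a).sp) (h' : c' ⟶ b') (y' : B'.alg b') :
    (F''.fiber (A.robj a)).inner (elμ d s g η h y) (elμ d s g' η' h' y') =
      B'.rsingle ((h' ≫ g') ≫ Groupoid.inv (h ≫ g)) (B'.act (Groupoid.inv (h ≫ g))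
        (star (B'.act g y) * (β.fibHom a ((E.mod a).ip η η') * B'.act g' y'))) := by
  refine ((s (A.robj a)).inner_τ _ _ _ _).trans (Eq.trans ?_ (B'.comp_star_rsingle g h g' h' y _ y'))
  have h1 : β.red.map ((F.fiber (A.robj a)).inner (d.ι g η) (d.ι g' η')) =
      B'.rsingle (g' ≫ Groupoid.inv g) (B'.act (Groupoid.inv g) (β.fibHom a ((E.mod a).ip η η'))) :=
    (congrArg β.red.map (d.inner_ι' g g' η η')).trans
      ((β.red_rsingle _ _).trans (congrArg _ (β.fibHom_act _ _)))
  exact congrArg (fun z => B'.red.comp (B'.red.star (B'.rsingle h y))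
    (B'.red.comp z (B'.rsingle h' y'))) h1

theorem grade_elκ {a b c : 𝒢} (g : b ⟶ a) (η : (E.mod a).sp) (h : c ⟶ b) (y : B'.alg b) :
    (F'.fiber (A.robj a)).grade (elκ d' t g η h y) =
      elκ d' t g ((E.mod a).grade η) h ((B'.alg b).grade y) := by
  refine (d'.grade_ι _ _).trans (d'.ι_congr rfl ?_)
  refine (grade_fibτ (t a) _ _).trans ?_
  rw [← (B'.act g).map_grade]

theorem grade_elμ {a b c : 𝒢} (g : b ⟶ a) (η : (E.mod a).sp) (h : c ⟶ b) (y : B'.alg b) :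
    (F''.fiber (A.robj a)).grade (elμ d s g η h y) =
      elμ d s g ((E.mod a).grade η) h ((B'.alg b).grade y) := by
  refine ((s (A.robj a)).grade_τ _ _).trans ?_
  exact congrArg₂ (fun ζ z => (s (A.robj a)).τ (b := B.robj b) ζ z) (d.grade_ι g η)
    (B'.rsingle_grade h y)

theorem op_elκ (hto : ∀ {a : 𝒢} (x : A.alg a) (η : (E.mod a).sp) (y : B'.alg a),
      (E'.op x).toFun (a := CAlg.pt _) (fibτ (t a) η y) = fibτ (t a) ((E.op x).toFun η) y)
    (htr : ∀ {a b : 𝒢} (g : a ⟶ b) (η : (E.mod a).sp) (y : B'.alg a),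
      E'.tr g (fibτ (t a) η y) = fibτ (t b) (E.tr g η) (B'.act g y))
    {a a' b c : 𝒢} (k : a ⟶ a') (x : A.alg a') (g : b ⟶ a) (η : (E.mod a).sp) (h : c ⟶ b)
    (y : B'.alg b) :
    (F'.op (A.rsingle k x)).toFun (elκ d' t g η h y) =
      elκ d' t (g ≫ k) ((E.op x).toFun (E.tr k η)) h y := by
  refine (d'.op_ι _ _ _ _).trans (d'.ι_congr (by simp) ?_)
  rw [htr, hto, B'.act_comp]

theorem op_elμ (hso : ∀ {p q : A.red.Obj} (x : A.red.Hom p q) {b : B.red.Obj} {c : B'.red.Obj}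
      (η : (F.fiber p).E b) (y : B'.red.Hom c (β.red.obj b)),
      (F''.op x).toFun ((s p).τ η y) = (s q).τ ((F.op x).toFun η) y)
    {a a' b c : 𝒢} (k : a ⟶ a') (x : A.alg a') (g : b ⟶ a) (η : (E.mod a).sp) (h : c ⟶ b)
    (y : B'.alg b) :
    (F''.op (A.rsingle k x)).toFun (elμ d s g η h y) =
      elμ d s (g ≫ k) ((E.op x).toFun (E.tr k η)) h y := by
  refine (hso _ _ _).trans ?_
  exact congrArg (fun ζ => (s (A.robj a')).τ (b := B.robj b) ζ (B'.rsingle h y)) (d.op_ι k x g η)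

end Index

theorem IsDescent.natIso_coeff {D : GFunctor (QDG A B) (QD A.red B.red)}
    {D' : GFunctor (QDG A B') (QD A.red B'.red)} (h : IsDescent D) (h' : IsDescent D')
    {β : GHom B B'} {Φ : GFunctor (QDG A B) (QDG A B')}
    {Ψ : GFunctor (QD A.red B.red) (QD A.red B'.red)} (hΦ : IsCoeffChangeG β Φ)
    (hΨ : IsCoeffChange β.red Ψ) : NatIso (Φ.comp D') (D.comp Ψ) := by
  obtain ⟨d, hd⟩ := h
  obtain ⟨d', hd'⟩ := h'
  obtain ⟨t, hto, htr, htT⟩ := hΦ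
  obtain ⟨s, hso, hsT⟩ := hΨ
  refine QD.natIso_of_total _ _
    (J := fun (E : GMod A B) a (c : 𝒢) => Σ b : 𝒢, ((b ⟶ a) × (E.mod a).sp) × ((c ⟶ b) × B'.alg b))
    (fun (E : GMod A B) a {c : 𝒢} j => elκ (d' (Φ.obj E)) (t E) j.2.1.1 j.2.1.2 j.2.2.1 j.2.2.2)
    (fun (E : GMod A B) a {c : 𝒢} j => elμ (d E) (s (D.obj E)) j.2.1.1 j.2.1.2 j.2.2.1 j.2.2.2)
    (fun E a (c : 𝒢) => total_elκ (d' (Φ.obj E)) (t E) a c)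
    (fun E a (c : 𝒢) => total_elμ (d E) (s (D.obj E)) a c)
    (fun E a {c c' : 𝒢} i j => (inner_elμ (d E) (s (D.obj E)) _ _ _ _ _ _ _ _).trans
      (inner_elκ (d' (Φ.obj E)) (t E) _ _ _ _ _ _ _ _).symm)
    (fun (E : GMod A B) a {c : 𝒢} j => ⟨⟨j.1, (j.2.1.1, (E.mod a).grade j.2.1.2),
      (j.2.2.1, (B'.alg j.1).grade j.2.2.2)⟩, grade_elκ (d' (Φ.obj E)) (t E) _ _ _ _,
        grade_elμ (d E) (s (D.obj E)) _ _ _ _⟩)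
    (fun (E : GMod A B) {p q} g x {c : 𝒢} j => ⟨⟨j.1, (j.2.1.1 ≫ g,
      (E.op x).toFun (E.tr g j.2.1.2)), j.2.2⟩,
        op_elκ (d' (Φ.obj E)) (t E) (hto E) (htr E) _ _ _ _ _ _,
        op_elμ (d E) (s (D.obj E)) (hso (D.obj E)) _ _ _ _ _ _⟩)
    (fun {E E₁} f => ?_)
  obtain ⟨T, rfl⟩ := (DGPair A B).cls_surj f
  obtain ⟨T', h1, h2⟩ := htT E E₁ T
  obtain ⟨S', h1', h2'⟩ := hd' _ _ T'
  obtain ⟨S, h3, h4⟩ := hd E E₁ T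
  obtain ⟨R, h3', h4'⟩ := hsT _ _ S
  refine ⟨S', R, (congrArg D'.map h2).trans h2', (congrArg Ψ.map h4).trans h4', fun a {c : 𝒢} j =>
    ⟨⟨j.1, (j.2.1.1, (T.1.1 a).toFun j.2.1.2), j.2.2⟩, ?_, ?_⟩⟩
  · exact (h1' _ _).trans ((d' (Φ.obj E₁)).ι_congr rfl (h1 a j.2.1.2 (B'.act j.2.1.1 j.2.2.2)))
  · refine (h3' (A.robj a) ((d E).ι j.2.1.1 j.2.1.2) (B'.rsingle j.2.2.1 j.2.2.2)).trans ?_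
    exact congrArg (fun ζ => (s (D.obj E₁) (A.robj a)).τ (b := B.robj j.1) ζ
      (B'.rsingle j.2.2.1 j.2.2.2)) (h3 j.2.1.1 j.2.1.2)

end Descent

end
end CStarDescent

namespace CStarDescent

noncomputable section

open GStarCat
open Filter (Tendsto atTop)

variable {𝕜 : Type} [RCLike 𝕜]

section Restrict

variable {ℋ 𝒢 : Type u} [Groupoid.{u} ℋ] [Groupoid.{u} 𝒢] (f : ℋ ⥤ 𝒢) [f.Faithful]
  {A B : GCAlg 𝕜 𝒢}

theorem GCAlg.restrict_red_rsingle (B : GCAlg 𝕜 𝒢) {a b : ℋ} (g : a ⟶ b)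
    (x : B.alg (f.obj b)) :
    (GCAlg.restrictHom f B).red.map ((B.restrict f).rsingle g x) = B.rsingle (f.map g) x :=
  CovHom.red_rsingle (GCAlg.restrictHom f B) g x

variable {f} {E : GMod A B} {F : Bimod A.red B.red}
  {F' : Bimod (A.restrict f).red (B.restrict f).red} {F'' : Bimod (A.restrict f).red B.red}
  (d : DescentMod E F) (d' : DescentMod (E.restrict f) F')
  (s : ∀ p, Tensor (GCAlg.restrictHom f B).red (F'.fiber p) (F''.fiber p))

/-- Elementary elements of the descent of a bimodule, restricted along a functor. -/
def resκ {a b : ℋ} {c : 𝒢} (h : b ⟶ a) (η : (E.mod (f.obj a)).sp) (k : c ⟶ f.obj b)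
    (y : B.alg (f.obj b)) : (F.fiber (A.robj (f.obj a))).E (B.robj c) :=
  d.ι (k ≫ f.map h) ((E.mod (f.obj a)).ac η (B.act (f.map h) y))

/-- Elementary elements of the induction of the descent of a restricted bimodule. -/
def resμ {a b : ℋ} {c : 𝒢} (h : b ⟶ a) (η : (E.mod (f.obj a)).sp) (k : c ⟶ f.obj b)
    (y : B.alg (f.obj b)) : (F''.fiber ((A.restrict f).robj a)).E (B.robj c) :=
  (s ((A.restrict f).robj a)).τ (b := (B.restrict f).robj b) (d'.ι h η) (B.rsingle k y)

theorem total_resκ (hB : B.SigmaUnital) (a : ℋ) (c : 𝒢) : Total 𝕜 fun j : Σ b : ℋ,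
    ((b ⟶ a) × (E.mod (f.obj a)).sp) × ((c ⟶ f.obj b) × B.alg (f.obj b)) =>
      resκ d j.2.1.1 j.2.1.2 j.2.2.1 j.2.2.2 := by
  refine Total.of_mem (d.total (f.obj a) c) fun p => ?_
  refine (E.total_act hB (f.obj a)).mem (f := d.ι p.1) (d.continuous_ι p.1) (fun q => ?_) p.2
  refine mem_span_range ⟨a, (𝟙 a, q.1), (p.1, q.2)⟩ ?_
  refine d.ι_congr (by simp) ?_
  rw [f.map_id, B.act_id]

theorem total_resμ (a : ℋ) (c : 𝒢) : Total 𝕜 fun j : Σ b : ℋ,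
    ((b ⟶ a) × (E.mod (f.obj a)).sp) × ((c ⟶ f.obj b) × B.alg (f.obj b)) =>
      resμ d' s j.2.1.1 j.2.1.2 j.2.2.1 j.2.2.2 :=
  (s ((A.restrict f).robj a)).total_of (c := B.robj c)
    (κ := fun (b : ℋ) (p : (b ⟶ a) × (E.mod (f.obj a)).sp) => d'.ι p.1 p.2)
    (ω := fun (b : ℋ) (p : (c ⟶ f.obj b) × B.alg (f.obj b)) => B.rsingle p.1 p.2)
    (fun b : ℋ => d'.total a b) (fun b : ℋ => B.total_rsingle c (f.obj b))

theorem inner_resκ {a b b' : ℋ} {c c' : 𝒢} (h : b ⟶ a) (η : (E.mod (f.obj a)).sp)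
    (k : c ⟶ f.obj b) (y : B.alg (f.obj b)) (h' : b' ⟶ a) (η' : (E.mod (f.obj a)).sp)
    (k' : c' ⟶ f.obj b') (y' : B.alg (f.obj b')) :
    (F.fiber (A.robj (f.obj a))).inner (resκ d h η k y) (resκ d h' η' k' y') =
      B.rsingle ((k' ≫ f.map h') ≫ Groupoid.inv (k ≫ f.map h))
        (B.act (Groupoid.inv (k ≫ f.map h)) (star (B.act (f.map h) y) *
          ((E.mod (f.obj a)).ip η η' * B.act (f.map h') y'))) := by
  refine (d.inner_ι' _ _ _ _).trans ?_
  rw [(E.mod (f.obj a)).ip_ac]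

theorem inner_resμ {a b b' : ℋ} {c c' : 𝒢} (h : b ⟶ a) (η : (E.mod (f.obj a)).sp)
    (k : c ⟶ f.obj b) (y : B.alg (f.obj b)) (h' : b' ⟶ a) (η' : (E.mod (f.obj a)).sp)
    (k' : c' ⟶ f.obj b') (y' : B.alg (f.obj b')) :
    (F''.fiber ((A.restrict f).robj a)).inner (resμ d' s h η k y) (resμ d' s h' η' k' y') =
      B.rsingle ((k' ≫ f.map h') ≫ Groupoid.inv (k ≫ f.map h))
        (B.act (Groupoid.inv (k ≫ f.map h)) (star (B.act (f.map h) y) *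
          ((E.mod (f.obj a)).ip η η' * B.act (f.map h') y'))) := by
  refine ((s ((A.restrict f).robj a)).inner_τ _ _ _ _).trans
    (Eq.trans ?_ (B.comp_star_rsingle (f.map h) k (f.map h') k' y _ y'))
  have e1 : f.map (Groupoid.inv h) = Groupoid.inv (f.map h) := by simp
  have e2 : f.map (h' ≫ Groupoid.inv h) = f.map h' ≫ Groupoid.inv (f.map h) := by simp
  have h1 : (GCAlg.restrictHom f B).red.map ((F'.fiber ((A.restrict f).robj a)).inner
      (d'.ι h η) (d'.ι h' η')) = B.rsingle (f.map h' ≫ Groupoid.inv (f.map h))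
        (B.act (Groupoid.inv (f.map h)) ((E.mod (f.obj a)).ip η η')) := by
    refine (congrArg (GCAlg.restrictHom f B).red.map (d'.inner_ι' h h' η η')).trans
      ((B.restrict_red_rsingle f _ _).trans (B.rsingle_congr e2 ?_))
    exact congrArg (fun k => B.act k ((E.mod (f.obj a)).ip η η')) e1
  exact congrArg (fun z => B.red.comp (B.red.star (B.rsingle k y))
    (B.red.comp z (B.rsingle k' y'))) h1

theorem grade_resκ {a b : ℋ} {c : 𝒢} (h : b ⟶ a) (η : (E.mod (f.obj a)).sp)
    (k : c ⟶ f.obj b) (y : B.alg (f.obj b)) :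
    (F.fiber (A.robj (f.obj a))).grade (resκ d h η k y) =
      resκ d h ((E.mod (f.obj a)).grade η) k ((B.alg (f.obj b)).grade y) := by
  refine (d.grade_ι _ _).trans (d.ι_congr rfl ?_)
  refine ((E.mod (f.obj a)).grade_ac _ _).trans ?_
  rw [← (B.act (f.map h)).map_grade]

theorem grade_resμ {a b : ℋ} {c : 𝒢} (h : b ⟶ a) (η : (E.mod (f.obj a)).sp)
    (k : c ⟶ f.obj b) (y : B.alg (f.obj b)) :
    (F''.fiber ((A.restrict f).robj a)).grade (resμ d' s h η k y) =
      resμ d' s h ((E.mod (f.obj a)).grade η) k ((B.alg (f.obj b)).grade y) := by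
  refine ((s ((A.restrict f).robj a)).grade_τ _ _).trans ?_
  exact congrArg₂ (fun ζ z => (s ((A.restrict f).robj a)).τ (b := (B.restrict f).robj b) ζ z)
    (d'.grade_ι h η) (B.rsingle_grade k y)

theorem op_resκ {a a' b : ℋ} {c : 𝒢} (g : a ⟶ a') (x : A.alg (f.obj a')) (h : b ⟶ a)
    (η : (E.mod (f.obj a)).sp) (k : c ⟶ f.obj b) (y : B.alg (f.obj b)) :
    (F.op ((GCAlg.restrictHom f A).red.map ((A.restrict f).rsingle g x))).toFun (resκ d h η k y) =
      resκ d (h ≫ g) ((E.op x).toFun (E.tr (f.map g) η)) k y := by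
  refine (congrArg (fun z => (F.op z).toFun (resκ d h η k y))
    (A.restrict_red_rsingle f g x)).trans ?_
  refine (d.op_ι (f.map g) x (k ≫ f.map h) _).trans (d.ι_congr ?_ ?_)
  · rw [f.map_comp, Category.assoc]
  · rw [E.tr_ac, f.map_comp, B.act_comp]
    exact Op.map_ac _ _ _

theorem op_resμ (hso : ∀ {p q : (A.restrict f).red.Obj} (x : (A.restrict f).red.Hom p q)
      {b : (B.restrict f).red.Obj} {c : B.red.Obj} (η : (F'.fiber p).E b)
      (y : B.red.Hom c ((GCAlg.restrictHom f B).red.obj b)),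
      (F''.op x).toFun ((s p).τ η y) = (s q).τ ((F'.op x).toFun η) y)
    {a a' b : ℋ} {c : 𝒢} (g : a ⟶ a') (x : A.alg (f.obj a')) (h : b ⟶ a)
    (η : (E.mod (f.obj a)).sp) (k : c ⟶ f.obj b) (y : B.alg (f.obj b)) :
    (F''.op ((A.restrict f).rsingle g x)).toFun (resμ d' s h η k y) =
      resμ d' s (h ≫ g) ((E.op x).toFun (E.tr (f.map g) η)) k y := by
  refine (hso _ _ _).trans ?_
  exact congrArg (fun ζ => (s ((A.restrict f).robj a')).τ (b := (B.restrict f).robj b) ζ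
    (B.rsingle k y)) (d'.op_ι g x h η)

theorem IsDescent.natIso_restrict (hB : B.SigmaUnital) {D : GFunctor (QDG A B) (QD A.red B.red)}
    {D' : GFunctor (QDG (A.restrict f) (B.restrict f))
      (QD (A.restrict f).red (B.restrict f).red)} (h : IsDescent D) (h' : IsDescent D')
    {Ψ : GFunctor (QD (A.restrict f).red (B.restrict f).red) (QD (A.restrict f).red B.red)}
    (hΨ : IsCoeffChange (GCAlg.restrictHom f B).red Ψ) :
    NatIso (D.comp (QD.pull (GCAlg.restrictHom f A).red)) ((QDG.restrict f).comp (D'.comp Ψ)) := by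
  obtain ⟨d, hd⟩ := h
  obtain ⟨d', hd'⟩ := h'
  obtain ⟨s, hso, hsT⟩ := hΨ
  refine QD.natIso_of_total _ _
    (J := fun (E : GMod A B) (a : ℋ) (c : 𝒢) => Σ b : ℋ, ((b ⟶ a) × (E.mod (f.obj a)).sp) ×
      ((c ⟶ f.obj b) × B.alg (f.obj b)))
    (fun (E : GMod A B) a {c : 𝒢} j => resκ (d E) j.2.1.1 j.2.1.2 j.2.2.1 j.2.2.2)
    (fun (E : GMod A B) a {c : 𝒢} j => resμ (d' (E.restrict f)) (s (D'.obj (E.restrict f)))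
      j.2.1.1 j.2.1.2 j.2.2.1 j.2.2.2)
    (fun E a (c : 𝒢) => total_resκ (d E) hB a c)
    (fun (E : GMod A B) a (c : 𝒢) =>
      total_resμ (d' (E.restrict f)) (s (D'.obj (E.restrict f))) a c)
    (fun (E : GMod A B) a {c c' : 𝒢} i j =>
      (inner_resμ (d' (E.restrict f)) (s (D'.obj (E.restrict f))) _ _ _ _ _ _ _ _).trans
        (inner_resκ (d E) _ _ _ _ _ _ _ _).symm)
    (fun (E : GMod A B) a {c : 𝒢} j => ⟨⟨j.1, (j.2.1.1, (E.mod (f.obj a)).grade j.2.1.2),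
      (j.2.2.1, (B.alg (f.obj j.1)).grade j.2.2.2)⟩, grade_resκ (d E) _ _ _ _,
        grade_resμ (d' (E.restrict f)) (s (D'.obj (E.restrict f))) _ _ _ _⟩)
    (fun (E : GMod A B) {p q} g x {c : 𝒢} j => ⟨⟨j.1, (j.2.1.1 ≫ g,
      (E.op (a := f.obj q) x).toFun (E.tr (f.map g) j.2.1.2)), j.2.2⟩,
        op_resκ (d E) g x _ _ _ _,
        op_resμ (d' (E.restrict f)) (s (D'.obj (E.restrict f))) (hso (D'.obj (E.restrict f)))
          g x _ _ _ _⟩)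
    (fun {E E₁} k => ?_)
  obtain ⟨T, rfl⟩ := (DGPair A B).cls_surj k
  let T' : (DGPair (A.restrict f) (B.restrict f)).P (GMod.restrict f E) (GMod.restrict f E₁) :=
    ⟨((FamCat.reindex GMod.mod f.obj).comp (FamCat.obMap GMod.mod (GMod.restrict f))).map T.1,
      GMod.Comm.restrict f T.2⟩
  obtain ⟨S', h1', h2'⟩ := hd' _ _ T'
  obtain ⟨S, h3, h4⟩ := hd E E₁ T
  obtain ⟨R, h3', h4'⟩ := hsT _ _ S'
  refine ⟨⟨((FamCat.reindex Bimod.fiber (GCAlg.restrictHom f A).red.obj).comp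
      (FamCat.obMap Bimod.fiber (Bimod.pull (GCAlg.restrictHom f A).red))).map S.1,
      Bimod.Comm.pull (GCAlg.restrictHom f A).red S.2⟩, R,
    congrArg (QD.pull (GCAlg.restrictHom f A).red).map h4, (congrArg Ψ.map h2').trans h4',
    fun a {c : 𝒢} j => ⟨⟨j.1, (j.2.1.1, (T.1.1 (f.obj a)).toFun j.2.1.2), j.2.2⟩, ?_, ?_⟩⟩
  · refine (h3 _ _).trans ((d E₁).ι_congr rfl ?_)
    exact Op.map_ac _ _ _
  · refine (h3' ((A.restrict f).robj a) ((d' (GMod.restrict f E)).ι j.2.1.1 j.2.1.2)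
      (B.rsingle j.2.2.1 j.2.2.2)).trans ?_
    exact congrArg (fun ζ => (s (D'.obj (GMod.restrict f E₁)) ((A.restrict f).robj a)).τ
      (b := (B.restrict f).robj j.1) ζ (B.rsingle j.2.2.1 j.2.2.2)) (h1' j.2.1.1 j.2.1.2)

end Restrict

end
end CStarDescent

namespace CStarDescent

noncomputable section

variable {𝕜 : Type} [RCLike 𝕜]

/-! ## Maps of spectra -/

section

variable {C : GStarCat.{v, w} 𝕜} {C' : GStarCat.{v', w'} 𝕜} (F : GFunctor C C')

theorem GFunctor.continuous_map {a b : C.Obj} : Continuous fun x : C.Hom a b => F.map x :=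
  AddMonoidHomClass.continuous_of_bound F.map 1 fun x => by rw [one_mul]; exact F.norm_map_le x

theorem KRep.continuous_map {S : Finset ℕ} {L : S → C.Obj × ℤˣ} :
    Continuous (KRep.map F : KRep C L → _) :=
  KRep.continuous_of_entries fun f i j => F.continuous_map.comp (KRep.continuous_entry f i j)

theorem KSp.continuous_map : Continuous (KSp.map F) :=
  continuous_quot_lift _ (continuous_sigma fun _ => continuous_sigma fun _ =>
    KSp.continuous_mk.comp (KRep.continuous_map F))

theorem KSp.map_base : KSp.map F (KSp.base C) = KSp.base C' := KSp.mk_empty _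

theorem KRep.map_susp {S : Finset ℕ} {L : S → C.Obj × ℤˣ} (φ : KRep C L) (t : OnePoint ℝ) :
    (φ.map F).susp t = (φ.susp t).map F.cl :=
  KRep.ext fun f i j => Prod.ext rfl (map_smul F.map (sgn (L j).2 : 𝕜) (φ.toFun (sinS t f) i j)).symm

theorem KSp.str_map (x : KSp C) (t : OnePoint ℝ) :
    (KSp.str (KSp.map F x)).1 t = KSp.map F.cl ((KSp.str x).1 t) := by
  obtain ⟨S, L, φ⟩ := x
  exact congrArg KSp.mk (KRep.map_susp F φ t)

/-- The map of K-theory spectra induced by a functor. -/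
def kSpecMap : SpectrumHom (kSpec C) (kSpec C') where
  f n := KSp.map (F.clN n)
  cont n := KSp.continuous_map (F.clN n)
  map_pt n := KSp.map_base (F.clN n)
  map_σ n x t := KSp.str_map (F.clN n) x t

end

/-- The map of loop spectra induced by a map of spectra. -/
def SpectrumHom.loop {E : Spectrum.{w}} {F : Spectrum.{w'}} (Δ : SpectrumHom E F) :
    SpectrumHom E.loop F.loop where
  f n γ := show Loop (F.X n) (F.pt n) from
    ⟨⟨fun t => Δ.f n (γ.1 t), (Δ.cont n).comp γ.1.continuous⟩, by
      change Δ.f n (γ.1 OnePoint.infty) = _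
      rw [γ.2, Δ.map_pt]⟩
  cont n := Loop.continuous_mk ((Δ.cont n).comp Loop.continuous_eval)
  map_pt n := Subtype.ext (ContinuousMap.ext fun _ => Δ.map_pt n)
  map_σ n γ s := Subtype.ext (ContinuousMap.ext fun t => Δ.map_σ n (γ.1 t) s)

theorem exists_isInducedBy {𝒢 : Type u} [Groupoid.{u} 𝒢] {A B : GCAlg 𝕜 𝒢}
    (D : GFunctor (QDG A B) (QD A.red B.red)) :
    ∃ Δ : SpectrumHom (KKG A B) (KK A.red B.red), IsInducedBy D Δ :=
  ⟨(kSpecMap D).loop, fun _ _ _ => rfl⟩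

end
end CStarDescent

theorem mainTheorem3 (𝕜 : Type) [RCLike 𝕜] :
    ∃ D : ∀ (𝒢 : Type u) [Groupoid.{u} 𝒢] (A B : GCAlg 𝕜 𝒢), A.SigmaUnital → B.SigmaUnital →
        GFunctor (QDG A B) (QD A.red B.red),
      -- each `D` is the descent functor, and is determined by this up to natural isomorphism
      (∀ (𝒢 : Type u) [Groupoid.{u} 𝒢] (A B : GCAlg 𝕜 𝒢) (hA : A.SigmaUnital)
        (hB : B.SigmaUnital),
        IsDescent (D 𝒢 A B hA hB) ∧
        ∀ D' : GFunctor (QDG A B) (QD A.red B.red), IsDescent D' → NatIso D' (D 𝒢 A B hA hB)) ∧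
      -- naturality in the first variable
      (∀ (𝒢 : Type u) [Groupoid.{u} 𝒢] (A A' B : GCAlg 𝕜 𝒢) (hA : A.SigmaUnital)
        (hA' : A'.SigmaUnital) (hB : B.SigmaUnital) (α : GHom A' A),
        NatIso ((QDG.pull α).comp (D 𝒢 A' B hA' hB)) ((D 𝒢 A B hA hB).comp (QD.pull α.red))) ∧
      -- naturality in the second variable
      (∀ (𝒢 : Type u) [Groupoid.{u} 𝒢] (A B B' : GCAlg 𝕜 𝒢) (hA : A.SigmaUnital)
        (hB : B.SigmaUnital) (hB' : B'.SigmaUnital) (β : GHom B B'),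
        (∃ Φ : GFunctor (QDG A B) (QDG A B'), IsCoeffChangeG β Φ) ∧
        (∃ Ψ : GFunctor (QD A.red B.red) (QD A.red B'.red), IsCoeffChange β.red Ψ) ∧
        ∀ (Φ : GFunctor (QDG A B) (QDG A B'))
          (Ψ : GFunctor (QD A.red B.red) (QD A.red B'.red)),
          IsCoeffChangeG β Φ → IsCoeffChange β.red Ψ →
            NatIso (Φ.comp (D 𝒢 A B' hA hB')) ((D 𝒢 A B hA hB).comp Ψ)) ∧
      -- naturality in the groupoid
      (∀ (ℋ 𝒢 : Type u) [Groupoid.{u} ℋ] [Groupoid.{u} 𝒢] (f : ℋ ⥤ 𝒢) [f.Faithful]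
        (A B : GCAlg 𝕜 𝒢) (hA : A.SigmaUnital) (hB : B.SigmaUnital),
        (∃ Ψ : GFunctor (QD (A.restrict f).red (B.restrict f).red) (QD (A.restrict f).red B.red),
          IsCoeffChange (GCAlg.restrictHom f B).red Ψ) ∧
        ∀ Ψ : GFunctor (QD (A.restrict f).red (B.restrict f).red) (QD (A.restrict f).red B.red),
          IsCoeffChange (GCAlg.restrictHom f B).red Ψ →
            NatIso ((D 𝒢 A B hA hB).comp (QD.pull (GCAlg.restrictHom f A).red))
              ((QDG.restrict f).comp
                ((D ℋ (A.restrict f) (B.restrict f) (hA.restrict f) (hB.restrict f)).comp Ψ))) ∧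
      -- the induced maps of spectra
      ∀ (𝒢 : Type u) [Groupoid.{u} 𝒢] (A B : GCAlg 𝕜 𝒢) (hA : A.SigmaUnital)
        (hB : B.SigmaUnital),
        ∃ Δ : SpectrumHom (KKG A B) (KK A.red B.red), IsInducedBy (D 𝒢 A B hA hB) Δ := by
  refine ⟨fun 𝒢 _ A B _ hB => descent A hB, fun 𝒢 _ A B _ hB => ⟨descent_isDescent A hB,
    fun D' h => h.natIso (descent_isDescent A hB)⟩, fun 𝒢 _ A A' B _ _ hB α =>
    (descent_isDescent A hB).natIso_pull (descent_isDescent A' hB) α,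
    fun 𝒢 _ A B B' _ hB hB' β => ⟨exists_isCoeffChangeG β hB,
      exists_isCoeffChange β.red hB.hasApprox_red A.red, fun Φ Ψ hΦ hΨ =>
        (descent_isDescent A hB).natIso_coeff (descent_isDescent A hB') hΦ hΨ⟩,
    fun ℋ 𝒢 _ _ f _ A B _ hB => ⟨exists_isCoeffChange _ (hB.restrict f).hasApprox_red _,
      fun Ψ hΨ => (descent_isDescent A hB).natIso_restrict hB
        (descent_isDescent _ (hB.restrict f)) hΨ⟩,
    fun 𝒢 _ A B _ hB => exists_isInducedBy (descent A hB)⟩
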